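/- **Conventions.** $\mathbb T^d=\mathbb R^d/\mathbb Z^d$; functions on $\mathbb T^d$ are $\mathbb Z^d$-periodic functions on $\mathbb R^d$; a map into $\mathbb T^d$ is represented by a lift $Q:\mathbb R^d\to\mathbb R^d$ with $Q(x)-Q(y)\in\mathbb Z^d$ whenever $x-y\in\mathbb Z^d$; $|x-y|_{\mathbb T^d}$ is the distance of $x-y$ to $\mathbb Z^d$. Elements of $\mathscr P(\mathbb T^d)$ are Borel probability measures on $\mathbb R^d$, identified when they have the same integrals against all continuous periodic functions, and functions on $\mathscr P(\mathbb T^d)$ respect this identification. Put $$\mathscr W^2(\mu,\nu)=\inf_{\gamma\in\Gamma(\mu,\nu)}\int|x-y|_{\mathbb T^d}^2\,\gamma(dx,dy),$$ where $\Gamma(\mu,\nu)$ is the set of couplings of $\mu$ and $\nu$ on $\mathbb R^d\times\mathbb R^d$. $\Gamma_0(\mu,\nu)$ is the set of the optimal $\gamma\in\Gamma(\mu,\nu)$ for which $|x-y|=|x-y|_{\mathbb T^d}$ for $\gamma$-a.e. $(x,y)$, i.e. for which $y-x$ is a shortest displacement on the torus. The tangent space $\mathscr T_\mu$ is the $L^2(\mu)$-closure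 of $\{\nabla\varphi:\varphi\in C^\infty(\mathbb T^d)\}$. The Wasserstein gradient $\nabla_\mu U(\mu)$ of $U:\mathscr P(\mathbb T^d)\to\mathbb R$ is the $\xi\in\mathscr T_\mu$ with $U(\nu)-U(\mu)-\int\xi(x)\cdot(y-x)\,\gamma(dx,dy)=o(\mathscr W(\mu,\nu))$, uniformly over $\nu$ and $\gamma\in\Gamma_0(\mu,\nu)$. A function $V:\mathbb T^d\times\mathscr P(\mathbb T^d)\to\mathbb R$ is called *twice continuously differentiable* if $\nabla_\mu V(q,\mu)(x)$ exists, is periodic in $q$ and $x$ and is differentiable in $x$ and in $q$, with derivatives $\nabla^2_{x\mu}V$, $\nabla^2_{q\mu}V$, and there are a matrix field $\nabla^2_{\mu\mu}V(q,\mu)(x,a)$, periodic in $q,x,a$, whose rows belong to $\mathscr T_\mu$ as functions of $a$, and moduli of continuity $\rho$ (concave) and $\epsilon$ such that, for all $\gamma\in\Gamma_0(\mu,\nu)$, $$\Big|\nabla_\mu V(\bar q,\nu)(y)-\nabla_\mu V(q,\mu)(x)-\nabla^2_{q\mu}V(q,\mu)(x)(\bar q-q)-\nabla^2_{x\mu}V(q,\mu)(x)(y-x)-\int\nabla^2_{\mu\mu}V(q,\mu)(x,a)(b-a)\,\gamma(da,db)\Big|$$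 $$\le o(|\bar q-q|)+\big(\mathscr W(\mu,\nu)+|x-y|\big)\big(\rho(\mathscr W(\mu,\nu))+\epsilon(|x-y|)\big),$$ where the $o(|\bar q-q|)$ is as $\bar q\to q$ for fixed $(q,\mu,x)$, uniformly in $\nu,y,\gamma$; and $\nabla_\mu V,\nabla^2_{q\mu}V,\nabla^2_{x\mu}V,\nabla^2_{\mu\mu}V$ are continuous in all their variables. **Assumptions.** $H=H(q,p)\in C^3(\mathbb T^d\times\mathbb R^d)$. Each of $F,g:\mathbb T^d\times\mathscr P(\mathbb T^d)\to\mathbb R$ is continuous in $\mu$ and $C^3$ in $q$, with first, second and third $q$-derivatives bounded by a constant $\kappa$; its gradient $\nabla_q F$ (resp. $\nabla_q g$) satisfies $|\nabla_qF(q_1,\mu_1)-\nabla_qF(q_2,\mu_2)|\le\kappa\sqrt{|q_1-q_2|^2+\mathscr W^2(\mu_1,\mu_2)}$ and has a Wasserstein gradient $\nabla_\mu\nabla_qF(q,\mu)(x)$, continuous in $(q,\mu,x)$; and $F$, $g$, as well as all components of $\nabla_qF$ and $\nabla_qg$, are twice continuously differentiable in the above sense. **Characteristics.** For $T>0$, $s\in[0,T]$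 and $\mu\in\mathscr P(\mathbb T^d)$ consider the continuous maps $Z=(Q,P):[0,T]\times\mathbb T^d\to\mathbb T^d\times\mathbb R^d$ that satisfy, for all $t\in[0,T]$ and $q$, writing $Q_\tau=Q(\tau,\cdot)$ and $P_\tau=P(\tau,\cdot)$, $$Q(t,q)=q+\int_s^t\nabla_pH(Q_\tau(q),P_\tau(q))\,d\tau,$$ $$P(t,q)=\nabla_qg\big(Q_0(q),(Q_0)_\#\mu\big)-\int_0^t\Big[\nabla_qH(Q_\tau(q),P_\tau(q))+\nabla_qF\big(Q_\tau(q),(Q_\tau)_\#\mu\big)\Big]d\tau .$$ **Statement.** There is $T_0>0$, depending only on $(H,F,g)$, such that for every $T\in(0,T_0]$ the following holds. For all $s\in[0,T]$ and $\mu\in\mathscr P(\mathbb T^d)$ there is exactly one such $Z$; denote it by $\Sigma[s,\mu]$. It is differentiable in $t\in[0,T]$ and in $q$, and the map $\Sigma[s,\cdot](\cdot,\cdot)$ is differentiable on $\mathscr P(\mathbb T^d)\times[0,T]\times\mathbb T^d$ in the following sense: there are a map $$\bar\nabla_\mu\Sigma:[0,T]\times[0,T]\times\mathbb T^d\times\mathbb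 T^d\times\mathscr P(\mathbb T^d)\to\mathbb R^{d\times d}\times\mathbb R^{d\times d},\qquad(t,s,q,x,\mu)\mapsto\bar\nabla_\mu\Sigma[s,\mu](t,q,x),$$ and a constant $C$ such that for all $s,t,t'\in[0,T]$, $q,q'\in\mathbb R^d$, $\mu,\nu\in\mathscr P(\mathbb T^d)$ and every $\gamma\in\Gamma_0(\mu,\nu)$, $$\Big|\Sigma[s,\nu](t',q')-\Sigma[s,\mu](t,q)-\partial_t\Sigma[s,\mu](t,q)(t'-t)-\nabla_q\Sigma[s,\mu](t,q)(q'-q)-\int\bar\nabla_\mu\Sigma[s,\mu](t,q,x)(y-x)\,\gamma(dx,dy)\Big|$$ $$\le C\big(|t'-t|^2+|q'-q|^2+\mathscr W^2(\mu,\nu)\big).$$ Moreover $\bar\nabla_\mu\Sigma$ is Lipschitz jointly in $(t,s,q,x,\mu)$, with respect to $|\cdot|$ on $[0,T]$, $|\cdot|_{\mathbb T^d}$ on $\mathbb T^d$ and $\mathscr W$ on $\mathscr P(\mathbb T^d)$. -/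

import Mathlib

open MeasureTheory Set Filter Topology

noncomputable section

namespace MFG

/-- Euclidean space `ℝ^d`, the universal cover of the torus `𝕋^d = ℝ^d / ℤ^d`. -/
abbrev E (d : ℕ) : Type := EuclideanSpace ℝ (Fin d)

/-- Borel probability measures on `ℝ^d`. Elements of `𝒫(𝕋^d)` are represented by such measures;
two of them represent the same element when `MeasEq` holds. -/
abbrev PM (d : ℕ) : Type := ProbabilityMeasure (E d)

variable {d : ℕ}

/-- `x ∼ y`: the points `x` and `y` of `ℝ^d` differ by an integer vector. -/
def TorusEq (x y : E d) : Prop := ∀ i, ∃ n : ℤ, x i - y i = n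

/-- `f` is a function on `𝕋^d`, that is, a `ℤ^d`-periodic function on `ℝ^d`. -/
def OnTorus {S : Type} (f : E d → S) : Prop := ∀ x y, TorusEq x y → f x = f y

/-- The distance `|x - y|_{𝕋^d}`: the Euclidean distance from `x - y` to the lattice `ℤ^d`. -/
def torusDist (x y : E d) : ℝ := Metric.infDist (x - y) {v : E d | TorusEq v 0}

/-- `μ` and `ν` represent the same element of `𝒫(𝕋^d)`: they integrate all continuous periodic
functions in the same way. -/
def MeasEq (μ ν : PM d) : Prop :=
  ∀ φ : E d → ℝ, Continuous φ → OnTorus φ →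
    ∫ x, φ x ∂(μ : Measure (E d)) = ∫ x, φ x ∂(ν : Measure (E d))

/-- `γ ∈ Γ(μ, ν)`: the measure `γ` on `ℝ^d × ℝ^d` has marginals `μ` and `ν`. -/
def IsPlan (γ : Measure (E d × E d)) (μ ν : PM d) : Prop :=
  γ.map Prod.fst = μ ∧ γ.map Prod.snd = ν

/-- The transport cost `∫ |x - y|_{𝕋^d}² γ(dx, dy)`. -/
def planCost (γ : Measure (E d × E d)) : ℝ := ∫ z, torusDist z.1 z.2 ^ 2 ∂γ

/-- The quadratic Wasserstein distance `𝒲` of `𝒫(𝕋^d)`. -/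
def wass (μ ν : PM d) : ℝ := Real.sqrt (sInf {c | ∃ γ, IsPlan γ μ ν ∧ c = planCost γ})

/-- `γ ∈ Γ₀(μ, ν)`: `γ` is an optimal plan between `μ` and `ν`. The last clause says that the vector
`y - x` is `γ`-almost everywhere a shortest displacement on the torus from the class of `x` to the
class of `y`, so that `∫ ξ(x) · (y - x) γ(dx, dy)` is the integral over `𝕋^d × 𝕋^d` it denotes.
(For every `μ`, every class in `𝒫(𝕋^d)` has a representative `ν` for which such a `γ` exists.) -/
def IsOptPlan (γ : Measure (E d × E d)) (μ ν : PM d) : Prop :=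
  IsPlan γ μ ν ∧ planCost γ = wass μ ν ^ 2 ∧ ∀ᵐ z ∂γ, ‖z.1 - z.2‖ = torusDist z.1 z.2

/-- The push-forward `f_# μ` (of a measurable map `f`). -/
def push (f : E d → E d) (μ : PM d) : PM d :=
  open Classical in
  if h : AEMeasurable f (μ : Measure (E d)) then μ.map h else μ

/-- Joint continuity of a function of a point `x` and of a measure in `(𝒫(𝕋^d), 𝒲)`. -/
def ContinuousW {X Y : Type} [PseudoMetricSpace X] [PseudoMetricSpace Y]
    (Φ : X → PM d → Y) : Prop :=
  ∀ x μ, ∀ ε > 0, ∃ δ > 0, ∀ x' ν, dist x' x < δ → wass μ ν < δ → dist (Φ x' ν) (Φ x μ) < ε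

/-- `ξ` belongs to the tangent space `𝒯_μ 𝒫(𝕋^d)`, the closure in `L²(μ)` of the gradients of smooth
periodic functions. -/
def InTangent (μ : PM d) (ξ : E d → E d) : Prop :=
  MemLp ξ 2 (μ : Measure (E d)) ∧
  ∀ ε > 0, ∃ φ : E d → ℝ, ContDiff ℝ (⊤ : ℕ∞) φ ∧ OnTorus φ ∧
    eLpNorm (fun x => ξ x - gradient φ x) 2 (μ : Measure (E d)) < ENNReal.ofReal ε

/-- `ξ` is the Wasserstein gradient `∇_μ U(μ)`: a first-order expansion of `U` at `μ` holds along all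
optimal plans, and `ξ` is tangent (the unique such `ξ`, equivalently the one of minimal norm). -/
def IsWassGrad (U : PM d → ℝ) (μ : PM d) (ξ : E d → E d) : Prop :=
  InTangent μ ξ ∧
  ∀ ε > 0, ∃ r > 0, ∀ (ν : PM d) (γ : Measure (E d × E d)), IsOptPlan γ μ ν → wass μ ν ≤ r →
    |U ν - U μ - ∫ z, inner ℝ (ξ z.1) (z.2 - z.1) ∂γ| ≤ ε * wass μ ν

/-- A modulus of continuity. -/
def IsModulus (ω : ℝ → ℝ) : Prop :=
  MonotoneOn ω (Ici 0) ∧ (∀ r, 0 ≤ r → 0 ≤ ω r) ∧ Tendsto ω (𝓝[≥] 0) (𝓝 0)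

/-- `V : 𝕋^d × 𝒫(𝕋^d) → ℝ` is twice differentiable everywhere, with
`N q μ x = ∇_μ V(q, μ)(x)`, `Dq q μ x = ∇²_{qμ} V(q, μ)(x)`, `Dx q μ x = ∇²_{xμ} V(q, μ)(x)` and
`A q μ x a = ∇²_{μμ} V(q, μ)(x, a)`, and these four functions are continuous in all variables. -/
structure HasSecondOrder (V : E d → PM d → ℝ) (N : E d → PM d → E d → E d)
    (Dq Dx : E d → PM d → E d → (E d →L[ℝ] E d))
    (A : E d → PM d → E d → E d → (E d →L[ℝ] E d)) : Prop where
  grad : ∀ q μ, IsWassGrad (V q) μ (N q μ)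
  grad_torus_q : ∀ μ x, OnTorus (fun q => N q μ x)
  grad_torus_x : ∀ q μ, OnTorus (N q μ)
  hess_torus_q : ∀ μ x a, OnTorus (fun q => A q μ x a)
  hess_torus_x : ∀ q μ a, OnTorus (fun x => A q μ x a)
  hess_torus_a : ∀ q μ x, OnTorus (A q μ x)
  deriv_x : ∀ q μ x, HasFDerivAt (N q μ) (Dx q μ x) x
  deriv_q : ∀ q μ x, HasFDerivAt (fun q' => N q' μ x) (Dq q μ x) q
  hess_tangent : ∀ q μ x (c : E d),
    InTangent μ (fun a => ContinuousLinearMap.adjoint (A q μ x a) c)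
  expansion : ∃ ρ ϵ : ℝ → ℝ, IsModulus ρ ∧ ConcaveOn ℝ (Ici 0) ρ ∧ IsModulus ϵ ∧
    ∀ q μ x, ∀ η > 0, ∃ δ > 0, ∀ q' (ν : PM d) y (γ : Measure (E d × E d)),
      ‖q' - q‖ < δ → IsOptPlan γ μ ν →
      ‖N q' ν y - N q μ x - Dq q μ x (q' - q)
          - (Dx q μ x (y - x) + ∫ z, A q μ x z.1 (z.2 - z.1) ∂γ)‖
        ≤ η * ‖q' - q‖ + (wass μ ν + ‖x - y‖) * (ρ (wass μ ν) + ϵ ‖x - y‖)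
  cont_grad : ContinuousW (fun (z : E d × E d) μ => N z.1 μ z.2)
  cont_q : ContinuousW (fun (z : E d × E d) μ => Dq z.1 μ z.2)
  cont_x : ContinuousW (fun (z : E d × E d) μ => Dx z.1 μ z.2)
  cont_hess : ContinuousW (fun (z : E d × E d × E d) μ => A z.1 μ z.2.1 z.2.2)

/-- `V` is twice differentiable with continuous first and second order derivatives
`∇_μ V`, `∇²_{qμ} V`, `∇²_{xμ} V`, `∇²_{μμ} V`. -/
def TwiceDiff (V : E d → PM d → ℝ) : Prop := ∃ N Dq Dx A, HasSecondOrder V N Dq Dx A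

/-- `∇_q F(q, μ)`. -/
def gradq (F : E d → PM d → ℝ) (q : E d) (μ : PM d) : E d := gradient (fun q' => F q' μ) q

/-- The Hamiltonian: `H ∈ C³(𝕋^d × ℝ^d)`. -/
structure IsHamiltonian (H : E d → E d → ℝ) : Prop where
  torus : ∀ p, OnTorus (fun q => H q p)
  smooth : ContDiff ℝ 3 (fun z : E d × E d => H z.1 z.2)

/-- The assumptions on a coupling `F : 𝕋^d × 𝒫(𝕋^d) → ℝ` for the mean field game system. -/
structure IsMFGCoupling (F : E d → PM d → ℝ) : Prop where
  torus : ∀ μ, OnTorus (fun q => F q μ)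
  meas_eq : ∀ q μ ν, MeasEq μ ν → F q μ = F q ν
  cont : ∀ q μ, ∀ ε > 0, ∃ δ > 0, ∀ ν, wass μ ν < δ → |F q ν - F q μ| < ε
  smooth : ∀ μ, ContDiff ℝ 3 (fun q => F q μ)
  bounds : ∃ κ > 0,
    (∀ q μ, ∀ k ∈ Finset.Icc 1 3, ‖iteratedFDeriv ℝ k (fun q' => F q' μ) q‖ ≤ κ) ∧
    ∀ q₁ q₂ μ₁ μ₂, ‖gradq F q₁ μ₁ - gradq F q₂ μ₂‖
      ≤ κ * Real.sqrt (‖q₁ - q₂‖ ^ 2 + wass μ₁ μ₂ ^ 2)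
  /-- `∇_μ ∇_q F(q, μ)(x)` exists (its `i`-th row is `N i q μ x`) and is continuous. -/
  mixed : ∃ N : Fin d → E d → PM d → E d → E d, ∀ i,
    (∀ q μ, OnTorus (N i q μ) ∧ IsWassGrad (fun ν => gradq F q ν i) μ (N i q μ)) ∧
    ContinuousW (fun (z : E d × E d) μ => N i z.1 μ z.2)

/-- The additional assumptions on a coupling for the master equation: `F` and the components of
`∇_q F` are twice differentiable, with continuous derivatives. -/
structure IsMasterCoupling (F : E d → PM d → ℝ) : Prop extends IsMFGCoupling F where
  twice : TwiceDiff F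
  twice_grad : ∀ i : Fin d, TwiceDiff (fun q μ => gradq F q μ i)

/-- `Z = (Q, P)` belongs to `𝓜 = C([0,T] × 𝕋^d; 𝕋^d × ℝ^d)`. -/
structure InM (T : ℝ) (Z : ℝ → E d → E d × E d) : Prop where
  cont : ContinuousOn (fun w : ℝ × E d => Z w.1 w.2) (Icc 0 T ×ˢ univ)
  torus_fst : ∀ t ∈ Icc 0 T, ∀ x y, TorusEq x y → TorusEq (Z t x).1 (Z t y).1
  torus_snd : ∀ t ∈ Icc 0 T, OnTorus (fun x => (Z t x).2)

/-- The operator `𝔪^{s,μ}` whose fixed points are the solutions of the characteristic system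
`∂_t Q = ∇_p H(Q, P)`, `∂_t P = -∇_q H(Q, P) - ∇_q F(Q, Q_t# μ)`, `Q(s, ·) = id`,
`P(0, ·) = ∇_q g(Q(0, ·), Q_0# μ)`. -/
def charOp (H : E d → E d → ℝ) (F g : E d → PM d → ℝ) (s : ℝ) (μ : PM d)
    (Z : ℝ → E d → E d × E d) : ℝ → E d → E d × E d := fun t q =>
  (q + ∫ τ in s..t, gradient (fun p => H (Z τ q).1 p) (Z τ q).2,
   gradq g (Z 0 q).1 (push (fun x => (Z 0 x).1) μ)
    - ∫ τ in (0 : ℝ)..t, (gradient (fun q' => H q' (Z τ q).2) (Z τ q).1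
        + gradq F (Z τ q).1 (push (fun x => (Z τ x).1) μ)))

/-- `Z ∈ 𝓜` is a fixed point of `𝔪^{s,μ}` on `[0, T]`. -/
def IsCharacteristic (H : E d → E d → ℝ) (F g : E d → PM d → ℝ) (T s : ℝ) (μ : PM d)
    (Z : ℝ → E d → E d × E d) : Prop :=
  InM T Z ∧ ∀ t ∈ Icc 0 T, ∀ q, charOp H F g s μ Z t q = Z t q

end MFG

end

open MFG

/-!
For a short time horizon the characteristics are the fixed point of a contraction, and the fixed
point inherits the regularity of the equation. Two things need care: what differentiability with
respect to the measure provides, and the nonlocal terms of the equation.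

**Functionals of measures.** By definition a Wasserstein gradient controls the increments of a
functional along optimal plans that move mass along shortest displacements. Because the gradient is
tangent, the expansion holds along every plan with square integrable displacement
(`IsWassGrad.expansion_of_isPlan`), hence functionals are differentiable along displacement
interpolations (`hasDerivAt_interp`). The space of probability measures on the torus is compact
(`ContinuousW.exists_bound`), so second order differentiability bounds the gradient and its Lipschitz
constant (`HasSecondOrder.exists_lipschitz`); integration along the interpolation then yields
expansions with quadratic remainder along all plans (`abs_sub_sub_integral_le`). The outcome is that
`∇_q F` and `∇_q g` are bounded with bounded Lipschitz first derivatives in the point and in the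
measure (`IsMasterCoupling.exists_smoothFn`).

**The fixed point.** A flow is represented by its displacement `U`, a bounded continuous function,
through `Z(q) = (q, 0) + U(q)`. Superposition with a function of the class above, with the measure
replaced by the law of the position, is a differentiable operator on displacements, and it has a
quadratic expansion if the measure changes at the same time (`SmoothField.nem_expansion`). After the
Hamiltonian has been modified for large momenta (`exists_smoothFn_field`), the characteristic system
is a fixed point problem for curves of displacements, for a contraction if the horizon is short
(`FlowData.existsUnique_fixed`). The a priori bound `FlowData.Represents.norm_momentum_le` shows that
characteristics do not see the modification, whence existence and uniqueness.

**Differentiability.** The derivatives of the flow in the position (`FlowData.jacX`) and in the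
measure (`FlowData.dX`) solve linear integral equations `w = A w + σ` with `‖A‖ ≤ 1/2`. The
difference quotients solve the same equations up to a quadratic error, which is therefore also the
error of the expansions (`FlowData.exists_norm_transC_sol_sub_jacX_le`,
`FlowData.exists_norm_sol_sub_integral_dX_le`). A subtle point is the Lipschitz continuity of the
derivative in the measure (`FlowData.exists_norm_dX_sub_le`): the nonlocal part of `A`, an integral
against `μ`, is not continuous in `μ` for the operator norm. It is Lipschitz in `μ` when applied to
displacements that are Lipschitz in the position, and the stability estimate `norm_sub_le_of_eq_add`
only applies the difference of the operators to one solution. That this solution is Lipschitz in the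
position is `FlowData.exists_dX_lipTorus`: nonlocal terms are automatically Lipschitz in the position,
and with the local part of `A` alone the equation preserves this regularity
(`FlowData.exists_lipTorus_of_eq`).
-/

noncomputable section

namespace MFG

variable {d : ℕ}

/-! ### The torus distance -/

lemma torusEq_sub_iff {x y : E d} : TorusEq (x - y) 0 ↔ TorusEq x y := by
  simp [TorusEq]

lemma torusEq_refl (x : E d) : TorusEq x x := fun _ => ⟨0, by simp⟩

lemma TorusEq.symm {x y : E d} (h : TorusEq x y) : TorusEq y x := fun i => by
  obtain ⟨n, hn⟩ := h i
  exact ⟨-n, by push_cast; linarith⟩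

lemma TorusEq.add {k l : E d} (hk : TorusEq k 0) (hl : TorusEq l 0) : TorusEq (k + l) 0 := fun i => by
  obtain ⟨n, hn⟩ := hk i
  obtain ⟨m, hm⟩ := hl i
  refine ⟨n + m, ?_⟩
  simp only [PiLp.zero_apply, sub_zero, PiLp.add_apply] at *
  push_cast; linarith

lemma TorusEq.neg {k : E d} (hk : TorusEq k 0) : TorusEq (-k) 0 := fun i => by
  obtain ⟨n, hn⟩ := hk i
  refine ⟨-n, ?_⟩
  simp only [PiLp.zero_apply, sub_zero, PiLp.neg_apply] at *
  push_cast; linarith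

lemma torusEq_add {k : E d} (hk : TorusEq k 0) (x : E d) : TorusEq (x + k) x := by
  rw [← torusEq_sub_iff]; simpa using hk

/-- The integer vector obtained from `v` by rounding its coordinates. -/
def roundVec (v : E d) : E d := WithLp.toLp 2 (fun i => (round (v i) : ℝ))

@[simp] lemma roundVec_apply (v : E d) (i : Fin d) : roundVec v i = round (v i) := rfl

lemma torusEq_roundVec (v : E d) : TorusEq (roundVec v) 0 := fun i => ⟨round (v i), by simp⟩

lemma norm_sub_roundVec_le {v k : E d} (hk : TorusEq k 0) : ‖v - roundVec v‖ ≤ ‖v - k‖ := by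
  rw [EuclideanSpace.norm_eq, EuclideanSpace.norm_eq]
  apply Real.sqrt_le_sqrt
  apply Finset.sum_le_sum
  intro i _
  obtain ⟨n, hn⟩ := hk i
  have hn' : k i = n := by simpa using hn
  have := round_le (v i) n
  simp only [PiLp.sub_apply, roundVec_apply, hn', Real.norm_eq_abs]
  gcongr

lemma torusDist_eq (x y : E d) : torusDist x y = ‖(x - y) - roundVec (x - y)‖ := by
  apply le_antisymm
  · have hm : roundVec (x - y) ∈ {v : E d | TorusEq v 0} := torusEq_roundVec (x - y)
    have h := Metric.infDist_le_dist_of_mem (x := x - y) hm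
    rwa [dist_eq_norm] at h
  · rw [torusDist, Metric.le_infDist ⟨0, torusEq_refl 0⟩]
    intro k hk
    rw [dist_eq_norm]
    exact norm_sub_roundVec_le hk

lemma torusDist_le {x y k : E d} (hk : TorusEq k 0) : torusDist x y ≤ ‖x - y - k‖ := by
  rw [torusDist_eq]; exact norm_sub_roundVec_le hk

lemma torusDist_le_norm (x y : E d) : torusDist x y ≤ ‖x - y‖ := by
  simpa using torusDist_le (x := x) (y := y) (torusEq_refl 0)

lemma torusDist_nonneg (x y : E d) : 0 ≤ torusDist x y := Metric.infDist_nonneg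

lemma norm_fract_le (v : E d) : ‖v - roundVec v‖ ≤ Real.sqrt d := by
  rw [EuclideanSpace.norm_eq]
  apply Real.sqrt_le_sqrt
  calc ∑ i, ‖(v - roundVec v) i‖ ^ 2 ≤ ∑ _i : Fin d, (1 : ℝ) := by
        apply Finset.sum_le_sum
        intro i _
        have := abs_sub_round (v i)
        simp only [PiLp.sub_apply, roundVec_apply, Real.norm_eq_abs, sq_abs]
        rw [abs_le] at this
        nlinarith
    _ = d := by simp

lemma torusDist_le_sqrt (x y : E d) : torusDist x y ≤ Real.sqrt d := by
  rw [torusDist_eq]; exact norm_fract_le _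

lemma torusDist_self (x : E d) : torusDist x x = 0 :=
  le_antisymm (by simpa using torusDist_le_norm x x) (torusDist_nonneg _ _)

lemma torusDist_triangle (x y z : E d) : torusDist x z ≤ torusDist x y + torusDist y z := by
  rw [torusDist_eq x y, torusDist_eq y z]
  refine (torusDist_le ((torusEq_roundVec (x - y)).add (torusEq_roundVec (y - z)))).trans ?_
  refine le_trans (le_of_eq ?_) (norm_add_le _ _)
  congr 1; abel

lemma torusDist_comm (x y : E d) : torusDist x y = torusDist y x := by
  have h : ∀ x y : E d, torusDist x y ≤ torusDist y x := fun x y => by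
    rw [torusDist_eq y x]
    refine (torusDist_le (torusEq_roundVec (y - x)).neg).trans (le_of_eq ?_)
    rw [← norm_neg]; congr 1; abel
  exact le_antisymm (h x y) (h y x)

lemma torusDist_congr_right {x y y' : E d} (h : torusDist y y' = 0) :
    torusDist x y = torusDist x y' := by
  have h1 := torusDist_triangle x y y'
  have h2 := torusDist_triangle x y' y
  rw [torusDist_comm y' y] at h2
  linarith

lemma torusDist_eq_zero_of_torusEq {x y : E d} (h : TorusEq x y) : torusDist x y = 0 :=
  le_antisymm (by simpa using torusDist_le (x := x) (y := y) (torusEq_sub_iff.2 h))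
    (torusDist_nonneg _ _)

lemma torusEq_of_torusDist_eq_zero {x y : E d} (h : torusDist x y = 0) : TorusEq x y := by
  rw [torusDist_eq, norm_eq_zero, sub_eq_zero] at h
  rw [← torusEq_sub_iff, h]; exact torusEq_roundVec _

lemma continuous_torusDist : Continuous (fun z : E d × E d => torusDist z.1 z.2) :=
  (Metric.continuous_infDist_pt _).comp (continuous_fst.sub continuous_snd)

lemma measurable_roundVec : Measurable (roundVec (d := d)) := by
  unfold roundVec
  refine (WithLp.measurable_toLp 2 _).comp (measurable_pi_lambda _ fun i => ?_)
  have : Measurable (fun v : E d => v i) := by fun_prop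
  simp_rw [round_eq]
  exact measurable_from_top.comp (Int.measurable_floor.comp (this.add_const _))

/-- `x - roundVec x` is the representative of `x` in the cube around the origin. -/
lemma torusEq_fract (x : E d) : TorusEq (x - roundVec x) x := by
  rw [← torusEq_sub_iff]
  simpa using (torusEq_roundVec x).neg

/-! ### Transport plans and the Wasserstein distance -/

lemma IsPlan.isProbabilityMeasure {γ : Measure (E d × E d)} {μ ν : PM d} (h : IsPlan γ μ ν) :
    IsProbabilityMeasure γ := by
  have : IsProbabilityMeasure (γ.map Prod.fst) := by rw [h.1]; infer_instance
  exact Measure.isProbabilityMeasure_of_map Prod.fst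

lemma IsPlan.integral_fst {γ : Measure (E d × E d)} {μ ν : PM d} (h : IsPlan γ μ ν)
    {X : Type*} [NormedAddCommGroup X] [NormedSpace ℝ X] {f : E d → X}
    (hf : AEStronglyMeasurable f (μ : Measure (E d))) :
    ∫ z, f z.1 ∂γ = ∫ x, f x ∂(μ : Measure (E d)) := by
  rw [← h.1, integral_map measurable_fst.aemeasurable (by rw [h.1]; exact hf)]

lemma IsPlan.integral_snd {γ : Measure (E d × E d)} {μ ν : PM d} (h : IsPlan γ μ ν)
    {X : Type*} [NormedAddCommGroup X] [NormedSpace ℝ X] {f : E d → X}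
    (hf : AEStronglyMeasurable f (ν : Measure (E d))) :
    ∫ z, f z.2 ∂γ = ∫ x, f x ∂(ν : Measure (E d)) := by
  rw [← h.2, integral_map measurable_snd.aemeasurable (by rw [h.2]; exact hf)]

lemma IsPlan.swap {γ : Measure (E d × E d)} {μ ν : PM d} (h : IsPlan γ μ ν) :
    IsPlan (γ.map Prod.swap) ν μ := by
  constructor
  · rw [Measure.map_map measurable_fst measurable_swap]; exact h.2
  · rw [Measure.map_map measurable_snd measurable_swap]; exact h.1

lemma isPlan_prod (μ ν : PM d) :
    IsPlan ((μ : Measure (E d)).prod (ν : Measure (E d))) μ ν := by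
  constructor
  · simp [Measure.map_fst_prod]
  · simp [Measure.map_snd_prod]

lemma continuous_torusDist_sq : Continuous (fun z : E d × E d => torusDist z.1 z.2 ^ 2) :=
  continuous_torusDist.pow 2

lemma integrable_torusDist_sq (γ : Measure (E d × E d)) [IsFiniteMeasure γ] :
    Integrable (fun z : E d × E d => torusDist z.1 z.2 ^ 2) γ := by
  refine Integrable.of_bound continuous_torusDist_sq.aestronglyMeasurable (d : ℝ)
    (ae_of_all _ fun z => ?_)
  have h1 := torusDist_le_sqrt z.1 z.2
  have h0 := torusDist_nonneg z.1 z.2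
  rw [Real.norm_of_nonneg (by positivity), ← Real.sq_sqrt (Nat.cast_nonneg d)]
  gcongr

lemma planCost_nonneg (γ : Measure (E d × E d)) : 0 ≤ planCost γ :=
  integral_nonneg fun _ => by positivity

lemma bddBelow_planCost (μ ν : PM d) : BddBelow {c | ∃ γ, IsPlan γ μ ν ∧ c = planCost γ} :=
  ⟨0, by rintro c ⟨γ, -, rfl⟩; exact planCost_nonneg γ⟩

lemma sInf_planCost_nonneg (μ ν : PM d) : 0 ≤ sInf {c | ∃ γ, IsPlan γ μ ν ∧ c = planCost γ} :=
  Real.sInf_nonneg (by rintro c ⟨γ, -, rfl⟩; exact planCost_nonneg γ)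

lemma wass_sq (μ ν : PM d) : wass μ ν ^ 2 = sInf {c | ∃ γ, IsPlan γ μ ν ∧ c = planCost γ} :=
  Real.sq_sqrt (sInf_planCost_nonneg μ ν)

lemma wass_nonneg (μ ν : PM d) : 0 ≤ wass μ ν := Real.sqrt_nonneg _

lemma IsPlan.wass_sq_le {γ : Measure (E d × E d)} {μ ν : PM d} (h : IsPlan γ μ ν) :
    wass μ ν ^ 2 ≤ planCost γ := by
  rw [wass_sq]; exact csInf_le (bddBelow_planCost μ ν) ⟨γ, h, rfl⟩

lemma le_wass_sq {μ ν : PM d} {c : ℝ} (h : ∀ γ, IsPlan γ μ ν → c ≤ planCost γ) :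
    c ≤ wass μ ν ^ 2 := by
  rw [wass_sq]
  refine le_csInf ⟨_, _, isPlan_prod μ ν, rfl⟩ ?_
  rintro c ⟨γ, hγ, rfl⟩; exact h γ hγ

lemma planCost_swap (γ : Measure (E d × E d)) : planCost (γ.map Prod.swap) = planCost γ := by
  rw [planCost, integral_map measurable_swap.aemeasurable
    continuous_torusDist_sq.aestronglyMeasurable]
  simp_rw [Prod.fst_swap, Prod.snd_swap, fun z : E d × E d => torusDist_comm z.2 z.1]
  rfl

lemma wass_comm (μ ν : PM d) : wass μ ν = wass ν μ := by
  have h : ∀ μ ν : PM d, wass μ ν ≤ wass ν μ := fun μ ν =>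
    (sq_le_sq₀ (wass_nonneg _ _) (wass_nonneg _ _)).1 <| le_wass_sq fun γ hγ => by
      rw [← planCost_swap γ]; exact hγ.swap.wass_sq_le
  exact le_antisymm (h μ ν) (h ν μ)

lemma wass_le_sqrt (μ ν : PM d) : wass μ ν ≤ Real.sqrt d := by
  have h := (isPlan_prod μ ν)
  have := h.isProbabilityMeasure
  rw [← sq_le_sq₀ (wass_nonneg _ _) (Real.sqrt_nonneg _)]
  refine h.wass_sq_le.trans ?_
  calc planCost _ ≤ ∫ _z, Real.sqrt d ^ 2 ∂((μ : Measure (E d)).prod (ν : Measure (E d))) := by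
        refine integral_mono (integrable_torusDist_sq _) (integrable_const _) fun z => ?_
        have h0 := torusDist_nonneg z.1 z.2
        have h1 := torusDist_le_sqrt z.1 z.2
        simp only; gcongr
    _ = _ := by simp

/-- Optimal plans exist: by Prokhorov's theorem the set of plans is compact for the weak topology,
and the cost is the integral of a bounded continuous function. -/
lemma exists_isPlan_planCost_eq (μ ν : PM d) : ∃ γ, IsPlan γ μ ν ∧ planCost γ = wass μ ν ^ 2 := by
  let S : Set (ProbabilityMeasure (E d × E d)) := {γ | IsPlan (γ : Measure (E d × E d)) μ ν}
  have hS : IsClosed S := by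
    have h1 : S = {γ | γ.map measurable_fst.aemeasurable = μ} ∩
        {γ | γ.map measurable_snd.aemeasurable = ν} := by
      ext γ
      exact and_congr (Subtype.ext_iff (a1 := γ.map measurable_fst.aemeasurable) (a2 := μ)).symm
        (Subtype.ext_iff (a1 := γ.map measurable_snd.aemeasurable) (a2 := ν)).symm
    rw [h1]
    exact (isClosed_eq (ProbabilityMeasure.continuous_map continuous_fst) continuous_const).inter
      (isClosed_eq (ProbabilityMeasure.continuous_map continuous_snd) continuous_const)
  -- the marginals are fixed, hence tight
  have htight : IsTightMeasureSet
      {((γ : ProbabilityMeasure (E d × E d)) : Measure (E d × E d)) | γ ∈ S} := by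
    apply IsTightMeasureSet.prodMk
    · refine (isTightMeasureSet_singleton (μ := (μ : Measure (E d)))).subset ?_
      rintro _ ⟨_, ⟨γ, hγ, rfl⟩, rfl⟩
      exact (show IsPlan _ μ ν from hγ).1
    · refine (isTightMeasureSet_singleton (μ := (ν : Measure (E d)))).subset ?_
      rintro _ ⟨_, ⟨γ, hγ, rfl⟩, rfl⟩
      exact (show IsPlan _ μ ν from hγ).2
  have hc : IsCompact S := by
    have := isCompact_closure_of_isTightMeasureSet htight
    rwa [hS.closure_eq] at this
  have hne : S.Nonempty := ⟨⟨(μ : Measure (E d)).prod (ν : Measure (E d)), inferInstance⟩,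
    isPlan_prod μ ν⟩
  let c : BoundedContinuousFunction (E d × E d) ℝ := BoundedContinuousFunction.ofNormedAddCommGroup
    (fun z => torusDist z.1 z.2 ^ 2) (continuous_torusDist.pow 2) d (fun z => by
      have h1 := torusDist_le_sqrt z.1 z.2
      have h0 := torusDist_nonneg z.1 z.2
      rw [Real.norm_of_nonneg (by positivity), ← Real.sq_sqrt (Nat.cast_nonneg d)]
      gcongr)
  have hcont : Continuous (fun γ : ProbabilityMeasure (E d × E d) => planCost (γ : Measure (E d × E d))) := by
    rw [continuous_iff_continuousAt]
    intro γ
    exact (ProbabilityMeasure.tendsto_iff_forall_integral_tendsto.1 tendsto_id) c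
  obtain ⟨γ, hγ, hmin⟩ := hc.exists_isMinOn hne hcont.continuousOn
  refine ⟨γ, hγ, le_antisymm (le_wass_sq fun η hη => ?_) (IsPlan.wass_sq_le hγ)⟩
  have := hη.isProbabilityMeasure
  exact hmin (show (⟨η, this⟩ : ProbabilityMeasure (E d × E d)) ∈ S from hη)

open ProbabilityTheory in
/-- Gluing of plans along a common marginal. -/
lemma IsPlan.glue {γ₁ γ₂ : Measure (E d × E d)} {μ ν σ : PM d} (h₁ : IsPlan γ₁ μ ν)
    (h₂ : IsPlan γ₂ ν σ) : ∃ π : Measure ((E d × E d) × E d),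
      π.map Prod.fst = γ₁ ∧ π.map (fun w => (w.1.2, w.2)) = γ₂ := by
  have := h₁.isProbabilityMeasure
  have := h₂.isProbabilityMeasure
  let κ := γ₂.condKernel
  refine ⟨γ₁ ⊗ₘ (κ.comap Prod.snd measurable_snd), ?_, ?_⟩
  · exact Measure.fst_compProd _ _
  · have hκ : γ₂ = (ν : Measure (E d)) ⊗ₘ κ := by
      rw [← h₂.1]; exact (Measure.disintegrate γ₂ γ₂.condKernel).symm
    conv_rhs => rw [hκ]
    ext s hs
    rw [Measure.map_apply (by fun_prop) hs, Measure.compProd_apply hs,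
      Measure.compProd_apply ((by fun_prop : Measurable fun w : (E d × E d) × E d =>
        (w.1.2, w.2)) hs), ← h₁.2, lintegral_map (Kernel.measurable_kernel_prodMk_left hs)
        measurable_snd]
    rfl

lemma planCost_map {X : Type*} [MeasurableSpace X] {π : Measure X} {f : X → E d × E d}
    (hf : Measurable f) : planCost (π.map f) = ∫ w, torusDist (f w).1 (f w).2 ^ 2 ∂π := by
  rw [planCost, integral_map hf.aemeasurable continuous_torusDist_sq.aestronglyMeasurable]

lemma wass_congr_right {ν ν' : PM d} {η : Measure (E d × E d)} (hη : IsPlan η ν ν')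
    (h0 : ∀ᵐ z ∂η, torusDist z.1 z.2 = 0) (μ : PM d) : wass μ ν = wass μ ν' := by
  have key : ∀ (ν ν' : PM d) (η : Measure (E d × E d)), IsPlan η ν ν' →
      (∀ᵐ z ∂η, torusDist z.1 z.2 = 0) → wass μ ν' ≤ wass μ ν := by
    intro ν ν' η hη h0
    refine (sq_le_sq₀ (wass_nonneg _ _) (wass_nonneg _ _)).1 <| le_wass_sq fun γ hγ => ?_
    obtain ⟨π, h1, h2⟩ := hγ.glue hη
    have hm : Measurable (fun w : (E d × E d) × E d => (w.1.1, w.2)) := by fun_prop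
    have hp : IsPlan (π.map (fun w : (E d × E d) × E d => (w.1.1, w.2))) μ ν' := by
      constructor
      · rw [Measure.map_map measurable_fst hm, ← hγ.1, ← h1, Measure.map_map measurable_fst
          measurable_fst]; rfl
      · rw [Measure.map_map measurable_snd hm, ← hη.2, ← h2, Measure.map_map measurable_snd
          (by fun_prop)]; rfl
    refine hp.wass_sq_le.trans (le_of_eq ?_)
    rw [planCost_map hm, ← h1, planCost_map measurable_fst]
    refine integral_congr_ae ?_
    rw [← h2] at h0
    filter_upwards [ae_of_ae_map (by fun_prop) h0] with w hw
    rw [torusDist_congr_right hw]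
  refine le_antisymm (key ν' ν _ hη.swap ?_) (key ν ν' η hη h0)
  rw [ae_map_iff measurable_swap.aemeasurable (measurableSet_eq_fun
    continuous_torusDist.measurable measurable_const)]
  filter_upwards [h0] with z hz
  simpa [torusDist_comm] using hz

lemma measEq_of_isPlan {ν ν' : PM d} {η : Measure (E d × E d)} (hη : IsPlan η ν ν')
    (h0 : ∀ᵐ z ∂η, torusDist z.1 z.2 = 0) : MeasEq ν ν' := by
  intro φ hc hφ
  rw [← hη.integral_fst hc.aestronglyMeasurable, ← hη.integral_snd hc.aestronglyMeasurable]
  refine integral_congr_ae ?_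
  filter_upwards [h0] with z hz
  exact hφ _ _ (torusEq_of_torusDist_eq_zero hz)

lemma wass_eq_zero_of_isPlan {ν ν' : PM d} {η : Measure (E d × E d)} (hη : IsPlan η ν ν')
    (h0 : ∀ᵐ z ∂η, torusDist z.1 z.2 = 0) : wass ν ν' = 0 := by
  have h : planCost η = 0 := by
    rw [planCost, integral_eq_zero_of_ae]
    filter_upwards [h0] with z hz
    simp [hz]
  have := hη.wass_sq_le
  rw [h] at this
  exact pow_eq_zero_iff two_ne_zero |>.1 (le_antisymm this (sq_nonneg _))

lemma isPlan_map {X : Type*} [MeasurableSpace X] {π : Measure X} {f g : X → E d} {μ ν : PM d}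
    (hf : Measurable f) (hg : Measurable g) (h1 : π.map f = μ) (h2 : π.map g = ν) :
    IsPlan (π.map fun w => (f w, g w)) μ ν := by
  constructor
  · rw [Measure.map_map measurable_fst (hf.prodMk hg)]; exact h1
  · rw [Measure.map_map measurable_snd (hf.prodMk hg)]; exact h2

/-- Every class of measures has a representative `ν'` which is reached from `μ` by an optimal plan
moving mass along shortest displacements: move an optimal plan by the integer vector that makes
`y - x` shortest. -/
lemma exists_isOptPlan (μ ν : PM d) : ∃ (ν' : PM d) (γ : Measure (E d × E d)),
    IsOptPlan γ μ ν' ∧ wass μ ν' = wass μ ν ∧ wass ν ν' = 0 ∧ MeasEq ν ν' := by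
  obtain ⟨γ, hγ, hcost⟩ := exists_isPlan_planCost_eq μ ν
  have := hγ.isProbabilityMeasure
  let f : E d × E d → E d := fun z => z.2 + roundVec (z.1 - z.2)
  have hf : Measurable f :=
    measurable_snd.add (measurable_roundVec.comp (measurable_fst.sub measurable_snd))
  have hf0 : ∀ z, torusDist z.2 (f z) = 0 := fun z => by
    rw [torusDist_comm]
    exact torusDist_eq_zero_of_torusEq (torusEq_add (torusEq_roundVec _) _)
  let ν' : PM d := ⟨γ.map f, Measure.isProbabilityMeasure_map hf.aemeasurable⟩
  have hη : IsPlan (γ.map fun z => (z.2, f z)) ν ν' := isPlan_map (f := Prod.snd) measurable_snd hf hγ.2 rfl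
  have h0 : ∀ᵐ z ∂(γ.map fun z => (z.2, f z)), torusDist z.1 z.2 = 0 := by
    rw [ae_map_iff (measurable_snd.prodMk hf).aemeasurable (measurableSet_eq_fun
      continuous_torusDist.measurable measurable_const)]
    exact ae_of_all _ hf0
  have hW : wass μ ν' = wass μ ν := (wass_congr_right hη h0 μ).symm
  refine ⟨ν', γ.map fun z => (z.1, f z), ⟨isPlan_map (f := Prod.fst) measurable_fst hf hγ.1 rfl, ?_, ?_⟩, hW,
    wass_eq_zero_of_isPlan hη h0, measEq_of_isPlan hη h0⟩
  · rw [hW, ← hcost, planCost_map (measurable_fst.prodMk hf)]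
    refine integral_congr_ae (ae_of_all _ fun z => ?_)
    simp only
    rw [torusDist_congr_right (hf0 z)]
  · have hm : MeasurableSet {z : E d × E d | ‖z.1 - z.2‖ = torusDist z.1 z.2} :=
      measurableSet_eq_fun (by fun_prop) continuous_torusDist.measurable
    rw [ae_map_iff (measurable_fst.prodMk hf).aemeasurable hm]
    refine ae_of_all _ fun z => ?_
    simp only
    rw [← torusDist_congr_right (hf0 z), torusDist_eq]
    congr 1; simp only [f]; abel

lemma coe_push {f : E d → E d} (hf : Continuous f) (μ : PM d) :
    (push f μ : Measure (E d)) = (μ : Measure (E d)).map f := by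
  have h : AEMeasurable f (μ : Measure (E d)) := hf.aemeasurable
  rw [push, dif_pos h]; rfl

lemma IsPlan.map_push {γ : Measure (E d × E d)} {μ ν : PM d} (h : IsPlan γ μ ν)
    {f g : E d → E d} (hf : Continuous f) (hg : Continuous g) :
    IsPlan (γ.map fun z => (f z.1, g z.2)) (push f μ) (push g ν) := by
  refine isPlan_map (by fun_prop) (by fun_prop) ?_ ?_
  · rw [coe_push hf, ← h.1, Measure.map_map hf.measurable measurable_fst]; rfl
  · rw [coe_push hg, ← h.2, Measure.map_map hg.measurable measurable_snd]; rfl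

/-- A plan along which `|x - y|² ` is integrable bounds the Wasserstein distance. -/
lemma IsPlan.wass_sq_le_integral {γ : Measure (E d × E d)} {μ ν : PM d} (h : IsPlan γ μ ν)
    (hi : Integrable (fun z : E d × E d => ‖z.2 - z.1‖ ^ 2) γ) :
    wass μ ν ^ 2 ≤ ∫ z, ‖z.2 - z.1‖ ^ 2 ∂γ := by
  have := h.isProbabilityMeasure
  refine h.wass_sq_le.trans (integral_mono (integrable_torusDist_sq γ) hi fun z => ?_)
  have h0 := torusDist_nonneg z.1 z.2
  have h1 := torusDist_le_norm z.1 z.2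
  rw [norm_sub_rev] at h1
  simp only; gcongr

lemma isPlan_diag (μ : PM d) : IsPlan ((μ : Measure (E d)).map fun x => (x, x)) μ μ :=
  isPlan_map measurable_id measurable_id (by simp) (by simp)

lemma wass_self (μ : PM d) : wass μ μ = 0 := by
  refine wass_eq_zero_of_isPlan (isPlan_diag μ) ?_
  rw [ae_map_iff (by fun_prop) (measurableSet_eq_fun continuous_torusDist.measurable
    measurable_const)]
  exact ae_of_all _ fun x => torusDist_self x

/-! ### Compactness of the space of probability measures on the torus -/

open scoped ENNReal in
lemma inv_max_mul_mul (A B : ℝ≥0∞) (hA : A ≠ ∞) (hB : B ≠ ∞) :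
    (max A B)⁻¹ * (A * B) = min A B := by
  rcases le_total A B with h | h
  · rw [max_eq_right h, min_eq_left h, mul_comm A B]
    rcases eq_or_ne B 0 with rfl | h0
    · simp [nonpos_iff_eq_zero.1 h]
    · rw [← mul_assoc, ENNReal.inv_mul_cancel h0 hB, one_mul]
  · rw [max_eq_left h, min_eq_right h]
    rcases eq_or_ne A 0 with rfl | h0
    · simp [nonpos_iff_eq_zero.1 h]
    · rw [← mul_assoc, ENNReal.inv_mul_cancel h0 hA, one_mul]

/-- Two probability measures that are cut into small pieces of almost equal masses are close: pair
the pieces as far as their masses agree, and couple the rest arbitrarily. -/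
lemma wass_sq_le_of_pieces {μ ν : PM d} {n : ℕ} {μi νi : Fin n → Measure (E d)} {η : ℝ}
    (hμ : ∑ i, μi i = (μ : Measure (E d))) (hν : ∑ i, νi i = (ν : Measure (E d)))
    (h : ∀ i, ∀ᵐ z ∂((μi i).prod (νi i)), torusDist z.1 z.2 ≤ η) :
    wass μ ν ^ 2 ≤ η ^ 2 + d * ∑ i, |(μi i).real univ - (νi i).real univ| := by
  have fμ : ∀ i, IsFiniteMeasure (μi i) := fun i => by
    refine isFiniteMeasure_of_le (μ : Measure (E d)) ?_
    rw [← hμ]; exact Finset.single_le_sum (f := μi) (fun _ _ => Measure.zero_le _) (Finset.mem_univ i)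
  have fν : ∀ i, IsFiniteMeasure (νi i) := fun i => by
    refine isFiniteMeasure_of_le (ν : Measure (E d)) ?_
    rw [← hν]; exact Finset.single_le_sum (f := νi) (fun _ _ => Measure.zero_le _) (Finset.mem_univ i)
  -- `c i * A i * B i = min (A i) (B i)`, so that `c i • (μi i).prod (νi i)` transports as much mass
  -- as the pieces have in common; `R` and `R'` are what remains of `μ` and `ν`
  let A := fun i => μi i univ
  let B := fun i => νi i univ
  let c := fun i => (max (A i) (B i))⁻¹
  have hA : ∀ i, A i ≠ ⊤ := fun i => measure_ne_top _ _
  have hB : ∀ i, B i ≠ ⊤ := fun i => measure_ne_top _ _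
  have hcA : ∀ i, c i * A i ≤ 1 := fun i =>
    (mul_le_mul_right (le_max_left _ _) _).trans (ENNReal.inv_mul_le_one _)
  have hcB : ∀ i, c i * B i ≤ 1 := fun i =>
    (mul_le_mul_right (le_max_right _ _) _).trans (ENNReal.inv_mul_le_one _)
  have hsA : ∑ i, A i = 1 := by
    have := congrArg (fun m : Measure (E d) => m univ) hμ
    simpa [Measure.finsetSum_apply] using this
  have hsB : ∑ i, B i = 1 := by
    have := congrArg (fun m : Measure (E d) => m univ) hν
    simpa [Measure.finsetSum_apply] using this
  let γ₀ : Measure (E d × E d) := ∑ i, c i • (μi i).prod (νi i)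
  let R : Measure (E d) := ∑ i, (1 - c i * B i) • μi i
  let R' : Measure (E d) := ∑ i, (1 - c i * A i) • νi i
  have hR : ∑ i, (c i * B i) • μi i + R = μ := by
    rw [← hμ, ← Finset.sum_add_distrib]
    exact Finset.sum_congr rfl fun i _ => by rw [← add_smul, add_tsub_cancel_of_le (hcB i), one_smul]
  have hR' : ∑ i, (c i * A i) • νi i + R' = ν := by
    rw [← hν, ← Finset.sum_add_distrib]
    exact Finset.sum_congr rfl fun i _ => by rw [← add_smul, add_tsub_cancel_of_le (hcA i), one_smul]
  have hm : ∑ i, min (A i) (B i) + R univ = 1 := by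
    have := congrArg (fun m : Measure (E d) => m univ) hR
    simp only [Measure.add_apply, Measure.finsetSum_apply, Measure.smul_apply, smul_eq_mul,
      measure_univ] at this
    rw [← this]; congr 1
    exact Finset.sum_congr rfl fun i _ => by
      rw [← inv_max_mul_mul _ _ (hA i) (hB i)]; ring
  have hm' : ∑ i, min (A i) (B i) + R' univ = 1 := by
    have := congrArg (fun m : Measure (E d) => m univ) hR'
    simp only [Measure.add_apply, Measure.finsetSum_apply, Measure.smul_apply, smul_eq_mul,
      measure_univ] at this
    rw [← this]; congr 1
    exact Finset.sum_congr rfl fun i _ => by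
      rw [← inv_max_mul_mul _ _ (hA i) (hB i)]; ring
  have hmin : ∑ i, min (A i) (B i) ≠ ⊤ := by
    intro h0; rw [h0] at hm; simp at hm
  -- the remainders have the same mass, so that their normalized product is a coupling
  have hRR' : R univ = R' univ := by
    rw [← hm'] at hm; exact (ENNReal.add_right_inj hmin).1 hm
  have hRtop : R univ ≠ ⊤ := by
    intro h0; rw [h0] at hm; simp at hm
  have fR : IsFiniteMeasure R := ⟨hRtop.lt_top⟩
  have fR' : IsFiniteMeasure R' := ⟨by rw [← hRR']; exact hRtop.lt_top⟩
  let γ₁ : Measure (E d × E d) := (R univ)⁻¹ • R.prod R'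
  have hγ₁ : γ₁.map Prod.fst = R ∧ γ₁.map Prod.snd = R' := by
    rcases eq_or_ne (R univ) 0 with h0 | h0
    · have e1 : R = 0 := Measure.measure_univ_eq_zero.1 h0
      have e2 : R' = 0 := Measure.measure_univ_eq_zero.1 (hRR' ▸ h0)
      simp [γ₁, e1, e2]
    · constructor
      · simp only [γ₁, Measure.map_smul, Measure.map_fst_prod, ← hRR', smul_smul]
        rw [ENNReal.inv_mul_cancel h0 hRtop, one_smul]
      · simp only [γ₁, Measure.map_smul, Measure.map_snd_prod, smul_smul]
        rw [ENNReal.inv_mul_cancel h0 hRtop, one_smul]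
  have hp : IsPlan (γ₀ + γ₁) μ ν := by
    constructor
    · rw [Measure.map_add _ _ measurable_fst, hγ₁.1, ← hR]
      congr 1
      simp only [γ₀, ← Measure.mapₗ_apply_of_measurable (measurable_fst (α := E d) (β := E d)),
        map_sum]
      refine Finset.sum_congr rfl fun i _ => ?_
      rw [Measure.mapₗ_apply_of_measurable measurable_fst, Measure.map_smul, Measure.map_fst_prod,
        smul_smul]
    · rw [Measure.map_add _ _ measurable_snd, hγ₁.2, ← hR']
      congr 1
      simp only [γ₀, ← Measure.mapₗ_apply_of_measurable (measurable_snd (α := E d) (β := E d)),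
        map_sum]
      refine Finset.sum_congr rfl fun i _ => ?_
      rw [Measure.mapₗ_apply_of_measurable measurable_snd, Measure.map_smul, Measure.map_snd_prod,
        smul_smul]
  have hprob := hp.isProbabilityMeasure
  have f0 : IsFiniteMeasure γ₀ := isFiniteMeasure_of_le (γ₀ + γ₁) (Measure.le_add_right le_rfl)
  have f1 : IsFiniteMeasure γ₁ := isFiniteMeasure_of_le (γ₀ + γ₁) (Measure.le_add_left le_rfl)
  have u1 : γ₁ univ = R univ := by
    rw [← hγ₁.1, Measure.map_apply measurable_fst MeasurableSet.univ, preimage_univ]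
  -- matched mass moves by at most `η`, the rest by at most `√d`
  have hae : ∀ᵐ z ∂γ₀, torusDist z.1 z.2 ^ 2 ≤ η ^ 2 := by
    have : ∀ᵐ z ∂γ₀, torusDist z.1 z.2 ≤ η := by
      rw [ae_iff, Measure.finsetSum_apply]
      exact Finset.sum_eq_zero fun i _ => by
        rw [Measure.smul_apply, ae_iff.1 (h i), smul_zero]
    filter_upwards [this] with z hz
    have := torusDist_nonneg z.1 z.2
    gcongr
  have hc0 : planCost γ₀ ≤ η ^ 2 := by
    calc planCost γ₀ ≤ ∫ _z, η ^ 2 ∂γ₀ :=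
          integral_mono_ae (integrable_torusDist_sq _) (integrable_const _) hae
      _ = γ₀.real univ * η ^ 2 := by simp
      _ ≤ 1 * η ^ 2 := by
          gcongr
          have hle : γ₀ ≤ γ₀ + γ₁ := Measure.le_add_right le_rfl
          exact (ENNReal.toReal_mono (measure_ne_top _ _) (hle univ)).trans
            (probReal_univ (μ := γ₀ + γ₁)).le
      _ = η ^ 2 := one_mul _
  have hc1 : planCost γ₁ ≤ d * ∑ i, |(μi i).real univ - (νi i).real univ| := by
    calc planCost γ₁ ≤ ∫ _z, (d : ℝ) ∂γ₁ := by
          refine integral_mono (integrable_torusDist_sq _) (integrable_const _) fun z => ?_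
          have h1 := torusDist_le_sqrt z.1 z.2
          have h0 := torusDist_nonneg z.1 z.2
          simp only
          rw [← Real.sq_sqrt (Nat.cast_nonneg d)]
          gcongr
      _ = d * (R univ).toReal := by simp [Measure.real, u1, mul_comm]
      _ ≤ _ := by
          gcongr
          have e1 := congrArg ENNReal.toReal (hm.trans hsA.symm)
          rw [ENNReal.toReal_add hmin hRtop, ENNReal.toReal_sum (fun i _ => hA i),
            ENNReal.toReal_sum (fun i _ => ne_top_of_le_ne_top (hA i) (min_le_left _ _))] at e1
          have e2 : (R univ).toReal = ∑ i, ((A i).toReal - (min (A i) (B i)).toReal) := by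
            rw [Finset.sum_sub_distrib]; linarith
          rw [e2]
          refine Finset.sum_le_sum fun i _ => ?_
          rw [ENNReal.toReal_min (hA i) (hB i)]
          change (A i).toReal - _ ≤ |(A i).toReal - (B i).toReal|
          rcases le_total (A i).toReal (B i).toReal with h | h
          · rw [min_eq_left h, sub_self]; positivity
          · rw [min_eq_right h]; exact le_abs_self _
  refine hp.wass_sq_le.trans ?_
  rw [planCost, integral_add_measure (integrable_torusDist_sq _) (integrable_torusDist_sq _)]
  exact add_le_add hc0 hc1

/-- On a compact set, weak convergence of probability measures implies convergence for `wass`. -/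
lemma eventually_wass_lt {K : Set (E d)} (hK : IsCompact K) (μ : PM d)
    (hμ : (μ : Measure (E d)) Kᶜ = 0) {δ : ℝ} (hδ : 0 < δ) :
    ∀ᶠ ν : PM d in 𝓝 μ, (ν : Measure (E d)) Kᶜ = 0 → wass μ ν < δ := by
  let η := δ / 2
  have hη : 0 < η := by positivity
  -- a partition of unity on `K` subordinate to balls of diameter `η`
  obtain ⟨t, -, htf, ht⟩ := finite_cover_balls_of_compact hK (show 0 < η / 2 by positivity)
  obtain ⟨n, f, hf⟩ : ∃ (n : ℕ) (f : Fin n → E d), K ⊆ ⋃ i, Metric.ball (f i) (η / 2) := by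
    have := htf.fintype
    refine ⟨Fintype.card t, fun i => ((Fintype.equivFin t).symm i : E d), ht.trans ?_⟩
    intro x hx
    simp only [mem_iUnion] at hx ⊢
    obtain ⟨y, hy, hxy⟩ := hx
    exact ⟨Fintype.equivFin t ⟨y, hy⟩, by simpa using hxy⟩
  obtain ⟨χ, hs, h1, h01, -⟩ := exists_continuous_sum_one_of_isOpen_isCompact
    (fun i => Metric.isOpen_ball (x := f i) (ε := η / 2)) hK hf
  -- the pieces `χᵢ ν` of a measure `ν` carried by `K`
  let p : PM d → Fin n → Measure (E d) := fun ν i =>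
    (ν : Measure (E d)).withDensity fun x => ENNReal.ofReal (χ i x)
  have hmeas : ∀ i, Measurable fun x => ENNReal.ofReal (χ i x) := fun i =>
    (χ i).continuous.measurable.ennreal_ofReal
  have hint : ∀ (ν : PM d) i, Integrable (χ i) (ν : Measure (E d)) := fun ν i =>
    Integrable.of_bound (χ i).continuous.aestronglyMeasurable 1 (ae_of_all _ fun x => by
      rw [Real.norm_of_nonneg (h01 i x).1]; exact (h01 i x).2)
  have hsum : ∀ ν : PM d, (ν : Measure (E d)) Kᶜ = 0 → ∑ i, p ν i = (ν : Measure (E d)) := by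
    intro ν hν
    have : ∑ i, p ν i = (ν : Measure (E d)).withDensity (fun x => ∑ i, ENNReal.ofReal (χ i x)) := by
      ext s hs
      rw [Measure.finsetSum_apply, withDensity_apply _ hs, lintegral_finsetSum _ fun i _ => hmeas i]
      exact Finset.sum_congr rfl fun i _ => withDensity_apply _ hs
    rw [this]
    conv_rhs => rw [← withDensity_one (μ := (ν : Measure (E d)))]
    refine withDensity_congr_ae ?_
    filter_upwards [compl_mem_ae_iff.2 hν] with x hx
    rw [compl_compl] at hx
    rw [← ENNReal.ofReal_sum_of_nonneg fun i _ => (h01 i x).1]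
    have := h1 hx
    simp only [Finset.sum_apply, Pi.one_apply] at this
    simp [this]
  have hreal : ∀ (ν : PM d) i, (p ν i).real univ = ∫ x, χ i x ∂(ν : Measure (E d)) := by
    intro ν i
    rw [Measure.real, withDensity_apply _ MeasurableSet.univ, Measure.restrict_univ,
      integral_eq_lintegral_of_nonneg_ae (ae_of_all _ fun x => (h01 i x).1)
      (χ i).continuous.aestronglyMeasurable]
  -- the masses of the pieces are integrals of continuous functions, hence weakly continuous
  have hlim : Tendsto (fun ν : PM d => η ^ 2 + d * ∑ i, |(p μ i).real univ - (p ν i).real univ|)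
      (𝓝 μ) (𝓝 (η ^ 2 + d * ∑ i : Fin n, |(p μ i).real univ - (p μ i).real univ|)) := by
    refine Tendsto.const_add _ (Tendsto.const_mul _ (tendsto_finsetSum _ fun i _ => ?_))
    refine (Tendsto.const_sub _ ?_).abs
    simp_rw [hreal]
    exact (ProbabilityMeasure.tendsto_iff_forall_integral_tendsto.1 tendsto_id)
      (BoundedContinuousFunction.ofNormedAddCommGroup (χ i) (χ i).continuous 1 fun x => by
        rw [Real.norm_of_nonneg (h01 i x).1]; exact (h01 i x).2)
  have hlt : η ^ 2 + d * ∑ i : Fin n, |(p μ i).real univ - (p μ i).real univ| < δ ^ 2 := by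
    simp only [sub_self, abs_zero, Finset.sum_const_zero, mul_zero, add_zero, η]
    nlinarith
  filter_upwards [hlim.eventually_lt_const hlt] with ν hν hνK
  rw [← sq_lt_sq₀ (wass_nonneg _ _) hδ.le]
  refine lt_of_le_of_lt (wass_sq_le_of_pieces (hsum μ hμ) (hsum ν hνK) fun i => ?_) hν
  have hpi : ∀ ν : PM d, ∀ᵐ x ∂(p ν i), x ∈ Metric.ball (f i) (η / 2) := fun ν => by
    rw [ae_withDensity_iff (hmeas i)]
    refine ae_of_all _ fun x hx => hs i (subset_tsupport _ ?_)
    intro h0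
    simp [h0] at hx
  have fin : ∀ ν : PM d, IsFiniteMeasure (p ν i) := fun ν =>
    isFiniteMeasure_withDensity_ofReal (hint ν i).2
  have e1 := Measure.quasiMeasurePreserving_fst (μ := p μ i) (ν := p ν i) |>.ae (hpi μ)
  have e2 := Measure.quasiMeasurePreserving_snd (μ := p μ i) (ν := p ν i) |>.ae (hpi ν)
  filter_upwards [e1, e2] with z hz1 hz2
  refine (torusDist_le_norm _ _).trans ?_
  rw [← dist_eq_norm]
  have := dist_triangle_right z.1 z.2 (f i)
  rw [Metric.mem_ball] at hz1 hz2
  linarith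

/-- The space of probability measures on the torus is compact, hence a function that is continuous
in a point and a measure is bounded if the point stays in a compact set. -/
lemma ContinuousW.exists_bound {X Y : Type} [PseudoMetricSpace X] [SeminormedAddCommGroup Y]
    {Φ : X → PM d → Y} (h : ContinuousW Φ) {s : Set X} (hs : IsCompact s) :
    ∃ C, ∀ x ∈ s, ∀ μ, ‖Φ x μ‖ ≤ C := by
  -- `K` contains the cube around the origin, a fundamental domain of the torus
  let K : Set (E d) := Metric.closedBall 0 (Real.sqrt d)
  have hK : IsCompact K := isCompact_closedBall _ _
  let S : Set (PM d) := {μ | (μ : Measure (E d)) Kᶜ = 0}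
  have hS : IsCompact S := by
    have := isCompact_setOfPred_probabilityMeasure_mass_eq_compl_isCompact_le (E := E d)
      (u := fun _ => 0) (K := fun _ => K) tendsto_const_nhds (fun _ => hK)
      (Or.inr monotone_const)
    convert this using 1
    ext μ
    simp [S, ProbabilityMeasure.null_iff_toMeasure_null]
  obtain ⟨C, hC⟩ : ∃ C, ∀ z ∈ s ×ˢ S, ‖Φ z.1 z.2‖ ≤ C := by
    refine (hs.prod hS).induction_on (p := fun t => ∃ C, ∀ z ∈ t, ‖Φ z.1 z.2‖ ≤ C) ⟨0, by simp⟩ ?_ ?_ ?_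
    · rintro t t' htt' ⟨C, hC⟩; exact ⟨C, fun z hz => hC z (htt' hz)⟩
    · rintro t t' ⟨C, hC⟩ ⟨C', hC'⟩
      refine ⟨max C C', fun z hz => ?_⟩
      rcases hz with hz | hz
      · exact (hC z hz).trans (le_max_left _ _)
      · exact (hC' z hz).trans (le_max_right _ _)
    · rintro ⟨x, μ⟩ ⟨-, hμ⟩
      obtain ⟨δ, hδ, hd⟩ := h x μ 1 one_pos
      refine ⟨Metric.ball x δ ×ˢ {ν | ν ∈ S ∧ wass μ ν < δ}, ?_, ‖Φ x μ‖ + 1, ?_⟩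
      · rw [nhdsWithin_prod_eq]
        refine prod_mem_prod (mem_nhdsWithin_of_mem_nhds (Metric.ball_mem_nhds _ hδ)) ?_
        have := eventually_wass_lt hK μ hμ hδ
        filter_upwards [mem_nhdsWithin_of_mem_nhds this, self_mem_nhdsWithin] with ν h1 h2
        exact ⟨h2, h1 h2⟩
      · rintro ⟨x', ν⟩ ⟨hx, -, hν⟩
        have := hd x' ν hx hν
        rw [dist_eq_norm] at this
        have h2 := norm_sub_norm_le (Φ x' ν) (Φ x μ)
        simp only at h2 ⊢
        linarith
  -- a general measure is at distance zero from its representative `μ'` carried by the cube, and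
  -- there `Φ` differs by at most one
  refine ⟨C + 1, fun x hx μ => ?_⟩
  have hm : Measurable (fun x : E d => x - roundVec x) := measurable_id.sub measurable_roundVec
  let μ' : PM d := ⟨(μ : Measure (E d)).map fun x => x - roundVec x,
    Measure.isProbabilityMeasure_map hm.aemeasurable⟩
  have hμ' : μ' ∈ S := by
    change (μ : Measure (E d)).map (fun x => x - roundVec x) Kᶜ = 0
    rw [Measure.map_apply hm hK.measurableSet.compl]
    convert measure_empty (μ := (μ : Measure (E d)))
    ext x
    simpa [K] using norm_fract_le x
  have hp : IsPlan ((μ : Measure (E d)).map fun x => (x, x - roundVec x)) μ μ' :=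
    isPlan_map measurable_id hm (by simp) rfl
  have hw : wass μ μ' = 0 := by
    refine wass_eq_zero_of_isPlan hp ?_
    rw [ae_map_iff (by fun_prop) (measurableSet_eq_fun continuous_torusDist.measurable
      measurable_const)]
    exact ae_of_all _ fun x => by
      rw [torusDist_comm]; exact torusDist_eq_zero_of_torusEq (torusEq_fract x)
  obtain ⟨δ, hδ, hd⟩ := h x μ 1 one_pos
  have h1 := hd x μ' (by simpa using hδ) (by rw [hw]; exact hδ)
  have h2 := hC (x, μ') ⟨hx, hμ'⟩
  rw [dist_eq_norm] at h1
  have h3 := norm_sub_norm_le (Φ x μ) (Φ x μ')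
  rw [norm_sub_rev] at h3
  simp only at h2
  linarith

/-! ### First-order expansions along arbitrary plans -/

/-- The total squared Euclidean displacement `∫ |y - x|² γ(dx, dy)`. -/
def sqCost (γ : Measure (E d × E d)) : ℝ := ∫ z, ‖z.2 - z.1‖ ^ 2 ∂γ

/-- The displacement `y - x` is square integrable. -/
def FiniteCost (γ : Measure (E d × E d)) : Prop :=
  MemLp (fun z : E d × E d => z.2 - z.1) 2 γ

lemma sqCost_nonneg (γ : Measure (E d × E d)) : 0 ≤ sqCost γ :=
  integral_nonneg fun _ => by positivity

lemma FiniteCost.integrable_sq {γ : Measure (E d × E d)} (h : FiniteCost γ) :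
    Integrable (fun z : E d × E d => ‖z.2 - z.1‖ ^ 2) γ :=
  (memLp_two_iff_integrable_sq_norm h.1).1 h

lemma finiteCost_of_bound {γ : Measure (E d × E d)} [IsFiniteMeasure γ] {C : ℝ}
    (h : ∀ᵐ z ∂γ, ‖z.2 - z.1‖ ≤ C) : FiniteCost γ :=
  MemLp.of_bound (by fun_prop) C h

lemma IsPlan.wass_le_sqrt_sqCost {γ : Measure (E d × E d)} {μ ν : PM d} (h : IsPlan γ μ ν)
    (hc : FiniteCost γ) : wass μ ν ≤ Real.sqrt (sqCost γ) :=
  Real.le_sqrt_of_sq_le (h.wass_sq_le_integral hc.integrable_sq)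

lemma integral_norm_mul_norm_le {X Y Z : Type*} [MeasurableSpace X] [NormedAddCommGroup Y]
    [NormedAddCommGroup Z] {γ : Measure X} {f : X → Y} {g : X → Z} (hf : MemLp f 2 γ)
    (hg : MemLp g 2 γ) :
    ∫ x, ‖f x‖ * ‖g x‖ ∂γ ≤ Real.sqrt (∫ x, ‖f x‖ ^ 2 ∂γ) * Real.sqrt (∫ x, ‖g x‖ ^ 2 ∂γ) := by
  have h := integral_mul_norm_le_Lp_mul_Lq (μ := γ) (f := fun x => ‖f x‖) (g := fun x => ‖g x‖)
    Real.HolderConjugate.two_two (by simpa using hf.norm) (by simpa using hg.norm)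
  simpa [Real.sqrt_eq_rpow] using h

lemma integral_norm_le_sqrt {X Y : Type*} [MeasurableSpace X] [NormedAddCommGroup Y]
    {γ : Measure X} [IsProbabilityMeasure γ] {f : X → Y} (hf : MemLp f 2 γ) :
    ∫ x, ‖f x‖ ∂γ ≤ Real.sqrt (∫ x, ‖f x‖ ^ 2 ∂γ) := by
  have h := integral_norm_mul_norm_le hf (memLp_const (1 : ℝ) (μ := γ))
  simpa using h

lemma IsOptPlan.norm_le {γ : Measure (E d × E d)} {μ ν : PM d} (h : IsOptPlan γ μ ν) :
    ∀ᵐ z ∂γ, ‖z.2 - z.1‖ ≤ Real.sqrt d := by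
  filter_upwards [h.2.2] with z hz
  rw [norm_sub_rev, hz]; exact torusDist_le_sqrt _ _

lemma IsOptPlan.finiteCost {γ : Measure (E d × E d)} {μ ν : PM d} (h : IsOptPlan γ μ ν) :
    FiniteCost γ := by
  have := h.1.isProbabilityMeasure
  exact finiteCost_of_bound h.norm_le

lemma IsOptPlan.sqCost_eq {γ : Measure (E d × E d)} {μ ν : PM d} (h : IsOptPlan γ μ ν) :
    sqCost γ = wass μ ν ^ 2 := by
  rw [← h.2.1]
  refine integral_congr_ae ?_
  filter_upwards [h.2.2] with z hz
  rw [norm_sub_rev, hz]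

lemma IsOptPlan.integral_norm_le {γ : Measure (E d × E d)} {μ ν : PM d} (h : IsOptPlan γ μ ν) :
    ∫ z, ‖z.2 - z.1‖ ∂γ ≤ wass μ ν := by
  have := h.1.isProbabilityMeasure
  refine (integral_norm_le_sqrt h.finiteCost).trans (le_of_eq ?_)
  change Real.sqrt (sqCost γ) = _
  rw [h.sqCost_eq, Real.sqrt_sq (wass_nonneg _ _)]

/-- A continuous function on the torus is bounded. -/
lemma OnTorus.exists_bound {Y : Type} [SeminormedAddCommGroup Y] {f : E d → Y} (hf : OnTorus f)
    (hc : Continuous f) : ∃ C, ∀ x, ‖f x‖ ≤ C := by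
  obtain ⟨C, hC⟩ := (isCompact_closedBall (0 : E d) (Real.sqrt d)).exists_bound_of_continuousOn
    hc.continuousOn
  refine ⟨C, fun x => ?_⟩
  rw [← hf _ _ (torusEq_fract x)]
  exact hC _ (by simpa using norm_fract_le x)

/-- Taylor's formula at first order for a map with Lipschitz derivative. -/
lemma norm_taylor_le {Z W : Type*} [NormedAddCommGroup Z] [NormedSpace ℝ Z]
    [NormedAddCommGroup W] [NormedSpace ℝ W] {f : Z → W} {f' : Z → Z →L[ℝ] W} {L : ℝ} (hL : 0 ≤ L)
    (hf : ∀ x, HasFDerivAt f (f' x) x) (hf' : ∀ x y, ‖f' y - f' x‖ ≤ L * ‖y - x‖) (x y : Z) :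
    ‖f y - f x - f' x (y - x)‖ ≤ L * ‖y - x‖ ^ 2 := by
  have := (convex_closedBall x ‖y - x‖).norm_image_sub_le_of_norm_hasFDerivWithin_le' (𝕜 := ℝ)
    (f := f) (f' := f') (φ := f' x) (C := L * ‖y - x‖) (fun z _ => (hf z).hasFDerivWithinAt)
    (fun z hz => (hf' x z).trans (by
      rw [mem_closedBall_iff_norm] at hz
      gcongr))
    (x := x) (y := y) (by simp) (by simp [dist_eq_norm])
  linarith [this, sq ‖y - x‖]

lemma norm_sub_le_of_fderiv {Z W : Type*} [NormedAddCommGroup Z] [NormedSpace ℝ Z]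
    [NormedAddCommGroup W] [NormedSpace ℝ W] {f : Z → W} {f' : Z → Z →L[ℝ] W} {C : ℝ}
    (hf : ∀ x, HasFDerivAt f (f' x) x) (hC : ∀ x, ‖f' x‖ ≤ C) (x y : Z) :
    ‖f y - f x‖ ≤ C * ‖y - x‖ :=
  convex_univ.norm_image_sub_le_of_norm_hasFDerivWithin_le (𝕜 := ℝ)
    (fun z _ => (hf z).hasFDerivWithinAt) (fun z _ => hC z) (mem_univ x) (mem_univ y)

lemma hasFDerivAt_comp_add {Z W : Type*} [NormedAddCommGroup Z] [NormedSpace ℝ Z]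
    [NormedAddCommGroup W] [NormedSpace ℝ W] {f : Z → W} {f' : Z →L[ℝ] W} {x k : Z}
    (h : HasFDerivAt f f' (x + k)) : HasFDerivAt (fun y => f (y + k)) f' x := by
  have := h.comp x ((hasFDerivAt_id x).add_const k)
  simpa using! this

/-- The derivative of a function on the torus is a function on the torus. -/
lemma OnTorus.hasFDerivAt {W : Type} [NormedAddCommGroup W] [NormedSpace ℝ W] {f : E d → W}
    {f' : E d → E d →L[ℝ] W} (hf : OnTorus f) (h : ∀ x, HasFDerivAt f (f' x) x) : OnTorus f' := by
  intro x y hxy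
  have h1 : HasFDerivAt (fun z => f (z + (y - x))) (f' y) x :=
    hasFDerivAt_comp_add (by simpa using h y)
  have h2 : (fun z => f (z + (y - x))) = f := by
    ext z
    exact hf _ _ (torusEq_add (torusEq_sub_iff.2 hxy.symm) z)
  rw [h2] at h1
  exact (h x).unique h1

/-- A smooth periodic function has a uniform first-order Taylor expansion. -/
lemma exists_taylor_bound_of_onTorus {φ : E d → ℝ} (hφ : ContDiff ℝ (⊤ : ℕ∞) φ)
    (hp : OnTorus φ) :
    ∃ C ≥ 0, ∀ x y, |φ y - φ x - inner ℝ (gradient φ x) (y - x)| ≤ C * ‖y - x‖ ^ 2 := by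
  have h1 : ∀ x, HasFDerivAt φ (fderiv ℝ φ x) x := fun x =>
    (hφ.differentiable (by simp) x).hasFDerivAt
  have hφ2 : ContDiff ℝ 1 (fderiv ℝ φ) := hφ.fderiv_right (by norm_cast)
  have h2 : ∀ x, HasFDerivAt (fderiv ℝ φ) (fderiv ℝ (fderiv ℝ φ) x) x := fun x =>
    (hφ2.differentiable (by simp) x).hasFDerivAt
  have hp2 : OnTorus (fderiv ℝ (fderiv ℝ φ)) := (hp.hasFDerivAt h1).hasFDerivAt h2
  obtain ⟨C, hC⟩ := hp2.exists_bound (hφ2.continuous_fderiv (by simp))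
  have hC0 : 0 ≤ C := le_trans (by positivity) (hC 0)
  refine ⟨C, hC0, fun x y => ?_⟩
  have := norm_taylor_le hC0 h1 (norm_sub_le_of_fderiv h2 hC) x y
  rw [Real.norm_eq_abs] at this
  simpa [gradient] using this

lemma integrable_inner_disp {γ : Measure (E d × E d)} {μ ν : PM d} (hγ : IsPlan γ μ ν)
    (hc : FiniteCost γ) {ξ : E d → E d} (hξ : MemLp ξ 2 (μ : Measure (E d))) :
    Integrable (fun z => inner ℝ (ξ z.1) (z.2 - z.1)) γ := by
  have h1 : MemLp (fun z : E d × E d => ξ z.1) 2 γ := by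
    rw [← hγ.1] at hξ
    exact (memLp_map_measure_iff hξ.1 measurable_fst.aemeasurable).1 hξ
  have := h1.norm.integrable_mul hc.norm
  refine this.mono (h1.1.inner hc.1) (ae_of_all _ fun z => ?_)
  simp only [Pi.mul_apply, norm_mul, norm_norm]
  exact norm_inner_le_norm _ _

lemma abs_integral_inner_disp_le {γ : Measure (E d × E d)} {μ ν : PM d} (hγ : IsPlan γ μ ν)
    (hc : FiniteCost γ) {ξ : E d → E d} (hξ : MemLp ξ 2 (μ : Measure (E d))) {ε : ℝ} (hε : 0 ≤ ε)
    (h : eLpNorm ξ 2 (μ : Measure (E d)) ≤ ENNReal.ofReal ε) :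
    |∫ z, inner ℝ (ξ z.1) (z.2 - z.1) ∂γ| ≤ ε * Real.sqrt (sqCost γ) := by
  have h1 : MemLp (fun z : E d × E d => ξ z.1) 2 γ := by
    rw [← hγ.1] at hξ
    exact (memLp_map_measure_iff hξ.1 measurable_fst.aemeasurable).1 hξ
  have h2 : Real.sqrt (∫ z, ‖ξ z.1‖ ^ 2 ∂γ) ≤ ε := by
    rw [hγ.integral_fst (f := fun x => ‖ξ x‖ ^ 2) (hξ.1.norm.pow 2)]
    have := hξ.eLpNorm_eq_integral_rpow_norm (by simp) (by simp)
    rw [this] at h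
    have h3 := (ENNReal.ofReal_le_ofReal_iff hε).1 h
    simpa [Real.sqrt_eq_rpow] using h3
  calc |∫ z, inner ℝ (ξ z.1) (z.2 - z.1) ∂γ|
      ≤ ∫ z, ‖ξ z.1‖ * ‖z.2 - z.1‖ ∂γ := by
        rw [← Real.norm_eq_abs]
        exact norm_integral_le_of_norm_le (h1.norm.integrable_mul hc.norm)
          (ae_of_all _ fun z => norm_inner_le_norm _ _)
    _ ≤ _ := integral_norm_mul_norm_le h1 hc
    _ ≤ _ := mul_le_mul_of_nonneg_right h2 (Real.sqrt_nonneg _)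

/-- The first-order expansion with a Wasserstein gradient holds along all plans, optimal or not.
This is where it matters that the gradient is tangent: for the gradient of a smooth function the
integral of `ξ(x) · (y - x)` depends, up to the cost of the plan, on the marginals only. -/
lemma IsWassGrad.expansion_of_isPlan {U : PM d → ℝ} (hU : ∀ μ ν, MeasEq μ ν → U μ = U ν)
    {μ : PM d} {ξ : E d → E d} (h : IsWassGrad U μ ξ) {ε : ℝ} (hε : 0 < ε) :
    ∃ r > 0, ∀ (ν : PM d) (γ : Measure (E d × E d)), IsPlan γ μ ν → FiniteCost γ →
      Real.sqrt (sqCost γ) ≤ r →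
      |U ν - U μ - ∫ z, inner ℝ (ξ z.1) (z.2 - z.1) ∂γ| ≤ ε * Real.sqrt (sqCost γ) := by
  obtain ⟨⟨hξ, happ⟩, hexp⟩ := h
  obtain ⟨φ, hφ, hper, hclose⟩ := happ (ε / 4) (by positivity)
  obtain ⟨C, hC0, hC⟩ := exists_taylor_bound_of_onTorus hφ hper
  obtain ⟨r, hr, hexp⟩ := hexp (ε / 4) (by positivity)
  have hφL : MemLp (gradient φ) 2 (μ : Measure (E d)) := by
    have hcont : Continuous (gradient φ) := by
      unfold gradient
      exact (InnerProductSpace.toDual ℝ (E d)).symm.continuous.comp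
        (hφ.continuous_fderiv (by simp))
    have := hξ.sub (g := fun x => ξ x - gradient φ x)
      ⟨hξ.1.sub hcont.aestronglyMeasurable, hclose.trans ENNReal.ofReal_lt_top⟩
    have e : (ξ - fun x => ξ x - gradient φ x) = gradient φ := by
      funext x; simp
    rwa [e] at this
  have hφi : ∀ ρ : PM d, Integrable φ (ρ : Measure (E d)) := fun ρ => by
    obtain ⟨B, hB⟩ := hper.exists_bound hφ.continuous
    exact Integrable.of_bound hφ.continuous.aestronglyMeasurable B (ae_of_all _ hB)
  -- `ξ` is within `ε / 4` of `∇φ`, and by Taylor the integral of `∇φ(x) · (y - x)` is the increment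
  -- of `∫ φ`, which only depends on the marginals
  have key : ∀ (ν : PM d) (γ : Measure (E d × E d)), IsPlan γ μ ν → FiniteCost γ →
      |∫ z, inner ℝ (ξ z.1) (z.2 - z.1) ∂γ - (∫ x, φ x ∂(ν : Measure (E d))
        - ∫ x, φ x ∂(μ : Measure (E d)))| ≤ ε / 4 * Real.sqrt (sqCost γ) + C * sqCost γ := by
    intro ν γ hγ hc
    have h1 := abs_integral_inner_disp_le hγ hc (hξ.sub hφL) (show 0 ≤ ε / 4 by positivity)
      hclose.le
    have i1 := integrable_inner_disp hγ hc hξ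
    have i2 := integrable_inner_disp hγ hc hφL
    have j1 : Integrable (fun z : E d × E d => φ z.1) γ := by
      have := hφi μ; rw [← hγ.1] at this
      exact (integrable_map_measure this.1 measurable_fst.aemeasurable).1 this
    have j2 : Integrable (fun z : E d × E d => φ z.2) γ := by
      have := hφi ν; rw [← hγ.2] at this
      exact (integrable_map_measure this.1 measurable_snd.aemeasurable).1 this
    have h2 : |∫ z, (φ z.2 - φ z.1 - inner ℝ (gradient φ z.1) (z.2 - z.1)) ∂γ| ≤ C * sqCost γ := by
      rw [sqCost, ← integral_const_mul, ← Real.norm_eq_abs]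
      exact norm_integral_le_of_norm_le (hc.integrable_sq.const_mul C)
        (ae_of_all _ fun z => by rw [Real.norm_eq_abs]; exact hC z.1 z.2)
    have h4 : ∫ z, (φ z.2 - φ z.1 - inner ℝ (gradient φ z.1) (z.2 - z.1)) ∂γ
        = ∫ z, φ z.2 ∂γ - ∫ z, φ z.1 ∂γ - ∫ z, inner ℝ (gradient φ z.1) (z.2 - z.1) ∂γ := by
      rw [← integral_sub j2 j1]
      exact integral_sub (j2.sub j1) i2
    rw [h4, hγ.integral_fst hφ.continuous.aestronglyMeasurable,
      hγ.integral_snd hφ.continuous.aestronglyMeasurable] at h2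
    have h3 : ∫ z, inner ℝ ((ξ - gradient φ) z.1) (z.2 - z.1) ∂γ
        = ∫ z, inner ℝ (ξ z.1) (z.2 - z.1) ∂γ - ∫ z, inner ℝ (gradient φ z.1) (z.2 - z.1) ∂γ := by
      rw [← integral_sub i1 i2]
      simp [inner_sub_left]
    rw [h3] at h1
    rw [abs_le] at h1 h2 ⊢
    constructor <;> linarith [h1.1, h1.2, h2.1, h2.2]
  -- compare `γ` with an optimal plan `γ₀` that has the same marginals on the torus
  refine ⟨min r (ε / (8 * (C + 1))), by positivity, fun ν γ hγ hc hsmall => ?_⟩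
  obtain ⟨ν', γ₀, hγ₀, hW, -, hM⟩ := exists_isOptPlan μ ν
  set c := Real.sqrt (sqCost γ) with hcdef
  have hc0 : 0 ≤ c := Real.sqrt_nonneg _
  have hwc : wass μ ν' ≤ c := hW ▸ hγ.wass_le_sqrt_sqCost hc
  have e1 := hexp ν' γ₀ hγ₀ (hwc.trans (hsmall.trans (min_le_left _ _)))
  have e2 := key ν γ hγ hc
  have e3 := key ν' γ₀ hγ₀.1 hγ₀.finiteCost
  rw [hγ₀.sqCost_eq, Real.sqrt_sq (wass_nonneg _ _)] at e3
  rw [hM φ hφ.continuous hper] at e2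
  rw [hU ν ν' hM]
  have hsq : sqCost γ = c ^ 2 := (Real.sq_sqrt (sqCost_nonneg γ)).symm
  rw [← hcdef, hsq] at e2
  have hw0 := wass_nonneg μ ν'
  have hCc : (C + 1) * c ≤ ε / 8 := by
    have := hsmall.trans (min_le_right _ _)
    rw [le_div_iff₀ (by positivity)] at this
    linarith
  have q1 : C * c ^ 2 ≤ ε / 8 * c := by nlinarith
  have q2 : C * wass μ ν' ^ 2 ≤ ε / 8 * c := by
    have : wass μ ν' ^ 2 ≤ c ^ 2 := by gcongr
    nlinarith
  have q3 : ε / 4 * wass μ ν' ≤ ε / 4 * c := by gcongr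
  rw [abs_le] at e1 e2 e3 ⊢
  constructor <;> linarith [e1.1, e1.2, e2.1, e2.2, e3.1, e3.2]

/-! ### Second-order estimates for functionals with Lipschitz Wasserstein gradient -/

/-- The displacement interpolation `((1 - θ) x + θ y)_# γ`. -/
def interp (γ : Measure (E d × E d)) [IsProbabilityMeasure γ] (θ : ℝ) : PM d :=
  ⟨γ.map fun z => z.1 + θ • (z.2 - z.1), Measure.isProbabilityMeasure_map (by fun_prop)⟩

lemma finiteCost_interp {γ : Measure (E d × E d)} (hc : FiniteCost γ) (θ θ' : ℝ) :
    FiniteCost (γ.map fun z => (z.1 + θ • (z.2 - z.1), z.1 + θ' • (z.2 - z.1))) := by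
  rw [FiniteCost, memLp_map_measure_iff (by fun_prop) (by fun_prop)]
  have := MemLp.const_smul hc (θ' - θ)
  refine this.ae_eq (ae_of_all _ fun z => ?_)
  simp [sub_smul]

lemma sqCost_interp (γ : Measure (E d × E d)) (θ θ' : ℝ) :
    sqCost (γ.map fun z => (z.1 + θ • (z.2 - z.1), z.1 + θ' • (z.2 - z.1)))
      = (θ' - θ) ^ 2 * sqCost γ := by
  rw [sqCost, integral_map (by fun_prop) (by fun_prop), sqCost, ← integral_const_mul]
  refine integral_congr_ae (ae_of_all _ fun z => ?_)
  simp only [add_sub_add_left_eq_sub, ← sub_smul, norm_smul, mul_pow, Real.norm_eq_abs, sq_abs]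

section Interp

variable {γ : Measure (E d × E d)} [IsProbabilityMeasure γ] {μ ν : PM d}

lemma interp_zero (h : IsPlan γ μ ν) : interp γ 0 = μ := by
  apply Subtype.ext
  simpa [interp] using! h.1

lemma interp_one (h : IsPlan γ μ ν) : interp γ 1 = ν := by
  apply Subtype.ext
  simpa [interp] using! h.2

lemma isPlan_interp (θ θ' : ℝ) :
    IsPlan (γ.map fun z => (z.1 + θ • (z.2 - z.1), z.1 + θ' • (z.2 - z.1)))
      (interp γ θ) (interp γ θ') :=
  isPlan_map (by fun_prop) (by fun_prop) rfl rfl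

lemma wass_interp_le (hc : FiniteCost γ) (h : IsPlan γ μ ν) {θ : ℝ} (hθ : θ ∈ Icc (0 : ℝ) 1) :
    wass μ (interp γ θ) ≤ Real.sqrt (sqCost γ) := by
  have h1 := (isPlan_interp (γ := γ) 0 θ).wass_le_sqrt_sqCost (finiteCost_interp hc 0 θ)
  rw [interp_zero h, sqCost_interp] at h1
  refine h1.trans (Real.sqrt_le_sqrt ?_)
  have := sqCost_nonneg γ
  have : (θ - 0) ^ 2 ≤ 1 := by rw [sub_zero]; nlinarith [hθ.1, hθ.2]
  nlinarith

/-- Along the displacement interpolation of any plan a functional with a Wasserstein gradient is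
differentiable. -/
lemma hasDerivAt_interp {U : PM d → ℝ} {N : PM d → E d → E d}
    (hU : ∀ μ ν, MeasEq μ ν → U μ = U ν) (hN : ∀ μ, IsWassGrad U μ (N μ))
    (hNc : ∀ μ, Continuous (N μ)) (hc : FiniteCost γ) (θ : ℝ) :
    HasDerivAt (fun θ => U (interp γ θ))
      (∫ z, inner ℝ (N (interp γ θ) (z.1 + θ • (z.2 - z.1))) (z.2 - z.1) ∂γ) θ := by
  rw [hasDerivAt_iff_isLittleO, Asymptotics.isLittleO_iff]
  intro ε hε
  set c := Real.sqrt (sqCost γ)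
  have hc0 : 0 ≤ c := Real.sqrt_nonneg _
  obtain ⟨r, hr, hexp⟩ := (hN (interp γ θ)).expansion_of_isPlan hU
    (show 0 < ε / (c + 1) by positivity)
  filter_upwards [Metric.ball_mem_nhds θ (show 0 < r / (c + 1) by positivity)] with θ' hθ'
  rw [Metric.mem_ball, Real.dist_eq, lt_div_iff₀ (by positivity)] at hθ'
  have hs : Real.sqrt (sqCost (γ.map fun z => (z.1 + θ • (z.2 - z.1), z.1 + θ' • (z.2 - z.1))))
      = |θ' - θ| * c := by
    rw [sqCost_interp, Real.sqrt_mul (sq_nonneg _), Real.sqrt_sq_eq_abs]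
  have h := hexp _ _ (isPlan_interp (γ := γ) θ θ') (finiteCost_interp hc θ θ') (by
    rw [hs]; nlinarith [abs_nonneg (θ' - θ)])
  have hm : Continuous fun w : E d × E d => inner ℝ (N (interp γ θ) w.1) (w.2 - w.1) :=
    ((hNc _).comp continuous_fst).inner (continuous_snd.sub continuous_fst)
  rw [hs, integral_map (by fun_prop) hm.aestronglyMeasurable] at h
  have e : ∫ z, inner ℝ (N (interp γ θ) (z.1 + θ • (z.2 - z.1)))
        (z.1 + θ' • (z.2 - z.1) - (z.1 + θ • (z.2 - z.1))) ∂γ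
      = (θ' - θ) • ∫ z, inner ℝ (N (interp γ θ) (z.1 + θ • (z.2 - z.1))) (z.2 - z.1) ∂γ := by
    rw [← integral_smul]
    refine integral_congr_ae (ae_of_all _ fun z => ?_)
    simp only [add_sub_add_left_eq_sub, ← sub_smul, inner_smul_right, smul_eq_mul]
  rw [e] at h
  rw [Real.norm_eq_abs, Real.norm_eq_abs]
  refine h.trans ?_
  rw [div_mul_eq_mul_div, div_le_iff₀ (by positivity)]
  nlinarith [mul_nonneg hε.le (abs_nonneg (θ' - θ))]

end Interp

lemma IsPlan.integrable_comp_fst {γ : Measure (E d × E d)} {μ ν : PM d} (h : IsPlan γ μ ν)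
    {X : Type*} [NormedAddCommGroup X] {f : E d → X} (hf : Integrable f (μ : Measure (E d))) :
    Integrable (fun z => f z.1) γ := by
  rw [← h.1] at hf
  exact (integrable_map_measure hf.1 measurable_fst.aemeasurable).1 hf

lemma integrable_inner_disp_of_bound {γ : Measure (E d × E d)} [IsProbabilityMeasure γ]
    (hc : FiniteCost γ) {ξ : E d × E d → E d} (hξ : Continuous ξ) {B : ℝ} (hB : ∀ z, ‖ξ z‖ ≤ B) :
    Integrable (fun z => inner ℝ (ξ z) (z.2 - z.1)) γ := by
  have h1 : Integrable (fun z : E d × E d => z.2 - z.1) γ := hc.integrable (by norm_num)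
  refine (h1.norm.const_mul B).mono' (hξ.inner (by fun_prop)).aestronglyMeasurable
    (ae_of_all _ fun z => ?_)
  exact (norm_inner_le_norm _ _).trans (by gcongr; exact hB z)

/-- The remainder of the first-order expansion is quadratic in the cost of the plan if the
gradient is Lipschitz. -/
lemma abs_sub_sub_integral_le {U : PM d → ℝ} {N : PM d → E d → E d} {L : ℝ} (hL : 0 ≤ L)
    (hU : ∀ μ ν, MeasEq μ ν → U μ = U ν) (hN : ∀ μ, IsWassGrad U μ (N μ))
    (hB : ∀ μ x, ‖N μ x‖ ≤ L)
    (hLip : ∀ μ ν x y, ‖N ν y - N μ x‖ ≤ L * (wass μ ν + ‖y - x‖))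
    {γ : Measure (E d × E d)} {μ ν : PM d} (hγ : IsPlan γ μ ν) (hc : FiniteCost γ) :
    |U ν - U μ - ∫ z, inner ℝ (N μ z.1) (z.2 - z.1) ∂γ| ≤ 2 * L * sqCost γ := by
  have := hγ.isProbabilityMeasure
  have hNc : ∀ μ, Continuous (N μ) := fun μ => by
    refine (LipschitzWith.of_dist_le_mul (K := L.toNNReal) fun x y => ?_).continuous
    rw [dist_eq_norm, dist_eq_norm, Real.coe_toNNReal L hL]
    simpa [wass_self] using hLip μ μ y x
  set c := Real.sqrt (sqCost γ) with hcd
  have hsq : c ^ 2 = sqCost γ := Real.sq_sqrt (sqCost_nonneg γ)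
  set a := ∫ z, inner ℝ (N μ z.1) (z.2 - z.1) ∂γ with ha
  have hnorm : ∫ z, ‖z.2 - z.1‖ ∂γ ≤ c := integral_norm_le_sqrt hc
  have hi : Integrable (fun z : E d × E d => z.2 - z.1) γ := hc.integrable (by norm_num)
  -- mean value inequality along the interpolation; the derivative differs from `a` by the change of
  -- the gradient over distances at most `c`, times the displacement
  have h := norm_image_sub_le_of_norm_deriv_le_segment_01' (C := 2 * L * sqCost γ)
    (f := fun θ => U (interp γ θ) - θ * a)
    (fun θ _ => ((hasDerivAt_interp hU hN hNc hc θ).sub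
      ((hasDerivAt_id θ).mul_const a)).hasDerivWithinAt) (fun θ hθ => ?_)
  · rw [interp_zero hγ, interp_one hγ] at h
    rw [Real.norm_eq_abs] at h
    convert h using 2; ring
  · have k1 : Continuous fun z : E d × E d => N (interp γ θ) (z.1 + θ • (z.2 - z.1)) :=
      (hNc _).comp (by fun_prop)
    have k2 : Continuous fun z : E d × E d => N μ z.1 := (hNc _).comp continuous_fst
    rw [one_mul, ha, ← integral_sub (integrable_inner_disp_of_bound hc k1 (fun z => hB _ _))
      (integrable_inner_disp_of_bound hc k2 (fun z => hB _ _))]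
    have hb : ∀ z : E d × E d, ‖inner ℝ (N (interp γ θ) (z.1 + θ • (z.2 - z.1))) (z.2 - z.1)
        - inner ℝ (N μ z.1) (z.2 - z.1)‖ ≤ L * c * ‖z.2 - z.1‖ + L * ‖z.2 - z.1‖ ^ 2 := by
      intro z
      rw [← inner_sub_left]
      refine (norm_inner_le_norm _ _).trans ?_
      have h1 := hLip μ (interp γ θ) z.1 (z.1 + θ • (z.2 - z.1))
      have h2 := wass_interp_le hc hγ (Ico_subset_Icc_self hθ)
      have h3 : ‖z.1 + θ • (z.2 - z.1) - z.1‖ ≤ ‖z.2 - z.1‖ := by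
        rw [add_sub_cancel_left, norm_smul, Real.norm_of_nonneg hθ.1]
        exact mul_le_of_le_one_left (norm_nonneg _) hθ.2.le
      calc _ ≤ (L * (c + ‖z.2 - z.1‖)) * ‖z.2 - z.1‖ := by
            refine mul_le_mul_of_nonneg_right (h1.trans ?_) (norm_nonneg _)
            gcongr
        _ = _ := by ring
    refine (norm_integral_le_of_norm_le
      ((hi.norm.const_mul _).add (hc.integrable_sq.const_mul L)) (ae_of_all _ hb)).trans ?_
    simp only [Pi.add_apply]
    rw [integral_add (hi.norm.const_mul _) (hc.integrable_sq.const_mul L), integral_const_mul,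
      integral_const_mul]
    change L * c * _ + L * sqCost γ ≤ _
    have : L * c * ∫ z, ‖z.2 - z.1‖ ∂γ ≤ L * c * c := by gcongr
    nlinarith

/-- Two functionals with close gradients have close increments. -/
lemma abs_sub_sub_sub_le {U₁ U₂ : PM d → ℝ} {N₁ N₂ : PM d → E d → E d} {B M : ℝ}
    (hU₁ : ∀ μ ν, MeasEq μ ν → U₁ μ = U₁ ν) (hN₁ : ∀ μ, IsWassGrad U₁ μ (N₁ μ))
    (hU₂ : ∀ μ ν, MeasEq μ ν → U₂ μ = U₂ ν) (hN₂ : ∀ μ, IsWassGrad U₂ μ (N₂ μ))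
    (hc₁ : ∀ μ, Continuous (N₁ μ)) (hc₂ : ∀ μ, Continuous (N₂ μ))
    (hB₁ : ∀ μ x, ‖N₁ μ x‖ ≤ B) (hB₂ : ∀ μ x, ‖N₂ μ x‖ ≤ B)
    (hM : ∀ μ x, ‖N₁ μ x - N₂ μ x‖ ≤ M) (μ ν : PM d) :
    |(U₁ ν - U₂ ν) - (U₁ μ - U₂ μ)| ≤ M * wass μ ν := by
  obtain ⟨ν', γ, hγ, hW, -, hM'⟩ := exists_isOptPlan μ ν
  rw [hU₁ ν ν' hM', hU₂ ν ν' hM', ← hW]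
  have := hγ.1.isProbabilityMeasure
  have hc := hγ.finiteCost
  have hM0 : 0 ≤ M := (norm_nonneg _).trans (hM μ 0)
  have hi : Integrable (fun z : E d × E d => z.2 - z.1) γ := hc.integrable (by norm_num)
  -- mean value inequality along the interpolation of an optimal plan
  have h := norm_image_sub_le_of_norm_deriv_le_segment_01' (C := M * wass μ ν')
    (f := fun θ => U₁ (interp γ θ) - U₂ (interp γ θ))
    (fun θ _ => ((hasDerivAt_interp hU₁ hN₁ hc₁ hc θ).sub
      (hasDerivAt_interp hU₂ hN₂ hc₂ hc θ)).hasDerivWithinAt) (fun θ hθ => ?_)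
  · simpa only [interp_zero hγ.1, interp_one hγ.1, Real.norm_eq_abs] using h
  · have k1 : Continuous fun z : E d × E d => N₁ (interp γ θ) (z.1 + θ • (z.2 - z.1)) :=
      (hc₁ _).comp (by fun_prop)
    have k2 : Continuous fun z : E d × E d => N₂ (interp γ θ) (z.1 + θ • (z.2 - z.1)) :=
      (hc₂ _).comp (by fun_prop)
    rw [← integral_sub (integrable_inner_disp_of_bound hc k1 (fun z => hB₁ _ _))
      (integrable_inner_disp_of_bound hc k2 (fun z => hB₂ _ _))]
    refine (norm_integral_le_of_norm_le (hi.norm.const_mul M) (ae_of_all _ fun z => ?_)).trans ?_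
    · rw [← inner_sub_left]
      exact (norm_inner_le_norm _ _).trans (mul_le_mul_of_nonneg_right (hM _ _) (norm_nonneg _))
    · rw [integral_const_mul]
      exact mul_le_mul_of_nonneg_left hγ.integral_norm_le hM0

lemma HasSecondOrder.exists_bound_of_torus {Y : Type} [NormedAddCommGroup Y]
    {Φ : E d → PM d → E d → Y} (hq : ∀ μ x, OnTorus fun q => Φ q μ x) (hx : ∀ q μ, OnTorus (Φ q μ))
    (hc : ContinuousW (fun (z : E d × E d) μ => Φ z.1 μ z.2)) :
    ∃ C, ∀ q μ x, ‖Φ q μ x‖ ≤ C := by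
  obtain ⟨C, hC⟩ := hc.exists_bound
    ((isCompact_closedBall (0 : E d) (Real.sqrt d)).prod (isCompact_closedBall 0 (Real.sqrt d)))
  refine ⟨C, fun q μ x => ?_⟩
  rw [← hx q μ _ _ (torusEq_fract x)]
  refine (congrArg norm (hq μ (x - roundVec x) _ _ (torusEq_fract q))).symm.le.trans ?_
  exact hC (q - roundVec q, x - roundVec x)
    ⟨by simpa using norm_fract_le q, by simpa using norm_fract_le x⟩ μ

/-- The Wasserstein gradient of a twice differentiable functional is bounded and Lipschitz in all
its variables. -/
lemma HasSecondOrder.exists_lipschitz {V : E d → PM d → ℝ} {N : E d → PM d → E d → E d}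
    {Dq Dx : E d → PM d → E d → (E d →L[ℝ] E d)} {A : E d → PM d → E d → E d → (E d →L[ℝ] E d)}
    (h : HasSecondOrder V N Dq Dx A) : ∃ L ≥ 0, (∀ q μ x, ‖N q μ x‖ ≤ L) ∧
      ∀ q q' μ ν x y, ‖N q' ν y - N q μ x‖ ≤ L * (‖q' - q‖ + wass μ ν + ‖y - x‖) := by
  obtain ⟨C₀, hC₀⟩ := exists_bound_of_torus h.grad_torus_q h.grad_torus_x h.cont_grad
  have hDxq : ∀ μ x, OnTorus fun q => Dx q μ x := by
    intro μ x q q' hq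
    have : N q μ = N q' μ := funext fun x => h.grad_torus_q μ x q q' hq
    have h1 := h.deriv_x q μ x
    rw [this] at h1
    exact h1.unique (h.deriv_x q' μ x)
  have hDqx : ∀ q μ, OnTorus (Dq q μ) := by
    intro q μ x x' hx
    have : (fun q => N q μ x) = (fun q => N q μ x') := funext fun q => h.grad_torus_x q μ x x' hx
    have h1 := h.deriv_q q μ x
    rw [this] at h1
    exact h1.unique (h.deriv_q q μ x')
  obtain ⟨C₁, hC₁⟩ := exists_bound_of_torus
    (fun μ x => (h.grad_torus_q μ x).hasFDerivAt fun q => h.deriv_q q μ x) hDqx h.cont_q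
  obtain ⟨C₂, hC₂⟩ := exists_bound_of_torus hDxq
    (fun q μ => (h.grad_torus_x q μ).hasFDerivAt fun x => h.deriv_x q μ x) h.cont_x
  obtain ⟨C₃, hC₃'⟩ := h.cont_hess.exists_bound
    ((isCompact_closedBall (0 : E d) (Real.sqrt d)).prod
      ((isCompact_closedBall 0 (Real.sqrt d)).prod (isCompact_closedBall 0 (Real.sqrt d))))
  have hC₃ : ∀ q μ x a, ‖A q μ x a‖ ≤ C₃ := by
    intro q μ x a
    rw [← h.hess_torus_a q μ x _ _ (torusEq_fract a)]
    refine (congrArg norm (h.hess_torus_x q μ (a - roundVec a) _ _ (torusEq_fract x))).symm.le.trans ?_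
    refine (congrArg norm (h.hess_torus_q μ (x - roundVec x) (a - roundVec a) _ _
      (torusEq_fract q))).symm.le.trans ?_
    exact hC₃' (q - roundVec q, x - roundVec x, a - roundVec a)
      ⟨by simpa using norm_fract_le q, by simpa using norm_fract_le x,
        by simpa using norm_fract_le a⟩ μ
  obtain ⟨ρ, ϵ, hρ, -, hϵ, hexp⟩ := h.expansion
  -- the modulus `ϵ` vanishes at zero, so that its term disappears when `x` is kept fixed
  have hϵ0 : ϵ 0 = 0 := by
    have h1 := hϵ.2.2
    have h2 : Tendsto ϵ (pure 0) (𝓝 0) := h1.mono_left (pure_le_nhdsWithin (by simp))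
    exact (tendsto_pure_nhds ϵ (0 : ℝ)).limUnder_eq.symm.trans h2.limUnder_eq
  set R := ρ (Real.sqrt d)
  have hR : 0 ≤ R := hρ.2.1 _ (Real.sqrt_nonneg _)
  -- Lipschitz continuity in the measure: take `q' = q` and `y = x` in the second order expansion,
  -- and estimate the modulus `ρ` by its value at `√d`
  have hμ : ∀ q μ ν x, ‖N q ν x - N q μ x‖ ≤ (C₃ + R) * wass μ ν := by
    intro q μ ν x
    obtain ⟨ν', γ, hγ, hW, h0, -⟩ := exists_isOptPlan μ ν
    -- the gradient is continuous for `wass`, hence the same at measures of distance zero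
    have heq : N q ν x = N q ν' x := by
      by_contra hne
      obtain ⟨δ, hδ, hd⟩ := h.cont_grad (q, x) ν (dist (N q ν' x) (N q ν x))
        (dist_pos.2 (Ne.symm hne))
      exact lt_irrefl _ (hd (q, x) ν' (by simpa using hδ) (by rw [h0]; exact hδ))
    obtain ⟨δ, hδ, hd⟩ := hexp q μ x 1 one_pos
    have h1 := hd q ν' x γ (by simpa using hδ) hγ
    simp only [sub_self, map_zero, sub_zero, norm_zero, mul_zero, zero_add, add_zero, hϵ0] at h1
    have h2 : ‖∫ z, A q μ x z.1 (z.2 - z.1) ∂γ‖ ≤ C₃ * wass μ ν' := by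
      have := hγ.1.isProbabilityMeasure
      have hi : Integrable (fun z : E d × E d => z.2 - z.1) γ := hγ.finiteCost.integrable (by norm_num)
      refine (norm_integral_le_of_norm_le (hi.norm.const_mul C₃) (ae_of_all _ fun z =>
        (A q μ x z.1).le_of_opNorm_le (hC₃ q μ x z.1) _)).trans ?_
      rw [integral_const_mul]
      exact mul_le_mul_of_nonneg_left hγ.integral_norm_le ((norm_nonneg _).trans (hC₃ q μ x 0))
    have h3 : ρ (wass μ ν') ≤ R :=
      hρ.1 (wass_nonneg _ _) (Real.sqrt_nonneg _) (wass_le_sqrt _ _)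
    have h4 : wass μ ν' * ρ (wass μ ν') ≤ wass μ ν' * R := by
      have := wass_nonneg μ ν'; gcongr
    rw [heq, ← hW]
    have h5 := norm_le_norm_add_norm_sub' (N q ν' x - N q μ x) (∫ z, A q μ x z.1 (z.2 - z.1) ∂γ)
    linarith
  have b0 : 0 ≤ C₀ := (norm_nonneg _).trans (hC₀ 0 ⟨Measure.dirac 0, inferInstance⟩ 0)
  have b1 : 0 ≤ C₁ := (norm_nonneg _).trans (hC₁ 0 ⟨Measure.dirac 0, inferInstance⟩ 0)
  have b2 : 0 ≤ C₂ := (norm_nonneg _).trans (hC₂ 0 ⟨Measure.dirac 0, inferInstance⟩ 0)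
  have b3 : 0 ≤ C₃ := (norm_nonneg _).trans (hC₃ 0 ⟨Measure.dirac 0, inferInstance⟩ 0 0)
  refine ⟨C₀ + C₁ + C₂ + (C₃ + R), by positivity, fun q μ x => (hC₀ q μ x).trans (by linarith),
    fun q q' μ ν x y => ?_⟩
  have h1 : ‖N q' ν y - N q ν y‖ ≤ C₁ * ‖q' - q‖ :=
    norm_sub_le_of_fderiv (fun q => h.deriv_q q ν y) (fun q => hC₁ q ν y) q q'
  have h2 : ‖N q ν y - N q ν x‖ ≤ C₂ * ‖y - x‖ :=
    norm_sub_le_of_fderiv (fun x => h.deriv_x q ν x) (fun x => hC₂ q ν x) x y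
  have h3 := hμ q μ ν x
  have h4 : N q' ν y - N q μ x = (N q' ν y - N q ν y) + (N q ν y - N q ν x) + (N q ν x - N q μ x) := by
    abel
  rw [h4]
  refine (norm_add₃_le).trans ?_
  have w0 := wass_nonneg μ ν
  have e1 := norm_nonneg (q' - q)
  have e2 := norm_nonneg (y - x)
  nlinarith [mul_nonneg b0 e1, mul_nonneg b0 e2, mul_nonneg b0 w0, mul_nonneg b1 e2,
    mul_nonneg b1 w0, mul_nonneg b2 e1, mul_nonneg b2 w0, mul_nonneg b3 e1, mul_nonneg b3 e2,
    mul_nonneg hR e1, mul_nonneg hR e2]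

/-! ### Functions of a point and a measure with Lipschitz first derivatives -/

/-- `f` is bounded and differentiable in the point `z` and in the measure `μ`, with bounded
Lipschitz derivatives `f'` and `N`: the first-order expansion holds along all transport plans, with
a remainder that is quadratic in the displacement. -/
structure SmoothFn {Z Y : Type} [NormedAddCommGroup Z] [NormedSpace ℝ Z] [NormedAddCommGroup Y]
    [NormedSpace ℝ Y] (f : Z → PM d → Y) (f' : Z → PM d → Z →L[ℝ] Y)
    (N : Z → PM d → E d → E d →L[ℝ] Y) (L : ℝ) : Prop where
  nonneg : 0 ≤ L
  bound : ∀ z μ, ‖f z μ‖ ≤ L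
  bound_deriv : ∀ z μ, ‖f' z μ‖ ≤ L
  bound_grad : ∀ z μ x, ‖N z μ x‖ ≤ L
  lip : ∀ z z' μ ν, ‖f z' ν - f z μ‖ ≤ L * (‖z' - z‖ + wass μ ν)
  lip_deriv : ∀ z z' μ ν, ‖f' z' ν - f' z μ‖ ≤ L * (‖z' - z‖ + wass μ ν)
  lip_grad : ∀ z z' μ ν x y, ‖N z' ν y - N z μ x‖ ≤ L * (‖z' - z‖ + wass μ ν + ‖y - x‖)
  expansion : ∀ z z' μ ν γ, IsPlan γ μ ν → FiniteCost γ →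
    ‖f z' ν - f z μ - f' z μ (z' - z) - ∫ w, N z μ w.1 (w.2 - w.1) ∂γ‖
      ≤ L * (‖z' - z‖ ^ 2 + sqCost γ)

/-- `f`, `f'`, `N` are periodic in the position, which is the first component of `z`. -/
structure TorusFn {Y : Type} [NormedAddCommGroup Y] [NormedSpace ℝ Y]
    (f : E d × E d → PM d → Y) (f' : E d × E d → PM d → E d × E d →L[ℝ] Y)
    (N : E d × E d → PM d → E d → E d →L[ℝ] Y) : Prop where
  fn : ∀ k, TorusEq k 0 → ∀ z μ, f (z + (k, 0)) μ = f z μ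
  deriv : ∀ k, TorusEq k 0 → ∀ z μ, f' (z + (k, 0)) μ = f' z μ
  grad : ∀ k, TorusEq k 0 → ∀ z μ x, N (z + (k, 0)) μ x = N z μ x
  grad_snd : ∀ k, TorusEq k 0 → ∀ z μ x, N z μ (x + k) = N z μ x

section SmoothFn

variable {Z Y : Type} [NormedAddCommGroup Z] [NormedSpace ℝ Z] [NormedAddCommGroup Y]
  [NormedSpace ℝ Y] {f : Z → PM d → Y} {f' : Z → PM d → Z →L[ℝ] Y}
  {N : Z → PM d → E d → E d →L[ℝ] Y} {L : ℝ}

lemma continuous_of_norm_sub_le {X W : Type*} [SeminormedAddCommGroup X] [SeminormedAddCommGroup W]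
    {f : X → W} {L : ℝ} (hL : 0 ≤ L) (h : ∀ x y, ‖f y - f x‖ ≤ L * ‖y - x‖) : Continuous f := by
  refine (LipschitzWith.of_dist_le_mul (K := L.toNNReal) fun x y => ?_).continuous
  rw [dist_eq_norm, dist_eq_norm, Real.coe_toNNReal L hL]
  exact h y x

lemma SmoothFn.continuous_grad (h : SmoothFn f f' N L) (z : Z) (μ : PM d) : Continuous (N z μ) :=
  continuous_of_norm_sub_le h.nonneg fun x y => by
    simpa [wass_self] using h.lip_grad z z μ μ x y

lemma SmoothFn.continuous_fn (h : SmoothFn f f' N L) (μ : PM d) : Continuous fun z => f z μ :=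
  continuous_of_norm_sub_le h.nonneg fun x y => by
    simpa [wass_self] using h.lip x y μ μ

lemma SmoothFn.continuous_deriv (h : SmoothFn f f' N L) (μ : PM d) : Continuous fun z => f' z μ :=
  continuous_of_norm_sub_le h.nonneg fun x y => by
    simpa [wass_self] using h.lip_deriv x y μ μ

lemma integrable_clm_disp {W : Type*} [NormedAddCommGroup W] [NormedSpace ℝ W]
    {γ : Measure (E d × E d)} [IsProbabilityMeasure γ] (hc : FiniteCost γ)
    {K : E d × E d → E d →L[ℝ] W} (hK : Continuous K) {B : ℝ} (hB : ∀ z, ‖K z‖ ≤ B) :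
    Integrable (fun z => K z (z.2 - z.1)) γ := by
  have h1 : Integrable (fun z : E d × E d => z.2 - z.1) γ := hc.integrable (by norm_num)
  refine (h1.norm.const_mul B).mono' (hK.clm_apply (by fun_prop)).aestronglyMeasurable
    (ae_of_all _ fun z => ?_)
  exact (K z).le_of_opNorm_le (hB z) _

lemma SmoothFn.integrable_grad (h : SmoothFn f f' N L) {γ : Measure (E d × E d)}
    [IsProbabilityMeasure γ] (hc : FiniteCost γ) (z : Z) (μ : PM d) :
    Integrable (fun w => N z μ w.1 (w.2 - w.1)) γ :=
  integrable_clm_disp hc ((h.continuous_grad z μ).comp continuous_fst) fun _ => h.bound_grad _ _ _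

lemma SmoothFn.comp [CompleteSpace Y] {Z' Y' : Type} [NormedAddCommGroup Z'] [NormedSpace ℝ Z']
    [NormedAddCommGroup Y'] [NormedSpace ℝ Y'] [CompleteSpace Y']
    (h : SmoothFn f f' N L) (A : Y →L[ℝ] Y') (B : Z' →L[ℝ] Z)
    (hA : ‖A‖ ≤ 1) (hB : ‖B‖ ≤ 1) :
    SmoothFn (fun z μ => A (f (B z) μ)) (fun z μ => A ∘L f' (B z) μ ∘L B)
      (fun z μ x => A ∘L N (B z) μ x) L := by
  have hL := h.nonneg
  have hA' : ∀ y, ‖A y‖ ≤ ‖y‖ := fun y => by simpa using A.le_of_opNorm_le hA y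
  have hB' : ∀ y, ‖B y‖ ≤ ‖y‖ := fun y => by simpa using B.le_of_opNorm_le hB y
  have hAc : ∀ {X : Type} [NormedAddCommGroup X] [NormedSpace ℝ X] (g : X →L[ℝ] Y),
      ‖A ∘L g‖ ≤ ‖g‖ := fun g => (A.opNorm_comp_le g).trans (mul_le_of_le_one_left (norm_nonneg _) hA)
  have hBc : ∀ (g : Z →L[ℝ] Y), ‖g ∘L B‖ ≤ ‖g‖ := fun g =>
    (g.opNorm_comp_le B).trans (mul_le_of_le_one_right (norm_nonneg _) hB)
  refine ⟨hL, fun z μ => (hA' _).trans (h.bound _ _), fun z μ => ?_, fun z μ x => ?_,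
    fun z z' μ ν => ?_, fun z z' μ ν => ?_, fun z z' μ ν x y => ?_, fun z z' μ ν γ hγ hc => ?_⟩
  · exact (hAc _).trans ((hBc _).trans (h.bound_deriv _ _))
  · exact (hAc _).trans (h.bound_grad _ _ _)
  · rw [← map_sub]
    refine (hA' _).trans ((h.lip _ _ _ _).trans ?_)
    rw [← map_sub]; gcongr; exact hB' _
  · rw [← ContinuousLinearMap.comp_sub, ← ContinuousLinearMap.sub_comp]
    refine (hAc _).trans ((hBc _).trans ((h.lip_deriv _ _ _ _).trans ?_))
    rw [← map_sub]; gcongr; exact hB' _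
  · rw [← ContinuousLinearMap.comp_sub]
    refine (hAc _).trans ((h.lip_grad _ _ _ _ _ _).trans ?_)
    rw [← map_sub]; gcongr; exact hB' _
  · have := hγ.isProbabilityMeasure
    have hi := h.integrable_grad hc (B z) μ
    have e : ∫ w, (A ∘L N (B z) μ w.1) (w.2 - w.1) ∂γ = A (∫ w, N (B z) μ w.1 (w.2 - w.1) ∂γ) :=
      A.integral_comp_comm hi
    rw [e]
    simp only [ContinuousLinearMap.comp_apply, ← map_sub]
    refine (hA' _).trans ?_
    rw [map_sub]
    refine (h.expansion _ _ _ _ _ hγ hc).trans ?_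
    rw [← map_sub]; gcongr; exact hB' _

lemma SmoothFn.add {g : Z → PM d → Y} {g' : Z → PM d → Z →L[ℝ] Y}
    {M : Z → PM d → E d → E d →L[ℝ] Y} {L' : ℝ} (h : SmoothFn f f' N L) (h' : SmoothFn g g' M L') :
    SmoothFn (fun z μ => f z μ + g z μ) (fun z μ => f' z μ + g' z μ)
      (fun z μ x => N z μ x + M z μ x) (L + L') := by
  refine ⟨add_nonneg h.nonneg h'.nonneg,
    fun z μ => (norm_add_le _ _).trans (add_le_add (h.bound _ _) (h'.bound _ _)),
    fun z μ => (norm_add_le _ _).trans (add_le_add (h.bound_deriv _ _) (h'.bound_deriv _ _)),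
    fun z μ x => (norm_add_le _ _).trans (add_le_add (h.bound_grad _ _ _) (h'.bound_grad _ _ _)),
    fun z z' μ ν => ?_, fun z z' μ ν => ?_, fun z z' μ ν x y => ?_, fun z z' μ ν γ hγ hc => ?_⟩
  · rw [add_sub_add_comm, add_mul]
    exact (norm_add_le _ _).trans (add_le_add (h.lip _ _ _ _) (h'.lip _ _ _ _))
  · rw [add_sub_add_comm, add_mul]
    exact (norm_add_le _ _).trans (add_le_add (h.lip_deriv _ _ _ _) (h'.lip_deriv _ _ _ _))
  · rw [add_sub_add_comm, add_mul]
    exact (norm_add_le _ _).trans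
      (add_le_add (h.lip_grad _ _ _ _ _ _) (h'.lip_grad _ _ _ _ _ _))
  · have := hγ.isProbabilityMeasure
    simp only [add_apply]
    rw [integral_add (h.integrable_grad hc z μ) (h'.integrable_grad hc z μ), add_mul]
    refine le_trans (le_of_eq ?_) ((norm_add_le _ _).trans (add_le_add
      (h.expansion z z' μ ν γ hγ hc) (h'.expansion z z' μ ν γ hγ hc)))
    congr 1
    abel

lemma SmoothFn.of_fun {v : Z → Y} {v' : Z → Z →L[ℝ] Y} (hL : 0 ≤ L)
    (hv : ∀ z, HasFDerivAt v (v' z) z) (hb : ∀ z, ‖v z‖ ≤ L) (hb' : ∀ z, ‖v' z‖ ≤ L)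
    (hl : ∀ z z', ‖v' z' - v' z‖ ≤ L * ‖z' - z‖) :
    SmoothFn (d := d) (fun z _ => v z) (fun z _ => v' z) (fun _ _ _ => 0) L := by
  refine ⟨hL, fun z _ => hb z, fun z _ => hb' z, fun _ _ _ => by simpa using hL,
    fun z z' μ ν => ?_, fun z z' μ ν => ?_, fun z z' μ ν x y => ?_, fun z z' μ ν γ hγ hc => ?_⟩
  · refine (norm_sub_le_of_fderiv hv hb' z z').trans ?_
    have := wass_nonneg μ ν
    gcongr; linarith
  · refine (hl z z').trans ?_
    have := wass_nonneg μ ν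
    gcongr; linarith
  · have := wass_nonneg μ ν
    rw [sub_self, norm_zero]; positivity
  · have := norm_taylor_le hL hv hl z z'
    simp only [zero_apply, integral_zero, sub_zero]
    refine this.trans ?_
    have := sqCost_nonneg γ
    gcongr; linarith

end SmoothFn

/-! ### The gradient of a coupling -/

lemma norm_le_sum_abs (v : E d) : ‖v‖ ≤ ∑ i, |v i| := by
  conv_lhs => rw [← (EuclideanSpace.basisFun (Fin d) ℝ).sum_repr v]
  refine (norm_sum_le _ _).trans (Finset.sum_le_sum fun i _ => ?_)
  rw [norm_smul]
  simp

lemma norm_le_of_forall_abs_le {v : E d} {B : ℝ} (h : ∀ i, |v i| ≤ B) : ‖v‖ ≤ d * B := by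
  refine (norm_le_sum_abs v).trans ((Finset.sum_le_sum fun i _ => h i).trans ?_)
  simp

lemma norm_fderiv_fderiv_sub_le {Z W : Type*} [NormedAddCommGroup Z] [NormedSpace ℝ Z]
    [NormedAddCommGroup W] [NormedSpace ℝ W] {g : Z → W} (hg : ContDiff ℝ 3 g) {C : ℝ}
    (hC : ∀ z, ‖iteratedFDeriv ℝ 3 g z‖ ≤ C) (x y : Z) :
    ‖fderiv ℝ (fderiv ℝ g) y - fderiv ℝ (fderiv ℝ g) x‖ ≤ C * ‖y - x‖ := by
  have h1 : ContDiff ℝ 2 (fderiv ℝ g) := hg.fderiv_right (by norm_num)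
  have h2 : ContDiff ℝ 1 (fderiv ℝ (fderiv ℝ g)) := h1.fderiv_right (by norm_num)
  refine norm_sub_le_of_fderiv (fun z => (h2.differentiable (by norm_num) z).hasFDerivAt)
    (fun z => ?_) x y
  have := hC z
  rwa [← norm_iteratedFDeriv_fderiv, ← norm_iteratedFDeriv_fderiv, norm_iteratedFDeriv_one] at this

lemma IsMFGCoupling.gradq_congr {F : E d → PM d → ℝ} (hF : IsMFGCoupling F) (q : E d) {μ ν : PM d}
    (h : MeasEq μ ν) : gradq F q μ = gradq F q ν := by
  have : (fun q' => F q' μ) = fun q' => F q' ν := funext fun q' => hF.meas_eq q' μ ν h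
  rw [gradq, gradq, this]

lemma IsMFGCoupling.gradq_torus {F : E d → PM d → ℝ} (hF : IsMFGCoupling F) (μ : PM d) :
    OnTorus fun q => gradq F q μ := by
  intro x y hxy
  have h := (hF.torus μ).hasFDerivAt (fun x =>
    ((hF.smooth μ).differentiable (by norm_num) x).hasFDerivAt) x y hxy
  simp only [gradq, gradient, h]

/-- The gradient `∇_q F` of an admissible coupling has bounded Lipschitz derivatives. -/
lemma IsMasterCoupling.exists_smoothFn {F : E d → PM d → ℝ} (hF : IsMasterCoupling F) :
    ∃ (f' : E d → PM d → E d →L[ℝ] E d) (N : E d → PM d → E d → E d →L[ℝ] E d) (L : ℝ),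
      SmoothFn (gradq F) f' N L ∧ (∀ μ, OnTorus fun q => f' q μ) ∧
      (∀ μ x, OnTorus fun q => N q μ x) ∧ ∀ q μ, OnTorus (N q μ) := by
  choose Ni Dq Dx A h2 using hF.twice_grad
  choose Li hLi0 hLiB hLiL using fun i => (h2 i).exists_lipschitz
  obtain ⟨κ, hκ, hbd, hlip⟩ := hF.bounds
  set L₀ := ∑ i, Li i
  have hL₀ : 0 ≤ L₀ := Finset.sum_nonneg fun i _ => hLi0 i
  have hLiL₀ : ∀ i, Li i ≤ L₀ := fun i =>
    Finset.single_le_sum (f := Li) (fun i _ => hLi0 i) (Finset.mem_univ i)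
  have hB : ∀ i q μ x, ‖Ni i q μ x‖ ≤ L₀ := fun i q μ x => (hLiB i q μ x).trans (hLiL₀ i)
  have hNL : ∀ i q q' μ ν x y,
      ‖Ni i q' ν y - Ni i q μ x‖ ≤ L₀ * (‖q' - q‖ + wass μ ν + ‖y - x‖) := fun i q q' μ ν x y =>
    (hLiL i q q' μ ν x y).trans (by
      have := wass_nonneg μ ν
      gcongr; exact hLiL₀ i)
  have hNc : ∀ i q μ, Continuous (Ni i q μ) := fun i q μ =>
    continuous_of_norm_sub_le hL₀ fun x y => by simpa [wass_self] using hNL i q q μ μ x y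
  let T := (InnerProductSpace.toDual ℝ (E d)).symm
  have hsm : ∀ μ, ContDiff ℝ 2 (fderiv ℝ fun q => F q μ) := fun μ =>
    (hF.smooth μ).fderiv_right (by norm_num)
  let TL : (E d →L[ℝ] ℝ) →L[ℝ] E d := T.toContinuousLinearEquiv.toContinuousLinearMap
  have hTL : ∀ v, ‖TL v‖ = ‖v‖ := fun v => T.norm_map v
  let f' : E d → PM d → E d →L[ℝ] E d := fun q μ => TL ∘L fderiv ℝ (fderiv ℝ fun q => F q μ) q
  have hf' : ∀ q μ, HasFDerivAt (fun q => gradq F q μ) (f' q μ) q := fun q μ =>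
    TL.hasFDerivAt.comp q (((hsm μ).differentiable (by norm_num) q).hasFDerivAt)
  have hTc : ∀ g : E d →L[ℝ] E d →L[ℝ] ℝ, ‖TL ∘L g‖ ≤ ‖g‖ := fun g =>
    ContinuousLinearMap.opNorm_le_bound _ (by positivity) fun x => by
      rw [ContinuousLinearMap.comp_apply, hTL]; exact g.le_opNorm x
  have b1 : ∀ q μ, ‖gradq F q μ‖ ≤ κ := fun q μ => by
    have := hbd q μ 1 (by simp)
    rw [norm_iteratedFDeriv_one] at this
    exact (hTL _).le.trans this
  have b2 : ∀ q μ, ‖f' q μ‖ ≤ κ := fun q μ => by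
    have := hbd q μ 2 (by simp)
    rw [← norm_iteratedFDeriv_fderiv, norm_iteratedFDeriv_one] at this
    exact (hTc _).trans this
  have b3 : ∀ μ q q', ‖f' q' μ - f' q μ‖ ≤ κ * ‖q' - q‖ := fun μ q q' => by
    simp only [f', ← ContinuousLinearMap.comp_sub]
    exact (hTc _).trans (norm_fderiv_fderiv_sub_le (hF.smooth μ) (fun q => hbd q μ 3 (by simp)) q q')
  have hU : ∀ i q μ ν, MeasEq μ ν → gradq F q μ i = gradq F q ν i := fun i q μ ν h => by
    rw [hF.gradq_congr q h]
  -- the derivative in `q` is Lipschitz in `μ` because the gradient in `μ` is Lipschitz in `q`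
  have b4 : ∀ q μ ν, ‖f' q ν - f' q μ‖ ≤ d * (L₀ * wass μ ν) := fun q μ ν => by
    have hw := wass_nonneg μ ν
    refine ((hf' q ν).sub (hf' q μ)).le_of_lip' (by positivity) (Eventually.of_forall fun q' => ?_)
    rw [mul_assoc]
    refine norm_le_of_forall_abs_le fun i => ?_
    have := abs_sub_sub_sub_le (hU i q') (fun μ => (h2 i).grad q' μ) (hU i q)
      (fun μ => (h2 i).grad q μ) (hNc i q') (hNc i q) (hB i q') (hB i q)
      (M := L₀ * ‖q' - q‖) (fun μ x => by simpa [wass_self] using hNL i q q' μ μ x x) μ ν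
    simp only [PiLp.sub_apply, Pi.sub_apply]
    convert this using 1
    · congr 1; ring
    · ring
  -- the matrix whose rows are the gradients of the components
  let N : E d → PM d → E d → E d →L[ℝ] E d := fun q μ x =>
    ∑ i, (innerSL ℝ (Ni i q μ x)).smulRight (EuclideanSpace.single i (1 : ℝ))
  have hN : ∀ q μ x e i, (N q μ x e) i = inner ℝ (Ni i q μ x) e := by
    intro q μ x e i
    simp [N, Pi.single_apply]
  have hNb : ∀ q μ x, ‖N q μ x‖ ≤ d * L₀ := fun q μ x =>
    ContinuousLinearMap.opNorm_le_bound _ (by positivity) fun e => by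
      rw [mul_assoc]
      refine norm_le_of_forall_abs_le fun i => ?_
      rw [hN]
      exact (abs_real_inner_le_norm _ _).trans (by gcongr; exact hB i q μ x)
  have hNlip : ∀ q q' μ ν x y,
      ‖N q' ν y - N q μ x‖ ≤ d * (L₀ * (‖q' - q‖ + wass μ ν + ‖y - x‖)) := fun q q' μ ν x y => by
    have hw := wass_nonneg μ ν
    refine ContinuousLinearMap.opNorm_le_bound _ (by positivity) fun e => ?_
    rw [mul_assoc]
    refine norm_le_of_forall_abs_le fun i => ?_
    rw [sub_apply, PiLp.sub_apply, hN, hN, ← inner_sub_left]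
    exact (abs_real_inner_le_norm _ _).trans (by gcongr; exact hNL i q q' μ ν x y)
  have hNcont : ∀ q μ, Continuous (N q μ) := fun q μ =>
    continuous_of_norm_sub_le (L := d * L₀) (by positivity) fun x y => by
      simpa [wass_self, mul_assoc] using hNlip q q μ μ x y
  have hdL : 0 ≤ d * L₀ := by positivity
  refine ⟨f', N, κ + 3 * (d * L₀), ⟨by positivity, fun q μ => (b1 q μ).trans (by linarith),
    fun q μ => (b2 q μ).trans (by linarith), fun q μ x => (hNb q μ x).trans (by linarith),
    fun q q' μ ν => ?_, fun q q' μ ν => ?_, fun q q' μ ν x y => ?_, fun q q' μ ν γ hγ hc => ?_⟩,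
    fun μ => ?_, fun μ x q q' hq => ?_, fun q μ x x' hx => ?_⟩
  · have hw := wass_nonneg μ ν
    have hn := norm_nonneg (q' - q)
    refine (hlip q' q ν μ).trans ?_
    have : Real.sqrt (‖q' - q‖ ^ 2 + wass ν μ ^ 2) ≤ ‖q' - q‖ + wass μ ν := by
      rw [wass_comm ν μ]
      refine Real.sqrt_le_iff.2 ⟨by positivity, by nlinarith⟩
    refine (mul_le_mul_of_nonneg_left this hκ.le).trans ?_
    gcongr; linarith
  · have hw := wass_nonneg μ ν
    have hn := norm_nonneg (q' - q)
    have h1 := b3 ν q q'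
    have h2 := b4 q μ ν
    have h3 := norm_add_le (f' q' ν - f' q ν) (f' q ν - f' q μ)
    rw [sub_add_sub_cancel] at h3
    nlinarith [mul_nonneg hdL hn, mul_nonneg hdL hw, mul_nonneg hκ.le hw]
  · have hw := wass_nonneg μ ν
    refine (hNlip q q' μ ν x y).trans ?_
    rw [← mul_assoc]
    gcongr; linarith
  · have := hγ.isProbabilityMeasure
    have hw := wass_nonneg μ ν
    have hn := norm_nonneg (q' - q)
    have hi : Integrable (fun w => N q μ w.1 (w.2 - w.1)) γ :=
      integrable_clm_disp hc ((hNcont q μ).comp continuous_fst) fun w => hNb _ _ _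
    have h1 : ‖gradq F q ν - gradq F q μ - ∫ w, N q μ w.1 (w.2 - w.1) ∂γ‖
        ≤ d * (2 * L₀ * sqCost γ) := by
      refine norm_le_of_forall_abs_le fun i => ?_
      have e : (∫ w, N q μ w.1 (w.2 - w.1) ∂γ) i = ∫ w, inner ℝ (Ni i q μ w.1) (w.2 - w.1) ∂γ := by
        have := (EuclideanSpace.proj (𝕜 := ℝ) i : E d →L[ℝ] ℝ).integral_comp_comm hi
        exact this.symm.trans (integral_congr_ae (ae_of_all _ fun w => hN _ _ _ _ _))
      rw [PiLp.sub_apply, PiLp.sub_apply, e]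
      exact abs_sub_sub_integral_le hL₀ (hU i q) (fun μ => (h2 i).grad q μ) (hB i q)
        (fun μ ν x y => by simpa using hNL i q q μ ν x y) hγ hc
    have h2 := norm_taylor_le hκ.le (fun q => hf' q ν) (b3 ν) q q'
    have h3 : ‖(f' q ν - f' q μ) (q' - q)‖ ≤ d * (L₀ * wass μ ν) * ‖q' - q‖ :=
      ContinuousLinearMap.le_of_opNorm_le _ (b4 q μ ν) _
    have h4 := hγ.wass_sq_le_integral hc.integrable_sq
    have h4' : wass μ ν ^ 2 ≤ sqCost γ := h4
    have e : gradq F q' ν - gradq F q μ - f' q μ (q' - q) - ∫ w, N q μ w.1 (w.2 - w.1) ∂γ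
        = (gradq F q ν - gradq F q μ - ∫ w, N q μ w.1 (w.2 - w.1) ∂γ)
          + (gradq F q' ν - gradq F q ν - f' q ν (q' - q)) + (f' q ν - f' q μ) (q' - q) := by
      rw [sub_apply]; abel
    rw [e]
    refine norm_add₃_le.trans ?_
    have h5 : wass μ ν * ‖q' - q‖ ≤ sqCost γ + ‖q' - q‖ ^ 2 := by
      nlinarith [sq_nonneg (wass μ ν - ‖q' - q‖), sq_nonneg (wass μ ν + ‖q' - q‖)]
    have h6 : d * (L₀ * wass μ ν) * ‖q' - q‖ ≤ d * L₀ * (sqCost γ + ‖q' - q‖ ^ 2) := by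
      calc _ = d * L₀ * (wass μ ν * ‖q' - q‖) := by ring
        _ ≤ _ := by gcongr
    have hs := sqCost_nonneg γ
    nlinarith [mul_nonneg hκ.le hs, mul_nonneg hdL (sq_nonneg ‖q' - q‖), mul_nonneg hdL hs]
  · exact (hF.gradq_torus μ).hasFDerivAt fun q => hf' q μ
  · have : ∀ i, Ni i q μ x = Ni i q' μ x := fun i => (h2 i).grad_torus_q μ x q q' hq
    simp only [N, this]
  · have : ∀ i, Ni i q μ x = Ni i q μ x' := fun i => (h2 i).grad_torus_x q μ x x' hx
    simp only [N, this]

/-! ### The truncated Hamiltonian vector field -/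

section Cutoff

variable {W : Type} [NormedAddCommGroup W]

/-- `g` is periodic in the position and vanishes for momenta of norm larger than `R`. -/
def IsCutoff (R : ℝ) (g : E d × E d → W) : Prop :=
  (∀ k, TorusEq k 0 → ∀ z, g (z + (k, 0)) = g z) ∧ ∀ z, R < ‖z.2‖ → g z = 0

lemma IsCutoff.exists_bound {R : ℝ} {g : E d × E d → W} (h : IsCutoff R g) (hc : Continuous g) :
    ∃ C, 0 ≤ C ∧ ∀ z, ‖g z‖ ≤ C := by
  obtain ⟨C, hC⟩ := ((isCompact_closedBall (0 : E d) (Real.sqrt d)).prod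
    (isCompact_closedBall (0 : E d) R)).exists_bound_of_continuousOn hc.continuousOn
  refine ⟨max C 0, le_max_right _ _, fun z => ?_⟩
  by_cases hz : R < ‖z.2‖
  · rw [h.2 z hz, norm_zero]; exact le_max_right _ _
  · rw [← h.1 _ (torusEq_roundVec z.1).neg z]
    refine (hC _ ⟨?_, ?_⟩).trans (le_max_left _ _)
    · simpa [← sub_eq_add_neg] using norm_fract_le z.1
    · simpa using hz

variable [NormedSpace ℝ W]

lemma IsCutoff.isCutoff_fderiv {R : ℝ} {g : E d × E d → W} (h : IsCutoff R g) :
    IsCutoff R (fderiv ℝ g) := by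
  refine ⟨fun k hk z => ?_, fun z hz => ?_⟩
  · have : (fun z => g (z + (k, 0))) = g := funext fun z => h.1 k hk z
    rw [← fderiv_comp_add_right, this]
  · have ho : IsOpen {z : E d × E d | R < ‖z.2‖} := isOpen_lt continuous_const (by fun_prop)
    have : g =ᶠ[𝓝 z] fun _ => 0 := by
      filter_upwards [ho.mem_nhds hz] with w hw using h.2 w hw
    rw [this.fderiv_eq]; simp

lemma IsCutoff.exists_bound_derivs {R : ℝ} {g : E d × E d → W} (h : IsCutoff R g)
    (hg : ContDiff ℝ 2 g) : ∃ M, 0 ≤ M ∧ (∀ z, ‖g z‖ ≤ M) ∧ (∀ z, ‖fderiv ℝ g z‖ ≤ M) ∧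
      ∀ z z', ‖fderiv ℝ g z' - fderiv ℝ g z‖ ≤ M * ‖z' - z‖ := by
  have h1 : ContDiff ℝ 1 (fderiv ℝ g) := hg.fderiv_right (by norm_num)
  obtain ⟨C₀, p₀, hC₀⟩ := h.exists_bound hg.continuous
  obtain ⟨C₁, p₁, hC₁⟩ := h.isCutoff_fderiv.exists_bound (hg.continuous_fderiv (by norm_num))
  obtain ⟨C₂, p₂, hC₂⟩ := h.isCutoff_fderiv.isCutoff_fderiv.exists_bound (h1.continuous_fderiv (by norm_num))
  refine ⟨C₀ + C₁ + C₂, by positivity, fun z => (hC₀ z).trans (by linarith),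
    fun z => (hC₁ z).trans (by linarith), fun z z' => ?_⟩
  refine (norm_sub_le_of_fderiv (fun z => (h1.differentiable (by norm_num) z).hasFDerivAt) hC₂
    z z').trans ?_
  gcongr; linarith

end Cutoff

/-- The Hamiltonian vector field `(∇_p H, -∇_q H)`. -/
def hamField (H : E d → E d → ℝ) (z : E d × E d) : E d × E d :=
  (gradient (fun p => H z.1 p) z.2, -gradient (fun q => H q z.2) z.1)

lemma IsHamiltonian.contDiff_hamField {H : E d → E d → ℝ} (hH : IsHamiltonian H) :
    ContDiff ℝ 2 (hamField H) := by
  let T : (E d →L[ℝ] ℝ) →L[ℝ] E d :=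
    (InnerProductSpace.toDual ℝ (E d)).symm.toContinuousLinearEquiv.toContinuousLinearMap
  have hsm := hH.smooth
  have hd : ∀ z, HasFDerivAt (fun z : E d × E d => H z.1 z.2)
      (fderiv ℝ (fun z : E d × E d => H z.1 z.2) z) z := fun z =>
    (hsm.differentiable (by norm_num) z).hasFDerivAt
  have h2 : ContDiff ℝ 2 (fderiv ℝ fun z : E d × E d => H z.1 z.2) :=
    hsm.fderiv_right (by norm_num)
  have e : hamField H = fun z =>
      (T (fderiv ℝ (fun z : E d × E d => H z.1 z.2) z ∘L ContinuousLinearMap.inr ℝ (E d) (E d)),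
        -T (fderiv ℝ (fun z : E d × E d => H z.1 z.2) z ∘L ContinuousLinearMap.inl ℝ (E d) (E d))) := by
    funext z
    have e1 : fderiv ℝ (fun p => H z.1 p) z.2
        = fderiv ℝ (fun z : E d × E d => H z.1 z.2) z ∘L ContinuousLinearMap.inr ℝ (E d) (E d) :=
      (HasFDerivAt.comp (g := fun z : E d × E d => H z.1 z.2) z.2 (hd (z.1, z.2))
        (hasFDerivAt_prodMk_right z.1 z.2)).fderiv
    have e2 : fderiv ℝ (fun q => H q z.2) z.1
        = fderiv ℝ (fun z : E d × E d => H z.1 z.2) z ∘L ContinuousLinearMap.inl ℝ (E d) (E d) :=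
      (HasFDerivAt.comp (g := fun z : E d × E d => H z.1 z.2) (f := fun q => (q, z.2)) z.1
        (hd (z.1, z.2)) (hasFDerivAt_prodMk_left z.1 z.2)).fderiv
    rw [hamField, gradient, gradient, e1, e2]
    rfl
  rw [e]
  exact (T.contDiff.comp (h2.clm_comp contDiff_const)).prodMk
    (T.contDiff.comp (h2.clm_comp contDiff_const)).neg

lemma IsHamiltonian.hamField_torus {H : E d → E d → ℝ} (hH : IsHamiltonian H) {k : E d}
    (hk : TorusEq k 0) (z : E d × E d) : hamField H (z + (k, 0)) = hamField H z := by
  have h1 : (fun p => H (z.1 + k) p) = fun p => H z.1 p :=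
    funext fun p => hH.torus p _ _ (torusEq_add hk _)
  have h2 : (fun q => H (q + k) z.2) = fun q => H q z.2 :=
    funext fun q => hH.torus z.2 _ _ (torusEq_add hk _)
  simp only [hamField, Prod.fst_add, Prod.snd_add, add_zero, h1]
  congr 2
  rw [gradient, gradient, ← fderiv_comp_add_right, h2]

/-- The Hamiltonian vector field can be modified for large momenta so that it becomes bounded with
bounded Lipschitz derivative. -/
lemma IsHamiltonian.exists_truncation {H : E d → E d → ℝ} (hH : IsHamiltonian H) {R : ℝ}
    (hR : 0 < R) : ∃ (v : E d × E d → E d × E d) (v' : E d × E d → E d × E d →L[ℝ] E d × E d) (M : ℝ),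
      SmoothFn (d := d) (fun z _ => v z) (fun z _ => v' z) (fun _ _ _ => 0) M ∧
      (∀ k, TorusEq k 0 → ∀ z, v (z + (k, 0)) = v z) ∧
      (∀ k, TorusEq k 0 → ∀ z, v' (z + (k, 0)) = v' z) ∧
      ∀ z, ‖z.2‖ ≤ R → v z = hamField H z := by
  let χ : ContDiffBump (0 : E d) := ⟨R, R + 1, hR, by linarith⟩
  let v : E d × E d → E d × E d := fun z => χ z.2 • hamField H z
  have hv : ContDiff ℝ 2 v :=
    (χ.contDiff.comp contDiff_snd).smul hH.contDiff_hamField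
  have hcut : IsCutoff (R + 1) v := by
    refine ⟨fun k hk z => ?_, fun z hz => ?_⟩
    · simp only [v, hH.hamField_torus hk z, Prod.snd_add, add_zero]
    · have : χ z.2 = 0 := χ.zero_of_le_dist (by simpa using hz.le)
      simp [v, this]
  obtain ⟨M, hM, b0, b1, b2⟩ := hcut.exists_bound_derivs hv
  refine ⟨v, fderiv ℝ v, M, SmoothFn.of_fun hM
    (fun z => (hv.differentiable (by norm_num) z).hasFDerivAt) b0 b1 b2, hcut.1, hcut.isCutoff_fderiv.1,
    fun z hz => ?_⟩
  have : χ z.2 = 1 := χ.one_of_mem_closedBall (by simpa using hz)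
  simp [v, this]

/-- The right hand side `(∇_p H, -∇_q H - ∇_q F)` of the characteristic system, modified for large
momenta, is a smooth function on the torus. -/
lemma exists_smoothFn_field {H : E d → E d → ℝ} {F : E d → PM d → ℝ} (hH : IsHamiltonian H)
    (hF : IsMasterCoupling F) {R : ℝ} (hR : 0 < R) :
    ∃ (f : E d × E d → PM d → E d × E d) (f' : E d × E d → PM d → E d × E d →L[ℝ] E d × E d)
      (N : E d × E d → PM d → E d → E d →L[ℝ] E d × E d) (L : ℝ),
      SmoothFn f f' N L ∧ TorusFn f f' N ∧
      ∀ z μ, ‖z.2‖ ≤ R → f z μ = hamField H z - (0, gradq F z.1 μ) := by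
  obtain ⟨v, v', M, hv, p1, p2, hvR⟩ := hH.exists_truncation hR
  obtain ⟨g', N, L, hg, q1, q2, q3⟩ := hF.exists_smoothFn
  refine ⟨_, _, _, _, hv.add (hg.comp (-ContinuousLinearMap.inr ℝ (E d) (E d))
    (ContinuousLinearMap.fst ℝ (E d) (E d))
    (by rw [norm_neg]; exact ContinuousLinearMap.norm_inr_le_one ℝ _ _)
    (ContinuousLinearMap.norm_fst_le ℝ _ _)),
    ⟨fun k hk z μ => ?_, fun k hk z μ => ?_, fun k hk z μ x => ?_, fun k hk z μ x => ?_⟩,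
    fun z μ hz => ?_⟩
  · have := hF.gradq_torus μ (z.1 + k) z.1 (torusEq_add hk _)
    simp only [p1 k hk] at this ⊢
    simp [this]
  · have := q1 μ (z.1 + k) z.1 (torusEq_add hk _)
    simp only [p2 k hk] at this ⊢
    simp [this]
  · have := q2 μ x (z.1 + k) z.1 (torusEq_add hk _)
    simp only at this ⊢
    simp [this]
  · have := q3 z.1 μ (x + k) x (torusEq_add hk _)
    simp [this]
  · simp [hvR z hz, sub_eq_add_neg]

/-- The initial momentum `∇_q g` as a smooth function on the torus. -/
lemma exists_smoothFn_initial {g : E d → PM d → ℝ} (hg : IsMasterCoupling g) :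
    ∃ (f' : E d × E d → PM d → E d × E d →L[ℝ] E d × E d)
      (N : E d × E d → PM d → E d → E d →L[ℝ] E d × E d) (L : ℝ),
      SmoothFn (fun z μ => ((0, gradq g z.1 μ) : E d × E d)) f' N L ∧
      TorusFn (fun z μ => ((0, gradq g z.1 μ) : E d × E d)) f' N := by
  obtain ⟨g', N, L, h, q1, q2, q3⟩ := hg.exists_smoothFn
  have h' := h.comp (ContinuousLinearMap.inr ℝ (E d) (E d)) (ContinuousLinearMap.fst ℝ (E d) (E d))
    (ContinuousLinearMap.norm_inr_le_one ℝ _ _) (ContinuousLinearMap.norm_fst_le ℝ _ _)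
  refine ⟨_, _, L, h', ⟨fun k hk z μ => ?_, fun k hk z μ => ?_, fun k hk z μ x => ?_,
    fun k hk z μ x => ?_⟩⟩
  · have := hg.gradq_torus μ (z.1 + k) z.1 (torusEq_add hk _)
    simpa using this
  · have := q1 μ (z.1 + k) z.1 (torusEq_add hk _)
    simp only at this ⊢
    simp [this]
  · have := q2 μ x (z.1 + k) z.1 (torusEq_add hk _)
    simp only at this ⊢
    simp [this]
  · have := q3 z.1 μ (x + k) x (torusEq_add hk _)
    simp [this]

open scoped BoundedContinuousFunction

/-! ### Linear integral equations in a Banach space -/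

section Linear

variable {Y : Type} [NormedAddCommGroup Y]

/-- The projection of `ℝ` onto `[0, T]`. -/
def clampT (T t : ℝ) : ℝ := max 0 (min t T)

lemma clampT_of_mem {T t : ℝ} (h : t ∈ Icc 0 T) : clampT T t = t := by
  rw [clampT, min_eq_left h.2, max_eq_right h.1]

lemma clampT_mem {T : ℝ} (hT : 0 ≤ T) (t : ℝ) : clampT T t ∈ Icc 0 T :=
  ⟨le_max_left _ _, max_le hT (min_le_right _ _)⟩

lemma continuous_clampT (T : ℝ) : Continuous (clampT T) := by unfold clampT; fun_prop

lemma abs_clampT_sub_le (T t t' : ℝ) : |clampT T t - clampT T t'| ≤ |t - t'| := by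
  unfold clampT
  refine (abs_max_sub_max_le_max _ _ _ _).trans ?_
  rw [sub_self, abs_zero]
  refine max_le (abs_nonneg _) ((abs_min_sub_min_le_max _ _ _ _).trans ?_)
  rw [sub_self, abs_zero]
  exact max_le le_rfl (abs_nonneg _)

lemma intervalIntegrable_bcf (h : ℝ →ᵇ Y) (a b : ℝ) : IntervalIntegrable h volume a b :=
  h.continuous.intervalIntegrable a b

variable [NormedSpace ℝ Y]

lemma norm_integral_bcf_le (h : ℝ →ᵇ Y) (a b : ℝ) : ‖∫ τ in a..b, h τ‖ ≤ ‖h‖ * |b - a| :=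
  intervalIntegral.norm_integral_le_of_norm_le_const fun τ _ => h.norm_coe_le_norm τ

lemma norm_volt_aux (T s : ℝ) (M : Y →L[ℝ] Y) (h : ℝ →ᵇ Y) (t : ℝ) :
    ‖(∫ τ in s..clampT T t, h τ) + M (∫ τ in s..(0 : ℝ), h τ)‖
      ≤ ((|T| + |s|) + ‖M‖ * |s|) * ‖h‖ := by
  have h1 : ‖∫ τ in s..clampT T t, h τ‖ ≤ ‖h‖ * (|T| + |s|) := by
    refine (norm_integral_bcf_le h _ _).trans ?_
    gcongr
    refine (abs_sub _ _).trans (add_le_add ?_ le_rfl)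
    rw [clampT, abs_of_nonneg (le_max_left _ _)]
    exact max_le (abs_nonneg _) ((min_le_right _ _).trans (le_abs_self _))
  have h2 : ‖M (∫ τ in s..(0 : ℝ), h τ)‖ ≤ ‖M‖ * (‖h‖ * |s|) := by
    refine (M.le_opNorm _).trans ?_
    gcongr
    simpa using norm_integral_bcf_le h s 0
  exact (norm_add_le _ _).trans ((add_le_add h1 h2).trans (le_of_eq (by ring)))

/-- The operator `h ↦ ∫_s^t h dτ + M ∫_s^0 h dτ` on curves; time is projected to `[0, T]`. -/
def volt (T s : ℝ) (M : Y →L[ℝ] Y) : (ℝ →ᵇ Y) →L[ℝ] (ℝ →ᵇ Y) :=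
  LinearMap.mkContinuous
    { toFun := fun h => BoundedContinuousFunction.ofNormedAddCommGroup
        (fun t => (∫ τ in s..clampT T t, h τ) + M (∫ τ in s..(0 : ℝ), h τ))
        (((intervalIntegral.continuous_primitive (intervalIntegrable_bcf h) s).comp
          (continuous_clampT T)).add continuous_const) _ (norm_volt_aux T s M h)
      map_add' := fun h h' => by
        ext t
        simp only [BoundedContinuousFunction.coe_ofNormedAddCommGroup,
          BoundedContinuousFunction.coe_add, Pi.add_apply]
        rw [intervalIntegral.integral_add (intervalIntegrable_bcf h _ _)
          (intervalIntegrable_bcf h' _ _), intervalIntegral.integral_add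
          (intervalIntegrable_bcf h _ _) (intervalIntegrable_bcf h' _ _), map_add]
        abel
      map_smul' := fun c h => by
        ext t
        simp [intervalIntegral.integral_smul, smul_add] }
    ((|T| + |s|) + ‖M‖ * |s|) (fun h =>
      (BoundedContinuousFunction.norm_le (by positivity)).2 (norm_volt_aux T s M h))

lemma volt_apply (T s : ℝ) (M : Y →L[ℝ] Y) (h : ℝ →ᵇ Y) (t : ℝ) :
    volt T s M h t = (∫ τ in s..clampT T t, h τ) + M (∫ τ in s..(0 : ℝ), h τ) := rfl

lemma norm_integral_le_of_mem_Icc {T a b c : ℝ} (ha : a ∈ Icc 0 T) (hb : b ∈ Icc 0 T) (hc : 0 ≤ c)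
    {h : ℝ → Y} (hh : ∀ τ ∈ Icc 0 T, ‖h τ‖ ≤ c) : ‖∫ τ in a..b, h τ‖ ≤ c * T := by
  have := intervalIntegral.norm_integral_le_of_norm_le_const (f := h) (a := a) (b := b) (C := c)
    fun τ hτ => hh τ (by
      have h1 := uIoc_subset_uIcc hτ
      have h2 : uIcc a b ⊆ Icc 0 T := by
        rw [← uIcc_of_le (ha.1.trans ha.2)]
        exact uIcc_subset_uIcc (by rwa [uIcc_of_le (ha.1.trans ha.2)])
          (by rwa [uIcc_of_le (ha.1.trans ha.2)])
      exact h2 h1)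
  refine this.trans ?_
  gcongr
  rw [abs_le]; constructor <;> linarith [ha.1, ha.2, hb.1, hb.2]

lemma norm_volt_apply_le {T s : ℝ} (hs : s ∈ Icc 0 T) (M : Y →L[ℝ] Y) (h : ℝ →ᵇ Y) {c : ℝ}
    (hc : 0 ≤ c) (hh : ∀ τ ∈ Icc 0 T, ‖h τ‖ ≤ c) : ‖volt T s M h‖ ≤ (1 + ‖M‖) * T * c := by
  have hT : 0 ≤ T := hs.1.trans hs.2
  refine (BoundedContinuousFunction.norm_le (by positivity)).2 fun t => ?_
  rw [volt_apply]
  have h1 := norm_integral_le_of_mem_Icc hs (clampT_mem hT t) hc hh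
  have h2 := norm_integral_le_of_mem_Icc hs (left_mem_Icc.2 hT) hc hh
  have h3 := (M.le_opNorm (∫ τ in s..(0 : ℝ), h τ)).trans
    (mul_le_mul_of_nonneg_left h2 (norm_nonneg M))
  refine (norm_add_le _ _).trans ((add_le_add h1 h3).trans (le_of_eq (by ring)))

lemma norm_volt_le {T s : ℝ} (hs : s ∈ Icc 0 T) (M : Y →L[ℝ] Y) :
    ‖volt T s M‖ ≤ (1 + ‖M‖) * T :=
  have hT : 0 ≤ T := hs.1.trans hs.2
  ContinuousLinearMap.opNorm_le_bound _ (by positivity) fun h =>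
    norm_volt_apply_le hs M h (norm_nonneg h) fun τ _ => h.norm_coe_le_norm τ

lemma volt_time_lipschitz (T s : ℝ) (M : Y →L[ℝ] Y) (h : ℝ →ᵇ Y) (t t' : ℝ) :
    ‖volt T s M h t' - volt T s M h t‖ ≤ ‖h‖ * |t' - t| := by
  rw [volt_apply, volt_apply, add_sub_add_right_eq_sub,
    intervalIntegral.integral_interval_sub_left (intervalIntegrable_bcf h _ _)
      (intervalIntegrable_bcf h _ _)]
  refine (norm_integral_bcf_le h _ _).trans ?_
  exact mul_le_mul_of_nonneg_left (abs_clampT_sub_le _ _ _) (norm_nonneg _)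

lemma norm_mulOp_aux {α : Type} [TopologicalSpace α] (A : α →ᵇ (Y →L[ℝ] Y)) (w : α →ᵇ Y) (t : α) : ‖A t (w t)‖ ≤ ‖A‖ * ‖w‖ :=
  ((A t).le_of_opNorm_le (A.norm_coe_le_norm t) _).trans (by
    gcongr; exact w.norm_coe_le_norm t)

/-- Pointwise application of a function with values in operators to a function with values in
vectors. -/
def mulOp {α : Type} [TopologicalSpace α] (A : α →ᵇ (Y →L[ℝ] Y)) : (α →ᵇ Y) →L[ℝ] (α →ᵇ Y) :=
  LinearMap.mkContinuous
    { toFun := fun w => BoundedContinuousFunction.ofNormedAddCommGroup (fun t => A t (w t))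
        (A.continuous.clm_apply w.continuous) _
        (norm_mulOp_aux A w)
      map_add' := fun w w' => by ext t; simp
      map_smul' := fun c w => by ext t; simp }
    ‖A‖ (fun w => (BoundedContinuousFunction.norm_le (by positivity)).2 (norm_mulOp_aux A w))

lemma norm_mulOp_le {α : Type} [TopologicalSpace α] (A : α →ᵇ (Y →L[ℝ] Y)) : ‖mulOp A‖ ≤ ‖A‖ :=
  LinearMap.mkContinuous_norm_le _ (by positivity) _

end Linear

section Resolvent

variable {X : Type} [NormedAddCommGroup X] [NormedSpace ℝ X]

/-- The a priori estimate for solutions of `w = A w + σ`. -/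
lemma norm_le_of_eq_add {A : X →L[ℝ] X} (hA : ‖A‖ ≤ 1 / 2) {w σ : X} (h : w = A w + σ) :
    ‖w‖ ≤ 2 * ‖σ‖ := by
  have h1 : ‖w‖ ≤ ‖A w‖ + ‖σ‖ := by
    conv_lhs => rw [h]
    exact norm_add_le _ _
  have h2 := A.le_of_opNorm_le hA w
  linarith

/-- Stability of the solutions of `w = A w + σ`. The difference of the operators is only applied to
one of the solutions, which may be more regular than a general element of the space. -/
lemma norm_sub_le_of_eq_add {A A' : X →L[ℝ] X} (hA' : ‖A'‖ ≤ 1 / 2) {w w' σ σ' : X}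
    (h : w = A w + σ) (h' : w' = A' w' + σ') :
    ‖w' - w‖ ≤ 2 * (‖A' w - A w‖ + ‖σ' - σ‖) := by
  have e : w' - w = A' (w' - w) + ((A' w - A w) + (σ' - σ)) := by
    conv_lhs => rw [h, h']
    rw [map_sub]; abel
  refine (norm_le_of_eq_add hA' e).trans ?_
  gcongr
  exact norm_add_le _ _

variable [CompleteSpace X]

/-- The operator `(1 - A)⁻¹` for an operator `A` of norm less than one. -/
def resolv (A : X →L[ℝ] X) : X →L[ℝ] X := Ring.inverse (1 - A)

lemma resolv_eq {A : X →L[ℝ] X} (hA : ‖A‖ ≤ 1 / 2) (σ : X) :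
    resolv A σ = A (resolv A σ) + σ := by
  have hu : IsUnit (1 - A) := (Units.oneSub A (by linarith)).isUnit
  have h := congrArg (fun B : X →L[ℝ] X => B σ) (Ring.mul_inverse_cancel (1 - A) hu)
  simp only [mul_apply_eq_comp, sub_apply] at h
  rw [resolv]
  rw [sub_eq_iff_eq_add] at h
  rw [add_comm]; exact h

lemma norm_sub_resolv_le {A : X →L[ℝ] X} (hA : ‖A‖ ≤ 1 / 2) (w σ : X) :
    ‖w - resolv A σ‖ ≤ 2 * ‖w - A w - σ‖ := by
  refine norm_le_of_eq_add hA (σ := w - A w - σ) ?_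
  conv_lhs => rw [resolv_eq hA σ]
  rw [map_sub]; abel

end Resolvent

/-- The linear map into bounded continuous functions defined by a bounded continuous function with
values in linear maps. -/
def flipCLM {α : Type} [TopologicalSpace α] {Z Y : Type} [NormedAddCommGroup Z] [NormedSpace ℝ Z]
    [NormedAddCommGroup Y] [NormedSpace ℝ Y] (c : α →ᵇ (Z →L[ℝ] Y)) : Z →L[ℝ] (α →ᵇ Y) :=
  LinearMap.mkContinuous
    { toFun := fun e => BoundedContinuousFunction.ofNormedAddCommGroup (fun t => c t e)
        (c.continuous.clm_apply continuous_const) (‖c‖ * ‖e‖) (fun t => (c t).le_of_opNorm_le (c.norm_coe_le_norm t) _)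
      map_add' := fun w w' => by ext t; simp
      map_smul' := fun a w => by ext t; simp }
    ‖c‖ (fun w => (BoundedContinuousFunction.norm_le (by positivity)).2 fun t =>
      (c t).le_of_opNorm_le (c.norm_coe_le_norm t) _)

section flipCLM

variable {α : Type} [TopologicalSpace α] {Z Y : Type} [NormedAddCommGroup Z] [NormedSpace ℝ Z]
  [NormedAddCommGroup Y] [NormedSpace ℝ Y]

lemma flipCLM_apply (c : α →ᵇ (Z →L[ℝ] Y)) (e : Z) (t : α) : flipCLM c e t = c t e := rfl

lemma norm_flipCLM_sub_le {c c' : α →ᵇ (Z →L[ℝ] Y)} {B : ℝ} (hB : 0 ≤ B)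
    (h : ∀ t, ‖c' t - c t‖ ≤ B) : ‖flipCLM c' - flipCLM c‖ ≤ B :=
  ContinuousLinearMap.opNorm_le_bound _ hB fun e =>
    (BoundedContinuousFunction.norm_le (by positivity)).2 fun t => by
      simpa [flipCLM_apply] using (c' t - c t).le_of_opNorm_le (h t) e

lemma norm_flipCLM_le {c : α →ᵇ (Z →L[ℝ] Y)} {B : ℝ} (hB : 0 ≤ B)
    (h : ∀ t, ‖c t‖ ≤ B) : ‖flipCLM c‖ ≤ B :=
  ContinuousLinearMap.opNorm_le_bound _ hB fun e =>
    (BoundedContinuousFunction.norm_le (by positivity)).2 fun t => by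
      simpa [flipCLM_apply] using (c t).le_of_opNorm_le (h t) e

end flipCLM

/-! ### Composition operators on displacements -/

lemma integral_const_add_const_mul {Ω : Type*} [MeasurableSpace Ω] {γ : Measure Ω}
    [IsProbabilityMeasure γ] {g : Ω → ℝ} (hg : Integrable g γ) (a b : ℝ) :
    ∫ z, (a + b * g z) ∂γ = a + b * ∫ z, g z ∂γ := by
  rw [integral_add (integrable_const a) (hg.const_mul b), integral_const_mul]
  simp

lemma integral_const_mul_add_const_mul {Ω : Type*} [MeasurableSpace Ω] {γ : Measure Ω}
    {f g : Ω → ℝ} (hf : Integrable f γ) (hg : Integrable g γ) (a b : ℝ) :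
    ∫ z, (a * f z + b * g z) ∂γ = a * ∫ z, f z ∂γ + b * ∫ z, g z ∂γ := by
  rw [integral_add (hf.const_mul a) (hg.const_mul b), integral_const_mul, integral_const_mul]

/-- Bounded continuous displacements: `U` stands for the map `q ↦ (q, 0) + U q` of positions to
positions and momenta. -/
abbrev Disp (d : ℕ) : Type := E d →ᵇ (E d × E d)

/-- The phase space point `(q, 0) + U q`. -/
def pt (U : Disp d) (q : E d) : E d × E d := (q, 0) + U q

/-- The position `x + (U x).1`. -/
def pos (U : Disp d) (x : E d) : E d := x + (U x).1

/-- The law of the position when `x` has law `μ`. -/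
def law (μ : PM d) (U : Disp d) : PM d := push (pos U) μ

lemma continuous_pt (U : Disp d) : Continuous (pt U) :=
  (by fun_prop : Continuous fun q : E d => ((q, 0) : E d × E d)).add U.continuous

lemma continuous_pos (U : Disp d) : Continuous (pos U) :=
  continuous_id.add (continuous_fst.comp U.continuous)

lemma pt_sub_pt (U U' : Disp d) (q : E d) : pt U' q - pt U q = (U' - U) q := by
  simp [pt]

lemma norm_pt_sub_pt_le (U U' : Disp d) (q : E d) : ‖pt U' q - pt U q‖ ≤ ‖U' - U‖ := by
  rw [pt_sub_pt]; exact (U' - U).norm_coe_le_norm q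

lemma pos_sub_pos (U U' : Disp d) (q : E d) : pos U' q - pos U q = ((U' - U) q).1 := by
  simp [pos]

lemma norm_pos_sub_pos_le (U U' : Disp d) (q : E d) : ‖pos U' q - pos U q‖ ≤ ‖U' - U‖ := by
  rw [pos_sub_pos]; exact (norm_fst_le _).trans ((U' - U).norm_coe_le_norm q)

/-- `U` is Lipschitz with constant `ℓ` for the torus distance. -/
def LipTorus {W : Type} [NormedAddCommGroup W] (ℓ : ℝ) (w : E d → W) : Prop :=
  ∀ x y, ‖w y - w x‖ ≤ ℓ * torusDist y x

lemma LipTorus.norm_sub_le {W : Type} [NormedAddCommGroup W] {ℓ : ℝ} (hℓ : 0 ≤ ℓ) {w : E d → W}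
    (h : LipTorus ℓ w) (x y : E d) : ‖w y - w x‖ ≤ ℓ * ‖y - x‖ :=
  (h x y).trans (by gcongr; exact torusDist_le_norm _ _)

lemma torusDist_pos_le {ℓ : ℝ} {U : Disp d} (hU : LipTorus ℓ U) (U' : Disp d) (x y : E d) :
    torusDist (pos U' y) (pos U x) ≤ ‖U' - U‖ + (1 + ℓ) * torusDist y x := by
  have h1 : torusDist (pos U' y) (pos U x) ≤ ‖pos U' y - pos U x - roundVec (y - x)‖ :=
    torusDist_le (torusEq_roundVec _)
  have e : pos U' y - pos U x - roundVec (y - x)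
      = (pos U' y - pos U y) + (y - x - roundVec (y - x)) + ((U y - U x).1) := by
    simp only [pos, Prod.fst_sub]; abel
  have h2 : ‖(pos U' y - pos U y) + (y - x - roundVec (y - x)) + (U y - U x).1‖
      ≤ ‖pos U' y - pos U y‖ + ‖y - x - roundVec (y - x)‖ + ‖(U y - U x).1‖ := norm_add₃_le
  have h3 := norm_pos_sub_pos_le U U' y
  have h4 : ‖(U y - U x).1‖ ≤ ℓ * torusDist y x := (norm_fst_le _).trans (hU x y)
  rw [← torusDist_eq] at h2
  rw [e] at h1
  linarith

lemma integral_torusDist_le {γ : Measure (E d × E d)} {μ ν : PM d} (hγ : IsPlan γ μ ν)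
    (hc : planCost γ = wass μ ν ^ 2) : ∫ z, torusDist z.2 z.1 ∂γ ≤ wass μ ν := by
  have := hγ.isProbabilityMeasure
  have hm : Continuous fun z : E d × E d => torusDist z.2 z.1 :=
    continuous_torusDist.congr fun z => torusDist_comm _ _
  have hn : ∀ z : E d × E d, ‖torusDist z.2 z.1‖ = torusDist z.1 z.2 := fun z => by
    rw [Real.norm_of_nonneg (torusDist_nonneg _ _), torusDist_comm]
  have hb : ∀ z : E d × E d, ‖torusDist z.2 z.1‖ ≤ Real.sqrt d := fun z => by
    rw [hn]; exact torusDist_le_sqrt _ _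
  have hL : MemLp (fun z : E d × E d => torusDist z.2 z.1) 2 γ :=
    MemLp.of_bound hm.aestronglyMeasurable (Real.sqrt d) (ae_of_all _ hb)
  have h := integral_norm_le_sqrt hL
  have e : ∫ z, ‖torusDist z.2 z.1‖ ^ 2 ∂γ = wass μ ν ^ 2 := by
    rw [← hc]
    exact integral_congr_ae (ae_of_all _ fun z => by simp only [hn])
  rw [e, Real.sqrt_sq (wass_nonneg _ _)] at h
  exact (integral_mono_ae (hL.integrable (by norm_num)) (hL.integrable (by norm_num)).norm
    (ae_of_all _ fun z => Real.le_norm_self _)).trans h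

lemma integrable_torusDist (γ : Measure (E d × E d)) [IsFiniteMeasure γ] :
    Integrable (fun z : E d × E d => torusDist z.2 z.1) γ :=
  Integrable.of_bound (continuous_torusDist.congr fun z => torusDist_comm _ _).aestronglyMeasurable
    (Real.sqrt d)
    (ae_of_all _ fun z => by
      rw [Real.norm_of_nonneg (torusDist_nonneg _ _)]; exact torusDist_le_sqrt _ _)

/-- The plan obtained from an optimal plan by the maps `pos U` and `pos U'` bounds the distance of
the laws. -/
lemma wass_law_le {ℓ : ℝ} (hℓ : 0 ≤ ℓ) {U : Disp d} (hU : LipTorus ℓ U) (U' : Disp d)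
    (μ ν : PM d) : wass (law μ U) (law ν U') ≤ 2 * (‖U' - U‖ + (1 + ℓ) * wass μ ν) := by
  obtain ⟨γ, hγ, hc⟩ := exists_isPlan_planCost_eq μ ν
  have := hγ.isProbabilityMeasure
  have hp := hγ.map_push (continuous_pos U) (continuous_pos U')
  have h1 := hp.wass_sq_le
  have hw := wass_nonneg μ ν
  have hm : Measurable fun z : E d × E d => (pos U z.1, pos U' z.2) :=
    (((continuous_pos U).comp continuous_fst).prodMk
      ((continuous_pos U').comp continuous_snd)).measurable
  rw [planCost_map hm] at h1
  have h2 : ∫ w, torusDist (pos U w.1) (pos U' w.2) ^ 2 ∂γ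
      ≤ ∫ w, (2 * ‖U' - U‖ ^ 2 + 2 * (1 + ℓ) ^ 2 * torusDist w.1 w.2 ^ 2) ∂γ := by
    refine integral_mono_of_nonneg (ae_of_all _ fun w => by positivity)
      ((integrable_const _).add ((integrable_torusDist_sq γ).const_mul _)) (ae_of_all _ fun w => ?_)
    have h := torusDist_pos_le hU U' w.1 w.2
    rw [torusDist_comm, torusDist_comm w.2] at h
    have h0 := torusDist_nonneg (pos U w.1) (pos U' w.2)
    have := pow_le_pow_left₀ h0 h 2
    refine this.trans ?_
    nlinarith [sq_nonneg (‖U' - U‖ - (1 + ℓ) * torusDist w.1 w.2)]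
  rw [integral_const_add_const_mul (integrable_torusDist_sq γ)] at h2
  change _ ≤ _ + 2 * (1 + ℓ) ^ 2 * planCost γ at h2
  rw [hc] at h2
  refine (sq_le_sq₀ (wass_nonneg _ _) (by positivity)).1 ((h1.trans h2).trans ?_)
  have a0 : 0 ≤ ‖U' - U‖ := norm_nonneg _
  have b0 : 0 ≤ (1 + ℓ) * wass μ ν := by positivity
  nlinarith [mul_nonneg a0 b0, sq_nonneg ((1 + ℓ) * wass μ ν)]

lemma wass_push_le {f g : E d → E d} (hf : Continuous f) (hg : Continuous g) {c : ℝ} (hc : 0 ≤ c)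
    (h : ∀ x, ‖g x - f x‖ ≤ c) (μ : PM d) : wass (push f μ) (push g μ) ≤ c := by
  have hp : IsPlan ((μ : Measure (E d)).map fun x => (f x, g x)) (push f μ) (push g μ) :=
    isPlan_map hf.measurable hg.measurable (coe_push hf μ).symm (coe_push hg μ).symm
  refine (sq_le_sq₀ (wass_nonneg _ _) hc).1 (hp.wass_sq_le.trans ?_)
  rw [planCost_map (hf.prodMk hg).measurable]
  calc _ ≤ ∫ _x, c ^ 2 ∂(μ : Measure (E d)) := by
        refine integral_mono_of_nonneg (ae_of_all _ fun w => by positivity) (integrable_const _)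
          (ae_of_all _ fun x => ?_)
        have h0 := torusDist_nonneg (f x) (g x)
        have h1 := torusDist_le_norm (f x) (g x)
        rw [norm_sub_rev] at h1
        have h2 := h1.trans (h x)
        simp only
        gcongr
    _ = _ := by simp

lemma wass_law_same_le (μ : PM d) (U U' : Disp d) : wass (law μ U) (law μ U') ≤ ‖U' - U‖ :=
  wass_push_le (continuous_pos U) (continuous_pos U') (norm_nonneg _) (norm_pos_sub_pos_le U U') μ

/-- A function on `𝕋^d × ℝ^d × 𝒫(𝕋^d)` with Lipschitz first derivatives. -/
structure SmoothField (d : ℕ) where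
  f : E d × E d → PM d → E d × E d
  f' : E d × E d → PM d → E d × E d →L[ℝ] E d × E d
  N : E d × E d → PM d → E d → E d →L[ℝ] E d × E d
  L : ℝ
  smooth : SmoothFn f f' N L
  torus : TorusFn f f' N

namespace SmoothField

variable (A : SmoothField d)

lemma L_nonneg : 0 ≤ A.L := A.smooth.nonneg

/-- In the point where mass is displaced, the gradient is Lipschitz for the torus distance because
it is periodic. -/
lemma lip_grad_torus (z z' : E d × E d) (μ ν : PM d) (x y : E d) :
    ‖A.N z' ν y - A.N z μ x‖ ≤ A.L * (‖z' - z‖ + wass μ ν + torusDist y x) := by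
  have h := A.smooth.lip_grad z z' μ ν x (y + -roundVec (y - x))
  rw [A.torus.grad_snd _ (torusEq_roundVec _).neg] at h
  rw [torusDist_eq]
  convert h using 3
  congr 1; abel

/-- The composition operator `U ↦ f(pt U, law μ U)`. -/
def nem (μ : PM d) (U : Disp d) : Disp d :=
  BoundedContinuousFunction.ofNormedAddCommGroup (fun q => A.f (pt U q) (law μ U))
    ((A.smooth.continuous_fn _).comp (continuous_pt U)) A.L (fun _ => A.smooth.bound _ _)

/-- The derivative in the point, along `U`. -/
def jac (μ : PM d) (U : Disp d) : E d →ᵇ (E d × E d →L[ℝ] E d × E d) :=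
  BoundedContinuousFunction.ofNormedAddCommGroup (fun q => A.f' (pt U q) (law μ U))
    ((A.smooth.continuous_deriv _).comp (continuous_pt U)) A.L
    (fun _ => A.smooth.bound_deriv _ _)

lemma continuous_grad_fst (μ : PM d) (y : E d) : Continuous fun z => A.N z μ y :=
  continuous_of_norm_sub_le A.L_nonneg fun x x' => by
    simpa [wass_self] using A.smooth.lip_grad x x' μ μ y y

/-- The derivative in the measure, along `U`, at the position of `x`. -/
def ker (μ : PM d) (U : Disp d) (x : E d) : E d →ᵇ (E d →L[ℝ] E d × E d) :=
  BoundedContinuousFunction.ofNormedAddCommGroup (fun q => A.N (pt U q) (law μ U) (pos U x))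
    ((A.continuous_grad_fst _ _).comp (continuous_pt U)) A.L
    (fun _ => A.smooth.bound_grad _ _ _)

lemma nem_apply (μ : PM d) (U : Disp d) (q : E d) : A.nem μ U q = A.f (pt U q) (law μ U) := rfl

lemma jac_apply (μ : PM d) (U : Disp d) (q : E d) : A.jac μ U q = A.f' (pt U q) (law μ U) := rfl

lemma ker_apply (μ : PM d) (U : Disp d) (x q : E d) :
    A.ker μ U x q = A.N (pt U q) (law μ U) (pos U x) := rfl

lemma norm_nem_le (μ : PM d) (U : Disp d) : ‖A.nem μ U‖ ≤ A.L :=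
  (BoundedContinuousFunction.norm_le A.L_nonneg).2 fun _ => A.smooth.bound _ _

lemma norm_nem_sub_le (μ ν : PM d) (U U' : Disp d) :
    ‖A.nem ν U' - A.nem μ U‖ ≤ A.L * (‖U' - U‖ + wass (law μ U) (law ν U')) := by
  have := wass_nonneg (law μ U) (law ν U')
  have hL := A.L_nonneg
  refine (BoundedContinuousFunction.norm_le (by positivity)).2 fun q => ?_
  refine (A.smooth.lip _ _ _ _).trans ?_
  gcongr
  exact norm_pt_sub_pt_le U U' q

lemma norm_nem_sub_same_le (μ : PM d) (U U' : Disp d) :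
    ‖A.nem μ U' - A.nem μ U‖ ≤ 2 * A.L * ‖U' - U‖ := by
  have hL := A.L_nonneg
  refine (A.norm_nem_sub_le μ μ U U').trans ?_
  have := wass_law_same_le μ U U'
  calc _ ≤ A.L * (‖U' - U‖ + ‖U' - U‖) := by gcongr
    _ = _ := by ring

lemma norm_jac_sub_le (μ ν : PM d) (U U' : Disp d) (q : E d) :
    ‖A.jac ν U' q - A.jac μ U q‖ ≤ A.L * (‖U' - U‖ + wass (law μ U) (law ν U')) := by
  have hL := A.L_nonneg
  refine (A.smooth.lip_deriv _ _ _ _).trans ?_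
  gcongr
  exact norm_pt_sub_pt_le U U' q

lemma norm_ker_sub_le (μ ν : PM d) (U U' : Disp d) (x y q : E d) :
    ‖A.ker ν U' y q - A.ker μ U x q‖ ≤
      A.L * (‖U' - U‖ + wass (law μ U) (law ν U') + torusDist (pos U' y) (pos U x)) := by
  have hL := A.L_nonneg
  refine (A.lip_grad_torus _ _ _ _ _ _).trans ?_
  gcongr
  exact norm_pt_sub_pt_le U U' q

lemma continuous_ker (μ : PM d) (U : Disp d) (q : E d) : Continuous fun x => A.ker μ U x q :=
  (A.smooth.continuous_grad _ _).comp (continuous_pos U)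

/-- The local part of the derivative of `nem`. -/
def loc (μ : PM d) (U : Disp d) : Disp d →L[ℝ] Disp d := mulOp (A.jac μ U)

lemma loc_apply (μ : PM d) (U w : Disp d) (q : E d) : A.loc μ U w q = A.jac μ U q (w q) := rfl

lemma norm_jac_le (μ : PM d) (U : Disp d) (q : E d) : ‖A.jac μ U q‖ ≤ A.L :=
  A.smooth.bound_deriv _ _

lemma norm_ker_le (μ : PM d) (U : Disp d) (x q : E d) : ‖A.ker μ U x q‖ ≤ A.L :=
  A.smooth.bound_grad _ _ _

lemma norm_loc_le (μ : PM d) (U : Disp d) : ‖A.loc μ U‖ ≤ A.L :=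
  (norm_mulOp_le _).trans
    ((BoundedContinuousFunction.norm_le A.L_nonneg).2 fun q => A.norm_jac_le μ U q)

lemma norm_loc_sub_le (μ ν : PM d) (U U' : Disp d) :
    ‖A.loc ν U' - A.loc μ U‖ ≤ A.L * (‖U' - U‖ + wass (law μ U) (law ν U')) := by
  have hL := A.L_nonneg
  have := wass_nonneg (law μ U) (law ν U')
  refine ContinuousLinearMap.opNorm_le_bound _ (by positivity) fun w =>
    (BoundedContinuousFunction.norm_le (by positivity)).2 fun q => ?_
  have h := (A.jac ν U' q - A.jac μ U q).le_of_opNorm_le (A.norm_jac_sub_le μ ν U U' q) (w q)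
  refine h.trans ?_
  gcongr
  exact w.norm_coe_le_norm q

lemma integrable_ker_apply (μ : PM d) (U w : Disp d) (q : E d) :
    Integrable (fun x => A.ker μ U x q (w x).1) (μ : Measure (E d)) := by
  refine Integrable.of_bound ((A.continuous_ker μ U q).clm_apply
    (continuous_fst.comp w.continuous)).aestronglyMeasurable (A.L * ‖w‖) (ae_of_all _ fun x => ?_)
  refine ((A.ker μ U x q).le_of_opNorm_le (A.norm_ker_le μ U x q) _).trans ?_
  have := A.L_nonneg
  gcongr
  exact (norm_fst_le _).trans (w.norm_coe_le_norm x)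

lemma norm_ker_apply_le (μ : PM d) (U w : Disp d) (x q : E d) :
    ‖A.ker μ U x q (w x).1‖ ≤ A.L * ‖w‖ := by
  refine ((A.ker μ U x q).le_of_opNorm_le (A.norm_ker_le μ U x q) _).trans ?_
  have := A.L_nonneg
  gcongr
  exact (norm_fst_le _).trans (w.norm_coe_le_norm x)

lemma norm_integral_ker_le (μ : PM d) (U w : Disp d) (q : E d) :
    ‖∫ x, A.ker μ U x q (w x).1 ∂(μ : Measure (E d))‖ ≤ A.L * ‖w‖ := by
  refine (norm_integral_le_of_norm_le (integrable_const _)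
    (ae_of_all _ fun x => A.norm_ker_apply_le μ U w x q)).trans ?_
  simp

lemma continuous_integral_ker (μ : PM d) (U w : Disp d) :
    Continuous fun q => ∫ x, A.ker μ U x q (w x).1 ∂(μ : Measure (E d)) :=
  continuous_of_dominated
    (fun q => (A.integrable_ker_apply μ U w q).aestronglyMeasurable)
    (fun q => ae_of_all _ fun x => A.norm_ker_apply_le μ U w x q) (integrable_const _)
    (ae_of_all _ fun x => (A.ker μ U x).continuous.clm_apply continuous_const)

/-- The nonlocal part of the derivative of `nem`. -/
def nonloc (μ : PM d) (U : Disp d) : Disp d →L[ℝ] Disp d :=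
  LinearMap.mkContinuous
    { toFun := fun w => BoundedContinuousFunction.ofNormedAddCommGroup
        (fun q => ∫ x, A.ker μ U x q (w x).1 ∂(μ : Measure (E d)))
        (A.continuous_integral_ker μ U w) _ (A.norm_integral_ker_le μ U w)
      map_add' := fun w w' => by
        refine BoundedContinuousFunction.ext fun q => ?_
        simp only [BoundedContinuousFunction.coe_ofNormedAddCommGroup,
          BoundedContinuousFunction.coe_add, Pi.add_apply, Prod.fst_add, map_add]
        exact integral_add (A.integrable_ker_apply μ U w q) (A.integrable_ker_apply μ U w' q)
      map_smul' := fun c w => by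
        refine BoundedContinuousFunction.ext fun q => ?_
        simp only [BoundedContinuousFunction.coe_ofNormedAddCommGroup,
          BoundedContinuousFunction.coe_smul, Prod.smul_fst, map_smul, RingHom.id_apply]
        exact integral_smul _ _ }
    A.L (fun w => (BoundedContinuousFunction.norm_le
      (mul_nonneg A.L_nonneg (norm_nonneg _))).2 (A.norm_integral_ker_le μ U w))

lemma nonloc_apply (μ : PM d) (U w : Disp d) (q : E d) :
    A.nonloc μ U w q = ∫ x, A.ker μ U x q (w x).1 ∂(μ : Measure (E d)) := rfl

lemma norm_nonloc_le (μ : PM d) (U : Disp d) : ‖A.nonloc μ U‖ ≤ A.L :=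
  LinearMap.mkContinuous_norm_le _ A.L_nonneg _

lemma norm_nonloc_sub_same_le (μ : PM d) (U U' : Disp d) :
    ‖A.nonloc μ U' - A.nonloc μ U‖ ≤ 3 * A.L * ‖U' - U‖ := by
  have hL := A.L_nonneg
  refine ContinuousLinearMap.opNorm_le_bound _ (by positivity) fun w =>
    (BoundedContinuousFunction.norm_le (by positivity)).2 fun q => ?_
  rw [sub_apply, BoundedContinuousFunction.coe_sub, Pi.sub_apply, nonloc_apply, nonloc_apply,
    ← integral_sub (A.integrable_ker_apply μ U' w q) (A.integrable_ker_apply μ U w q)]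
  refine (norm_integral_le_of_norm_le (integrable_const (3 * A.L * ‖U' - U‖ * ‖w‖))
    (ae_of_all _ fun x => ?_)).trans (by simp)
  have h := A.norm_ker_sub_le μ μ U U' x x q
  have h1 := wass_law_same_le μ U U'
  have h2 := (torusDist_le_norm (pos U' x) (pos U x)).trans (norm_pos_sub_pos_le U U' x)
  rw [← sub_apply]
  refine ((A.ker μ U' x q - A.ker μ U x q).le_of_opNorm_le h _).trans ?_
  calc _ ≤ A.L * (‖U' - U‖ + ‖U' - U‖ + ‖U' - U‖) * ‖w‖ := by
        gcongr
        exact (norm_fst_le _).trans (w.norm_coe_le_norm x)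
    _ = _ := by ring

/-- The nonlocal part depends on the measure in a Lipschitz way only when it is applied to Lipschitz
displacements. -/
lemma norm_nonloc_apply_sub_le {ℓ ℓ' : ℝ} (hℓ : 0 ≤ ℓ) (hℓ' : 0 ≤ ℓ') {U : Disp d}
    (hU : LipTorus ℓ U) (U' : Disp d) {w : Disp d} (hw : LipTorus ℓ' w) (μ ν : PM d) :
    ‖A.nonloc ν U' w - A.nonloc μ U w‖ ≤
      A.L * (4 * ‖U' - U‖ + 3 * (1 + ℓ) * wass μ ν) * ‖w‖ + A.L * ℓ' * wass μ ν := by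
  obtain ⟨γ, hγ, hc⟩ := exists_isPlan_planCost_eq μ ν
  have := hγ.isProbabilityMeasure
  have hL := A.L_nonneg
  have hW := wass_nonneg μ ν
  refine (BoundedContinuousFunction.norm_le (by positivity)).2 fun q => ?_
  have i1 := A.integrable_ker_apply μ U w q
  have i2 := A.integrable_ker_apply ν U' w q
  have j2 : Integrable (fun z : E d × E d => A.ker ν U' z.2 q (w z.2).1) γ := by
    rw [← hγ.2] at i2
    exact (integrable_map_measure i2.1 measurable_snd.aemeasurable).1 i2
  have hl := wass_law_le hℓ hU U' μ ν
  have it := integrable_torusDist γ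
  rw [BoundedContinuousFunction.coe_sub, Pi.sub_apply, nonloc_apply, nonloc_apply,
    ← hγ.integral_fst (A.integrable_ker_apply μ U w q).aestronglyMeasurable,
    ← hγ.integral_snd (A.integrable_ker_apply ν U' w q).aestronglyMeasurable,
    ← integral_sub j2 (hγ.integrable_comp_fst i1)]
  have hb : ∀ z : E d × E d, ‖A.ker ν U' z.2 q (w z.2).1 - A.ker μ U z.1 q (w z.1).1‖
      ≤ A.L * (4 * ‖U' - U‖ + 2 * (1 + ℓ) * wass μ ν) * ‖w‖
        + (A.L * (1 + ℓ) * ‖w‖ + A.L * ℓ') * torusDist z.2 z.1 := by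
    intro z
    have e : A.ker ν U' z.2 q (w z.2).1 - A.ker μ U z.1 q (w z.1).1
        = (A.ker ν U' z.2 q - A.ker μ U z.1 q) (w z.2).1
          + A.ker μ U z.1 q ((w z.2 - w z.1).1) := by
      rw [sub_apply, Prod.fst_sub, map_sub]; abel
    rw [e]
    have ht := torusDist_nonneg z.2 z.1
    have h1 : ‖(A.ker ν U' z.2 q - A.ker μ U z.1 q) (w z.2).1‖
        ≤ A.L * (‖U' - U‖ + 2 * (‖U' - U‖ + (1 + ℓ) * wass μ ν)
          + (‖U' - U‖ + (1 + ℓ) * torusDist z.2 z.1)) * ‖w‖ := by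
      refine ((A.ker ν U' z.2 q - A.ker μ U z.1 q).le_of_opNorm_le
        (A.norm_ker_sub_le μ ν U U' z.1 z.2 q) _).trans ?_
      gcongr
      · exact torusDist_pos_le hU U' z.1 z.2
      · exact (norm_fst_le _).trans (w.norm_coe_le_norm _)
    have h2 : ‖A.ker μ U z.1 q ((w z.2 - w z.1).1)‖ ≤ A.L * (ℓ' * torusDist z.2 z.1) := by
      refine ((A.ker μ U z.1 q).le_of_opNorm_le (A.norm_ker_le μ U z.1 q) _).trans ?_
      gcongr
      exact (norm_fst_le _).trans (hw z.1 z.2)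
    refine (norm_add_le _ _).trans ((add_le_add h1 h2).trans (le_of_eq ?_))
    ring
  refine (norm_integral_le_of_norm_le ((integrable_const _).add (it.const_mul _))
    (ae_of_all _ hb)).trans ?_
  simp only [Pi.add_apply]
  rw [integral_const_add_const_mul it]
  have h3 := mul_le_mul_of_nonneg_left (integral_torusDist_le hγ hc)
    (show 0 ≤ A.L * (1 + ℓ) * ‖w‖ + A.L * ℓ' by positivity)
  refine (add_le_add le_rfl h3).trans (le_of_eq ?_)
  ring

/-- The derivative of `nem` in the displacement. -/
def lin (μ : PM d) (U : Disp d) : Disp d →L[ℝ] Disp d := A.loc μ U + A.nonloc μ U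

lemma norm_lin_le (μ : PM d) (U : Disp d) : ‖A.lin μ U‖ ≤ 2 * A.L := by
  refine (norm_add_le (A.loc μ U) (A.nonloc μ U)).trans ?_
  have := A.norm_loc_le μ U
  have := A.norm_nonloc_le μ U
  linarith

lemma norm_loc_sub_same_le (μ : PM d) (U U' : Disp d) :
    ‖A.loc μ U' - A.loc μ U‖ ≤ 2 * A.L * ‖U' - U‖ := by
  have hL := A.L_nonneg
  have h1 := wass_law_same_le μ U U'
  calc _ ≤ A.L * (‖U' - U‖ + wass (law μ U) (law μ U')) := A.norm_loc_sub_le μ μ U U'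
    _ ≤ A.L * (‖U' - U‖ + ‖U' - U‖) := by gcongr
    _ = _ := by ring

lemma norm_lin_sub_same_le (μ : PM d) (U U' : Disp d) :
    ‖A.lin μ U' - A.lin μ U‖ ≤ 5 * A.L * ‖U' - U‖ := by
  have e : A.lin μ U' - A.lin μ U
      = (A.loc μ U' - A.loc μ U) + (A.nonloc μ U' - A.nonloc μ U) := by
    simp only [lin]; abel
  rw [e]
  refine (norm_add_le (A.loc μ U' - A.loc μ U) (A.nonloc μ U' - A.nonloc μ U)).trans ?_
  have := A.norm_loc_sub_same_le μ U U'
  have := A.norm_nonloc_sub_same_le μ U U'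
  linarith

/-- First-order expansion of the composition operator when the measure changes along an optimal plan
and the displacement changes at the same time. -/
lemma nem_expansion {b b₂ m : ℝ} (hb : 0 ≤ b) (hm : 0 ≤ m) {μ ν : PM d}
    {γ : Measure (E d × E d)} (hγ : IsOptPlan γ μ ν) {U U' : Disp d} {B : E d → E d →L[ℝ] E d}
    (hBc : Continuous B) (hBb : ∀ x, ‖B x‖ ≤ b)
    (hB : ∀ x y, ‖pos U y - pos U x - B x (y - x)‖ ≤ b₂ * ‖y - x‖ ^ 2)
    (hU : ∀ x y, ‖pos U y - pos U x‖ ≤ b * ‖y - x‖)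
    (hδ : ∀ x y, ‖((U' - U) y - (U' - U) x).1‖ ≤ m * ‖y - x‖) (q : E d) :
    ‖A.nem ν U' q - A.nem μ U q - A.lin μ U (U' - U) q
        - ∫ z, (A.ker μ U z.1 q ∘L B z.1) (z.2 - z.1) ∂γ‖
      ≤ A.L * (3 * ‖U' - U‖ ^ 2 + (2 * b ^ 2 + b₂) * wass μ ν ^ 2 + m * wass μ ν) := by
  have := hγ.1.isProbabilityMeasure
  have hL := A.L_nonneg
  have hW := wass_nonneg μ ν
  have hc := hγ.finiteCost
  have hp : IsPlan (γ.map fun z => (pos U z.1, pos U' z.2)) (law μ U) (law ν U') :=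
    hγ.1.map_push (continuous_pos U) (continuous_pos U')
  have hmc : Continuous fun z : E d × E d => (pos U z.1, pos U' z.2) :=
    ((continuous_pos U).comp continuous_fst).prodMk ((continuous_pos U').comp continuous_snd)
  have hdisp : ∀ z : E d × E d, ‖pos U' z.2 - pos U z.1‖ ≤ ‖U' - U‖ + b * ‖z.2 - z.1‖ := fun z => by
    have h1 := norm_add_le (pos U' z.2 - pos U z.2) (pos U z.2 - pos U z.1)
    rw [sub_add_sub_cancel] at h1
    linarith [norm_pos_sub_pos_le U U' z.2, hU z.1 z.2]
  have hfc : FiniteCost (γ.map fun z => (pos U z.1, pos U' z.2)) := by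
    have := hp.isProbabilityMeasure
    refine finiteCost_of_bound (C := ‖U' - U‖ + b * Real.sqrt d) ?_
    rw [ae_map_iff hmc.aemeasurable (measurableSet_le (by fun_prop) measurable_const)]
    filter_upwards [hγ.norm_le] with z hz
    exact (hdisp z).trans (by gcongr)
  -- the pushed forward plan need not be optimal, so an expansion along arbitrary plans is needed here
  have hexp := A.smooth.expansion (pt U q) (pt U' q) _ _ _ hp hfc
  have hsq : sqCost (γ.map fun z => (pos U z.1, pos U' z.2))
      ≤ 2 * ‖U' - U‖ ^ 2 + 2 * b ^ 2 * wass μ ν ^ 2 := by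
    rw [sqCost, integral_map hmc.aemeasurable (by fun_prop)]
    have : ∫ z, ‖pos U' z.2 - pos U z.1‖ ^ 2 ∂γ
        ≤ ∫ z, (2 * ‖U' - U‖ ^ 2 + 2 * b ^ 2 * ‖z.2 - z.1‖ ^ 2) ∂γ := by
      refine integral_mono_of_nonneg (ae_of_all _ fun w => by positivity)
        ((integrable_const _).add (hc.integrable_sq.const_mul _)) (ae_of_all _ fun z => ?_)
      have := pow_le_pow_left₀ (norm_nonneg _) (hdisp z) 2
      refine this.trans ?_
      nlinarith [sq_nonneg (‖U' - U‖ - b * ‖z.2 - z.1‖)]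
    refine this.trans (le_of_eq ?_)
    rw [integral_const_add_const_mul hc.integrable_sq]
    change _ + 2 * b ^ 2 * sqCost γ = _
    rw [hγ.sqCost_eq]
  -- the integral against the transported plan is compared with its linearization
  have hNc : Continuous fun z : E d × E d => A.ker μ U z.1 q :=
    (A.continuous_ker μ U q).comp continuous_fst
  have e1 : ∫ w, A.N (pt U q) (law μ U) w.1 (w.2 - w.1) ∂(γ.map fun z => (pos U z.1, pos U' z.2))
      = ∫ z, A.ker μ U z.1 q (pos U' z.2 - pos U z.1) ∂γ := by
    rw [integral_map hmc.aemeasurable]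
    · rfl
    · exact (((A.smooth.continuous_grad _ _).comp continuous_fst).clm_apply
        (continuous_snd.sub continuous_fst)).aestronglyMeasurable
  have i1 : Integrable (fun z : E d × E d => A.ker μ U z.1 q (pos U' z.2 - pos U z.1)) γ := by
    have hi : Integrable (fun z : E d × E d => z.2 - z.1) γ := hc.integrable (by norm_num)
    refine (((integrable_const ‖U' - U‖).add (hi.norm.const_mul b)).const_mul A.L).mono'
      (hNc.clm_apply (((continuous_pos U').comp continuous_snd).sub
        ((continuous_pos U).comp continuous_fst))).aestronglyMeasurable (ae_of_all _ fun z => ?_)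
    refine ((A.ker μ U z.1 q).le_of_opNorm_le (A.norm_ker_le μ U z.1 q) _).trans ?_
    exact mul_le_mul_of_nonneg_left (hdisp z) hL
  have i2 : Integrable (fun z : E d × E d => A.ker μ U z.1 q ((U' - U) z.1).1) γ :=
    hγ.1.integrable_comp_fst (A.integrable_ker_apply μ U (U' - U) q)
  have i3 : Integrable (fun z : E d × E d => (A.ker μ U z.1 q ∘L B z.1) (z.2 - z.1)) γ :=
    integrable_clm_disp hc (hNc.clm_comp (hBc.comp continuous_fst)) (B := A.L * b) fun z =>
      (ContinuousLinearMap.opNorm_comp_le _ _).trans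
        (mul_le_mul (A.norm_ker_le _ _ _ _) (hBb _) (norm_nonneg _) hL)
  have e2 : A.nonloc μ U (U' - U) q = ∫ z, A.ker μ U z.1 q ((U' - U) z.1).1 ∂γ := by
    rw [nonloc_apply, ← hγ.1.integral_fst (A.integrable_ker_apply μ U (U' - U) q).aestronglyMeasurable]
  have hrem : ‖∫ z, A.ker μ U z.1 q (pos U' z.2 - pos U z.1) ∂γ - A.nonloc μ U (U' - U) q
      - ∫ z, (A.ker μ U z.1 q ∘L B z.1) (z.2 - z.1) ∂γ‖
      ≤ A.L * (m * wass μ ν + b₂ * wass μ ν ^ 2) := by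
    have hi : Integrable (fun z : E d × E d => z.2 - z.1) γ := hc.integrable (by norm_num)
    have i12 : Integrable (fun z : E d × E d => A.ker μ U z.1 q (pos U' z.2 - pos U z.1)
      - A.ker μ U z.1 q ((U' - U) z.1).1) γ := i1.sub i2
    rw [e2, ← integral_sub i1 i2, ← integral_sub i12 i3]
    have hbd : ∀ z : E d × E d, ‖A.ker μ U z.1 q (pos U' z.2 - pos U z.1)
        - A.ker μ U z.1 q ((U' - U) z.1).1 - (A.ker μ U z.1 q ∘L B z.1) (z.2 - z.1)‖
        ≤ A.L * m * ‖z.2 - z.1‖ + A.L * b₂ * ‖z.2 - z.1‖ ^ 2 := by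
      intro z
      rw [ContinuousLinearMap.comp_apply, ← map_sub, ← map_sub]
      refine ((A.ker μ U z.1 q).le_of_opNorm_le (A.norm_ker_le μ U z.1 q) _).trans ?_
      have e : pos U' z.2 - pos U z.1 - ((U' - U) z.1).1 - B z.1 (z.2 - z.1)
          = ((U' - U) z.2 - (U' - U) z.1).1 + (pos U z.2 - pos U z.1 - B z.1 (z.2 - z.1)) := by
        rw [Prod.fst_sub, ← pos_sub_pos, ← pos_sub_pos]; abel
      rw [e, mul_assoc, mul_assoc, ← mul_add]
      refine mul_le_mul_of_nonneg_left ((norm_add_le _ _).trans (add_le_add ?_ (hB _ _))) hL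
      exact hδ _ _
    refine (norm_integral_le_of_norm_le ((hi.norm.const_mul _).add (hc.integrable_sq.const_mul _))
      (ae_of_all _ hbd)).trans ?_
    simp only [Pi.add_apply]
    rw [integral_const_mul_add_const_mul hi.norm hc.integrable_sq]
    change _ + A.L * b₂ * sqCost γ ≤ _
    rw [hγ.sqCost_eq]
    have := mul_le_mul_of_nonneg_left hγ.integral_norm_le (show 0 ≤ A.L * m by positivity)
    linarith
  rw [e1] at hexp
  have hδq : ‖pt U' q - pt U q‖ ^ 2 ≤ ‖U' - U‖ ^ 2 := by
    gcongr; exact norm_pt_sub_pt_le U U' q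
  have e3 : A.nem ν U' q - A.nem μ U q - A.lin μ U (U' - U) q
        - ∫ z, (A.ker μ U z.1 q ∘L B z.1) (z.2 - z.1) ∂γ
      = (A.f (pt U' q) (law ν U') - A.f (pt U q) (law μ U)
          - A.f' (pt U q) (law μ U) (pt U' q - pt U q)
          - ∫ z, A.ker μ U z.1 q (pos U' z.2 - pos U z.1) ∂γ)
        + (∫ z, A.ker μ U z.1 q (pos U' z.2 - pos U z.1) ∂γ - A.nonloc μ U (U' - U) q
          - ∫ z, (A.ker μ U z.1 q ∘L B z.1) (z.2 - z.1) ∂γ) := by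
    rw [lin, add_apply, BoundedContinuousFunction.coe_add, Pi.add_apply, loc_apply, jac_apply,
      pt_sub_pt, nem_apply, nem_apply]
    abel
  rw [e3]
  refine (norm_add_le _ _).trans ((add_le_add hexp hrem).trans ?_)
  rw [← mul_add]
  refine mul_le_mul_of_nonneg_left ?_ hL
  linarith

end SmoothField

/-! ### Translations -/

/-- The translated displacement `U(· + h)`. -/
def trans (h : E d) (U : Disp d) : Disp d :=
  U.compContinuous ⟨fun q => q + h, by fun_prop⟩

lemma pt_add_sub (U : Disp d) (q h k : E d) :
    pt U (q + h) + (-k, 0) - pt U q = (h - k, 0) + (U (q + h) - U q) := by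
  simp only [pt]
  ext1
  · simp only [Prod.fst_sub, Prod.fst_add]; abel
  · simp

lemma norm_pt_add_sub_le (U : Disp d) (q h k : E d) :
    ‖pt U (q + h) + (-k, 0) - pt U q‖ ≤ ‖h - k‖ + ‖U (q + h) - U q‖ := by
  rw [pt_add_sub]
  refine (norm_add_le _ _).trans (add_le_add (le_of_eq ?_) le_rfl)
  simp [Prod.norm_def]

namespace SmoothField

variable (A : SmoothField d)

lemma norm_nem_add_sub_le (μ : PM d) (U : Disp d) (q h : E d) {k : E d} (hk : TorusEq k 0) :
    ‖A.nem μ U (q + h) - A.nem μ U q‖ ≤ A.L * (‖h - k‖ + ‖U (q + h) - U q‖) := by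
  have hL := A.L_nonneg
  rw [nem_apply, nem_apply, ← A.torus.fn _ hk.neg]
  refine (A.smooth.lip _ _ _ _).trans ?_
  rw [wass_self, add_zero]
  gcongr
  exact norm_pt_add_sub_le U q h k

lemma norm_jac_add_sub_le (μ : PM d) (U : Disp d) (q h : E d) {k : E d} (hk : TorusEq k 0) :
    ‖A.jac μ U (q + h) - A.jac μ U q‖ ≤ A.L * (‖h - k‖ + ‖U (q + h) - U q‖) := by
  have hL := A.L_nonneg
  rw [jac_apply, jac_apply, ← A.torus.deriv _ hk.neg]
  refine (A.smooth.lip_deriv _ _ _ _).trans ?_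
  rw [wass_self, add_zero]
  gcongr
  exact norm_pt_add_sub_le U q h k

lemma norm_ker_add_sub_le (μ : PM d) (U : Disp d) (x q h : E d) {k : E d} (hk : TorusEq k 0) :
    ‖A.ker μ U x (q + h) - A.ker μ U x q‖ ≤ A.L * (‖h - k‖ + ‖U (q + h) - U q‖) := by
  have hL := A.L_nonneg
  rw [ker_apply, ker_apply, ← A.torus.grad _ hk.neg]
  refine (A.smooth.lip_grad _ _ _ _ _ _).trans ?_
  rw [wass_self, add_zero, sub_self, norm_zero, add_zero]
  gcongr
  exact norm_pt_add_sub_le U q h k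

/-- First-order expansion of the composition operator under a translation. -/
lemma nem_add_expansion (μ : PM d) (U : Disp d) (q h : E d) :
    ‖A.nem μ U (q + h) - A.nem μ U q - A.jac μ U q ((h, 0) + (U (q + h) - U q))‖
      ≤ A.L * (‖h‖ + ‖U (q + h) - U q‖) ^ 2 := by
  have hL := A.L_nonneg
  have hp := isPlan_diag (law μ U)
  have hfc : FiniteCost (((law μ U : PM d) : Measure (E d)).map fun x => (x, x)) := by
    have := hp.isProbabilityMeasure
    refine finiteCost_of_bound (C := 0) ?_
    rw [ae_map_iff (by fun_prop) (measurableSet_le (by fun_prop) measurable_const)]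
    exact ae_of_all _ fun x => by simp
  have h1 := A.smooth.expansion (pt U q) (pt U (q + h)) _ _ _ hp hfc
  have e1 : ∫ w, A.N (pt U q) (law μ U) w.1 (w.2 - w.1)
      ∂(((law μ U : PM d) : Measure (E d)).map fun x => (x, x)) = 0 := by
    rw [integral_map (by fun_prop)]
    · simp
    · exact (((A.smooth.continuous_grad _ _).comp continuous_fst).clm_apply
        (continuous_snd.sub continuous_fst)).aestronglyMeasurable
  have e2 : sqCost (((law μ U : PM d) : Measure (E d)).map fun x => (x, x)) = 0 := by
    rw [sqCost, integral_map (by fun_prop) (by fun_prop)]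
    simp
  have e3 := pt_add_sub U q h 0
  have e4 := norm_pt_add_sub_le U q h 0
  simp only [neg_zero, Prod.mk_zero_zero, add_zero, sub_zero] at e3 e4
  rw [e1, e2, sub_zero, add_zero, e3] at h1
  rw [e3] at e4
  exact h1.trans (by gcongr)

end SmoothField

/-! ### Perturbation of integral equations -/

section Perturbation

variable {Y : Type} [NormedAddCommGroup Y] [NormedSpace ℝ Y]

/-- Constant functions, as a linear map. -/
def constL (α : Type) [TopologicalSpace α] (Y : Type) [NormedAddCommGroup Y] [NormedSpace ℝ Y] :
    Y →L[ℝ] (α →ᵇ Y) :=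
  flipCLM (BoundedContinuousFunction.const α (ContinuousLinearMap.id ℝ Y))

lemma constL_apply {α : Type} [TopologicalSpace α] (y : Y) (t : α) : constL α Y y t = y := rfl

lemma norm_constL_apply_le {α : Type} [TopologicalSpace α] (y : Y) : ‖constL α Y y‖ ≤ ‖y‖ :=
  (BoundedContinuousFunction.norm_le (norm_nonneg _)).2 fun _ => le_rfl

lemma volt_add_apply (T s : ℝ) (M M' : Y →L[ℝ] Y) (h : ℝ →ᵇ Y) :
    volt T s (M + M') h = volt T s M h + constL ℝ Y (M' (∫ τ in s..(0 : ℝ), h τ)) := by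
  ext t
  rw [BoundedContinuousFunction.coe_add, Pi.add_apply, volt_apply, volt_apply, constL_apply,
    add_apply, add_assoc]

lemma norm_initial_integral_le {T s : ℝ} (hs : s ∈ Icc 0 T) (h : ℝ →ᵇ Y) :
    ‖∫ τ in s..(0 : ℝ), h τ‖ ≤ T * ‖h‖ := by
  rw [mul_comm]
  exact norm_integral_le_of_mem_Icc hs (left_mem_Icc.2 (hs.1.trans hs.2)) (norm_nonneg h)
    fun τ _ => h.norm_coe_le_norm τ

lemma norm_initial_integral_sub_le {T s s' : ℝ} (hs' : s' ∈ Icc 0 T)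
    (h h' : ℝ →ᵇ Y) :
    ‖(∫ τ in s'..(0 : ℝ), h' τ) - ∫ τ in s..(0 : ℝ), h τ‖ ≤ T * ‖h' - h‖ + |s' - s| * ‖h‖ := by
  have e : (∫ τ in s'..(0 : ℝ), h' τ) - ∫ τ in s..(0 : ℝ), h τ
      = (∫ τ in s'..(0 : ℝ), (h' - h) τ) + ∫ τ in s'..s, h τ := by
    simp only [BoundedContinuousFunction.coe_sub, Pi.sub_apply]
    rw [intervalIntegral.integral_sub (intervalIntegrable_bcf _ _ _)
      (intervalIntegrable_bcf _ _ _), ← intervalIntegral.integral_add_adjacent_intervals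
      (intervalIntegrable_bcf h s' s) (intervalIntegrable_bcf h s 0)]
    abel
  rw [e]
  refine (norm_add_le _ _).trans (add_le_add (norm_initial_integral_le hs' _) ?_)
  rw [mul_comm, abs_sub_comm]
  exact norm_integral_bcf_le h s' s

/-- Dependence of `volt` on its parameters. The difference of the operators is only applied to one
vector, which may be more regular than a general one. -/
lemma norm_volt_sub_volt_apply_le {T s s' : ℝ} (M M' : Y →L[ℝ] Y) (h : ℝ →ᵇ Y) :
    ‖volt T s' M' h - volt T s M h‖ ≤
      (1 + ‖M'‖) * |s' - s| * ‖h‖ + ‖(M' - M) (∫ τ in s..(0 : ℝ), h τ)‖ := by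
  refine (BoundedContinuousFunction.norm_le (by positivity)).2 fun t => ?_
  rw [BoundedContinuousFunction.coe_sub, Pi.sub_apply, volt_apply, volt_apply]
  have e1 : (∫ τ in s'..clampT T t, h τ) = (∫ τ in s..clampT T t, h τ) + ∫ τ in s'..s, h τ := by
    rw [add_comm, intervalIntegral.integral_add_adjacent_intervals (intervalIntegrable_bcf h _ _)
      (intervalIntegrable_bcf h _ _)]
  have e2 : (∫ τ in s'..(0 : ℝ), h τ) = (∫ τ in s..(0 : ℝ), h τ) + ∫ τ in s'..s, h τ := by
    rw [add_comm, intervalIntegral.integral_add_adjacent_intervals (intervalIntegrable_bcf h _ _)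
      (intervalIntegrable_bcf h _ _)]
  have e3 : (∫ τ in s'..clampT T t, h τ) + M' (∫ τ in s'..(0 : ℝ), h τ)
      - ((∫ τ in s..clampT T t, h τ) + M (∫ τ in s..(0 : ℝ), h τ))
      = (∫ τ in s'..s, h τ) + M' (∫ τ in s'..s, h τ) + (M' - M) (∫ τ in s..(0 : ℝ), h τ) := by
    rw [e1, e2, map_add, sub_apply]; abel
  have b1 : ‖∫ τ in s'..s, h τ‖ ≤ ‖h‖ * |s' - s| := by
    rw [abs_sub_comm]; exact norm_integral_bcf_le h s' s
  rw [e3]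
  refine norm_add₃_le.trans ?_
  have b3 := (M'.le_opNorm (∫ τ in s'..s, h τ)).trans
    (mul_le_mul_of_nonneg_left b1 (norm_nonneg M'))
  refine (add_le_add (add_le_add b1 b3) le_rfl).trans (le_of_eq (by ring))

lemma norm_volt_sub_volt_le {T s s' : ℝ} (hs' : s' ∈ Icc 0 T)
    (M M' : Y →L[ℝ] Y) (h h' : ℝ →ᵇ Y) :
    ‖volt T s' M' h' - volt T s M h‖ ≤ (1 + ‖M'‖) * T * ‖h' - h‖ +
      ((1 + ‖M'‖) * |s' - s| * ‖h‖ + ‖(M' - M) (∫ τ in s..(0 : ℝ), h τ)‖) := by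
  have e : volt T s' M' h' - volt T s M h
      = volt T s' M' (h' - h) + (volt T s' M' h - volt T s M h) := by
    rw [map_sub]; abel
  rw [e]
  exact (norm_add_le _ _).trans (add_le_add ((volt T s' M').le_of_opNorm_le (norm_volt_le hs' M') _)
    (norm_volt_sub_volt_apply_le M M' h))

lemma norm_volt_add_constL_sub_le {T s s' : ℝ} (hs' : s' ∈ Icc 0 T) (M : Y →L[ℝ] Y)
    (h h' : ℝ →ᵇ Y) (e e' : Y) :
    ‖(volt T s' M h' + constL ℝ Y e') - (volt T s M h + constL ℝ Y e)‖
      ≤ (1 + ‖M‖) * T * ‖h' - h‖ + (1 + ‖M‖) * |s' - s| * ‖h‖ + ‖e' - e‖ := by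
  have e1 : (volt T s' M h' + constL ℝ Y e') - (volt T s M h + constL ℝ Y e)
      = (volt T s' M h' - volt T s M h) + constL ℝ Y (e' - e) := by
    rw [map_sub]; abel
  have h1 := norm_volt_sub_volt_le (s := s) hs' M M h h'
  rw [sub_self, zero_apply, norm_zero, add_zero] at h1
  rw [e1]
  exact (norm_add_le _ _).trans (add_le_add h1 (norm_constL_apply_le _))

/-- Linearization of an integral equation with an initial condition: `w` is the difference of two
solutions, `k` and `e` are the differences of the right hand sides, which are equal to `l + h` and
`M ∫_s^0 k + g` up to small terms. -/
lemma norm_sub_linearization_le {T s : ℝ} (hs : s ∈ Icc 0 T) {P M : Y →L[ℝ] Y} {w k l h : ℝ →ᵇ Y}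
    {e g : Y} (hw : w = volt T s P k + constL ℝ Y e) :
    ‖w - volt T s (P + M) l - (volt T s (P + M) h + constL ℝ Y g)‖
      ≤ (1 + ‖P + M‖) * T * ‖k - l - h‖ + ‖e - M (∫ τ in s..(0 : ℝ), k τ) - g‖ := by
  have e1 : w - volt T s (P + M) l - (volt T s (P + M) h + constL ℝ Y g)
      = volt T s (P + M) (k - l - h) + constL ℝ Y (e - M (∫ τ in s..(0 : ℝ), k τ) - g) := by
    rw [map_sub, map_sub, map_sub, map_sub, volt_add_apply T s P M k, hw]
    abel
  rw [e1]
  have h1 := (volt T s (P + M)).le_of_opNorm_le (norm_volt_le hs (P + M)) (k - l - h)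
  have h2 := norm_constL_apply_le (α := ℝ) (e - M (∫ τ in s..(0 : ℝ), k τ) - g)
  exact (norm_add_le _ _).trans (add_le_add h1 h2)

/-- Operators that commute with `M` commute with `volt`. -/
lemma compLeft_volt [CompleteSpace Y] (T s : ℝ) {M g : Y →L[ℝ] Y} (hg : ∀ y, g (M y) = M (g y))
    (h : ℝ →ᵇ Y) :
    g.compLeftContinuousBounded ℝ (volt T s M h)
      = volt T s M (g.compLeftContinuousBounded ℝ h) := by
  ext t
  simp only [ContinuousLinearMap.compLeftContinuousBounded_apply, volt_apply, map_add, hg]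
  rw [g.intervalIntegral_comp_comm (intervalIntegrable_bcf _ _ _),
    g.intervalIntegral_comp_comm (intervalIntegrable_bcf _ _ _)]

end Perturbation

/-! ### Translations of displacements -/

/-- Curves of displacements. -/
abbrev Curve (d : ℕ) : Type := ℝ →ᵇ Disp d

/-- Translation by `h`, as a linear map. -/
def transL (h : E d) : Disp d →L[ℝ] Disp d :=
  LinearMap.mkContinuous
    { toFun := trans h
      map_add' := fun _ _ => rfl
      map_smul' := fun _ _ => rfl } 1 (fun U =>
        (BoundedContinuousFunction.norm_le (by positivity)).2 fun q => by
          rw [one_mul]; exact U.norm_coe_le_norm _)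

lemma transL_apply (h : E d) (U : Disp d) (q : E d) : transL h U q = U (q + h) := rfl

lemma torusDist_add_self (q h : E d) : torusDist (q + h) q = torusDist h 0 := by
  rw [torusDist_eq, torusDist_eq]; simp

lemma lipTorus_of_transL {β : ℝ} {U : Disp d} (h : ∀ v, ‖transL v U - U‖ ≤ β * torusDist v 0) :
    LipTorus β U := fun x y => by
  have h1 := ((transL (y - x) U - U).norm_coe_le_norm x).trans (h (y - x))
  rw [← torusDist_add_self x (y - x), add_sub_cancel] at h1
  rw [BoundedContinuousFunction.coe_sub, Pi.sub_apply, transL_apply, add_sub_cancel] at h1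
  exact h1

lemma LipTorus.norm_transL_sub_le {β : ℝ} (hβ : 0 ≤ β) {U : Disp d} (hU : LipTorus β U) (v : E d) :
    ‖transL v U - U‖ ≤ β * torusDist v 0 :=
  (BoundedContinuousFunction.norm_le (mul_nonneg hβ (torusDist_nonneg _ _))).2 fun q => by
    rw [BoundedContinuousFunction.coe_sub, Pi.sub_apply, transL_apply,
      ← torusDist_add_self q v]
    exact hU _ _

/-- The projection of displacements onto the momentum component. -/
def momL (d : ℕ) : Disp d →L[ℝ] Disp d :=
  ((ContinuousLinearMap.inr ℝ (E d) (E d)).comp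
    (ContinuousLinearMap.snd ℝ (E d) (E d))).compLeftContinuousBounded (E d)

lemma momL_apply (U : Disp d) (q : E d) : momL d U q = (0, (U q).2) := rfl

lemma norm_momL_le : ‖momL d‖ ≤ 1 :=
  ContinuousLinearMap.opNorm_le_bound _ zero_le_one fun U =>
    (BoundedContinuousFunction.norm_le (by positivity)).2 fun q => by
      rw [momL_apply, one_mul, Prod.norm_def, norm_zero]
      exact max_le (norm_nonneg _) ((norm_snd_le (U q)).trans (U.norm_coe_le_norm q))

namespace SmoothField

variable (A : SmoothField d) {ℓ : ℝ} {U : Disp d}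

lemma lipTorus_nem (hU : LipTorus ℓ U) (μ : PM d) : LipTorus (A.L * (1 + ℓ)) (A.nem μ U) :=
  fun x y => by
    have h := A.norm_nem_add_sub_le μ U x (y - x) (torusEq_roundVec (y - x))
    rw [add_sub_cancel, ← torusDist_eq] at h
    refine h.trans ((mul_le_mul_of_nonneg_left (add_le_add le_rfl (hU x y)) A.L_nonneg).trans
      (le_of_eq (by ring)))

lemma lipTorus_jac (hU : LipTorus ℓ U) (μ : PM d) : LipTorus (A.L * (1 + ℓ)) (A.jac μ U) :=
  fun x y => by
    have h := A.norm_jac_add_sub_le μ U x (y - x) (torusEq_roundVec (y - x))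
    rw [add_sub_cancel, ← torusDist_eq] at h
    refine h.trans ((mul_le_mul_of_nonneg_left (add_le_add le_rfl (hU x y)) A.L_nonneg).trans
      (le_of_eq (by ring)))

lemma lipTorus_ker (hU : LipTorus ℓ U) (μ : PM d) (z : E d) :
    LipTorus (A.L * (1 + ℓ)) (A.ker μ U z) :=
  fun x y => by
    have h := A.norm_ker_add_sub_le μ U z x (y - x) (torusEq_roundVec (y - x))
    rw [add_sub_cancel, ← torusDist_eq] at h
    refine h.trans ((mul_le_mul_of_nonneg_left (add_le_add le_rfl (hU x y)) A.L_nonneg).trans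
      (le_of_eq (by ring)))

lemma lipTorus_nonloc (hℓ : 0 ≤ ℓ) (hU : LipTorus ℓ U) (μ : PM d) (w : Disp d) :
    LipTorus (A.L * (1 + ℓ) * ‖w‖) (A.nonloc μ U w) := fun x y => by
  have hL := A.L_nonneg
  have ht := torusDist_nonneg y x
  rw [nonloc_apply, nonloc_apply, ← integral_sub (A.integrable_ker_apply μ U w y)
    (A.integrable_ker_apply μ U w x)]
  refine (norm_integral_le_of_norm_le (integrable_const (A.L * (1 + ℓ) * ‖w‖ * torusDist y x))
    (ae_of_all _ fun z => ?_)).trans (le_of_eq (by simp))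
  rw [← sub_apply]
  refine ((A.ker μ U z y - A.ker μ U z x).le_of_opNorm_le (A.lipTorus_ker hU μ z x y) _).trans ?_
  calc _ ≤ A.L * (1 + ℓ) * torusDist y x * ‖w‖ := by
        gcongr
        exact (norm_fst_le _).trans (w.norm_coe_le_norm z)
    _ = _ := by ring

lemma lipTorus_loc {β : ℝ} (hU : LipTorus ℓ U) (μ : PM d) {w : Disp d}
    (hw : LipTorus β w) : LipTorus (A.L * (1 + ℓ) * ‖w‖ + A.L * β) (A.loc μ U w) := fun x y => by
  have hL := A.L_nonneg
  have e : A.loc μ U w y - A.loc μ U w x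
      = (A.jac μ U y - A.jac μ U x) (w y) + A.jac μ U x (w y - w x) := by
    rw [loc_apply, loc_apply, sub_apply, map_sub]; abel
  rw [e]
  have h1 := ((A.jac μ U y - A.jac μ U x).le_of_opNorm_le (A.lipTorus_jac hU μ x y) (w y))
  have h0 : 0 ≤ A.L * (1 + ℓ) * torusDist y x := (norm_nonneg _).trans (A.lipTorus_jac hU μ x y)
  have h2 := ((A.jac μ U x).le_of_opNorm_le (A.norm_jac_le μ U x) (w y - w x))
  have h3 := mul_le_mul_of_nonneg_left (w.norm_coe_le_norm y) h0
  have h4 := mul_le_mul_of_nonneg_left (hw x y) hL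
  refine (norm_add_le _ _).trans ?_
  linarith

/-- Translations do not commute with the local part of the derivative, but the commutator is
bounded. -/
lemma norm_transL_loc_sub_le (hℓ : 0 ≤ ℓ) (hU : LipTorus ℓ U) (μ : PM d) (w : Disp d) (v : E d) :
    ‖transL v (A.loc μ U w) - A.loc μ U w - A.loc μ U (transL v w - w)‖
      ≤ A.L * (1 + ℓ) * torusDist v 0 * ‖w‖ := by
  have hL := A.L_nonneg
  have ht := torusDist_nonneg v 0
  refine (BoundedContinuousFunction.norm_le (by positivity)).2 fun q => ?_
  have e : (transL v (A.loc μ U w) - A.loc μ U w - A.loc μ U (transL v w - w)) q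
      = (A.jac μ U (q + v) - A.jac μ U q) (w (q + v)) := by
    simp only [BoundedContinuousFunction.coe_sub, Pi.sub_apply, transL_apply, loc_apply, map_sub,
      sub_apply]
    abel
  rw [e]
  have h := A.lipTorus_jac hU μ q (q + v)
  rw [torusDist_add_self] at h
  refine ((A.jac μ U (q + v) - A.jac μ U q).le_of_opNorm_le h _).trans ?_
  gcongr
  exact w.norm_coe_le_norm _

/-- First-order expansion of the composition operator under translations. -/
lemma norm_transL_nem_sub_le (μ : PM d) (U : Disp d) (v : E d) :
    ‖transL v (A.nem μ U) - A.nem μ U - A.loc μ U (constL _ _ (v, 0) + (transL v U - U))‖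
      ≤ A.L * (‖v‖ + ‖transL v U - U‖) ^ 2 := by
  have hL := A.L_nonneg
  refine (BoundedContinuousFunction.norm_le (by positivity)).2 fun q => ?_
  refine (A.nem_add_expansion μ U q v).trans ?_
  gcongr
  exact (transL v U - U).norm_coe_le_norm q

lemma norm_transL_nem_sub_zero_le (μ : PM d) (U : Disp d) (v : E d) :
    ‖transL v (A.nem μ U) - A.nem μ U‖ ≤ A.L * (torusDist v 0 + ‖transL v U - U‖) := by
  have hL := A.L_nonneg
  have ht := torusDist_nonneg v 0
  refine (BoundedContinuousFunction.norm_le (by positivity)).2 fun q => ?_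
  have h := A.norm_nem_add_sub_le μ U q v (torusEq_roundVec v)
  have e := torusDist_eq v 0
  rw [sub_zero] at e
  rw [← e] at h
  refine h.trans ?_
  gcongr
  exact (transL v U - U).norm_coe_le_norm q

end SmoothField

/-! ### The flow on short time intervals -/

/-- The vector field `K` of the flow, the function `G` that defines the initial momentum, and a time
interval that is short with respect to their Lipschitz constants. The constant `1 / 100` makes `psi`
a contraction and bounds the operators of the linearized equations by `1 / 2`. -/
structure FlowData (d : ℕ) where
  K : SmoothField d
  G : SmoothField d
  G_fst : ∀ z μ, (G.f z μ).1 = 0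
  T : ℝ
  T_nonneg : 0 ≤ T
  small : K.L * T * (1 + G.L) ≤ 1 / 100

namespace FlowData

variable (F : FlowData d)

lemma KL_nonneg : 0 ≤ F.K.L := F.K.L_nonneg

lemma GL_nonneg : 0 ≤ F.G.L := F.G.L_nonneg

lemma KT_nonneg : 0 ≤ F.K.L * F.T := mul_nonneg F.KL_nonneg F.T_nonneg

lemma KT_le : F.K.L * F.T ≤ 1 / 100 := by
  have h := F.small
  nlinarith [mul_nonneg F.KT_nonneg F.GL_nonneg]

lemma GKT_le : F.G.L * (F.K.L * F.T) ≤ 1 / 100 := by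
  have h := F.small
  nlinarith [F.KT_nonneg]

lemma norm_neg_momL_le : ‖-momL d‖ ≤ 1 := (norm_neg (momL d)).trans_le norm_momL_le

lemma norm_add_momL_le (M : Disp d →L[ℝ] Disp d) : ‖-momL d + M‖ ≤ 1 + ‖M‖ :=
  (norm_add_le (-momL d) M).trans (add_le_add norm_neg_momL_le le_rfl)

/-- The velocity along a curve of displacements. -/
def vel (μ : PM d) (U : Curve d) : Curve d :=
  BoundedContinuousFunction.ofNormedAddCommGroup (fun t => F.K.nem μ (U t))
    ((continuous_of_norm_sub_le (mul_nonneg (by norm_num) F.KL_nonneg)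
      (F.K.norm_nem_sub_same_le μ)).comp U.continuous) F.K.L (fun _ => F.K.norm_nem_le μ _)

lemma vel_apply (μ : PM d) (U : Curve d) (t : ℝ) : F.vel μ U t = F.K.nem μ (U t) := rfl

lemma norm_vel_le (μ : PM d) (U : Curve d) : ‖F.vel μ U‖ ≤ F.K.L :=
  (BoundedContinuousFunction.norm_le F.KL_nonneg).2 fun _ => F.K.norm_nem_le μ _

lemma norm_vel_sub_same_le (μ : PM d) (U U' : Curve d) :
    ‖F.vel μ U' - F.vel μ U‖ ≤ 2 * F.K.L * ‖U' - U‖ := by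
  have hK := F.KL_nonneg
  refine (BoundedContinuousFunction.norm_le (by positivity)).2 fun t => ?_
  refine (F.K.norm_nem_sub_same_le μ _ _).trans ?_
  exact mul_le_mul_of_nonneg_left ((U' - U).norm_coe_le_norm t) (by positivity)

/-- The displacement at time zero before the initial momentum is set. Its position is that of the
flow at time zero; its momentum is discarded. -/
def init (s : ℝ) (μ : PM d) (U : Curve d) : Disp d := ∫ τ in s..(0 : ℝ), F.vel μ U τ

/-- The operator whose fixed points are the displacements of the flow: integrate the velocity from
`s`, remove the momentum at time zero and replace it by `G`, evaluated at the position at time zero.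
The argument of `G` is `init` and not `U 0`, which makes `psi` a contraction. -/
def psi (s : ℝ) (μ : PM d) (U : Curve d) : Curve d :=
  volt F.T s (-momL d) (F.vel μ U) + constL ℝ (Disp d) (F.G.nem μ (F.init s μ U))

lemma psi_apply (s : ℝ) (μ : PM d) (U : Curve d) (t : ℝ) :
    F.psi s μ U t = (∫ τ in s..clampT F.T t, F.vel μ U τ)
      - momL d (F.init s μ U) + F.G.nem μ (F.init s μ U) := by
  rw [psi, BoundedContinuousFunction.coe_add, Pi.add_apply, volt_apply, constL_apply, neg_apply,
    ← sub_eq_add_neg]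
  rfl

variable {s s' : ℝ}

lemma norm_volt_add_constL_le (hs : s ∈ Icc 0 F.T) (k : Curve d) (e : Disp d) :
    ‖volt F.T s (-momL d) k + constL ℝ (Disp d) e‖ ≤ 2 * F.T * ‖k‖ + ‖e‖ := by
  have hT := F.T_nonneg
  have h1 := (volt F.T s (-momL d)).le_of_opNorm_le (norm_volt_le hs (-momL d)) k
  have h2 := norm_constL_apply_le (α := ℝ) e
  refine (norm_add_le _ _).trans (add_le_add (h1.trans ?_) h2)
  have := norm_neg_momL_le (d := d)
  gcongr
  linarith

lemma volt_add_constL_sub (k k' : Curve d) (e e' : Disp d) :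
    (volt F.T s (-momL d) k' + constL ℝ (Disp d) e')
        - (volt F.T s (-momL d) k + constL ℝ (Disp d) e)
      = volt F.T s (-momL d) (k' - k) + constL ℝ (Disp d) (e' - e) := by
  rw [map_sub, map_sub]; abel

lemma norm_psi_sub_le (hs : s ∈ Icc 0 F.T) (μ : PM d) (U U' : Curve d) :
    ‖F.psi s μ U' - F.psi s μ U‖ ≤ 1 / 2 * ‖U' - U‖ := by
  have hT := F.T_nonneg
  have hG := F.GL_nonneg
  have h1 := F.norm_vel_sub_same_le μ U U'
  have h2 : ‖F.init s μ U' - F.init s μ U‖ ≤ F.T * ‖F.vel μ U' - F.vel μ U‖ := by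
    have := norm_initial_integral_sub_le (s := s) hs (F.vel μ U) (F.vel μ U')
    rwa [sub_self, abs_zero, zero_mul, add_zero] at this
  have h3 := F.G.norm_nem_sub_same_le μ (F.init s μ U) (F.init s μ U')
  rw [psi, psi, volt_add_constL_sub]
  refine (F.norm_volt_add_constL_le hs _ _).trans ?_
  have h4 := mul_le_mul_of_nonneg_left h1 hT
  have h5 := mul_le_mul_of_nonneg_left (h2.trans h4) hG
  have hn : 0 ≤ ‖U' - U‖ := norm_nonneg (U' - U)
  have h6 := mul_le_mul_of_nonneg_right F.KT_le hn
  have h7 := mul_le_mul_of_nonneg_right F.GKT_le hn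
  linarith

lemma existsUnique_fixed (hs : s ∈ Icc 0 F.T) (μ : PM d) : ∃! U, F.psi s μ U = U := by
  have hc : ContractingWith (1 / 2) (F.psi s μ) := by
    refine ⟨by norm_num, LipschitzWith.of_dist_le_mul fun U U' => ?_⟩
    refine (dist_eq_norm (F.psi s μ U) (F.psi s μ U')).trans_le
      ((F.norm_psi_sub_le hs μ U' U).trans (le_of_eq ?_))
    rw [← show dist U U' = ‖U - U'‖ from dist_eq_norm U U']
    simp
  exact ⟨hc.fixedPoint, hc.fixedPoint_isFixedPt, fun V hV => hc.fixedPoint_unique hV⟩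

/-- The displacement of the flow, meaningful for `s` in the time interval. -/
def sol (s : ℝ) (μ : PM d) : Curve d := Classical.epsilon fun U => F.psi s μ U = U

lemma psi_sol (hs : s ∈ Icc 0 F.T) (μ : PM d) : F.psi s μ (F.sol s μ) = F.sol s μ :=
  Classical.epsilon_spec (F.existsUnique_fixed hs μ).exists

lemma eq_sol (hs : s ∈ Icc 0 F.T) {μ : PM d} {U : Curve d} (h : F.psi s μ U = U) :
    U = F.sol s μ := (F.existsUnique_fixed hs μ).unique h (F.psi_sol hs μ)

/-- `init` along the solution. -/
def sol₀ (s : ℝ) (μ : PM d) : Disp d := F.init s μ (F.sol s μ)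

lemma sol₀_eq (s : ℝ) (μ : PM d) :
    F.sol₀ s μ = ∫ τ in s..(0 : ℝ), F.vel μ (F.sol s μ) τ := rfl

lemma sol_eq (hs : s ∈ Icc 0 F.T) (μ : PM d) :
    F.sol s μ = volt F.T s (-momL d) (F.vel μ (F.sol s μ))
      + constL ℝ (Disp d) (F.G.nem μ (F.sol₀ s μ)) := (F.psi_sol hs μ).symm

/-- `sol₀` describes the position of the flow at time zero; only its momentum is not the one of the
flow. -/
lemma sol_zero_fst (hs : s ∈ Icc 0 F.T) (μ : PM d) (q : E d) :
    (F.sol s μ 0 q).1 = (F.sol₀ s μ q).1 := by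
  have h := F.psi_sol hs μ
  rw [← h, psi_apply, clampT_of_mem (left_mem_Icc.2 F.T_nonneg)]
  change ((F.init s μ (F.sol s μ) - momL d (F.init s μ (F.sol s μ))
    + F.G.nem μ (F.init s μ (F.sol s μ))) q).1 = _
  simp [momL_apply, SmoothField.nem_apply, F.G_fst, sol₀]

lemma pos_sol_zero (hs : s ∈ Icc 0 F.T) (μ : PM d) : pos (F.sol s μ 0) = pos (F.sol₀ s μ) := by
  funext q; rw [pos, pos, F.sol_zero_fst hs]

lemma norm_sol_time_sub_le (hs : s ∈ Icc 0 F.T) (μ : PM d) (t t' : ℝ) :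
    ‖F.sol s μ t' - F.sol s μ t‖ ≤ F.K.L * |t' - t| := by
  have e : F.sol s μ t' - F.sol s μ t = volt F.T s (-momL d) (F.vel μ (F.sol s μ)) t'
      - volt F.T s (-momL d) (F.vel μ (F.sol s μ)) t := by
    conv_lhs => rw [F.sol_eq hs μ]
    simp only [BoundedContinuousFunction.coe_add, Pi.add_apply, constL_apply, add_sub_add_right_eq_sub]
  rw [e]
  refine (volt_time_lipschitz _ _ _ _ _ _).trans ?_
  gcongr
  exact F.norm_vel_le _ _

/-! ### Translations of the flow -/

/-- Translation of curves of displacements. -/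
abbrev transC (v : E d) : Curve d →L[ℝ] Curve d := (transL v).compLeftContinuousBounded ℝ

lemma transL_momL (v : E d) (U : Disp d) :
    transL v ((-momL d) U) = (-momL d) (transL v U) := by
  rw [neg_apply, neg_apply, map_neg]; rfl

/-- The Lipschitz constant of the flow in the position. -/
def ell : ℝ := 1 + 2 * F.G.L

lemma ell_nonneg : 0 ≤ F.ell := by have := F.GL_nonneg; unfold ell; positivity

/-- The equation for the difference of a solution and its translation. -/
lemma transC_sub_eq {k y : Curve d} {e : Disp d}
    (hy : y = volt F.T s (-momL d) k + constL ℝ (Disp d) e) (v : E d) :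
    transC v y - y = volt F.T s (-momL d) (transC v k - k)
      + constL ℝ (Disp d) (transL v e - e) := by
  have e1 : transC v y = volt F.T s (-momL d) (transC v k) + constL ℝ (Disp d) (transL v e) := by
    conv_lhs => rw [hy, map_add, compLeft_volt _ _ (transL_momL v)]
    rfl
  conv_lhs => rw [e1, hy]
  rw [map_sub, map_sub]; abel

lemma norm_transC_vel_sub_le (μ : PM d) (U : Curve d) (v : E d) :
    ‖transC v (F.vel μ U) - F.vel μ U‖ ≤ F.K.L * (torusDist v 0 + ‖transC v U - U‖) := by
  have hK := F.KL_nonneg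
  have ht := torusDist_nonneg v 0
  refine (BoundedContinuousFunction.norm_le (by positivity)).2 fun t => ?_
  refine (F.K.norm_transL_nem_sub_zero_le μ (U t) v).trans ?_
  gcongr
  exact (transC v U - U).norm_coe_le_norm t

lemma transL_integral (v : E d) (k : Curve d) (a b : ℝ) :
    transL v (∫ τ in a..b, k τ) = ∫ τ in a..b, transC v k τ :=
  ((transL v).intervalIntegral_comp_comm (intervalIntegrable_bcf k a b)).symm

lemma norm_transL_integral_sub_le (hs : s ∈ Icc 0 F.T) (v : E d) (k : Curve d) :
    ‖transL v (∫ τ in s..(0 : ℝ), k τ) - ∫ τ in s..(0 : ℝ), k τ‖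
      ≤ F.T * ‖transC v k - k‖ := by
  rw [transL_integral]
  simpa using norm_initial_integral_sub_le (s := s) hs k (transC v k)

/-- The flow is Lipschitz in the position: its translation by `v` solves the equation in which the
positions are shifted by `v`. -/
lemma norm_transC_sol_sub_le (hs : s ∈ Icc 0 F.T) (μ : PM d) (v : E d) :
    ‖transC v (F.sol s μ) - F.sol s μ‖ ≤ F.ell * torusDist v 0 := by
  have hK := F.KL_nonneg
  have hT := F.T_nonneg
  have hG := F.GL_nonneg
  have ht := torusDist_nonneg v 0
  set k := F.vel μ (F.sol s μ)
  have e := F.transC_sub_eq (F.sol_eq hs μ) v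
  have h1 := F.norm_transC_vel_sub_le μ (F.sol s μ) v
  have h2 := F.norm_transL_integral_sub_le hs v k
  have h3 := F.G.norm_transL_nem_sub_zero_le μ (F.sol₀ s μ) v
  have h4 : ‖transC v (F.sol s μ) - F.sol s μ‖ ≤ 2 * F.T * ‖transC v k - k‖
      + ‖transL v (F.G.nem μ (F.sol₀ s μ)) - F.G.nem μ (F.sol₀ s μ)‖ := by
    rw [e]
    exact F.norm_volt_add_constL_le hs _ _
  change ‖transL v (F.sol₀ s μ) - F.sol₀ s μ‖ ≤ _ at h2
  have hn : 0 ≤ ‖transC v (F.sol s μ) - F.sol s μ‖ := norm_nonneg (transC v (F.sol s μ) - F.sol s μ)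
  set n := ‖transC v (F.sol s μ) - F.sol s μ‖
  set θ := torusDist v 0
  have h5 := mul_le_mul_of_nonneg_left h1 hT
  have h6 := mul_le_mul_of_nonneg_left (h2.trans h5) hG
  have h7 := mul_le_mul_of_nonneg_right F.KT_le (add_nonneg ht hn)
  have h8 := mul_le_mul_of_nonneg_right F.GKT_le (add_nonneg ht hn)
  have h9 := mul_nonneg hG ht
  unfold ell
  linarith

lemma lipTorus_sol (hs : s ∈ Icc 0 F.T) (μ : PM d) (t : ℝ) : LipTorus F.ell (F.sol s μ t) :=
  lipTorus_of_transL fun v =>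
    ((transC v (F.sol s μ) - F.sol s μ).norm_coe_le_norm t).trans (F.norm_transC_sol_sub_le hs μ v)

lemma norm_transL_sol₀_sub_le (hs : s ∈ Icc 0 F.T) (μ : PM d) (v : E d) :
    ‖transL v (F.sol₀ s μ) - F.sol₀ s μ‖ ≤ F.ell * torusDist v 0 := by
  have hT := F.T_nonneg
  have hl := F.ell_nonneg
  have ht := torusDist_nonneg v 0
  refine (F.norm_transL_integral_sub_le hs v _).trans ?_
  have h1 := mul_le_mul_of_nonneg_left (F.norm_transC_vel_sub_le μ (F.sol s μ) v) hT
  have h2 := F.norm_transC_sol_sub_le hs μ v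
  have h3 := mul_le_mul_of_nonneg_left h2 F.KT_nonneg
  have h4 := mul_le_mul_of_nonneg_right F.KT_le (mul_nonneg hl ht)
  have h5 := mul_le_mul_of_nonneg_right F.KT_le ht
  have h6 : 1 * torusDist v 0 ≤ F.ell * torusDist v 0 := by
    gcongr
    have := F.GL_nonneg
    unfold ell; linarith
  have h7 := mul_nonneg hl ht
  linarith

lemma lipTorus_sol₀ (hs : s ∈ Icc 0 F.T) (μ : PM d) : LipTorus F.ell (F.sol₀ s μ) :=
  lipTorus_of_transL fun v => F.norm_transL_sol₀_sub_le hs μ v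

/-! ### Dependence of the flow on the initial time and on the measure -/

lemma norm_vel_sub_le (hs : s ∈ Icc 0 F.T) (μ ν : PM d) (U' : Curve d) :
    ‖F.vel ν U' - F.vel μ (F.sol s μ)‖ ≤
      F.K.L * (3 * ‖U' - F.sol s μ‖ + 2 * (1 + F.ell) * wass μ ν) := by
  have hK := F.KL_nonneg
  have hl := F.ell_nonneg
  have hW := wass_nonneg μ ν
  refine (BoundedContinuousFunction.norm_le (by positivity)).2 fun t => ?_
  refine (F.K.norm_nem_sub_le μ ν _ _).trans ?_
  have h1 := wass_law_le hl (F.lipTorus_sol hs μ t) (U' t) μ ν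
  have h2 : ‖U' t - F.sol s μ t‖ ≤ ‖U' - F.sol s μ‖ := (U' - F.sol s μ).norm_coe_le_norm t
  refine mul_le_mul_of_nonneg_left ?_ hK
  linarith

/-- Closes the estimates of `exists_norm_sol_sub_le`, where the difference `n` of the flows occurs
on both sides, by the smallness of the time interval. -/
lemma lipschitz_arith {K T G ℓ W σ n n₀ δ e : ℝ} (hK : 0 ≤ K) (hT : 0 ≤ T) (hG : 0 ≤ G)
    (hℓ : 0 ≤ ℓ) (hW : 0 ≤ W) (hσ : 0 ≤ σ) (hKT : K * T ≤ 1 / 100) (hGKT : G * (K * T) ≤ 1 / 100)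
    (hn : 0 ≤ n) (hδ : δ ≤ K * (3 * n + 2 * (1 + ℓ) * W))
    (hn₀ : n₀ ≤ T * δ + σ * K) (he : e ≤ G * (n₀ + 2 * (n₀ + (1 + ℓ) * W)))
    (hn' : n ≤ 2 * T * δ + 2 * σ * K + e) :
    n ≤ 20 * (1 + K + G * K + G + ℓ + G * ℓ) * (σ + W) ∧
      n₀ ≤ 20 * (1 + K + G * K + G + ℓ + G * ℓ) * (σ + W) := by
  have hX : 0 ≤ 3 * n + 2 * (1 + ℓ) * W := by positivity
  have h0 : T * δ ≤ (K * T) * (3 * n + 2 * (1 + ℓ) * W) := by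
    calc _ ≤ T * (K * (3 * n + 2 * (1 + ℓ) * W)) := by gcongr
      _ = _ := by ring
  have h1 : T * δ ≤ 1 / 100 * (3 * n + 2 * (1 + ℓ) * W) :=
    h0.trans (mul_le_mul_of_nonneg_right hKT hX)
  have h2 : G * (T * δ) ≤ 1 / 100 * (3 * n + 2 * (1 + ℓ) * W) :=
    (mul_le_mul_of_nonneg_left h0 hG).trans (by
      rw [← mul_assoc]; exact mul_le_mul_of_nonneg_right hGKT hX)
  have h3 : G * n₀ ≤ G * (T * δ + σ * K) := mul_le_mul_of_nonneg_left hn₀ hG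
  have p1 : 0 ≤ G * K * W := by positivity
  have p2 : 0 ≤ G * σ := by positivity
  have p3 : 0 ≤ G * ℓ * σ := by positivity
  have p4 : 0 ≤ ℓ * σ := by positivity
  have p5 : 0 ≤ K * W := by positivity
  have p6 : 0 ≤ K * σ := by positivity
  have p7 : 0 ≤ G * K * σ := by positivity
  have p8 : 0 ≤ G * W := by positivity
  have p9 : 0 ≤ G * ℓ * W := by positivity
  have p10 : 0 ≤ ℓ * W := by positivity
  constructor <;> linarith

/-- The flow is Lipschitz in the initial time and the measure. -/
lemma exists_norm_sol_sub_le : ∃ C, 0 ≤ C ∧ ∀ s ∈ Icc 0 F.T, ∀ s' ∈ Icc 0 F.T, ∀ μ ν,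
    ‖F.sol s' ν - F.sol s μ‖ ≤ C * (|s' - s| + wass μ ν) ∧
    ‖F.sol₀ s' ν - F.sol₀ s μ‖ ≤ C * (|s' - s| + wass μ ν) ∧
    (∀ t, wass (law μ (F.sol s μ t)) (law ν (F.sol s' ν t)) ≤ C * (|s' - s| + wass μ ν)) ∧
    wass (law μ (F.sol₀ s μ)) (law ν (F.sol₀ s' ν)) ≤ C * (|s' - s| + wass μ ν) := by
  have hK := F.KL_nonneg
  have hT := F.T_nonneg
  have hG := F.GL_nonneg
  have hl := F.ell_nonneg
  set c : ℝ := 20 * (1 + F.K.L + F.G.L * F.K.L + F.G.L + F.ell + F.G.L * F.ell) with hc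
  have hc0 : 0 ≤ c := by positivity
  refine ⟨4 * c + 4 * (1 + F.ell), by positivity, fun s hs s' hs' μ ν => ?_⟩
  have hW := wass_nonneg μ ν
  have hσ := abs_nonneg (s' - s)
  set U := F.sol s μ
  set U' := F.sol s' ν
  have h1 := F.norm_vel_sub_le hs μ ν U'
  have h2 := norm_initial_integral_sub_le (s := s) hs' (F.vel μ U) (F.vel ν U')
  change ‖F.sol₀ s' ν - F.sol₀ s μ‖ ≤ _ at h2
  have hw0 := wass_law_le hl (F.lipTorus_sol₀ hs μ) (F.sol₀ s' ν) μ ν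
  have h3 := F.G.norm_nem_sub_le μ ν (F.sol₀ s μ) (F.sol₀ s' ν)
  have h4 : ‖U' - U‖ ≤ _ := (congrArg norm (congrArg₂ (· - ·) (F.sol_eq hs' ν)
    (F.sol_eq hs μ))).trans_le (norm_volt_add_constL_sub_le hs' _ _ _ _ _)
  have hm := norm_neg_momL_le (d := d)
  have hv := F.norm_vel_le μ U
  have h4' : ‖U' - U‖ ≤ 2 * F.T * ‖F.vel ν U' - F.vel μ U‖ + 2 * |s' - s| * F.K.L
      + ‖F.G.nem ν (F.sol₀ s' ν) - F.G.nem μ (F.sol₀ s μ)‖ := by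
    refine h4.trans ?_
    gcongr <;> linarith
  have h2' : ‖F.sol₀ s' ν - F.sol₀ s μ‖ ≤ F.T * ‖F.vel ν U' - F.vel μ U‖ + |s' - s| * F.K.L := by
    refine h2.trans ?_
    gcongr
  have h3' := h3.trans (mul_le_mul_of_nonneg_left (add_le_add_right hw0 _) hG)
  obtain ⟨hn, hn₀⟩ := lipschitz_arith hK hT hG hl hW hσ F.KT_le F.GKT_le
    (norm_nonneg (U' - U)) h1 h2' h3' h4'
  have h5 : ∀ a, a ≤ c * (|s' - s| + wass μ ν) →
      2 * (a + (1 + F.ell) * wass μ ν) ≤ (4 * c + 4 * (1 + F.ell)) * (|s' - s| + wass μ ν) := by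
    intro a ha
    have p1 : 0 ≤ c * (|s' - s| + wass μ ν) := by positivity
    have p2 : 0 ≤ (1 + F.ell) * wass μ ν := by positivity
    have p3 : 0 ≤ (1 + F.ell) * |s' - s| := by positivity
    linarith
  have h6 : ∀ a, a ≤ c * (|s' - s| + wass μ ν) →
      a ≤ (4 * c + 4 * (1 + F.ell)) * (|s' - s| + wass μ ν) := by
    intro a ha
    have p1 : 0 ≤ c * (|s' - s| + wass μ ν) := by positivity
    have p2 : 0 ≤ (1 + F.ell) * (|s' - s| + wass μ ν) := by positivity
    linarith
  refine ⟨h6 _ hn, h6 _ hn₀, fun t => ?_, hw0.trans (h5 _ hn₀)⟩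
  exact (wass_law_le hl (F.lipTorus_sol hs μ t) (U' t) μ ν).trans
    (h5 _ (((U' - U).norm_coe_le_norm t).trans hn))

end FlowData

set_option maxSynthPendingDepth 3

/-! ### Linear operators of Volterra type -/

section VoltOp

variable {Y : Type} [NormedAddCommGroup Y] [NormedSpace ℝ Y]

/-- The operator `w ↦ ∫_s^t c w dτ + M ∫_s^0 c w dτ`. -/
def voltOp (T s : ℝ) (M : Y →L[ℝ] Y) (c : ℝ →ᵇ (Y →L[ℝ] Y)) : (ℝ →ᵇ Y) →L[ℝ] (ℝ →ᵇ Y) :=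
  (volt T s M).comp (mulOp c)

lemma voltOp_apply (T s : ℝ) (M : Y →L[ℝ] Y) (c : ℝ →ᵇ (Y →L[ℝ] Y)) (w : ℝ →ᵇ Y) :
    voltOp T s M c w = volt T s M (mulOp c w) := rfl

lemma norm_mulOp_apply_le (c : ℝ →ᵇ (Y →L[ℝ] Y)) (w : ℝ →ᵇ Y) : ‖mulOp c w‖ ≤ ‖c‖ * ‖w‖ :=
  (mulOp c).le_of_opNorm_le (norm_mulOp_le c) w

lemma norm_mulOp_sub_apply_le (c c' : ℝ →ᵇ (Y →L[ℝ] Y)) (w : ℝ →ᵇ Y) :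
    ‖mulOp c' w - mulOp c w‖ ≤ ‖c' - c‖ * ‖w‖ := norm_mulOp_apply_le (c' - c) w

lemma norm_voltOp_le {T s : ℝ} (hs : s ∈ Icc 0 T) (M : Y →L[ℝ] Y) (c : ℝ →ᵇ (Y →L[ℝ] Y)) :
    ‖voltOp T s M c‖ ≤ (1 + ‖M‖) * T * ‖c‖ :=
  (ContinuousLinearMap.opNorm_comp_le _ _).trans
    (mul_le_mul (norm_volt_le hs M) (norm_mulOp_le c) (norm_nonneg _)
      (mul_nonneg (by positivity) (hs.1.trans hs.2)))

lemma norm_voltOp_sub_apply_le {T s s' : ℝ} (hs' : s' ∈ Icc 0 T)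
    (M M' : Y →L[ℝ] Y) (c c' : ℝ →ᵇ (Y →L[ℝ] Y)) (w : ℝ →ᵇ Y) :
    ‖voltOp T s' M' c' w - voltOp T s M c w‖ ≤ (1 + ‖M'‖) * T * ‖mulOp c' w - mulOp c w‖
      + ((1 + ‖M'‖) * |s' - s| * (‖c‖ * ‖w‖)
        + ‖(M' - M) (∫ τ in s..(0 : ℝ), mulOp c w τ)‖) := by
  refine (norm_volt_sub_volt_le (s := s) hs' M M' (mulOp c w) (mulOp c' w)).trans ?_
  have := norm_mulOp_apply_le c w
  have hT : 0 ≤ T := hs'.1.trans hs'.2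
  gcongr

lemma norm_voltOp_sub_le {T s s' : ℝ} (hs : s ∈ Icc 0 T) (hs' : s' ∈ Icc 0 T)
    (M M' : Y →L[ℝ] Y) (c c' : ℝ →ᵇ (Y →L[ℝ] Y)) :
    ‖voltOp T s' M' c' - voltOp T s M c‖ ≤ (1 + ‖M'‖) * T * ‖c' - c‖
      + ((1 + ‖M'‖) * |s' - s| + ‖M' - M‖ * T) * ‖c‖ := by
  have hT : 0 ≤ T := hs.1.trans hs.2
  refine ContinuousLinearMap.opNorm_le_bound _ (by positivity) fun w => ?_
  refine (norm_voltOp_sub_apply_le hs' M M' c c' w).trans ?_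
  have h1 := norm_mulOp_sub_apply_le c c' w
  have h2 := (norm_initial_integral_le hs (mulOp c w)).trans
    (mul_le_mul_of_nonneg_left (norm_mulOp_apply_le c w) hT)
  have h3 := (M' - M).le_opNorm_of_le h2
  have h4 := mul_le_mul_of_nonneg_left h1 (show 0 ≤ (1 + ‖M'‖) * T by positivity)
  linarith

lemma norm_volt_add_const_time_le (T s : ℝ) (M : Y →L[ℝ] Y) (k : ℝ →ᵇ Y) (e : Y) (t t' : ℝ) :
    ‖(volt T s M k + constL ℝ Y e) t' - (volt T s M k + constL ℝ Y e) t‖ ≤ ‖k‖ * |t' - t| := by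
  have := volt_time_lipschitz T s M k t t'
  simpa only [BoundedContinuousFunction.coe_add, Pi.add_apply, constL_apply,
    add_sub_add_right_eq_sub] using this

end VoltOp

namespace FlowData

variable (F : FlowData d) {s s' : ℝ}

/-! ### The spatial derivative of the flow -/

/-- The local part of the linearized vector field along a curve. -/
def locC (μ : PM d) (U : Curve d) : ℝ →ᵇ (Disp d →L[ℝ] Disp d) :=
  BoundedContinuousFunction.ofNormedAddCommGroup (fun t => F.K.loc μ (U t))
    ((continuous_of_norm_sub_le (f := F.K.loc μ) (L := 2 * F.K.L)
      (mul_nonneg (by norm_num) F.KL_nonneg)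
      (F.K.norm_loc_sub_same_le μ)).comp U.continuous) F.K.L (fun _ => F.K.norm_loc_le μ _)

lemma norm_locC_le (μ : PM d) (U : Curve d) : ‖F.locC μ U‖ ≤ F.K.L :=
  (BoundedContinuousFunction.norm_le F.KL_nonneg).2 fun _ => F.K.norm_loc_le μ _

/-- The local part of the linearized initial condition. -/
def locM (s : ℝ) (μ : PM d) : Disp d →L[ℝ] Disp d := -momL d + F.G.loc μ (F.sol₀ s μ)

lemma norm_locM_le (s : ℝ) (μ : PM d) : ‖F.locM s μ‖ ≤ 1 + F.G.L :=
  (norm_add_momL_le _).trans (add_le_add le_rfl (F.G.norm_loc_le μ _))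

/-- The operator of the equation for the spatial derivative. -/
def locOp (s : ℝ) (μ : PM d) : Curve d →L[ℝ] Curve d :=
  voltOp F.T s (F.locM s μ) (F.locC μ (F.sol s μ))

lemma norm_locOp_le (hs : s ∈ Icc 0 F.T) (μ : PM d) : ‖F.locOp s μ‖ ≤ 1 / 2 := by
  refine (norm_voltOp_le hs _ _).trans ?_
  have h1 := F.norm_locM_le s μ
  have h2 := F.norm_locC_le μ (F.sol s μ)
  have hT := F.T_nonneg
  have hG := F.GL_nonneg
  calc _ ≤ (1 + (1 + F.G.L)) * F.T * F.K.L := by gcongr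
    _ = 2 * (F.K.L * F.T) + F.G.L * (F.K.L * F.T) := by ring
    _ ≤ _ := by linarith [F.KT_le, F.GKT_le]

/-- The displacements `(e, 0)`. -/
def shift (d : ℕ) : E d →L[ℝ] Disp d :=
  (constL (E d) (E d × E d)).comp (ContinuousLinearMap.inl ℝ (E d) (E d))

lemma shift_apply (e q : E d) : shift d e q = (e, 0) := rfl

lemma norm_shift_apply_le (e : E d) : ‖shift d e‖ ≤ ‖e‖ :=
  (BoundedContinuousFunction.norm_le (norm_nonneg _)).2 fun q => by
    rw [shift_apply]; simp [Prod.norm_def]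

lemma lipTorus_shift (e : E d) : LipTorus 0 (shift d e) := fun x y => by
  rw [shift_apply, shift_apply, sub_self, norm_zero, zero_mul]

/-- The right hand side of the equation for the spatial derivative. -/
def jacSrc (s : ℝ) (μ : PM d) : E d →L[ℝ] Curve d :=
  (F.locOp s μ).comp ((constL ℝ (Disp d)).comp (shift d))
    + (constL ℝ (Disp d)).comp ((F.G.loc μ (F.sol₀ s μ)).comp (shift d))

lemma jacSrc_apply (s : ℝ) (μ : PM d) (e : E d) :
    F.jacSrc s μ e = volt F.T s (F.locM s μ)
        (mulOp (F.locC μ (F.sol s μ)) (constL ℝ (Disp d) (shift d e)))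
      + constL ℝ (Disp d) (F.G.loc μ (F.sol₀ s μ) (shift d e)) := rfl

lemma norm_constL_shift_le (e : E d) : ‖constL ℝ (Disp d) (shift d e)‖ ≤ ‖e‖ :=
  (norm_constL_apply_le _).trans (norm_shift_apply_le e)

lemma norm_jacSrc_apply_le (hs : s ∈ Icc 0 F.T) (μ : PM d) (e : E d) :
    ‖F.jacSrc s μ e‖ ≤ (1 + F.G.L) * ‖e‖ := by
  have h1 := (F.locOp s μ).le_of_opNorm_le (F.norm_locOp_le hs μ) (constL ℝ (Disp d) (shift d e))
  have h2 := (F.G.loc μ (F.sol₀ s μ)).le_of_opNorm_le (F.G.norm_loc_le μ _) (shift d e)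
  have h3 := norm_constL_apply_le (α := ℝ) (F.G.loc μ (F.sol₀ s μ) (shift d e))
  have h4 := norm_constL_shift_le e
  have h5 := mul_le_mul_of_nonneg_left (norm_shift_apply_le e) F.GL_nonneg
  have h6 := norm_nonneg e
  refine (norm_add_le (F.locOp s μ (constL ℝ (Disp d) (shift d e)))
    (constL ℝ (Disp d) (F.G.loc μ (F.sol₀ s μ) (shift d e)))).trans ?_
  linarith

/-- The spatial derivative of the displacement of the flow. -/
def jacX (s : ℝ) (μ : PM d) : E d →L[ℝ] Curve d := (resolv (F.locOp s μ)).comp (F.jacSrc s μ)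

lemma jacX_eq (hs : s ∈ Icc 0 F.T) (μ : PM d) (e : E d) :
    F.jacX s μ e = F.locOp s μ (F.jacX s μ e) + F.jacSrc s μ e :=
  resolv_eq (F.norm_locOp_le hs μ) _

lemma norm_jacX_apply_le (hs : s ∈ Icc 0 F.T) (μ : PM d) (e : E d) :
    ‖F.jacX s μ e‖ ≤ 2 * (1 + F.G.L) * ‖e‖ := by
  have h := norm_le_of_eq_add (F.norm_locOp_le hs μ) (F.jacX_eq hs μ e)
  have h1 := F.norm_jacSrc_apply_le hs μ e
  linarith

lemma transC_integral_eq (v : E d) (μ : PM d) :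
    ∫ τ in s..(0 : ℝ), (transC v (F.vel μ (F.sol s μ)) - F.vel μ (F.sol s μ)) τ
      = transL v (F.sol₀ s μ) - F.sol₀ s μ := by
  rw [sol₀_eq, transL_integral, ← intervalIntegral.integral_sub (intervalIntegrable_bcf _ _ _)
      (intervalIntegrable_bcf _ _ _)]
  rfl

/-- The flow is differentiable in the position, uniformly. -/
lemma exists_norm_transC_sol_sub_jacX_le : ∃ C, 0 ≤ C ∧ ∀ s ∈ Icc 0 F.T, ∀ μ v,
    ‖transC v (F.sol s μ) - F.sol s μ - F.jacX s μ v‖ ≤ C * ‖v‖ ^ 2 := by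
  have hK := F.KL_nonneg
  have hT := F.T_nonneg
  have hG := F.GL_nonneg
  have hl := F.ell_nonneg
  refine ⟨2 * ((1 + (1 + F.G.L)) * F.T * (F.K.L * (1 + F.ell) ^ 2) + F.G.L * (1 + F.ell) ^ 2),
    by positivity, fun s hs μ v => ?_⟩
  have hθ := torusDist_le_norm v 0
  rw [sub_zero] at hθ
  have hv := norm_nonneg v
  set U := F.sol s μ with hU
  set w := transC v U - U with hw
  have h1 : ‖w‖ ≤ F.ell * ‖v‖ :=
    (F.norm_transC_sol_sub_le hs μ v).trans (mul_le_mul_of_nonneg_left hθ hl)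
  have h2 : ‖transL v (F.sol₀ s μ) - F.sol₀ s μ‖ ≤ F.ell * ‖v‖ :=
    (F.norm_transL_sol₀_sub_le hs μ v).trans (mul_le_mul_of_nonneg_left hθ hl)
  have e : w = _ := F.transC_sub_eq (F.sol_eq hs μ) v
  have hb : ∀ n, 0 ≤ n → n ≤ F.ell * ‖v‖ → (‖v‖ + n) ^ 2 ≤ (1 + F.ell) ^ 2 * ‖v‖ ^ 2 := by
    intro n hn0 hn
    rw [← mul_pow]
    gcongr
    linarith
  -- both nonlinearities are linearized, with errors quadratic in `v`
  have h3 : ‖transC v (F.vel μ U) - F.vel μ U - mulOp (F.locC μ U) w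
      - mulOp (F.locC μ U) (constL ℝ (Disp d) (shift d v))‖
      ≤ F.K.L * ((1 + F.ell) ^ 2 * ‖v‖ ^ 2) := by
    refine (BoundedContinuousFunction.norm_le (by positivity)).2 fun t => ?_
    have h := F.K.norm_transL_nem_sub_le μ (U t) v
    have ht : ‖transL v (U t) - U t‖ ≤ F.ell * ‖v‖ := (w.norm_coe_le_norm t).trans h1
    have h' := h.trans (mul_le_mul_of_nonneg_left (hb _ (norm_nonneg _) ht) hK)
    rw [map_add, ← sub_sub, sub_right_comm] at h'
    exact h'
  have h4 : ‖transL v (F.G.nem μ (F.sol₀ s μ)) - F.G.nem μ (F.sol₀ s μ)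
      - F.G.loc μ (F.sol₀ s μ) (∫ τ in s..(0 : ℝ), (transC v (F.vel μ U) - F.vel μ U) τ)
      - F.G.loc μ (F.sol₀ s μ) (shift d v)‖ ≤ F.G.L * ((1 + F.ell) ^ 2 * ‖v‖ ^ 2) := by
    rw [hU, F.transC_integral_eq v μ]
    have h := F.G.norm_transL_nem_sub_le μ (F.sol₀ s μ) v
    have h' := h.trans (mul_le_mul_of_nonneg_left (hb _ (norm_nonneg _) h2) hG)
    rw [map_add, ← sub_sub, sub_right_comm] at h'
    exact h'
  -- `w` solves the equation of `jacX` up to these errors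
  have h5 := norm_sub_linearization_le hs (M := F.G.loc μ (F.sol₀ s μ))
    (l := mulOp (F.locC μ U) w) (h := mulOp (F.locC μ U) (constL ℝ (Disp d) (shift d v)))
    (g := F.G.loc μ (F.sol₀ s μ) (shift d v)) e
  have h6 := norm_sub_resolv_le (F.norm_locOp_le hs μ) w (F.jacSrc s μ v)
  have h7 : ‖w - F.locOp s μ w - F.jacSrc s μ v‖ ≤ _ := h5
  refine h6.trans ((mul_le_mul_of_nonneg_left h7 (by norm_num)).trans ?_)
  have hM : ‖-momL d + F.G.loc μ (F.sol₀ s μ)‖ ≤ 1 + F.G.L := F.norm_locM_le s μ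
  calc _ ≤ 2 * ((1 + (1 + F.G.L)) * F.T * (F.K.L * ((1 + F.ell) ^ 2 * ‖v‖ ^ 2))
        + F.G.L * ((1 + F.ell) ^ 2 * ‖v‖ ^ 2)) := by gcongr
    _ = _ := by ring

/-- Computes the constant of `exists_lipTorus_of_eq`. -/
lemma lipTorus_arith {K T G ℓ θ y b β i : ℝ} (hK : 0 ≤ K) (hT : 0 ≤ T) (hG : 0 ≤ G) (hℓ : 0 ≤ ℓ)
    (hθ : 0 ≤ θ) (hβ : 0 ≤ β) (hy : 0 ≤ y) (hb : 0 ≤ b) (hi : i ≤ T * (K * y + b)) :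
    2 * ((2 + G) * T * (K * (1 + ℓ) * θ * y + β * θ) + (G * (1 + ℓ) * θ * i + β * θ))
      ≤ 2 * ((2 + G) * T * (K * (1 + ℓ) + 1) + G * (1 + ℓ) * (T * (K + 1)) + 1)
        * (y + b + β) * θ := by
  have p1 : K * (1 + ℓ) * θ * y + β * θ ≤ (K * (1 + ℓ) + 1) * (y + b + β) * θ := by
    have : 0 ≤ K * (1 + ℓ) * θ * (b + β) + (y + b) * θ := by positivity
    linarith
  have p2 : T * (K * y + b) ≤ T * ((K + 1) * (y + b + β)) := by
    refine mul_le_mul_of_nonneg_left ?_ hT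
    have : 0 ≤ K * (b + β) + y + β := by positivity
    linarith
  have p3 : β * θ ≤ (y + b + β) * θ := by gcongr; linarith
  have p4 := mul_le_mul_of_nonneg_left p1 (show 0 ≤ (2 + G) * T by positivity)
  have p5 := mul_le_mul_of_nonneg_left (hi.trans p2) (show 0 ≤ G * (1 + ℓ) * θ by positivity)
  linarith

/-- Regularity in the position of the solutions of linear equations with the local operator: a
translation of `y` solves the same equation up to the variation of the coefficients, which are
Lipschitz. -/
lemma exists_lipTorus_of_eq : ∃ C, 0 ≤ C ∧ ∀ s ∈ Icc 0 F.T, ∀ (μ : PM d) (y b : Curve d)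
    (g : Disp d) (β : ℝ), 0 ≤ β → (∀ t, LipTorus β (b t)) → LipTorus β g →
    y = F.locOp s μ y + (volt F.T s (F.locM s μ) b + constL ℝ (Disp d) g) →
    ∀ t, LipTorus (C * (‖y‖ + ‖b‖ + β)) (y t) := by
  have hK := F.KL_nonneg
  have hT := F.T_nonneg
  have hG := F.GL_nonneg
  have hl := F.ell_nonneg
  refine ⟨2 * ((2 + F.G.L) * F.T * (F.K.L * (1 + F.ell) + 1)
    + F.G.L * (1 + F.ell) * (F.T * (F.K.L + 1)) + 1), by positivity,
    fun s hs μ y b g β hβ hb hg hy t => lipTorus_of_transL fun v => ?_⟩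
  refine ((transC v y - y).norm_coe_le_norm t).trans ?_
  have ht := torusDist_nonneg v 0
  set θ := torusDist v 0
  set c := F.locC μ (F.sol s μ)
  set N := F.G.loc μ (F.sol₀ s μ)
  set m := mulOp c y + b with hm
  set I := ∫ τ in s..(0 : ℝ), m τ with hI
  -- the equation in the form to which `transC_sub_eq` applies
  have hy' : y = volt F.T s (-momL d) m + constL ℝ (Disp d) (N I + g) := by
    have h := volt_add_apply F.T s (-momL d) N m
    have h' : volt F.T s (-momL d + N) m
        = volt F.T s (-momL d + N) (mulOp c y) + volt F.T s (-momL d + N) b := by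
      rw [hm, map_add]
    rw [map_add (constL ℝ (Disp d)), ← add_assoc, ← h, h', add_assoc]
    exact hy
  have e := F.transC_sub_eq hy' v
  have hm_n : ‖m‖ ≤ F.K.L * ‖y‖ + ‖b‖ := by
    refine (norm_add_le (mulOp c y) b).trans (add_le_add ?_ le_rfl)
    refine (norm_mulOp_apply_le c y).trans ?_
    gcongr
    exact F.norm_locC_le _ _
  have hI_n : ‖I‖ ≤ F.T * (F.K.L * ‖y‖ + ‖b‖) :=
    (norm_initial_integral_le hs m).trans (mul_le_mul_of_nonneg_left hm_n hT)
  have h1 : ‖transC v m - m - mulOp c (transC v y - y) - 0‖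
      ≤ F.K.L * (1 + F.ell) * θ * ‖y‖ + β * θ := by
    refine (BoundedContinuousFunction.norm_le (by positivity)).2 fun τ => ?_
    have h := F.K.norm_transL_loc_sub_le hl (F.lipTorus_sol hs μ τ) μ (y τ) v
    have h' := (hb τ).norm_transL_sub_le hβ v
    have e1 : (transC v m - m - mulOp c (transC v y - y) - 0) τ
        = (transL v (F.K.loc μ (F.sol s μ τ) (y τ)) - F.K.loc μ (F.sol s μ τ) (y τ)
          - F.K.loc μ (F.sol s μ τ) (transL v (y τ) - y τ)) + (transL v (b τ) - b τ) := by
      change transL v (F.K.loc μ (F.sol s μ τ) (y τ) + b τ)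
        - (F.K.loc μ (F.sol s μ τ) (y τ) + b τ)
        - F.K.loc μ (F.sol s μ τ) (transL v (y τ) - y τ) - 0 = _
      rw [map_add, sub_zero]; abel
    rw [e1]
    refine (norm_add_le _ _).trans (add_le_add (h.trans ?_) h')
    gcongr
    exact y.norm_coe_le_norm τ
  have h2 : ‖transL v (N I + g) - (N I + g) - N (∫ τ in s..(0 : ℝ), (transC v m - m) τ) - 0‖
      ≤ F.G.L * (1 + F.ell) * θ * ‖I‖ + β * θ := by
    have e2 : ∫ τ in s..(0 : ℝ), (transC v m - m) τ = transL v I - I := by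
      rw [hI, transL_integral, ← intervalIntegral.integral_sub (intervalIntegrable_bcf _ _ _)
        (intervalIntegrable_bcf _ _ _)]
      rfl
    have e1 : transL v (N I + g) - (N I + g) - N (transL v I - I) - 0
        = (transL v (N I) - N I - N (transL v I - I)) + (transL v g - g) := by
      rw [map_add, sub_zero]; abel
    rw [e2, e1]
    exact (norm_add_le _ _).trans (add_le_add
      (F.G.norm_transL_loc_sub_le hl (F.lipTorus_sol₀ hs μ) μ I v) (hg.norm_transL_sub_le hβ v))
  have h3 := norm_sub_linearization_le hs (M := N) (l := mulOp c (transC v y - y)) (h := 0)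
    (g := 0) e
  -- the translation differs from `y` by a solution of the equation with a source of order `θ`
  have e3 : transC v y - y = F.locOp s μ (transC v y - y)
      + (transC v y - y - F.locOp s μ (transC v y - y)) := by abel
  have h4 := norm_le_of_eq_add (F.norm_locOp_le hs μ) e3
  rw [map_zero, map_zero, add_zero, sub_zero] at h3
  have h5 : ‖transC v y - y - F.locOp s μ (transC v y - y)‖ ≤ _ := h3
  refine h4.trans ((mul_le_mul_of_nonneg_left h5 (by norm_num)).trans ?_)
  have hM : ‖-momL d + N‖ ≤ 1 + F.G.L := F.norm_locM_le s μ
  refine le_trans ?_ (lipTorus_arith hK hT hG hl ht hβ (norm_nonneg y) (norm_nonneg b) hI_n)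
  have hM' : 1 + ‖-momL d + N‖ ≤ 2 + F.G.L := by linarith only [hM]
  exact mul_le_mul_of_nonneg_left (add_le_add (mul_le_mul (mul_le_mul_of_nonneg_right hM' hT) h1
    (norm_nonneg _) (by positivity)) h2) (by norm_num)

end FlowData

lemma LipTorus.mono {W : Type} [NormedAddCommGroup W] {ℓ ℓ' : ℝ} {w : E d → W} (h : LipTorus ℓ w)
    (hℓ : ℓ ≤ ℓ') : LipTorus ℓ' w := fun x y =>
  (h x y).trans (mul_le_mul_of_nonneg_right hℓ (torusDist_nonneg _ _))

namespace FlowData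

variable (F : FlowData d) {s s' : ℝ}

/-! ### Regularity of the spatial derivative -/

lemma jacX_eq_volt (hs : s ∈ Icc 0 F.T) (μ : PM d) (e : E d) :
    F.jacX s μ e = volt F.T s (F.locM s μ) (mulOp (F.locC μ (F.sol s μ))
        (F.jacX s μ e + constL ℝ (Disp d) (shift d e)))
      + constL ℝ (Disp d) (F.G.loc μ (F.sol₀ s μ) (shift d e)) := by
  have h := F.jacX_eq hs μ e
  rw [jacSrc_apply] at h
  rw [map_add, map_add, add_assoc]
  exact h

lemma norm_mulOp_locC_le (μ : PM d) (U w : Curve d) :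
    ‖mulOp (F.locC μ U) w‖ ≤ F.K.L * ‖w‖ :=
  (norm_mulOp_apply_le _ w).trans
    (mul_le_mul_of_nonneg_right (F.norm_locC_le μ U) (norm_nonneg w))

lemma exists_jacX_time_lipschitz : ∃ C, 0 ≤ C ∧ ∀ s ∈ Icc 0 F.T, ∀ μ e t t',
    ‖F.jacX s μ e t' - F.jacX s μ e t‖ ≤ C * ‖e‖ * |t' - t| := by
  have hK := F.KL_nonneg
  have hG := F.GL_nonneg
  refine ⟨F.K.L * (2 * (1 + F.G.L) + 1), by positivity, fun s hs μ e t t' => ?_⟩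
  rw [F.jacX_eq_volt hs μ e]
  refine (norm_volt_add_const_time_le _ _ _ _ _ _ _).trans ?_
  refine mul_le_mul_of_nonneg_right ?_ (abs_nonneg _)
  refine (F.norm_mulOp_locC_le _ _ _).trans ?_
  rw [mul_assoc]
  refine mul_le_mul_of_nonneg_left ((norm_add_le _ _).trans ?_) hK
  have h1 := F.norm_jacX_apply_le hs μ e
  have h2 := norm_constL_shift_le e
  linarith

lemma exists_jacX_lipTorus : ∃ C, 0 ≤ C ∧ ∀ s ∈ Icc 0 F.T, ∀ μ e t,
    LipTorus (C * ‖e‖) (F.jacX s μ e t) := by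
  have hK := F.KL_nonneg
  have hG := F.GL_nonneg
  have hl := F.ell_nonneg
  obtain ⟨C, hC, h⟩ := F.exists_lipTorus_of_eq
  refine ⟨C * (2 * (1 + F.G.L) + F.K.L + (F.K.L + F.G.L) * (1 + F.ell)), by positivity,
    fun s hs μ e t => ?_⟩
  have hn := norm_nonneg e
  have hsh := norm_shift_apply_le e
  have h1 := h s hs μ (F.jacX s μ e) (mulOp (F.locC μ (F.sol s μ)) (constL ℝ (Disp d) (shift d e)))
    (F.G.loc μ (F.sol₀ s μ) (shift d e)) ((F.K.L + F.G.L) * (1 + F.ell) * ‖e‖) (by positivity)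
    (fun τ => (F.K.lipTorus_loc (F.lipTorus_sol hs μ τ) μ (lipTorus_shift e)).mono ?_)
    ((F.G.lipTorus_loc (F.lipTorus_sol₀ hs μ) μ (lipTorus_shift e)).mono ?_)
    (F.jacX_eq hs μ e) t
  · refine h1.mono ?_
    rw [mul_assoc C]
    refine mul_le_mul_of_nonneg_left ?_ hC
    have h2 := F.norm_jacX_apply_le hs μ e
    have h3 := (F.norm_mulOp_locC_le μ (F.sol s μ) (constL ℝ (Disp d) (shift d e))).trans
      (mul_le_mul_of_nonneg_left (norm_constL_shift_le e) hK)
    linarith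
  · have : 0 ≤ F.G.L * (1 + F.ell) * ‖e‖ := by positivity
    have : F.K.L * (1 + F.ell) * ‖shift d e‖ ≤ F.K.L * (1 + F.ell) * ‖e‖ := by gcongr
    linarith
  · have : 0 ≤ F.K.L * (1 + F.ell) * ‖e‖ := by positivity
    have : F.G.L * (1 + F.ell) * ‖shift d e‖ ≤ F.G.L * (1 + F.ell) * ‖e‖ := by gcongr
    linarith

lemma exists_norm_locOp_sub_le : ∃ C, 0 ≤ C ∧ ∀ s ∈ Icc 0 F.T, ∀ s' ∈ Icc 0 F.T, ∀ μ ν,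
    ‖F.locOp s' ν - F.locOp s μ‖ ≤ C * (|s' - s| + wass μ ν) ∧
    ‖F.locC ν (F.sol s' ν) - F.locC μ (F.sol s μ)‖ ≤ C * (|s' - s| + wass μ ν) ∧
    ‖F.G.loc ν (F.sol₀ s' ν) - F.G.loc μ (F.sol₀ s μ)‖ ≤ C * (|s' - s| + wass μ ν) := by
  have hK := F.KL_nonneg
  have hG := F.GL_nonneg
  have hT := F.T_nonneg
  obtain ⟨C, hC, h⟩ := F.exists_norm_sol_sub_le
  set a : ℝ := 2 * (F.K.L + F.G.L) * C with ha
  have ha0 : 0 ≤ a := by positivity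
  refine ⟨a + (2 + F.G.L) * F.T * a + ((2 + F.G.L) + a * F.T) * F.K.L, by positivity,
    fun s hs s' hs' μ ν => ?_⟩
  obtain ⟨h1, h2, h3, h4⟩ := h s hs s' hs' μ ν
  have hW := wass_nonneg μ ν
  have hρ : 0 ≤ |s' - s| + wass μ ν := by positivity
  set ρ := |s' - s| + wass μ ν with hρd
  have hc : ‖F.locC ν (F.sol s' ν) - F.locC μ (F.sol s μ)‖ ≤ a * ρ := by
    refine (BoundedContinuousFunction.norm_le (by positivity)).2 fun t => ?_
    refine (F.K.norm_loc_sub_le μ ν _ _).trans ?_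
    have h5 : ‖F.sol s' ν t - F.sol s μ t‖ ≤ C * ρ :=
      ((F.sol s' ν - F.sol s μ).norm_coe_le_norm t).trans h1
    have h6 : 0 ≤ F.G.L * C * ρ := by positivity
    have h7 := mul_le_mul_of_nonneg_left (add_le_add h5 (h3 t)) hK
    rw [ha]
    linarith
  have hg : ‖F.G.loc ν (F.sol₀ s' ν) - F.G.loc μ (F.sol₀ s μ)‖ ≤ a * ρ := by
    refine (F.G.norm_loc_sub_le μ ν _ _).trans ?_
    have h6 : 0 ≤ F.K.L * C * ρ := by positivity
    have h7 := mul_le_mul_of_nonneg_left (add_le_add h2 h4) hG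
    rw [ha]
    linarith
  have p1 : 0 ≤ (2 + F.G.L) * F.T * a := by positivity
  have p2 : 0 ≤ ((2 + F.G.L) + a * F.T) * F.K.L := by positivity
  refine ⟨?_, hc.trans ?_, hg.trans ?_⟩
  · refine (norm_voltOp_sub_le hs hs' (F.locM s μ) (F.locM s' ν) _ _).trans ?_
    have hM : 1 + ‖F.locM s' ν‖ ≤ 2 + F.G.L := by linarith only [F.norm_locM_le s' ν]
    have hMM : ‖F.locM s' ν - F.locM s μ‖ ≤ a * ρ := by
      rw [locM, locM, add_sub_add_left_eq_sub]; exact hg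
    have hcc := F.norm_locC_le μ (F.sol s μ)
    have hsρ : |s' - s| ≤ ρ := by rw [hρd]; linarith only [hW]
    have q1 : (1 + ‖F.locM s' ν‖) * F.T * ‖F.locC ν (F.sol s' ν) - F.locC μ (F.sol s μ)‖
        ≤ (2 + F.G.L) * F.T * (a * ρ) :=
      mul_le_mul (mul_le_mul_of_nonneg_right hM hT) hc (norm_nonneg _) (by positivity)
    have q2 : ((1 + ‖F.locM s' ν‖) * |s' - s| + ‖F.locM s' ν - F.locM s μ‖ * F.T)
        * ‖F.locC μ (F.sol s μ)‖ ≤ ((2 + F.G.L) * ρ + a * ρ * F.T) * F.K.L :=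
      mul_le_mul (add_le_add (mul_le_mul hM hsρ (abs_nonneg _) (by positivity))
        (mul_le_mul_of_nonneg_right hMM hT)) hcc (norm_nonneg _) (by positivity)
    refine (add_le_add q1 q2).trans ?_
    have : 0 ≤ a * ρ := by positivity
    linarith only [this]
  · exact mul_le_mul_of_nonneg_right (by linarith only [p1, p2]) hρ
  · exact mul_le_mul_of_nonneg_right (by linarith only [p1, p2]) hρ

lemma exists_norm_jacX_sub_le : ∃ C, 0 ≤ C ∧ ∀ s ∈ Icc 0 F.T, ∀ s' ∈ Icc 0 F.T, ∀ μ ν e,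
    ‖F.jacX s' ν e - F.jacX s μ e‖ ≤ C * ‖e‖ * (|s' - s| + wass μ ν) := by
  have hG := F.GL_nonneg
  obtain ⟨C, hC, h⟩ := F.exists_norm_locOp_sub_le
  refine ⟨2 * (2 * (1 + F.G.L) + 2) * C, by positivity, fun s hs s' hs' μ ν e => ?_⟩
  obtain ⟨h1, -, h3⟩ := h s hs s' hs' μ ν
  have hW := wass_nonneg μ ν
  have hρ : 0 ≤ |s' - s| + wass μ ν := by positivity
  set ρ := |s' - s| + wass μ ν
  have h4 := norm_sub_le_of_eq_add (F.norm_locOp_le hs' ν) (F.jacX_eq hs μ e) (F.jacX_eq hs' ν e)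
  have h5 : ‖F.locOp s' ν (F.jacX s μ e) - F.locOp s μ (F.jacX s μ e)‖
      ≤ C * ρ * (2 * (1 + F.G.L) * ‖e‖) := by
    refine ((F.locOp s' ν - F.locOp s μ).le_of_opNorm_le h1 _).trans ?_
    exact mul_le_mul_of_nonneg_left (F.norm_jacX_apply_le hs μ e) (by positivity)
  have h6 : ‖F.jacSrc s' ν e - F.jacSrc s μ e‖ ≤ C * ρ * ‖e‖ + C * ρ * ‖e‖ := by
    have e1 : F.jacSrc s' ν e - F.jacSrc s μ e
        = (F.locOp s' ν - F.locOp s μ) (constL ℝ (Disp d) (shift d e))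
          + constL ℝ (Disp d)
            ((F.G.loc ν (F.sol₀ s' ν) - F.G.loc μ (F.sol₀ s μ)) (shift d e)) := by
      rw [sub_apply, sub_apply, map_sub]
      exact add_sub_add_comm (α := Curve d) _ _ _ _
    rw [e1]
    refine (norm_add_le _ _).trans (add_le_add ?_ ((norm_constL_apply_le _).trans ?_))
    · refine ((F.locOp s' ν - F.locOp s μ).le_of_opNorm_le h1 _).trans ?_
      exact mul_le_mul_of_nonneg_left (norm_constL_shift_le e) (by positivity)
    · refine ((F.G.loc ν (F.sol₀ s' ν) - F.G.loc μ (F.sol₀ s μ)).le_of_opNorm_le h3 _).trans ?_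
      exact mul_le_mul_of_nonneg_left (norm_shift_apply_le e) (by positivity)
  refine h4.trans ((mul_le_mul_of_nonneg_left (add_le_add h5 h6) (by norm_num)).trans
    (le_of_eq (by ring)))

/-- The spatial derivative of the displacement at time `t` and position `q`. -/
def jacF (s : ℝ) (μ : PM d) (t : ℝ) (q : E d) : E d →L[ℝ] E d × E d :=
  (BoundedContinuousFunction.evalCLM ℝ q).comp
    ((BoundedContinuousFunction.evalCLM ℝ t).comp (F.jacX s μ))

lemma jacF_apply (s : ℝ) (μ : PM d) (t : ℝ) (q e : E d) :
    F.jacF s μ t q e = F.jacX s μ e t q := rfl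

lemma exists_norm_sol_sub_sub_jacF_le : ∃ C, 0 ≤ C ∧ ∀ s ∈ Icc 0 F.T, ∀ μ t q q',
    ‖F.sol s μ t q' - F.sol s μ t q - F.jacF s μ t q (q' - q)‖ ≤ C * ‖q' - q‖ ^ 2 := by
  obtain ⟨C, hC, h⟩ := F.exists_norm_transC_sol_sub_jacX_le
  refine ⟨C, hC, fun s hs μ t q q' => ?_⟩
  set y : Curve d := transC (q' - q) (F.sol s μ) - F.sol s μ - F.jacX s μ (q' - q) with hy
  have h1 := ((y t).norm_coe_le_norm q).trans ((y.norm_coe_le_norm t).trans (h s hs μ (q' - q)))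
  have e : y t q = F.sol s μ t (q + (q' - q)) - F.sol s μ t q - F.jacF s μ t q (q' - q) := rfl
  rw [e, add_sub_cancel] at h1
  exact h1

lemma hasFDerivAt_sol (hs : s ∈ Icc 0 F.T) (μ : PM d) (t : ℝ) (q : E d) :
    HasFDerivAt (F.sol s μ t) (F.jacF s μ t q) q := by
  obtain ⟨C, hC, h⟩ := F.exists_norm_sol_sub_sub_jacF_le
  have h1 : (fun q' => F.sol s μ t q' - F.sol s μ t q - F.jacF s μ t q (q' - q))
      =O[𝓝 q] fun q' => ‖q' - q‖ ^ 2 :=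
    Asymptotics.IsBigO.of_bound C (Eventually.of_forall fun q' => by
      rw [Real.norm_of_nonneg (by positivity)]; exact h s hs μ t q q')
  exact .of_isLittleO (h1.trans_isLittleO (Asymptotics.isLittleO_pow_sub_sub q one_lt_two))

/-- The spatial derivative is bounded and Lipschitz in all its variables. -/
lemma exists_jacF_bounds : ∃ C, 0 ≤ C ∧ ∀ s ∈ Icc 0 F.T, ∀ μ t q,
    ‖F.jacF s μ t q‖ ≤ C ∧
    ∀ s' ∈ Icc 0 F.T, ∀ ν t' q', ‖F.jacF s' ν t' q' - F.jacF s μ t q‖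
      ≤ C * (|t' - t| + |s' - s| + torusDist q' q + wass μ ν) := by
  have hG := F.GL_nonneg
  obtain ⟨C₁, hC₁, h₁⟩ := F.exists_jacX_time_lipschitz
  obtain ⟨C₂, hC₂, h₂⟩ := F.exists_jacX_lipTorus
  obtain ⟨C₃, hC₃, h₃⟩ := F.exists_norm_jacX_sub_le
  refine ⟨2 * (1 + F.G.L) + C₁ + C₂ + C₃, by positivity, fun s hs μ t q => ⟨?_, ?_⟩⟩
  · refine ContinuousLinearMap.opNorm_le_bound _ (by positivity) fun e => ?_
    rw [jacF_apply]
    refine ((F.jacX s μ e t).norm_coe_le_norm q).trans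
      (((F.jacX s μ e).norm_coe_le_norm t).trans ((F.norm_jacX_apply_le hs μ e).trans ?_))
    gcongr
    linarith
  · intro s' hs' ν t' q'
    have hW := wass_nonneg μ ν
    have ht := torusDist_nonneg q' q
    refine ContinuousLinearMap.opNorm_le_bound _ (by positivity) fun e => ?_
    have e1 : (F.jacF s' ν t' q' - F.jacF s μ t q) e
        = ((F.jacX s' ν e - F.jacX s μ e) t' q' + (F.jacX s μ e t' - F.jacX s μ e t) q')
          + (F.jacX s μ e t q' - F.jacX s μ e t q) := by
      rw [sub_apply, jacF_apply, jacF_apply]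
      simp only [BoundedContinuousFunction.coe_sub, Pi.sub_apply]
      abel
    have a1 : ‖(F.jacX s' ν e - F.jacX s μ e) t' q'‖ ≤ C₃ * ‖e‖ * (|s' - s| + wass μ ν) :=
      (((F.jacX s' ν e - F.jacX s μ e) t').norm_coe_le_norm q').trans
        (((F.jacX s' ν e - F.jacX s μ e).norm_coe_le_norm t').trans (h₃ s hs s' hs' μ ν e))
    have a2 : ‖(F.jacX s μ e t' - F.jacX s μ e t) q'‖ ≤ C₁ * ‖e‖ * |t' - t| :=
      ((F.jacX s μ e t' - F.jacX s μ e t).norm_coe_le_norm q').trans (h₁ s hs μ e t t')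
    have a3 := h₂ s hs μ e t q q'
    rw [e1]
    refine (norm_add_le _ _).trans ((add_le_add ((norm_add_le _ _).trans (add_le_add a1 a2))
      a3).trans ?_)
    have hn := norm_nonneg e
    have b1 : 0 ≤ (2 * (1 + F.G.L) + C₁ + C₂) * ‖e‖ * (|s' - s| + wass μ ν) := by positivity
    have b2 : 0 ≤ (2 * (1 + F.G.L) + C₃ + C₂) * ‖e‖ * |t' - t| := by positivity
    have b3 : 0 ≤ (2 * (1 + F.G.L) + C₁ + C₃) * ‖e‖ * torusDist q' q := by positivity
    linarith only [b1, b2, b3]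

/-- The difference of two flows has a Lipschitz constant in the position of the order of the
distance of the measures. -/
lemma exists_norm_sol_sub_lipschitz : ∃ C, 0 ≤ C ∧ ∀ s ∈ Icc 0 F.T, ∀ μ ν t x y,
    ‖(F.sol s ν t - F.sol s μ t) y - (F.sol s ν t - F.sol s μ t) x‖
      ≤ C * wass μ ν * ‖y - x‖ := by
  obtain ⟨C, hC, h⟩ := F.exists_jacF_bounds
  refine ⟨C, hC, fun s hs μ ν t x y => ?_⟩
  refine Convex.norm_image_sub_le_of_norm_hasFDerivWithin_le
    (f' := fun q => F.jacF s ν t q - F.jacF s μ t q) (s := univ)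
    (fun q _ => ((F.hasFDerivAt_sol hs ν t q).sub (F.hasFDerivAt_sol hs μ t q)).hasFDerivWithinAt)
    (fun q _ => ?_) convex_univ (mem_univ _) (mem_univ _)
  have := (h s hs μ t q).2 s hs ν t q
  simpa [torusDist_self] using this

end FlowData

/-! ### The kernel of the derivative in the measure -/

/-- The derivative in the measure of the composition operator, composed with the derivative `B` of
the position at `x`. -/
def SmoothField.kerD (A : SmoothField d) (μ : PM d) (U : Disp d) (x : E d) (B : E d →L[ℝ] E d) :
    E d →L[ℝ] Disp d := (flipCLM (A.ker μ U x)).comp B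

lemma SmoothField.kerD_apply (A : SmoothField d) (μ : PM d) (U : Disp d) (x : E d)
    (B : E d →L[ℝ] E d) (e q : E d) : A.kerD μ U x B e q = (A.ker μ U x q ∘L B) e := rfl

lemma SmoothField.norm_kerD_le (A : SmoothField d) (μ : PM d) (U : Disp d) (x : E d)
    (B : E d →L[ℝ] E d) : ‖A.kerD μ U x B‖ ≤ A.L * ‖B‖ :=
  (ContinuousLinearMap.opNorm_comp_le _ _).trans
    (mul_le_mul_of_nonneg_right (norm_flipCLM_le A.L_nonneg (A.norm_ker_le μ U x)) (norm_nonneg _))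

lemma SmoothField.norm_kerD_sub_le (A : SmoothField d) (μ ν : PM d) (U U' : Disp d) (x y : E d)
    (B B' : E d →L[ℝ] E d) : ‖A.kerD ν U' y B' - A.kerD μ U x B‖ ≤
      A.L * (‖U' - U‖ + wass (law μ U) (law ν U') + torusDist (pos U' y) (pos U x)) * ‖B‖
        + A.L * ‖B' - B‖ := by
  have hL := A.L_nonneg
  have e : A.kerD ν U' y B' - A.kerD μ U x B
      = (flipCLM (A.ker ν U' y) - flipCLM (A.ker μ U x)).comp B
        + (flipCLM (A.ker ν U' y)).comp (B' - B) := by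
    ext1 v
    simp only [SmoothField.kerD, sub_apply, add_apply, ContinuousLinearMap.comp_apply, map_sub]
    abel
  rw [e]
  have h0 := wass_nonneg (law μ U) (law ν U')
  have h1 := torusDist_nonneg (pos U' y) (pos U x)
  refine (norm_add_le _ _).trans (add_le_add
    ((ContinuousLinearMap.opNorm_comp_le _ _).trans (mul_le_mul_of_nonneg_right
      (norm_flipCLM_sub_le (by positivity) (A.norm_ker_sub_le μ ν U U' x y)) (norm_nonneg _)))
    ((ContinuousLinearMap.opNorm_comp_le _ _).trans (mul_le_mul_of_nonneg_right
      (norm_flipCLM_le hL (A.norm_ker_le ν U' y)) (norm_nonneg _))))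

namespace FlowData

variable (F : FlowData d) {s s' : ℝ}

/-- The derivative of the position at time `t`. -/
def posJac (s : ℝ) (μ : PM d) (t : ℝ) (x : E d) : E d →L[ℝ] E d :=
  ContinuousLinearMap.id ℝ (E d) + (ContinuousLinearMap.fst ℝ (E d) (E d)).comp (F.jacF s μ t x)

lemma posJac_apply (s : ℝ) (μ : PM d) (t : ℝ) (x e : E d) :
    F.posJac s μ t x e = e + (F.jacF s μ t x e).1 := rfl

lemma exists_posJac_bounds : ∃ C, 0 ≤ C ∧ ∀ s ∈ Icc 0 F.T, ∀ μ t q,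
    ‖F.posJac s μ t q‖ ≤ C ∧
    ∀ s' ∈ Icc 0 F.T, ∀ ν t' q', ‖F.posJac s' ν t' q' - F.posJac s μ t q‖
      ≤ C * (|t' - t| + |s' - s| + torusDist q' q + wass μ ν) := by
  obtain ⟨C, hC, h⟩ := F.exists_jacF_bounds
  refine ⟨1 + C, by positivity, fun s hs μ t q => ⟨?_, fun s' hs' ν t' q' => ?_⟩⟩
  · refine ContinuousLinearMap.opNorm_le_bound _ (by positivity) fun e => ?_
    rw [posJac_apply]
    have h1 := ((norm_fst_le _).trans ((F.jacF s μ t q).le_of_opNorm_le (h s hs μ t q).1 e))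
    refine (norm_add_le _ _).trans ((add_le_add le_rfl h1).trans (le_of_eq (by ring)))
  · have h0 := (h s hs μ t q).2 s' hs' ν t' q'
    have hp := (norm_nonneg _).trans h0
    have h2 : 0 ≤ |t' - t| + |s' - s| + torusDist q' q + wass μ ν := by
      have := wass_nonneg μ ν
      have := torusDist_nonneg q' q
      positivity
    refine ContinuousLinearMap.opNorm_le_bound _ (by positivity) fun e => ?_
    rw [sub_apply, posJac_apply, posJac_apply, add_sub_add_left_eq_sub, ← Prod.fst_sub,
      ← sub_apply]
    refine (norm_fst_le _).trans (((F.jacF s' ν t' q' - F.jacF s μ t q).le_of_opNorm_le h0 e).trans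
      ?_)
    gcongr
    linarith

lemma norm_pos_sol_sub_le (hs : s ∈ Icc 0 F.T) (μ : PM d) (t : ℝ) (x y : E d) :
    ‖pos (F.sol s μ t) y - pos (F.sol s μ t) x‖ ≤ (1 + F.ell) * ‖y - x‖ := by
  have e : pos (F.sol s μ t) y - pos (F.sol s μ t) x
      = (y - x) + (F.sol s μ t y - F.sol s μ t x).1 := by
    rw [pos, pos, Prod.fst_sub]; abel
  rw [e]
  have h1 := (norm_fst_le _).trans ((F.lipTorus_sol hs μ t).norm_sub_le F.ell_nonneg x y)
  exact (norm_add_le _ _).trans ((add_le_add le_rfl h1).trans (le_of_eq (by ring)))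

lemma exists_norm_pos_sol_sub_sub_le : ∃ C, 0 ≤ C ∧ ∀ s ∈ Icc 0 F.T, ∀ μ t x y,
    ‖pos (F.sol s μ t) y - pos (F.sol s μ t) x - F.posJac s μ t x (y - x)‖
      ≤ C * ‖y - x‖ ^ 2 := by
  obtain ⟨C, hC, h⟩ := F.exists_norm_sol_sub_sub_jacF_le
  refine ⟨C, hC, fun s hs μ t x y => ?_⟩
  have e : pos (F.sol s μ t) y - pos (F.sol s μ t) x - F.posJac s μ t x (y - x)
      = (F.sol s μ t y - F.sol s μ t x - F.jacF s μ t x (y - x)).1 := by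
    rw [pos, pos, posJac_apply, Prod.fst_sub, Prod.fst_sub]; abel
  rw [e]
  exact (norm_fst_le _).trans (h s hs μ t x y)

/-- The effect on the velocity of a displacement of the mass at `x`. -/
def kerT (s : ℝ) (μ : PM d) (t : ℝ) (x : E d) : E d →L[ℝ] Disp d :=
  F.K.kerD μ (F.sol s μ t) x (F.posJac s μ t x)

/-- The effect on the initial condition of a displacement of the mass at `x`. -/
def ker₀ (s : ℝ) (μ : PM d) (x : E d) : E d →L[ℝ] Disp d :=
  F.G.kerD μ (F.sol₀ s μ) x (F.posJac s μ 0 x)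

/-- Collects the terms of `norm_kerD_sub_le` along flows. -/
lemma kerD_sub_arith {L δ w τ b β C r D : ℝ} (hL : 0 ≤ L) (hD : 0 ≤ D)
    (hr : 0 ≤ r) (hb0 : 0 ≤ b) (hδ : δ ≤ D * r) (hw : w ≤ D * r) (hτ : τ ≤ D * r) (hb : b ≤ C)
    (hβ : β ≤ C * r) : L * (δ + w + τ) * b + L * β ≤ (L * (3 * D) * C + L * C) * r := by
  have h1 : δ + w + τ ≤ 3 * D * r := by linarith
  have h2 : L * (δ + w + τ) * b ≤ L * (3 * D * r) * C :=
    mul_le_mul (mul_le_mul_of_nonneg_left h1 hL) hb hb0 (by positivity)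
  have h3 := mul_le_mul_of_nonneg_left hβ hL
  linarith

lemma exists_norm_sol_sub_time_le : ∃ C, 0 ≤ C ∧ ∀ s ∈ Icc 0 F.T, ∀ s' ∈ Icc 0 F.T, ∀ μ ν t t',
    ‖F.sol s' ν t' - F.sol s μ t‖ ≤ C * (|t' - t| + |s' - s| + wass μ ν) := by
  have hK := F.KL_nonneg
  obtain ⟨C, hC, h⟩ := F.exists_norm_sol_sub_le
  refine ⟨C + F.K.L, by positivity, fun s hs s' hs' μ ν t t' => ?_⟩
  have h1 := (h s hs s' hs' μ ν).1
  have h2 := F.norm_sol_time_sub_le hs μ t t'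
  have h3 : ‖F.sol s' ν t' - F.sol s μ t'‖ ≤ C * (|s' - s| + wass μ ν) :=
    ((F.sol s' ν - F.sol s μ).norm_coe_le_norm t').trans h1
  have h4 := norm_add_le (F.sol s' ν t' - F.sol s μ t') (F.sol s μ t' - F.sol s μ t)
  rw [sub_add_sub_cancel] at h4
  have hW := wass_nonneg μ ν
  have h5 : 0 ≤ C * |t' - t| := by positivity
  have h6 : 0 ≤ F.K.L * (|s' - s| + wass μ ν) := by positivity
  linarith

/-- The kernels are bounded and Lipschitz in all their variables. -/
lemma exists_ker_bounds : ∃ C, 0 ≤ C ∧ ∀ s ∈ Icc 0 F.T, ∀ μ x,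
    (∀ t, ‖F.kerT s μ t x‖ ≤ C) ∧ ‖F.ker₀ s μ x‖ ≤ C ∧
    ∀ s' ∈ Icc 0 F.T, ∀ ν y,
      (∀ t t', ‖F.kerT s' ν t' y - F.kerT s μ t x‖
        ≤ C * (|t' - t| + |s' - s| + torusDist y x + wass μ ν)) ∧
      ‖F.ker₀ s' ν y - F.ker₀ s μ x‖ ≤ C * (|s' - s| + torusDist y x + wass μ ν) := by
  have hK := F.KL_nonneg
  have hG := F.GL_nonneg
  have hl := F.ell_nonneg
  obtain ⟨C, hC, h⟩ := F.exists_posJac_bounds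
  obtain ⟨C₁, hC₁, h₁⟩ := F.exists_norm_sol_sub_time_le
  obtain ⟨C₂, hC₂, h₂⟩ := F.exists_norm_sol_sub_le
  set D : ℝ := 2 * (C₁ + C₂ + 1 + F.ell) with hD
  have hD0 : 0 ≤ D := by positivity
  refine ⟨F.K.L * C + F.G.L * C + (F.K.L * (3 * D) * C + F.K.L * C)
    + (F.G.L * (3 * D) * C + F.G.L * C), by positivity, fun s hs μ x => ⟨fun t => ?_, ?_,
    fun s' hs' ν y => ⟨fun t t' => ?_, ?_⟩⟩⟩
  · refine (F.K.norm_kerD_le _ _ _ _).trans ?_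
    have h1 := mul_le_mul_of_nonneg_left (h s hs μ t x).1 hK
    have h2 : 0 ≤ F.G.L * C + (F.K.L * (3 * D) * C + F.K.L * C)
      + (F.G.L * (3 * D) * C + F.G.L * C) := by positivity
    linarith
  · refine (F.G.norm_kerD_le _ _ _ _).trans ?_
    have h1 := mul_le_mul_of_nonneg_left (h s hs μ 0 x).1 hG
    have h2 : 0 ≤ F.K.L * C + (F.K.L * (3 * D) * C + F.K.L * C)
      + (F.G.L * (3 * D) * C + F.G.L * C) := by positivity
    linarith
  · have hW := wass_nonneg μ ν
    have ht := torusDist_nonneg y x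
    have hsol := h₁ s hs s' hs' μ ν t t'
    have hlaw := wass_law_le hl (F.lipTorus_sol hs μ t) (F.sol s' ν t') μ ν
    have htd := torusDist_pos_le (F.lipTorus_sol hs μ t) (F.sol s' ν t') x y
    have hτ0 := abs_nonneg (t' - t)
    have hσ0 := abs_nonneg (s' - s)
    set r := |t' - t| + |s' - s| + torusDist y x + wass μ ν with hr
    have hr0 : 0 ≤ r := by positivity
    have hsol' : ‖F.sol s' ν t' - F.sol s μ t‖ ≤ C₁ * r :=
      hsol.trans (mul_le_mul_of_nonneg_left (by linarith) hC₁)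
    have hW' : (1 + F.ell) * wass μ ν ≤ (1 + F.ell) * r :=
      mul_le_mul_of_nonneg_left (by linarith) (by positivity)
    have ht' : (1 + F.ell) * torusDist y x ≤ (1 + F.ell) * r :=
      mul_le_mul_of_nonneg_left (by linarith) (by positivity)
    have p1 : 0 ≤ C₁ * r := by positivity
    have p2 : 0 ≤ C₂ * r := by positivity
    have p3 : 0 ≤ (1 + F.ell) * r := by positivity
    have hDr : D * r = 2 * (C₁ * r) + 2 * (C₂ * r) + 2 * ((1 + F.ell) * r) := by rw [hD]; ring
    refine (F.K.norm_kerD_sub_le _ _ _ _ _ _ _ _).trans ((kerD_sub_arith hK hD0 hr0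
      (norm_nonneg _) (D := D) ?_ ?_ ?_ (h s hs μ t x).1 ((h s hs μ t x).2 s' hs' ν t' y)).trans ?_)
    · linarith only [hsol', p1, p2, p3, hDr]
    · linarith only [hlaw, hsol', hW', p1, p2, p3, hDr]
    · linarith only [htd, hsol', ht', p1, p2, p3, hDr]
    · refine mul_le_mul_of_nonneg_right ?_ hr0
      have : 0 ≤ F.K.L * C + F.G.L * C + (F.G.L * (3 * D) * C + F.G.L * C) := by positivity
      linarith only [this]
  · have hW := wass_nonneg μ ν
    have ht := torusDist_nonneg y x
    obtain ⟨-, hsol, -, hlaw⟩ := h₂ s hs s' hs' μ ν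
    have htd := torusDist_pos_le (F.lipTorus_sol₀ hs μ) (F.sol₀ s' ν) x y
    have hσ0 := abs_nonneg (s' - s)
    have hB := (h s hs μ 0 x).2 s' hs' ν 0 y
    rw [sub_self, abs_zero, zero_add] at hB
    set r := |s' - s| + torusDist y x + wass μ ν with hr
    have hr0 : 0 ≤ r := by positivity
    have hsol' : ‖F.sol₀ s' ν - F.sol₀ s μ‖ ≤ C₂ * r :=
      hsol.trans (mul_le_mul_of_nonneg_left (by linarith) hC₂)
    have hlaw' : wass (law μ (F.sol₀ s μ)) (law ν (F.sol₀ s' ν)) ≤ C₂ * r :=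
      hlaw.trans (mul_le_mul_of_nonneg_left (by linarith) hC₂)
    have ht' : (1 + F.ell) * torusDist y x ≤ (1 + F.ell) * r :=
      mul_le_mul_of_nonneg_left (by linarith) (by positivity)
    have p1 : 0 ≤ C₁ * r := by positivity
    have p2 : 0 ≤ C₂ * r := by positivity
    have p3 : 0 ≤ (1 + F.ell) * r := by positivity
    have hDr : D * r = 2 * (C₁ * r) + 2 * (C₂ * r) + 2 * ((1 + F.ell) * r) := by rw [hD]; ring
    refine (F.G.norm_kerD_sub_le _ _ _ _ _ _ _ _).trans ((kerD_sub_arith hG hD0 hr0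
      (norm_nonneg _) (D := D) ?_ ?_ ?_ (h s hs μ 0 x).1 hB).trans ?_)
    · linarith only [hsol', p1, p2, p3, hDr]
    · linarith only [hlaw', p1, p2, p3, hDr]
    · linarith only [htd, hsol', ht', p1, p2, p3, hDr]
    · refine mul_le_mul_of_nonneg_right ?_ hr0
      have : 0 ≤ F.K.L * C + F.G.L * C + (F.K.L * (3 * D) * C + F.K.L * C) := by positivity
      linarith only [this]

open Classical in
/-- `kerT` as a curve of operators. For `s` in the time interval `kerT` is continuous and bounded in
time (`kerC_apply`); where this fails the value zero is chosen. -/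
def kerC (s : ℝ) (μ : PM d) (x : E d) : ℝ →ᵇ (E d →L[ℝ] Disp d) :=
  if h : Continuous (fun t => F.kerT s μ t x) ∧ ∃ C, ∀ t, ‖F.kerT s μ t x‖ ≤ C then
    BoundedContinuousFunction.ofNormedAddCommGroup (fun t => F.kerT s μ t x) h.1 h.2.choose
      h.2.choose_spec
  else 0

lemma kerC_apply (hs : s ∈ Icc 0 F.T) (μ : PM d) (x : E d) (t : ℝ) :
    F.kerC s μ x t = F.kerT s μ t x := by
  obtain ⟨C, hC, h⟩ := F.exists_ker_bounds
  have hc : Continuous (fun t => F.kerT s μ t x) ∧ ∃ C, ∀ t, ‖F.kerT s μ t x‖ ≤ C := by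
    refine ⟨continuous_of_norm_sub_le hC fun t t' => ?_, C, (h s hs μ x).1⟩
    have := ((h s hs μ x).2.2 s hs μ x).1 t t'
    simpa [torusDist_self, wass_self] using this
  rw [kerC, dif_pos hc]
  rfl

/-! ### The linearized equation -/

/-- The linearized vector field along a curve. -/
def linC (μ : PM d) (U : Curve d) : ℝ →ᵇ (Disp d →L[ℝ] Disp d) :=
  BoundedContinuousFunction.ofNormedAddCommGroup (fun t => F.K.lin μ (U t))
    ((continuous_of_norm_sub_le (f := F.K.lin μ) (L := 5 * F.K.L)
      (mul_nonneg (by norm_num) F.KL_nonneg)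
      (F.K.norm_lin_sub_same_le μ)).comp U.continuous) (2 * F.K.L) (fun _ => F.K.norm_lin_le μ _)

lemma norm_linC_le (μ : PM d) (U : Curve d) : ‖F.linC μ U‖ ≤ 2 * F.K.L :=
  (BoundedContinuousFunction.norm_le (mul_nonneg (by norm_num) F.KL_nonneg)).2
    fun _ => F.K.norm_lin_le μ _

/-- The linearized initial condition. -/
def linM (s : ℝ) (μ : PM d) : Disp d →L[ℝ] Disp d := -momL d + F.G.lin μ (F.sol₀ s μ)

lemma norm_linM_le (s : ℝ) (μ : PM d) : ‖F.linM s μ‖ ≤ 1 + 2 * F.G.L :=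
  (norm_add_momL_le _).trans (add_le_add le_rfl (F.G.norm_lin_le μ _))

/-- The operator of the linearized equation. -/
def linOp (s : ℝ) (μ : PM d) : Curve d →L[ℝ] Curve d :=
  voltOp F.T s (F.linM s μ) (F.linC μ (F.sol s μ))

lemma norm_linOp_le (hs : s ∈ Icc 0 F.T) (μ : PM d) : ‖F.linOp s μ‖ ≤ 1 / 2 := by
  refine (norm_voltOp_le hs _ _).trans ?_
  have h1 := F.norm_linM_le s μ
  have h2 := F.norm_linC_le μ (F.sol s μ)
  have hT := F.T_nonneg
  have hG := F.GL_nonneg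
  calc _ ≤ (1 + (1 + 2 * F.G.L)) * F.T * (2 * F.K.L) := by gcongr
    _ = 4 * (F.K.L * F.T) + 4 * (F.G.L * (F.K.L * F.T)) := by ring
    _ ≤ _ := by linarith [F.KT_le, F.GKT_le]

/-- The right hand side of the linearized equation, for a displacement of the mass at `x`. -/
def src (s : ℝ) (μ : PM d) (x : E d) : E d →L[ℝ] Curve d :=
  (volt F.T s (F.linM s μ)).comp (flipCLM (F.kerC s μ x))
    + (constL ℝ (Disp d)).comp (F.ker₀ s μ x)

lemma src_apply (s : ℝ) (μ : PM d) (x e : E d) :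
    F.src s μ x e = volt F.T s (F.linM s μ) (flipCLM (F.kerC s μ x) e)
      + constL ℝ (Disp d) (F.ker₀ s μ x e) := rfl

/-- The derivative of the flow in the measure, for a displacement of the mass at `x`. -/
def dX (s : ℝ) (μ : PM d) (x : E d) : E d →L[ℝ] Curve d :=
  (resolv (F.linOp s μ)).comp (F.src s μ x)

lemma dX_eq (hs : s ∈ Icc 0 F.T) (μ : PM d) (x e : E d) :
    F.dX s μ x e = F.linOp s μ (F.dX s μ x e) + F.src s μ x e :=
  resolv_eq (F.norm_linOp_le hs μ) _

lemma exists_flip_kerC_bounds : ∃ C, 0 ≤ C ∧ ∀ s ∈ Icc 0 F.T, ∀ μ x,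
    ‖flipCLM (F.kerC s μ x)‖ ≤ C ∧ ‖F.ker₀ s μ x‖ ≤ C ∧
    ∀ s' ∈ Icc 0 F.T, ∀ ν y,
      ‖flipCLM (F.kerC s' ν y) - flipCLM (F.kerC s μ x)‖
        ≤ C * (|s' - s| + torusDist y x + wass μ ν) ∧
      ‖F.ker₀ s' ν y - F.ker₀ s μ x‖ ≤ C * (|s' - s| + torusDist y x + wass μ ν) := by
  obtain ⟨C, hC, h⟩ := F.exists_ker_bounds
  refine ⟨C, hC, fun s hs μ x => ?_⟩
  obtain ⟨h1, h2, h3⟩ := h s hs μ x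
  refine ⟨norm_flipCLM_le hC fun t => ?_, h2, fun s' hs' ν y => ⟨?_, (h3 s' hs' ν y).2⟩⟩
  · rw [F.kerC_apply hs]; exact h1 t
  · have hW := wass_nonneg μ ν
    have ht := torusDist_nonneg y x
    refine norm_flipCLM_sub_le (by positivity) fun t => ?_
    rw [F.kerC_apply hs, F.kerC_apply hs']
    have := (h3 s' hs' ν y).1 t t
    rwa [sub_self, abs_zero, zero_add] at this

end FlowData

namespace FlowData

variable (F : FlowData d) {s s' : ℝ}

/-! ### Differentiability of the flow in the measure -/

lemma continuous_flip_kerC (hs : s ∈ Icc 0 F.T) (μ : PM d) :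
    Continuous fun x => flipCLM (F.kerC s μ x) := by
  obtain ⟨C, hC, h⟩ := F.exists_flip_kerC_bounds
  refine continuous_of_norm_sub_le hC fun x y => ?_
  have h1 := ((h s hs μ x).2.2 s hs μ y).1
  rw [sub_self, abs_zero, zero_add, wass_self, add_zero] at h1
  exact h1.trans (mul_le_mul_of_nonneg_left (torusDist_le_norm y x) hC)

lemma continuous_ker₀ (hs : s ∈ Icc 0 F.T) (μ : PM d) : Continuous (F.ker₀ s μ) := by
  obtain ⟨C, hC, h⟩ := F.exists_flip_kerC_bounds
  refine continuous_of_norm_sub_le hC fun x y => ?_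
  have h1 := ((h s hs μ x).2.2 s hs μ y).2
  rw [sub_self, abs_zero, zero_add, wass_self, add_zero] at h1
  exact h1.trans (mul_le_mul_of_nonneg_left (torusDist_le_norm y x) hC)

lemma integrable_flip_kerC (hs : s ∈ Icc 0 F.T) {μ ν : PM d} {γ : Measure (E d × E d)}
    (hγ : IsOptPlan γ μ ν) :
    Integrable (fun z => flipCLM (F.kerC s μ z.1) (z.2 - z.1)) γ := by
  have := hγ.1.isProbabilityMeasure
  obtain ⟨C, hC, h⟩ := F.exists_flip_kerC_bounds
  exact integrable_clm_disp (K := fun z => flipCLM (F.kerC s μ z.1)) hγ.finiteCost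
    ((F.continuous_flip_kerC hs μ).comp continuous_fst) (fun z => (h s hs μ z.1).1)

lemma integrable_ker₀ (hs : s ∈ Icc 0 F.T) {μ ν : PM d} {γ : Measure (E d × E d)}
    (hγ : IsOptPlan γ μ ν) :
    Integrable (fun z => F.ker₀ s μ z.1 (z.2 - z.1)) γ := by
  have := hγ.1.isProbabilityMeasure
  obtain ⟨C, hC, h⟩ := F.exists_flip_kerC_bounds
  exact integrable_clm_disp (K := fun z => F.ker₀ s μ z.1) hγ.finiteCost
    ((F.continuous_ker₀ hs μ).comp continuous_fst) (fun z => (h s hs μ z.1).2.1)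

/-- The right hand side of the linearized equation, integrated against a plan. -/
lemma integral_src (hs : s ∈ Icc 0 F.T) {μ ν : PM d} {γ : Measure (E d × E d)}
    (hγ : IsOptPlan γ μ ν) :
    Integrable (fun z => F.src s μ z.1 (z.2 - z.1)) γ ∧
    ∫ z, F.src s μ z.1 (z.2 - z.1) ∂γ
      = volt F.T s (F.linM s μ) (∫ z, flipCLM (F.kerC s μ z.1) (z.2 - z.1) ∂γ)
        + constL ℝ (Disp d) (∫ z, F.ker₀ s μ z.1 (z.2 - z.1) ∂γ) := by
  have h1 := F.integrable_flip_kerC hs hγ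
  have h2 := F.integrable_ker₀ hs hγ
  have h3 := (volt F.T s (F.linM s μ)).integrable_comp h1
  have h4 := (constL ℝ (Disp d)).integrable_comp h2
  refine ⟨h3.add h4, ?_⟩
  rw [← (volt F.T s (F.linM s μ)).integral_comp_comm h1,
    ← (constL ℝ (Disp d)).integral_comp_comm h2]
  exact integral_add h3 h4

lemma integrable_dX (hs : s ∈ Icc 0 F.T) {μ ν : PM d} {γ : Measure (E d × E d)}
    (hγ : IsOptPlan γ μ ν) : Integrable (fun z => F.dX s μ z.1 (z.2 - z.1)) γ :=
  (resolv (F.linOp s μ)).integrable_comp (F.integral_src hs hγ).1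

lemma integral_dX (hs : s ∈ Icc 0 F.T) {μ ν : PM d} {γ : Measure (E d × E d)}
    (hγ : IsOptPlan γ μ ν) : ∫ z, F.dX s μ z.1 (z.2 - z.1) ∂γ
      = resolv (F.linOp s μ) (∫ z, F.src s μ z.1 (z.2 - z.1) ∂γ) :=
  (resolv (F.linOp s μ)).integral_comp_comm (F.integral_src hs hγ).1

lemma integral_kerC_apply (hs : s ∈ Icc 0 F.T) {μ ν : PM d} {γ : Measure (E d × E d)}
    (hγ : IsOptPlan γ μ ν) (t : ℝ) (q : E d) :
    (∫ z, flipCLM (F.kerC s μ z.1) (z.2 - z.1) ∂γ) t q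
      = ∫ z, (F.K.ker μ (F.sol s μ t) z.1 q ∘L F.posJac s μ t z.1) (z.2 - z.1) ∂γ := by
  have h1 := F.integrable_flip_kerC hs hγ
  have h2 := ((BoundedContinuousFunction.evalCLM (β := E d × E d) ℝ q).comp
    (BoundedContinuousFunction.evalCLM (β := Disp d) ℝ t)).integral_comp_comm h1
  refine h2.symm.trans (integral_congr_ae (ae_of_all _ fun z => ?_))
  change (flipCLM (F.kerC s μ z.1) (z.2 - z.1)) t q = _
  rw [flipCLM_apply, F.kerC_apply hs]
  rfl

lemma integral_ker₀_apply (hs : s ∈ Icc 0 F.T) {μ ν : PM d} {γ : Measure (E d × E d)}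
    (hγ : IsOptPlan γ μ ν) (q : E d) :
    (∫ z, F.ker₀ s μ z.1 (z.2 - z.1) ∂γ) q
      = ∫ z, (F.G.ker μ (F.sol₀ s μ) z.1 q ∘L F.posJac s μ 0 z.1) (z.2 - z.1) ∂γ :=
  ((BoundedContinuousFunction.evalCLM (β := E d × E d) ℝ q).integral_comp_comm
    (F.integrable_ker₀ hs hγ)).symm

lemma continuous_posJac (hs : s ∈ Icc 0 F.T) (μ : PM d) (t : ℝ) :
    Continuous (F.posJac s μ t) := by
  obtain ⟨C, hC, h⟩ := F.exists_posJac_bounds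
  refine continuous_of_norm_sub_le hC fun x y => ?_
  have h1 := (h s hs μ t x).2 s hs μ t y
  rw [sub_self, sub_self, abs_zero, zero_add, zero_add, wass_self, add_zero] at h1
  exact h1.trans (mul_le_mul_of_nonneg_left (torusDist_le_norm y x) hC)

/-- The flow is differentiable in the measure, with a quadratic remainder. -/
lemma exists_norm_sol_sub_integral_dX_le : ∃ C, 0 ≤ C ∧ ∀ s ∈ Icc 0 F.T, ∀ (μ ν : PM d)
    (γ : Measure (E d × E d)), IsOptPlan γ μ ν →
    ‖F.sol s ν - F.sol s μ - ∫ z, F.dX s μ z.1 (z.2 - z.1) ∂γ‖ ≤ C * wass μ ν ^ 2 := by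
  have hK := F.KL_nonneg
  have hG := F.GL_nonneg
  have hT := F.T_nonneg
  have hl := F.ell_nonneg
  obtain ⟨C₁, hC₁, h₁⟩ := F.exists_norm_sol_sub_le
  obtain ⟨C₂, hC₂, h₂⟩ := F.exists_posJac_bounds
  obtain ⟨C₃, hC₃, h₃⟩ := F.exists_norm_pos_sol_sub_sub_le
  obtain ⟨C₄, hC₄, h₄⟩ := F.exists_norm_sol_sub_lipschitz
  set b : ℝ := 1 + F.ell + C₂ with hb
  have hb0 : 0 ≤ b := by positivity
  set R : ℝ := 3 * C₁ ^ 2 + (2 * b ^ 2 + C₃) + C₄ with hR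
  have hR0 : 0 ≤ R := by positivity
  refine ⟨2 * ((2 + 2 * F.G.L) * F.T * (F.K.L * R) + F.G.L * R), by positivity,
    fun s hs μ ν γ hγ => ?_⟩
  have hW := wass_nonneg μ ν
  obtain ⟨hs1, hs2, -, -⟩ := h₁ s hs s hs μ ν
  rw [sub_self, abs_zero, zero_add] at hs1 hs2
  set U := F.sol s μ with hU
  set U' := F.sol s ν with hU'
  have hRW : ∀ n, 0 ≤ n → n ≤ C₁ * wass μ ν →
      3 * n ^ 2 + (2 * b ^ 2 + C₃) * wass μ ν ^ 2 + C₄ * wass μ ν * wass μ ν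
        ≤ R * wass μ ν ^ 2 := by
    intro n hn0 hn
    have := pow_le_pow_left₀ hn0 hn 2
    rw [hR]
    linarith only [this]
  have hbU : ∀ t x y, ‖pos (U t) y - pos (U t) x‖ ≤ b * ‖y - x‖ := fun t x y =>
    (F.norm_pos_sol_sub_le hs μ t x y).trans
      (mul_le_mul_of_nonneg_right (by rw [hb]; linarith only [hC₂]) (norm_nonneg _))
  have hbB : ∀ t x, ‖F.posJac s μ t x‖ ≤ b := fun t x =>
    (h₂ s hs μ t x).1.trans (by rw [hb]; linarith only [hl])
  have hm : 0 ≤ C₄ * wass μ ν := by positivity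
  -- the velocity is expanded at both flows; `C₄ * wass μ ν` bounds the Lipschitz
  -- constant of `U' - U`
  have k1 : ‖F.vel ν U' - F.vel μ U - mulOp (F.linC μ U) (U' - U)
      - ∫ z, flipCLM (F.kerC s μ z.1) (z.2 - z.1) ∂γ‖ ≤ F.K.L * (R * wass μ ν ^ 2) := by
    refine (BoundedContinuousFunction.norm_le (by positivity)).2 fun t =>
      (BoundedContinuousFunction.norm_le (by positivity)).2 fun q => ?_
    have h := F.K.nem_expansion (U := U t) (U' := U' t) hb0 hm hγ
      (F.continuous_posJac hs μ t) (hbB t) (h₃ s hs μ t) (hbU t)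
      (fun x y => (norm_fst_le _).trans (h₄ s hs μ ν t x y)) q
    rw [← F.integral_kerC_apply hs hγ t q] at h
    exact h.trans (mul_le_mul_of_nonneg_left
      (hRW _ (norm_nonneg _) (((U' - U).norm_coe_le_norm t).trans hs1)) hK)
  have e0 : pos (F.sol₀ s μ) = pos (U 0) := (F.pos_sol_zero hs μ).symm
  -- the same for the initial momentum, with positions at time zero
  have k2 : ‖F.G.nem ν (F.sol₀ s ν) - F.G.nem μ (F.sol₀ s μ)
      - F.G.lin μ (F.sol₀ s μ) (F.sol₀ s ν - F.sol₀ s μ)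
      - ∫ z, F.ker₀ s μ z.1 (z.2 - z.1) ∂γ‖ ≤ F.G.L * (R * wass μ ν ^ 2) := by
    refine (BoundedContinuousFunction.norm_le (by positivity)).2 fun q => ?_
    have h := F.G.nem_expansion (U := F.sol₀ s μ) (U' := F.sol₀ s ν) hb0 hm hγ
      (F.continuous_posJac hs μ 0) (hbB 0) (by rw [e0]; exact h₃ s hs μ 0)
      (by rw [e0]; exact hbU 0)
      (fun x y => by
        have e1 : ((F.sol₀ s ν - F.sol₀ s μ) y - (F.sol₀ s ν - F.sol₀ s μ) x).1
            = ((F.sol s ν 0 - F.sol s μ 0) y - (F.sol s ν 0 - F.sol s μ 0) x).1 := by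
          simp only [BoundedContinuousFunction.coe_sub, Pi.sub_apply, Prod.fst_sub,
            F.sol_zero_fst hs]
        rw [e1]
        exact (norm_fst_le _).trans (h₄ s hs μ ν 0 x y)) q
    rw [← F.integral_ker₀_apply hs hγ q] at h
    exact h.trans (mul_le_mul_of_nonneg_left (hRW _ (norm_nonneg _) hs2) hG)
  have e1 : U' - U = volt F.T s (-momL d) (F.vel ν U' - F.vel μ U)
      + constL ℝ (Disp d) (F.G.nem ν (F.sol₀ s ν) - F.G.nem μ (F.sol₀ s μ)) :=
    (congrArg₂ (· - ·) (F.sol_eq hs ν) (F.sol_eq hs μ)).trans (volt_add_constL_sub F _ _ _ _)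
  have e2 : ∫ τ in s..(0 : ℝ), (F.vel ν U' - F.vel μ U) τ = F.sol₀ s ν - F.sol₀ s μ := by
    rw [sol₀_eq, sol₀_eq, ← intervalIntegral.integral_sub (intervalIntegrable_bcf _ _ _)
      (intervalIntegrable_bcf _ _ _)]
    rfl
  rw [← e2] at k2
  have h5 := norm_sub_linearization_le hs (M := F.G.lin μ (F.sol₀ s μ))
    (l := mulOp (F.linC μ U) (U' - U))
    (h := ∫ z, flipCLM (F.kerC s μ z.1) (z.2 - z.1) ∂γ)
    (g := ∫ z, F.ker₀ s μ z.1 (z.2 - z.1) ∂γ) e1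
  have hM0 : ‖-momL d + F.G.lin μ (F.sol₀ s μ)‖ ≤ 1 + 2 * F.G.L := F.norm_linM_le s μ
  have hM : 1 + ‖-momL d + F.G.lin μ (F.sol₀ s μ)‖ ≤ 2 + 2 * F.G.L := by linarith only [hM0]
  -- `U' - U` solves the linearized equation up to a quadratic error
  have h6 := norm_sub_resolv_le (F.norm_linOp_le hs μ) (U' - U)
    (∫ z, F.src s μ z.1 (z.2 - z.1) ∂γ)
  rw [← F.integral_dX hs hγ] at h6
  refine h6.trans ?_
  rw [(F.integral_src hs hγ).2]
  have h7 := h5.trans (add_le_add (mul_le_mul (mul_le_mul_of_nonneg_right hM hT) k1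
    (norm_nonneg _) (by positivity)) k2)
  exact (mul_le_mul_of_nonneg_left h7 (by norm_num)).trans (le_of_eq (by ring))

end FlowData

/-! ### Regularity of the derivative in the measure -/

lemma LipTorus.add {W : Type} [NormedAddCommGroup W] {ℓ ℓ' : ℝ} {w w' : E d → W}
    (h : LipTorus ℓ w) (h' : LipTorus ℓ' w') : LipTorus (ℓ + ℓ') (fun x => w x + w' x) := fun x y => by
  rw [add_sub_add_comm, add_mul]
  exact (norm_add_le _ _).trans (add_le_add (h x y) (h' x y))

namespace SmoothField

variable (A : SmoothField d)

lemma lin_apply (μ : PM d) (U w : Disp d) : A.lin μ U w = A.loc μ U w + A.nonloc μ U w := rfl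

lemma lipTorus_lin {ℓ β : ℝ} (hℓ : 0 ≤ ℓ) {U : Disp d} (hU : LipTorus ℓ U) (μ : PM d) {w : Disp d}
    (hw : LipTorus β w) : LipTorus (2 * (A.L * (1 + ℓ) * ‖w‖) + A.L * β) (A.lin μ U w) :=
  ((A.lipTorus_loc hU μ hw).add (A.lipTorus_nonloc hℓ hU μ w)).mono (le_of_eq (by ring))

lemma norm_lin_apply_sub_le {ℓ β C r : ℝ} (hℓ : 0 ≤ ℓ) (hβ : 0 ≤ β) {U : Disp d}
    (hU : LipTorus ℓ U) {U' w : Disp d} (hw : LipTorus β w) {μ ν : PM d}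
    (h₁ : ‖U' - U‖ ≤ C * r) (h₂ : wass (law μ U) (law ν U') ≤ C * r) (h₃ : wass μ ν ≤ r) :
    ‖A.lin ν U' w - A.lin μ U w‖ ≤ A.L * (6 * C + 3 * (1 + ℓ) + 1) * (‖w‖ + β) * r := by
  have hL := A.L_nonneg
  have hw0 : 0 ≤ ‖w‖ := norm_nonneg w
  have e : A.lin ν U' w - A.lin μ U w
      = (A.loc ν U' - A.loc μ U) w + (A.nonloc ν U' w - A.nonloc μ U w) := by
    rw [lin_apply, lin_apply, sub_apply]; abel
  rw [e]
  have hW := wass_nonneg μ ν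
  have hr : 0 ≤ r := hW.trans h₃
  have hCr : 0 ≤ C * r := (norm_nonneg _).trans h₁
  have k1 := (A.loc ν U' - A.loc μ U).le_of_opNorm_le ((A.norm_loc_sub_le μ ν U U').trans
    (mul_le_mul_of_nonneg_left (add_le_add h₁ h₂) hL)) w
  have k2 := A.norm_nonloc_apply_sub_le hℓ hβ hU U' hw μ ν
  have k3 : A.L * (4 * ‖U' - U‖ + 3 * (1 + ℓ) * wass μ ν) * ‖w‖
      ≤ A.L * (4 * (C * r) + 3 * (1 + ℓ) * r) * ‖w‖ := by gcongr
  have k4 : A.L * β * wass μ ν ≤ A.L * β * r := by gcongr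
  refine (norm_add_le _ _).trans ?_
  have k5 : 0 ≤ A.L * ‖w‖ * r := by positivity
  have k6 : 0 ≤ A.L * β * (6 * (C * r)) := by positivity
  have k7 : 0 ≤ A.L * β * (3 * (1 + ℓ)) * r := by positivity
  linarith only [k1, k2, k3, k4, k5, k6, k7]

lemma lipTorus_kerD {ℓ : ℝ} {U : Disp d} (hU : LipTorus ℓ U) (μ : PM d) (z : E d)
    (B : E d →L[ℝ] E d) (e : E d) : LipTorus (A.L * (1 + ℓ) * ‖B e‖) fun q => A.kerD μ U z B e q :=
  fun x y => by
    beta_reduce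
    rw [kerD_apply, kerD_apply, ContinuousLinearMap.comp_apply, ContinuousLinearMap.comp_apply,
      ← sub_apply]
    exact ((A.ker μ U z y - A.ker μ U z x).le_of_opNorm_le (A.lipTorus_ker hU μ z x y) _).trans
      (le_of_eq (by ring))

end SmoothField

namespace FlowData

variable (F : FlowData d) {s s' : ℝ}

lemma lipTorus_initial_integral (hs : s ∈ Icc 0 F.T) {k : Curve d} {β : ℝ} (hβ : 0 ≤ β)
    (hk : ∀ t, LipTorus β (k t)) : LipTorus (F.T * β) (∫ τ in s..(0 : ℝ), k τ : Disp d) :=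
  lipTorus_of_transL fun v => by
    have ht := torusDist_nonneg v 0
    refine (F.norm_transL_integral_sub_le hs v k).trans ?_
    rw [mul_assoc]
    refine mul_le_mul_of_nonneg_left ?_ F.T_nonneg
    exact (BoundedContinuousFunction.norm_le (by positivity)).2 fun t =>
      (hk t).norm_transL_sub_le hβ v

/-- The coefficients of the linearized equation are Lipschitz in the initial time and in the measure
on displacements that are Lipschitz in the position. -/
lemma exists_lin_sub_le : ∃ C, 0 ≤ C ∧ ∀ s ∈ Icc 0 F.T, ∀ s' ∈ Icc 0 F.T, ∀ μ ν,
    (∀ (w : Curve d) (β : ℝ), 0 ≤ β → (∀ t, LipTorus β (w t)) →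
      ‖mulOp (F.linC ν (F.sol s' ν)) w - mulOp (F.linC μ (F.sol s μ)) w‖
        ≤ C * (‖w‖ + β) * (|s' - s| + wass μ ν)) ∧
    ∀ (w : Disp d) (β : ℝ), 0 ≤ β → LipTorus β w →
      ‖(F.linM s' ν - F.linM s μ) w‖ ≤ C * (‖w‖ + β) * (|s' - s| + wass μ ν) := by
  have hK := F.KL_nonneg
  have hG := F.GL_nonneg
  have hl := F.ell_nonneg
  obtain ⟨C, hC, h⟩ := F.exists_norm_sol_sub_le
  refine ⟨(F.K.L + F.G.L) * (6 * C + 3 * (1 + F.ell) + 1), by positivity,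
    fun s hs s' hs' μ ν => ?_⟩
  obtain ⟨h1, h2, h3, h4⟩ := h s hs s' hs' μ ν
  have hσ := abs_nonneg (s' - s)
  have hW := wass_nonneg μ ν
  have hr : wass μ ν ≤ |s' - s| + wass μ ν := by linarith only [hσ]
  have hr0 := hW.trans hr
  refine ⟨fun w β hβ hw => ?_, fun w β hβ hw => ?_⟩
  · have hw0 : 0 ≤ ‖w‖ := norm_nonneg w
    refine (BoundedContinuousFunction.norm_le (by positivity)).2 fun t => ?_
    refine (F.K.norm_lin_apply_sub_le hl hβ (F.lipTorus_sol hs μ t) (hw t)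
      (((F.sol s' ν - F.sol s μ).norm_coe_le_norm t).trans h1) (h3 t) hr).trans ?_
    refine mul_le_mul_of_nonneg_right ?_ hr0
    refine mul_le_mul (mul_le_mul_of_nonneg_right (by linarith only [hG]) (by positivity))
      (add_le_add (w.norm_coe_le_norm t) le_rfl) (by positivity) (by positivity)
  · have hw0 : 0 ≤ ‖w‖ := norm_nonneg w
    have e : (F.linM s' ν - F.linM s μ) w
        = F.G.lin ν (F.sol₀ s' ν) w - F.G.lin μ (F.sol₀ s μ) w := by
      rw [linM, linM, add_sub_add_left_eq_sub, sub_apply]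
    rw [e]
    refine (F.G.norm_lin_apply_sub_le hl hβ (F.lipTorus_sol₀ hs μ) hw h2 h4 hr).trans ?_
    refine mul_le_mul_of_nonneg_right (mul_le_mul_of_nonneg_right
      (mul_le_mul_of_nonneg_right (by linarith only [hK]) (by positivity)) (by positivity)) hr0

lemma norm_mulOp_linC_le (μ : PM d) (U w : Curve d) :
    ‖mulOp (F.linC μ U) w‖ ≤ 2 * F.K.L * ‖w‖ :=
  (norm_mulOp_apply_le _ w).trans
    (mul_le_mul_of_nonneg_right (F.norm_linC_le μ U) (norm_nonneg w))

lemma exists_norm_dX_le : ∃ C, 0 ≤ C ∧ ∀ s ∈ Icc 0 F.T, ∀ μ x e,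
    ‖F.dX s μ x e‖ ≤ C * ‖e‖ := by
  have hG := F.GL_nonneg
  have hT := F.T_nonneg
  obtain ⟨C, hC, h⟩ := F.exists_flip_kerC_bounds
  refine ⟨2 * ((2 + 2 * F.G.L) * F.T * C + C), by positivity, fun s hs μ x e => ?_⟩
  obtain ⟨h1, h2, -⟩ := h s hs μ x
  have h3 := norm_le_of_eq_add (F.norm_linOp_le hs μ) (F.dX_eq hs μ x e)
  have hM : 1 + ‖F.linM s μ‖ ≤ 2 + 2 * F.G.L := by linarith only [F.norm_linM_le s μ]
  have h4 := (volt F.T s (F.linM s μ)).le_of_opNorm_le ((norm_volt_le hs _).trans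
    (mul_le_mul_of_nonneg_right hM hT)) (flipCLM (F.kerC s μ x) e)
  have h5 := mul_le_mul_of_nonneg_left ((flipCLM (F.kerC s μ x)).le_of_opNorm_le h1 e)
    (show 0 ≤ (2 + 2 * F.G.L) * F.T by positivity)
  have h6 := (norm_constL_apply_le (α := ℝ) (F.ker₀ s μ x e)).trans
    ((F.ker₀ s μ x).le_of_opNorm_le h2 e)
  have h7 : ‖F.src s μ x e‖ ≤ ‖volt F.T s (F.linM s μ) (flipCLM (F.kerC s μ x) e)‖
      + ‖constL ℝ (Disp d) (F.ker₀ s μ x e)‖ := norm_add_le _ _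
  linarith only [h3, h4, h5, h6, h7]

/-- The source of the integral equation solved by `dX`. -/
def velD (s : ℝ) (μ : PM d) (x e : E d) : Curve d :=
  mulOp (F.linC μ (F.sol s μ)) (F.dX s μ x e) + flipCLM (F.kerC s μ x) e

lemma dX_eq_volt (hs : s ∈ Icc 0 F.T) (μ : PM d) (x e : E d) :
    F.dX s μ x e = volt F.T s (F.linM s μ) (F.velD s μ x e)
      + constL ℝ (Disp d) (F.ker₀ s μ x e) := by
  have h := F.dX_eq hs μ x e
  rw [src_apply] at h
  rw [velD, map_add, add_assoc]
  exact h

lemma exists_norm_velD_le : ∃ C, 0 ≤ C ∧ ∀ s ∈ Icc 0 F.T, ∀ μ x e,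
    ‖F.velD s μ x e‖ ≤ C * ‖e‖ := by
  have hK := F.KL_nonneg
  obtain ⟨C, hC, h⟩ := F.exists_flip_kerC_bounds
  obtain ⟨C₁, hC₁, h₁⟩ := F.exists_norm_dX_le
  refine ⟨2 * F.K.L * C₁ + C, by positivity, fun s hs μ x e => ?_⟩
  have k1 := (F.norm_mulOp_linC_le μ (F.sol s μ) (F.dX s μ x e)).trans
    (mul_le_mul_of_nonneg_left (h₁ s hs μ x e) (by positivity))
  have k2 := (flipCLM (F.kerC s μ x)).le_of_opNorm_le (h s hs μ x).1 e
  have k3 : ‖F.velD s μ x e‖ ≤ ‖mulOp (F.linC μ (F.sol s μ)) (F.dX s μ x e)‖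
      + ‖flipCLM (F.kerC s μ x) e‖ := norm_add_le _ _
  linarith only [k1, k2, k3]

lemma exists_dX_time_lipschitz : ∃ C, 0 ≤ C ∧ ∀ s ∈ Icc 0 F.T, ∀ μ x e t t',
    ‖F.dX s μ x e t' - F.dX s μ x e t‖ ≤ C * ‖e‖ * |t' - t| := by
  obtain ⟨C, hC, h⟩ := F.exists_norm_velD_le
  refine ⟨C, hC, fun s hs μ x e t t' => ?_⟩
  rw [F.dX_eq_volt hs μ x e]
  exact (norm_volt_add_const_time_le _ _ _ _ _ _ _).trans
    (mul_le_mul_of_nonneg_right (h s hs μ x e) (abs_nonneg _))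

lemma kerC_flip_apply (hs : s ∈ Icc 0 F.T) (μ : PM d) (x e : E d) (t : ℝ) :
    flipCLM (F.kerC s μ x) e t = F.K.kerD μ (F.sol s μ t) x (F.posJac s μ t x) e := by
  rw [flipCLM_apply, F.kerC_apply hs]; rfl

lemma exists_lipTorus_kernels : ∃ C, 0 ≤ C ∧ ∀ s ∈ Icc 0 F.T, ∀ μ x e,
    (∀ t, LipTorus (C * ‖e‖) (flipCLM (F.kerC s μ x) e t)) ∧
    LipTorus (C * ‖e‖) (F.ker₀ s μ x e) := by
  have hK := F.KL_nonneg
  have hG := F.GL_nonneg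
  have hl := F.ell_nonneg
  obtain ⟨C, hC, h⟩ := F.exists_posJac_bounds
  refine ⟨(F.K.L + F.G.L) * (1 + F.ell) * C, by positivity, fun s hs μ x e => ⟨fun t => ?_, ?_⟩⟩
  · rw [F.kerC_flip_apply hs]
    refine (F.K.lipTorus_kerD (F.lipTorus_sol hs μ t) μ x _ e).mono ?_
    rw [mul_assoc _ C]
    exact mul_le_mul (mul_le_mul_of_nonneg_right (by linarith only [hG]) (by positivity))
      ((F.posJac s μ t x).le_of_opNorm_le (h s hs μ t x).1 e) (norm_nonneg _) (by positivity)
  · refine (F.G.lipTorus_kerD (F.lipTorus_sol₀ hs μ) μ x _ e).mono ?_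
    rw [mul_assoc _ C]
    exact mul_le_mul (mul_le_mul_of_nonneg_right (by linarith only [hK]) (by positivity))
      ((F.posJac s μ 0 x).le_of_opNorm_le (h s hs μ 0 x).1 e) (norm_nonneg _) (by positivity)

lemma velD_sub_apply (μ : PM d) (x e : E d) (t : ℝ) :
    (F.velD s μ x e - mulOp (F.locC μ (F.sol s μ)) (F.dX s μ x e)) t
      = F.K.nonloc μ (F.sol s μ t) (F.dX s μ x e t) + flipCLM (F.kerC s μ x) e t := by
  change F.K.lin μ (F.sol s μ t) (F.dX s μ x e t) + flipCLM (F.kerC s μ x) e t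
    - F.K.loc μ (F.sol s μ t) (F.dX s μ x e t) = _
  rw [SmoothField.lin_apply]; abel

/-- The derivative in the measure is Lipschitz in the position: the nonlocal terms of the linearized
equation are, and the local ones are treated by `exists_lipTorus_of_eq`. -/
lemma exists_dX_lipTorus : ∃ C, 0 ≤ C ∧ ∀ s ∈ Icc 0 F.T, ∀ μ x e t,
    LipTorus (C * ‖e‖) (F.dX s μ x e t) := by
  have hK := F.KL_nonneg
  have hG := F.GL_nonneg
  have hT := F.T_nonneg
  have hl := F.ell_nonneg
  obtain ⟨C, hC, h⟩ := F.exists_lipTorus_of_eq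
  obtain ⟨C₁, hC₁, h₁⟩ := F.exists_norm_dX_le
  obtain ⟨C₂, hC₂, h₂⟩ := F.exists_norm_velD_le
  obtain ⟨C₃, hC₃, h₃⟩ := F.exists_lipTorus_kernels
  set a : ℝ := F.K.L * (1 + F.ell) * C₁ + F.G.L * (1 + F.ell) * (F.T * C₂) + C₃ with ha
  have ha0 : 0 ≤ a := by positivity
  refine ⟨C * (C₁ + (C₂ + F.K.L * C₁) + a), by positivity, fun s hs μ x e t => ?_⟩
  have hn := norm_nonneg e
  set v := F.dX s μ x e
  set k := F.velD s μ x e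
  set I := ∫ τ in s..(0 : ℝ), k τ
  have hI : ‖I‖ ≤ F.T * (C₂ * ‖e‖) := (norm_initial_integral_le hs k).trans
    (mul_le_mul_of_nonneg_left (h₂ s hs μ x e) hT)
  -- the nonlocal terms are moved to the source
  have hv : v = F.locOp s μ v + (volt F.T s (F.locM s μ) (k - mulOp (F.locC μ (F.sol s μ)) v)
      + constL ℝ (Disp d) (F.G.nonloc μ (F.sol₀ s μ) I + F.ker₀ s μ x e)) := by
    have e1 := F.dX_eq_volt hs μ x e
    have e2 : F.linM s μ = F.locM s μ + F.G.nonloc μ (F.sol₀ s μ) := by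
      rw [linM, locM, SmoothField.lin, add_assoc]
    rw [e2, volt_add_apply] at e1
    refine e1.trans ?_
    rw [map_sub, map_add, locOp, voltOp_apply]
    abel
  have hb : ∀ τ, LipTorus (a * ‖e‖) ((k - mulOp (F.locC μ (F.sol s μ)) v) τ) := fun τ => by
    rw [F.velD_sub_apply]
    refine ((F.K.lipTorus_nonloc hl (F.lipTorus_sol hs μ τ) μ (v τ)).add
      ((h₃ s hs μ x e).1 τ)).mono ?_
    have k1 := mul_le_mul_of_nonneg_left ((v.norm_coe_le_norm τ).trans (h₁ s hs μ x e))
      (show 0 ≤ F.K.L * (1 + F.ell) by positivity)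
    have k2 : 0 ≤ F.G.L * (1 + F.ell) * (F.T * C₂) * ‖e‖ := by positivity
    rw [ha]
    linarith only [k1, k2]
  have hg : LipTorus (a * ‖e‖) (F.G.nonloc μ (F.sol₀ s μ) I + F.ker₀ s μ x e : Disp d) := by
    refine ((F.G.lipTorus_nonloc hl (F.lipTorus_sol₀ hs μ) μ I).add (h₃ s hs μ x e).2).mono ?_
    have k1 := mul_le_mul_of_nonneg_left hI (show 0 ≤ F.G.L * (1 + F.ell) by positivity)
    have k2 : 0 ≤ F.K.L * (1 + F.ell) * C₁ * ‖e‖ := by positivity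
    rw [ha]
    linarith only [k1, k2]
  refine (h s hs μ v _ _ (a * ‖e‖) (by positivity) hb hg hv t).mono ?_
  rw [mul_assoc C]
  refine mul_le_mul_of_nonneg_left ?_ hC
  have k1 := h₁ s hs μ x e
  have k2 := (norm_sub_le k (mulOp (F.locC μ (F.sol s μ)) v)).trans
    (add_le_add (h₂ s hs μ x e) ((F.norm_mulOp_locC_le μ (F.sol s μ) v).trans
      (mul_le_mul_of_nonneg_left k1 hK)))
  linarith only [k1, k2]

/-- Monotonicity of the bound of `norm_volt_sub_volt_le` in its parameters. -/
lemma volt_sub_arith {V M T m δ a σ r b b' J j : ℝ} (h : V ≤ (1 + M) * T * δ + ((1 + M) * σ * b' + J))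
    (hM0 : 0 ≤ M) (hM : 1 + M ≤ m) (hT : 0 ≤ T) (hδ0 : 0 ≤ δ) (hδ : δ ≤ a) (hσ0 : 0 ≤ σ) (hσ : σ ≤ r)
    (hb0 : 0 ≤ b') (hb : b' ≤ b) (hJ : J ≤ j) : V ≤ m * T * a + (m * r * b + j) := by
  have hm : 0 ≤ m := by linarith
  have ha := hδ0.trans hδ
  have hr := hσ0.trans hσ
  refine h.trans ?_
  gcongr

/-- The integral operator, with the linearized initial condition, is Lipschitz in the initial time
and in the measure on curves that are Lipschitz in the position. -/
lemma exists_norm_volt_linM_sub_le : ∃ C, 0 ≤ C ∧ ∀ s ∈ Icc 0 F.T, ∀ s' ∈ Icc 0 F.T, ∀ μ ν,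
    ∀ (k k' : Curve d) (a b β r : ℝ), ‖k' - k‖ ≤ a → ‖k‖ ≤ b → 0 ≤ β → (∀ t, LipTorus β (k t)) →
      |s' - s| + wass μ ν ≤ r →
      ‖volt F.T s' (F.linM s' ν) k' - volt F.T s (F.linM s μ) k‖ ≤ C * (a + (b + β) * r) := by
  have hG := F.GL_nonneg
  have hT := F.T_nonneg
  obtain ⟨C₃, hC₃, h₃⟩ := F.exists_lin_sub_le
  refine ⟨(2 + 2 * F.G.L) * F.T + (2 + 2 * F.G.L) + C₃ * F.T, by positivity,
    fun s hs s' hs' μ ν k k' a b β r ha hb hβ hk hr => ?_⟩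
  obtain ⟨-, hM⟩ := h₃ s hs s' hs' μ ν
  have hσ0 := abs_nonneg (s' - s)
  have hW := wass_nonneg μ ν
  have hr0 : 0 ≤ r := (add_nonneg hσ0 hW).trans hr
  have hb0 : 0 ≤ b := (norm_nonneg _).trans hb
  have ha0 : 0 ≤ a := (norm_nonneg _).trans ha
  have a4 := F.lipTorus_initial_integral hs hβ hk
  have a5 := (norm_initial_integral_le hs k).trans (mul_le_mul_of_nonneg_left hb hT)
  have a6 := (hM _ _ (mul_nonneg hT hβ) a4).trans
    (mul_le_mul (mul_le_mul_of_nonneg_left (add_le_add a5 le_rfl) hC₃) hr (add_nonneg hσ0 hW)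
      (by positivity))
  have a7 := volt_sub_arith (norm_volt_sub_volt_le (s := s) hs' (F.linM s μ) (F.linM s' ν) k k')
    (norm_nonneg _) (m := 2 + 2 * F.G.L) (by linarith only [F.norm_linM_le s' ν]) hT
    (norm_nonneg _) ha hσ0 (show |s' - s| ≤ r by linarith only [hW, hr]) (norm_nonneg _) hb a6
  refine a7.trans ?_
  have p1 : 0 ≤ (2 + 2 * F.G.L) * a := by positivity
  have p2 : 0 ≤ C₃ * F.T * a := by positivity
  have p3 : 0 ≤ (2 + 2 * F.G.L) * F.T * ((b + β) * r) := by positivity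
  have p4 : 0 ≤ (2 + 2 * F.G.L) * (β * r) := by positivity
  linarith only [p1, p2, p3, p4]

lemma exists_norm_linOp_sub_apply_le : ∃ C, 0 ≤ C ∧ ∀ s ∈ Icc 0 F.T, ∀ s' ∈ Icc 0 F.T, ∀ μ ν,
    ∀ (w : Curve d) (b β r : ℝ), ‖w‖ ≤ b → 0 ≤ β → (∀ t, LipTorus β (w t)) →
      |s' - s| + wass μ ν ≤ r →
      ‖F.linOp s' ν w - F.linOp s μ w‖ ≤ C * ((b + β) * r) := by
  have hK := F.KL_nonneg
  have hl := F.ell_nonneg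
  obtain ⟨C, hC, h⟩ := F.exists_norm_volt_linM_sub_le
  obtain ⟨C₃, hC₃, h₃⟩ := F.exists_lin_sub_le
  refine ⟨C * (C₃ + (2 * F.K.L + 2 * (F.K.L * (1 + F.ell)) + F.K.L)), by positivity,
    fun s hs s' hs' μ ν w b β r hb hβ hw hr => ?_⟩
  obtain ⟨hc, -⟩ := h₃ s hs s' hs' μ ν
  have hσW := add_nonneg (abs_nonneg (s' - s)) (wass_nonneg μ ν)
  have hr0 : 0 ≤ r := hσW.trans hr
  have hb0 : 0 ≤ b := (norm_nonneg _).trans hb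
  have a1 := (hc w β hβ hw).trans
    (mul_le_mul (mul_le_mul_of_nonneg_left (add_le_add hb le_rfl) hC₃) hr hσW (by positivity))
  have a2 := (F.norm_mulOp_linC_le μ (F.sol s μ) w).trans
    (mul_le_mul_of_nonneg_left hb (by positivity))
  have a3 : ∀ t, LipTorus (2 * (F.K.L * (1 + F.ell) * b) + F.K.L * β)
      (mulOp (F.linC μ (F.sol s μ)) w t) := fun t => by
    refine (F.K.lipTorus_lin hl (F.lipTorus_sol hs μ t) μ (hw t)).mono ?_
    have := mul_le_mul_of_nonneg_left ((w.norm_coe_le_norm t).trans hb)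
      (show 0 ≤ F.K.L * (1 + F.ell) by positivity)
    linarith only [this]
  refine (h s hs s' hs' μ ν _ _ _ _ _ r a1 a2 (by positivity) a3 hr).trans ?_
  rw [mul_assoc C]
  refine mul_le_mul_of_nonneg_left ?_ hC
  have p1 : 0 ≤ 2 * F.K.L * (β * r) := by positivity
  have p2 : 0 ≤ 2 * (F.K.L * (1 + F.ell)) * (β * r) := by positivity
  have p3 : 0 ≤ F.K.L * (b * r) := by positivity
  linarith only [p1, p2, p3]

lemma exists_norm_src_sub_le : ∃ C, 0 ≤ C ∧ ∀ s ∈ Icc 0 F.T, ∀ s' ∈ Icc 0 F.T, ∀ μ ν x y e r,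
    |s' - s| + torusDist y x + wass μ ν ≤ r →
      ‖F.src s' ν y e - F.src s μ x e‖ ≤ C * (‖e‖ * r) := by
  obtain ⟨C, hC, h⟩ := F.exists_norm_volt_linM_sub_le
  obtain ⟨C₄, hC₄, h₄⟩ := F.exists_flip_kerC_bounds
  obtain ⟨C₅, hC₅, h₅⟩ := F.exists_lipTorus_kernels
  refine ⟨C * (C₄ + (C₄ + C₅)) + C₄, by positivity, fun s hs s' hs' μ ν x y e r hr => ?_⟩
  obtain ⟨f1, -, f3⟩ := h₄ s hs μ x
  obtain ⟨f4, f5⟩ := f3 s' hs' ν y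
  have ht := torusDist_nonneg y x
  have hr' : |s' - s| + wass μ ν ≤ r := by linarith only [ht, hr]
  have a0 : ‖flipCLM (F.kerC s μ x) e‖ ≤ C₄ * ‖e‖ := (flipCLM (F.kerC s μ x)).le_of_opNorm_le f1 e
  have a1 : ‖flipCLM (F.kerC s' ν y) e - flipCLM (F.kerC s μ x) e‖ ≤ C₄ * r * ‖e‖ :=
    (flipCLM (F.kerC s' ν y) - flipCLM (F.kerC s μ x)).le_of_opNorm_le
      (f4.trans (mul_le_mul_of_nonneg_left hr hC₄)) e
  have a2 : ‖F.ker₀ s' ν y e - F.ker₀ s μ x e‖ ≤ C₄ * r * ‖e‖ :=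
    (F.ker₀ s' ν y - F.ker₀ s μ x).le_of_opNorm_le
      (f5.trans (mul_le_mul_of_nonneg_left hr hC₄)) e
  have a3 := h s hs s' hs' μ ν _ _ _ _ _ r a1 a0 (by positivity) (h₅ s hs μ x e).1 hr'
  have a4 := (norm_constL_apply_le (α := ℝ) (F.ker₀ s' ν y e - F.ker₀ s μ x e)).trans a2
  have e1 : F.src s' ν y e - F.src s μ x e
      = (volt F.T s' (F.linM s' ν) (flipCLM (F.kerC s' ν y) e)
          - volt F.T s (F.linM s μ) (flipCLM (F.kerC s μ x) e))
        + constL ℝ (Disp d) (F.ker₀ s' ν y e - F.ker₀ s μ x e) := by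
    rw [src_apply, src_apply, map_sub]; abel
  rw [e1]
  refine ((norm_add_le _ _).trans (add_le_add a3 a4)).trans (le_of_eq (by ring))

/-- The derivative in the measure is Lipschitz in the initial time, in the point where mass is
displaced and in the measure. -/
lemma exists_norm_dX_sub_le : ∃ C, 0 ≤ C ∧ ∀ s ∈ Icc 0 F.T, ∀ s' ∈ Icc 0 F.T, ∀ μ ν x y e,
    ‖F.dX s' ν y e - F.dX s μ x e‖ ≤ C * ‖e‖ * (|s' - s| + torusDist y x + wass μ ν) := by
  obtain ⟨C₁, hC₁, h₁⟩ := F.exists_norm_dX_le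
  obtain ⟨C₂, hC₂, h₂⟩ := F.exists_dX_lipTorus
  obtain ⟨C₃, hC₃, h₃⟩ := F.exists_norm_linOp_sub_apply_le
  obtain ⟨C₄, hC₄, h₄⟩ := F.exists_norm_src_sub_le
  refine ⟨2 * (C₃ * (C₁ + C₂) + C₄), by positivity, fun s hs s' hs' μ ν x y e => ?_⟩
  have ht := torusDist_nonneg y x
  have k1 := h₃ s hs s' hs' μ ν (F.dX s μ x e) _ (C₂ * ‖e‖) (|s' - s| + torusDist y x + wass μ ν)
    (h₁ s hs μ x e) (mul_nonneg hC₂ (norm_nonneg e)) (h₂ s hs μ x e) (by linarith only [ht])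
  have k2 := h₄ s hs s' hs' μ ν x y e _ le_rfl
  refine (norm_sub_le_of_eq_add (F.norm_linOp_le hs' ν) (F.dX_eq hs μ x e)
    (F.dX_eq hs' ν y e)).trans ?_
  refine (mul_le_mul_of_nonneg_left (add_le_add k1 k2) zero_le_two).trans (le_of_eq (by ring))

end FlowData

/-! ### Joint expansion of the flow -/

namespace FlowData

variable (F : FlowData d) {s s' : ℝ}

/-- The derivative of the flow in the measure, at the time `t` and the position `q`. -/
def dXF (s : ℝ) (μ : PM d) (t : ℝ) (q x : E d) : E d →L[ℝ] E d × E d :=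
  (BoundedContinuousFunction.evalCLM ℝ q).comp
    ((BoundedContinuousFunction.evalCLM ℝ t).comp (F.dX s μ x))

lemma dXF_apply (s : ℝ) (μ : PM d) (t : ℝ) (q x e : E d) :
    F.dXF s μ t q x e = F.dX s μ x e t q := rfl

/-- The derivative in the measure is Lipschitz in all its variables. -/
lemma exists_norm_dXF_sub_le : ∃ C, 0 ≤ C ∧ ∀ s ∈ Icc 0 F.T, ∀ s' ∈ Icc 0 F.T, ∀ μ ν t t' q q' x y,
    ‖F.dXF s' ν t' q' y - F.dXF s μ t q x‖
      ≤ C * (|t' - t| + |s' - s| + torusDist q' q + torusDist y x + wass μ ν) := by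
  obtain ⟨C₁, hC₁, h₁⟩ := F.exists_dX_time_lipschitz
  obtain ⟨C₂, hC₂, h₂⟩ := F.exists_dX_lipTorus
  obtain ⟨C₃, hC₃, h₃⟩ := F.exists_norm_dX_sub_le
  refine ⟨C₁ + C₂ + C₃, by positivity, fun s hs s' hs' μ ν t t' q q' x y => ?_⟩
  have hW := wass_nonneg μ ν
  have ht := torusDist_nonneg q' q
  have ht' := torusDist_nonneg y x
  refine ContinuousLinearMap.opNorm_le_bound _ (by positivity) fun e => ?_
  have e1 : (F.dXF s' ν t' q' y - F.dXF s μ t q x) e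
      = ((F.dX s' ν y e - F.dX s μ x e) t' q' + (F.dX s μ x e t' - F.dX s μ x e t) q')
        + (F.dX s μ x e t q' - F.dX s μ x e t q) := by
    rw [sub_apply, dXF_apply, dXF_apply]
    simp only [BoundedContinuousFunction.coe_sub, Pi.sub_apply]
    abel
  have a1 : ‖(F.dX s' ν y e - F.dX s μ x e) t' q'‖
      ≤ C₃ * ‖e‖ * (|s' - s| + torusDist y x + wass μ ν) :=
    (((F.dX s' ν y e - F.dX s μ x e) t').norm_coe_le_norm q').trans
      (((F.dX s' ν y e - F.dX s μ x e).norm_coe_le_norm t').trans (h₃ s hs s' hs' μ ν x y e))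
  have a2 : ‖(F.dX s μ x e t' - F.dX s μ x e t) q'‖ ≤ C₁ * ‖e‖ * |t' - t| :=
    ((F.dX s μ x e t' - F.dX s μ x e t).norm_coe_le_norm q').trans (h₁ s hs μ x e t t')
  have a3 : ‖F.dX s μ x e t q' - F.dX s μ x e t q‖ ≤ C₂ * ‖e‖ * torusDist q' q :=
    h₂ s hs μ x e t q q'
  rw [e1]
  refine (norm_add_le _ _).trans ((add_le_add ((norm_add_le _ _).trans (add_le_add a1 a2))
    a3).trans ?_)
  have hn := norm_nonneg e
  have b1 : 0 ≤ (C₁ + C₂) * ‖e‖ * (|s' - s| + torusDist y x + wass μ ν) := by positivity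
  have b2 : 0 ≤ (C₂ + C₃) * ‖e‖ * |t' - t| := by positivity
  have b3 : 0 ≤ (C₁ + C₃) * ‖e‖ * torusDist q' q := by positivity
  linarith only [b1, b2, b3]

lemma integrable_dXF (hs : s ∈ Icc 0 F.T) {μ ν : PM d} {γ : Measure (E d × E d)}
    (hγ : IsOptPlan γ μ ν) (t : ℝ) (q : E d) :
    Integrable (fun z => F.dXF s μ t q z.1 (z.2 - z.1)) γ :=
  ((BoundedContinuousFunction.evalCLM (β := E d × E d) ℝ q).comp
    (BoundedContinuousFunction.evalCLM (β := Disp d) ℝ t)).integrable_comp (F.integrable_dX hs hγ)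

lemma integral_dXF (hs : s ∈ Icc 0 F.T) {μ ν : PM d} {γ : Measure (E d × E d)}
    (hγ : IsOptPlan γ μ ν) (t : ℝ) (q : E d) :
    ∫ z, F.dXF s μ t q z.1 (z.2 - z.1) ∂γ = (∫ z, F.dX s μ z.1 (z.2 - z.1) ∂γ) t q :=
  ((BoundedContinuousFunction.evalCLM (β := E d × E d) ℝ q).comp
    (BoundedContinuousFunction.evalCLM (β := Disp d) ℝ t)).integral_comp_comm
      (F.integrable_dX hs hγ)

lemma exists_norm_integral_dXF_sub_le : ∃ C, 0 ≤ C ∧ ∀ s ∈ Icc 0 F.T, ∀ (μ ν : PM d)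
    (γ : Measure (E d × E d)), IsOptPlan γ μ ν → ∀ t t' q q',
    ‖∫ z, F.dXF s μ t' q' z.1 (z.2 - z.1) ∂γ - ∫ z, F.dXF s μ t q z.1 (z.2 - z.1) ∂γ‖
      ≤ C * (|t' - t| + ‖q' - q‖) * wass μ ν := by
  obtain ⟨C, hC, h⟩ := F.exists_norm_dXF_sub_le
  refine ⟨C, hC, fun s hs μ ν γ hγ t t' q q' => ?_⟩
  have := hγ.1.isProbabilityMeasure
  rw [← integral_sub (F.integrable_dXF hs hγ t' q') (F.integrable_dXF hs hγ t q)]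
  have h1 : Integrable (fun z : E d × E d => z.2 - z.1) γ :=
    hγ.finiteCost.integrable (by norm_num)
  refine (norm_integral_le_of_norm_le (h1.norm.const_mul (C * (|t' - t| + ‖q' - q‖)))
    (ae_of_all _ fun z => ?_)).trans ?_
  · rw [← sub_apply]
    refine (F.dXF s μ t' q' z.1 - F.dXF s μ t q z.1).le_of_opNorm_le
      ((h s hs s hs μ μ t t' q q' z.1 z.1).trans (mul_le_mul_of_nonneg_left ?_ hC)) _
    rw [sub_self, abs_zero, torusDist_self, wass_self, add_zero, add_zero, add_zero]
    exact add_le_add le_rfl (torusDist_le_norm _ _)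
  · rw [integral_const_mul]
    exact mul_le_mul_of_nonneg_left hγ.integral_norm_le (by positivity)

lemma sol_sub_eq_integral (hs : s ∈ Icc 0 F.T) (μ : PM d) {t t' : ℝ} (ht : t ∈ Icc 0 F.T)
    (ht' : t' ∈ Icc 0 F.T) :
    F.sol s μ t' - F.sol s μ t = ∫ τ in t..t', F.vel μ (F.sol s μ) τ := by
  conv_lhs => rw [← F.psi_sol hs μ, psi_apply, psi_apply, clampT_of_mem ht, clampT_of_mem ht']
  rw [add_sub_add_right_eq_sub, sub_sub_sub_cancel_right]
  exact intervalIntegral.integral_interval_sub_left (intervalIntegrable_bcf _ _ _)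
    (intervalIntegrable_bcf _ _ _)

lemma norm_sol_time_sub_sub_le (hs : s ∈ Icc 0 F.T) (μ : PM d) {t t' : ℝ} (ht : t ∈ Icc 0 F.T)
    (ht' : t' ∈ Icc 0 F.T) :
    ‖F.sol s μ t' - F.sol s μ t - (t' - t) • F.vel μ (F.sol s μ) t‖
      ≤ 2 * F.K.L ^ 2 * (t' - t) ^ 2 := by
  have hK := F.KL_nonneg
  have e : F.sol s μ t' - F.sol s μ t - (t' - t) • F.vel μ (F.sol s μ) t
      = ∫ τ in t..t', (F.vel μ (F.sol s μ) τ - F.vel μ (F.sol s μ) t) := by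
    rw [F.sol_sub_eq_integral hs μ ht ht',
      intervalIntegral.integral_sub (intervalIntegrable_bcf _ _ _) intervalIntegrable_const,
      intervalIntegral.integral_const]
  have h1 : ∀ τ ∈ uIoc t t', ‖F.vel μ (F.sol s μ) τ - F.vel μ (F.sol s μ) t‖
      ≤ 2 * F.K.L ^ 2 * |t' - t| := fun τ hτ => by
    rw [vel_apply, vel_apply]
    refine (F.K.norm_nem_sub_same_le μ _ _).trans ((mul_le_mul_of_nonneg_left
      (F.norm_sol_time_sub_le hs μ t τ) (by positivity)).trans ?_)
    have h2 : |τ - t| ≤ |t' - t| := abs_sub_left_of_mem_uIcc (uIoc_subset_uIcc hτ)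
    calc 2 * F.K.L * (F.K.L * |τ - t|) = 2 * F.K.L ^ 2 * |τ - t| := by ring
      _ ≤ _ := by gcongr
  have h3 := intervalIntegral.norm_integral_le_of_norm_le_const h1
  rw [e]
  refine h3.trans (le_of_eq ?_)
  rw [← sq_abs (t' - t)]; ring

/-- The flow on phase space. -/
def flow (s : ℝ) (μ : PM d) (t : ℝ) (q : E d) : E d × E d := pt (F.sol s μ t) q

lemma hasDerivWithinAt_flow (hs : s ∈ Icc 0 F.T) (μ : PM d) {t : ℝ} (ht : t ∈ Icc 0 F.T) (q : E d) :
    HasDerivWithinAt (fun τ => F.flow s μ τ q) (F.vel μ (F.sol s μ) t q) (Icc 0 F.T) t := by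
  have h1 : (fun τ => F.flow s μ τ q - F.flow s μ t q - (τ - t) • F.vel μ (F.sol s μ) t q)
      =O[𝓝[Icc 0 F.T] t] fun τ => ‖τ - t‖ ^ 2 := by
    refine Asymptotics.IsBigO.of_bound (2 * F.K.L ^ 2) ?_
    filter_upwards [self_mem_nhdsWithin] with τ hτ
    rw [Real.norm_of_nonneg (by positivity), Real.norm_eq_abs, sq_abs, flow, flow, pt_sub_pt]
    exact ((F.sol s μ τ - F.sol s μ t - (τ - t) • F.vel μ (F.sol s μ) t).norm_coe_le_norm q).trans
      (F.norm_sol_time_sub_sub_le hs μ ht hτ)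
  rw [hasDerivWithinAt_iff_isLittleO]
  exact h1.trans_isLittleO ((Asymptotics.isLittleO_pow_sub_sub t one_lt_two).mono
    nhdsWithin_le_nhds)

lemma hasFDerivAt_flow (hs : s ∈ Icc 0 F.T) (μ : PM d) (t : ℝ) (q : E d) :
    HasFDerivAt (F.flow s μ t) (ContinuousLinearMap.inl ℝ (E d) (E d) + F.jacF s μ t q) q :=
  (ContinuousLinearMap.inl ℝ (E d) (E d)).hasFDerivAt.add (F.hasFDerivAt_sol hs μ t q)

/-- Young's inequality for the mixed terms of the joint expansion. -/
lemma expansion_arith {a b w C₁ C₂ C₃ C₄ C₅ x₁ x₂ x₃ x₄ x₅ : ℝ} (h₁ : x₁ ≤ C₁ * w ^ 2)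
    (h₂ : x₂ ≤ C₂ * a ^ 2) (h₃ : x₃ ≤ a * (C₃ * b)) (h₄ : x₄ ≤ C₄ * b ^ 2)
    (h₅ : x₅ ≤ C₅ * (a + b) * w) (p₁ : 0 ≤ C₁) (p₂ : 0 ≤ C₂) (p₃ : 0 ≤ C₃) (p₄ : 0 ≤ C₄)
    (p₅ : 0 ≤ C₅) :
    x₁ + x₂ + x₃ + x₄ + x₅ ≤ (C₁ + C₂ + C₃ + C₄ + C₅) * (a ^ 2 + b ^ 2 + w ^ 2) := by
  have k1 := mul_nonneg p₃ (sq_nonneg (a - b))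
  have k2 := mul_nonneg p₅ (sq_nonneg (a - w))
  have k3 := mul_nonneg p₅ (sq_nonneg (b - w))
  have k4 := mul_nonneg p₃ (add_nonneg (sq_nonneg a) (add_nonneg (sq_nonneg b) (sq_nonneg w)))
  have k5 := mul_nonneg p₁ (add_nonneg (sq_nonneg a) (sq_nonneg b))
  have k6 := mul_nonneg p₂ (add_nonneg (sq_nonneg b) (sq_nonneg w))
  have k7 := mul_nonneg p₄ (add_nonneg (sq_nonneg a) (sq_nonneg w))
  have k8 := mul_nonneg p₃ (sq_nonneg a)
  have k9 := mul_nonneg p₃ (sq_nonneg b)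
  have k10 := mul_nonneg p₃ (sq_nonneg w)
  have k11 := mul_nonneg p₅ (sq_nonneg a)
  have k12 := mul_nonneg p₅ (sq_nonneg b)
  linarith only [h₁, h₂, h₃, h₄, h₅, k1, k2, k3, k4, k5, k6, k7, k8, k9, k10, k11, k12]

/-- The flow has a first order expansion in time, position and measure, with a quadratic
remainder. -/
lemma exists_norm_flow_sub_le : ∃ C, 0 ≤ C ∧ ∀ s ∈ Icc 0 F.T, ∀ t ∈ Icc 0 F.T, ∀ t' ∈ Icc 0 F.T,
    ∀ (q q' : E d) (μ ν : PM d) (γ : Measure (E d × E d)), IsOptPlan γ μ ν →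
    ‖F.flow s ν t' q' - F.flow s μ t q - (t' - t) • F.vel μ (F.sol s μ) t q
        - (ContinuousLinearMap.inl ℝ (E d) (E d) + F.jacF s μ t q) (q' - q)
        - ∫ z, F.dXF s μ t q z.1 (z.2 - z.1) ∂γ‖
      ≤ C * ((t' - t) ^ 2 + ‖q' - q‖ ^ 2 + wass μ ν ^ 2) := by
  have hK := F.KL_nonneg
  have hl := F.ell_nonneg
  obtain ⟨C₁, hC₁, h₁⟩ := F.exists_norm_sol_sub_integral_dX_le
  obtain ⟨C₄, hC₄, h₄⟩ := F.exists_norm_sol_sub_sub_jacF_le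
  obtain ⟨C₅, hC₅, h₅⟩ := F.exists_norm_integral_dXF_sub_le
  refine ⟨C₁ + 2 * F.K.L ^ 2 + F.K.L * (1 + F.ell) + C₄ + C₅, by positivity,
    fun s hs t ht t' ht' q q' μ ν γ hγ => ?_⟩
  set J := ∫ z, F.dX s μ z.1 (z.2 - z.1) ∂γ with hJ
  set U := F.sol s μ with hU
  set V := F.sol s ν with hV
  set v := F.vel μ U t with hv
  have a1 : ‖(V - U - J) t' q'‖ ≤ C₁ * wass μ ν ^ 2 :=
    (((V - U - J) t').norm_coe_le_norm q').trans
      (((V - U - J).norm_coe_le_norm t').trans (h₁ s hs μ ν γ hγ))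
  have a2 : ‖(U t' - U t - (t' - t) • v) q'‖ ≤ 2 * F.K.L ^ 2 * |t' - t| ^ 2 := by
    rw [sq_abs]
    exact ((U t' - U t - (t' - t) • v).norm_coe_le_norm q').trans
      (F.norm_sol_time_sub_sub_le hs μ ht ht')
  have a3 : ‖(t' - t) • (v q' - v q)‖ ≤ |t' - t| * (F.K.L * (1 + F.ell) * ‖q' - q‖) := by
    rw [norm_smul, Real.norm_eq_abs]
    refine mul_le_mul_of_nonneg_left ?_ (abs_nonneg _)
    exact (F.K.lipTorus_nem (F.lipTorus_sol hs μ t) μ).norm_sub_le (by positivity) q q'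
  have a4 := h₄ s hs μ t q q'
  have a5 := h₅ s hs μ ν γ hγ t t' q q'
  -- first the measure is changed at `(t', q')`, then the time at `q'`, then the position
  have e : F.flow s ν t' q' - F.flow s μ t q - (t' - t) • v q
        - (ContinuousLinearMap.inl ℝ (E d) (E d) + F.jacF s μ t q) (q' - q)
        - ∫ z, F.dXF s μ t q z.1 (z.2 - z.1) ∂γ
      = (V - U - J) t' q' + (U t' - U t - (t' - t) • v) q' + (t' - t) • (v q' - v q)
        + (U t q' - U t q - F.jacF s μ t q (q' - q))
        + (∫ z, F.dXF s μ t' q' z.1 (z.2 - z.1) ∂γ - ∫ z, F.dXF s μ t q z.1 (z.2 - z.1) ∂γ) := by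
    have e1 : F.flow s ν t' q' - F.flow s μ t q
        = ContinuousLinearMap.inl ℝ (E d) (E d) (q' - q) + (V t' q' - U t q) := by
      have : ContinuousLinearMap.inl ℝ (E d) (E d) (q' - q)
          = ((q', 0) : E d × E d) - ((q, 0) : E d × E d) := by
        simp
      rw [this, flow, flow, pt, pt]; abel
    rw [e1, add_apply, F.integral_dXF hs hγ t' q', ← hJ]
    simp only [BoundedContinuousFunction.coe_sub, BoundedContinuousFunction.coe_smul, Pi.sub_apply,
      smul_sub]
    abel
  rw [e, ← sq_abs (t' - t)]
  refine (norm_add_le _ _).trans ((add_le_add ((norm_add_le _ _).trans (add_le_add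
    ((norm_add_le _ _).trans (add_le_add (norm_add_le _ _) le_rfl)) le_rfl)) le_rfl).trans ?_)
  exact expansion_arith a1 a2 a3 a4 a5 hC₁ (by positivity) (by positivity) hC₄ hC₅

end FlowData

/-! ### The flow and the characteristics -/

lemma LipTorus.eq_of_torusEq {W : Type} [NormedAddCommGroup W] {ℓ : ℝ} {w : E d → W}
    (h : LipTorus ℓ w) {x y : E d} (hxy : TorusEq x y) : w x = w y := by
  have h1 := h y x
  rw [torusDist_eq_zero_of_torusEq hxy, mul_zero] at h1
  exact sub_eq_zero.1 (norm_le_zero_iff.1 h1)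

/-- A continuous function that stays below a level as long as it does not exceed it never exceeds
it. -/
lemma forall_le_of_bootstrap {φ : ℝ → ℝ} {T R : ℝ} (hφ : ContinuousOn φ (Icc 0 T))
    (h : ∀ t ∈ Icc 0 T, (∀ τ ∈ Icc 0 t, φ τ ≤ R) → φ t < R) (h0 : φ 0 ≤ R) :
    ∀ t ∈ Icc 0 T, φ t ≤ R := by
  by_contra! hc
  obtain ⟨t, ht, hR⟩ := hc
  have hcross : ∀ τ ∈ Icc 0 t, R ≤ φ τ → ∃ c ∈ Icc 0 τ, φ c = R := fun τ hτ h1 =>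
    intermediate_value_Icc hτ.1 (hφ.mono (Icc_subset_Icc le_rfl (hτ.2.trans ht.2))) ⟨h0, h1⟩
  have hclosed : IsClosed (Icc 0 t ∩ φ ⁻¹' {R}) :=
    (hφ.mono (Icc_subset_Icc le_rfl ht.2)).preimage_isClosed_of_isClosed isClosed_Icc
      isClosed_singleton
  obtain ⟨c₀, hc₀, e₀⟩ := hcross t ⟨ht.1, le_rfl⟩ hR.le
  -- the first time at which the level is reached
  obtain ⟨c, ⟨hc, hφc⟩, hmin⟩ := (isCompact_Icc.of_isClosed_subset hclosed
    inter_subset_left).exists_isLeast ⟨c₀, hc₀, e₀⟩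
  refine (h c ⟨hc.1, hc.2.trans ht.2⟩ fun τ hτ => ?_).ne hφc
  by_contra! hτR
  obtain ⟨b, hb, hbR⟩ := hcross τ ⟨hτ.1, hτ.2.trans hc.2⟩ hτR.le
  have h1 : c ≤ b := hmin ⟨⟨hb.1, hb.2.trans (hτ.2.trans hc.2)⟩, hbR⟩
  have h2 : τ = c := le_antisymm hτ.2 (h1.trans hb.2)
  rw [h2] at hτR
  exact hτR.ne' hφc

namespace FlowData

variable (F : FlowData d) {s : ℝ}

lemma pt_psi_fst (s : ℝ) (μ : PM d) (U : Curve d) (t : ℝ) (q : E d) :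
    (pt (F.psi s μ U t) q).1 = q + ((∫ τ in s..clampT F.T t, F.vel μ U τ) q).1 := by
  rw [psi_apply]
  simp only [pt, BoundedContinuousFunction.coe_add, BoundedContinuousFunction.coe_sub, Pi.add_apply,
    Pi.sub_apply, Prod.fst_add, Prod.fst_sub, momL_apply, SmoothField.nem_apply, F.G_fst, sub_zero,
    add_zero]

lemma pt_psi_snd (s : ℝ) (μ : PM d) (U : Curve d) (t : ℝ) (q : E d) :
    (pt (F.psi s μ U t) q).2 = ((∫ τ in (0 : ℝ)..clampT F.T t, F.vel μ U τ) q).2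
      + (F.G.nem μ (F.init s μ U) q).2 := by
  have e : ∫ τ in (0 : ℝ)..clampT F.T t, F.vel μ U τ
      = (∫ τ in s..clampT F.T t, F.vel μ U τ) - F.init s μ U :=
    (intervalIntegral.integral_interval_sub_left (intervalIntegrable_bcf _ _ _)
      (intervalIntegrable_bcf _ _ _)).symm
  rw [psi_apply, e]
  simp only [pt, BoundedContinuousFunction.coe_add, BoundedContinuousFunction.coe_sub, Pi.add_apply,
    Pi.sub_apply, Prod.snd_add, Prod.snd_sub, momL_apply, zero_add]

/-- The momenta of the flow are bounded by `F.G.L + 1`, because the velocity is bounded on all of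
phase space and the time interval is short. -/
lemma norm_pt_psi_snd_le (s : ℝ) (μ : PM d) (U : Curve d) (t : ℝ) (q : E d) :
    ‖(pt (F.psi s μ U t) q).2‖ ≤ F.G.L + 1 := by
  have h0 := clampT_mem F.T_nonneg t
  rw [pt_psi_snd]
  have h1 : ‖∫ τ in (0 : ℝ)..clampT F.T t, F.vel μ U τ‖ ≤ F.K.L * F.T :=
    norm_integral_le_of_mem_Icc (left_mem_Icc.2 F.T_nonneg) h0 F.KL_nonneg
      fun τ _ => F.K.norm_nem_le μ _
  have h2 := (norm_snd_le _).trans (((∫ τ in (0 : ℝ)..clampT F.T t,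
    F.vel μ U τ).norm_coe_le_norm q).trans h1)
  have h3 := (norm_snd_le (F.G.nem μ (F.init s μ U) q)).trans (F.G.smooth.bound _ _)
  have h4 := F.KT_le
  refine (norm_add_le _ _).trans ?_
  linarith

lemma integral_vel_apply (μ : PM d) (U : Curve d) (a b : ℝ) (q : E d) :
    (∫ τ in a..b, F.vel μ U τ) q = ∫ τ in a..b, F.vel μ U τ q :=
  ((BoundedContinuousFunction.evalCLM (β := E d × E d) ℝ q).intervalIntegral_comp_comm
    (intervalIntegrable_bcf (F.vel μ U) a b)).symm

lemma intervalIntegrable_vel (μ : PM d) (U : Curve d) (a b : ℝ) (q : E d) :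
    IntervalIntegrable (fun τ => F.vel μ U τ q) volume a b :=
  ((BoundedContinuousFunction.evalCLM (β := E d × E d) ℝ q).continuous.comp
    (F.vel μ U).continuous).intervalIntegrable a b

lemma integral_vel_apply_fst (μ : PM d) (U : Curve d) (a b : ℝ) (q : E d) :
    ((∫ τ in a..b, F.vel μ U τ) q).1 = ∫ τ in a..b, (F.vel μ U τ q).1 := by
  rw [integral_vel_apply]
  exact ((ContinuousLinearMap.fst ℝ (E d) (E d)).intervalIntegral_comp_comm
    (F.intervalIntegrable_vel μ U a b q)).symm

lemma integral_vel_apply_snd (μ : PM d) (U : Curve d) (a b : ℝ) (q : E d) :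
    ((∫ τ in a..b, F.vel μ U τ) q).2 = ∫ τ in a..b, (F.vel μ U τ q).2 := by
  rw [integral_vel_apply]
  exact ((ContinuousLinearMap.snd ℝ (E d) (E d)).intervalIntegral_comp_comm
    (F.intervalIntegrable_vel μ U a b q)).symm

/-- The velocity of the flow is that of the characteristic system as long as the momentum is at most
`F.G.L + 1`, which bounds the momenta that the flow reaches, and the initial momentum is the one of
the characteristic system. -/
structure Represents (F : FlowData d) (H : E d → E d → ℝ) (Fc g : E d → PM d → ℝ) : Prop where
  field : ∀ z μ, ‖z.2‖ ≤ F.G.L + 1 → F.K.f z μ = hamField H z - (0, gradq Fc z.1 μ)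
  initial : ∀ z μ, F.G.f z μ = (0, gradq g z.1 μ)

variable {F} {H : E d → E d → ℝ} {Fc g : E d → PM d → ℝ}

lemma Represents.vel_apply (hF : F.Represents H Fc g) (μ : PM d) {U : Curve d}
    {Z : ℝ → E d → E d × E d} {τ : ℝ} (hZ : ∀ q, Z τ q = pt (U τ) q)
    (hR : ∀ q, ‖(pt (U τ) q).2‖ ≤ F.G.L + 1) (q : E d) :
    F.vel μ U τ q = (gradient (fun p => H (Z τ q).1 p) (Z τ q).2,
      -(gradient (fun q' => H q' (Z τ q).2) (Z τ q).1
        + gradq Fc (Z τ q).1 (push (fun x => (Z τ x).1) μ))) := by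
  have e : push (fun x => (Z τ x).1) μ = law μ (U τ) :=
    congrArg (push · μ) (funext fun x => by rw [hZ]; rfl)
  rw [e, hZ q, FlowData.vel_apply, SmoothField.nem_apply, hF.field _ _ (hR q), hamField]
  ext1
  · simp
  · simp only [Prod.snd_sub]; abel

/-- As long as the momenta are in the region where the vector field has not been modified, `psi` is
the characteristic operator. -/
lemma Represents.charOp_fst (hF : F.Represents H Fc g) (hs : s ∈ Icc 0 F.T) (μ : PM d)
    {U : Curve d} {Z : ℝ → E d → E d × E d} (hZ : ∀ τ ∈ Icc 0 F.T, ∀ q, Z τ q = pt (U τ) q)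
    (hR : ∀ τ ∈ Icc 0 F.T, ∀ q, ‖(pt (U τ) q).2‖ ≤ F.G.L + 1) {t : ℝ} (ht : t ∈ Icc 0 F.T)
    (q : E d) : (charOp H Fc g s μ Z t q).1 = (pt (F.psi s μ U t) q).1 := by
  rw [pt_psi_fst, clampT_of_mem ht, integral_vel_apply_fst, charOp]
  refine congrArg (q + ·) (intervalIntegral.integral_congr fun τ hτ => ?_)
  have hτ' : τ ∈ Icc 0 F.T := uIcc_subset_Icc hs ht hτ
  rw [hF.vel_apply μ (hZ τ hτ') (hR τ hτ')]

/-- The counterpart of `charOp_fst` for the momentum. The hypothesis `h0` is needed as `psi` takes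
the position at time zero from `init`; it holds at fixed points of either operator. -/
lemma Represents.charOp_snd (hF : F.Represents H Fc g) (μ : PM d)
    {U : Curve d} {Z : ℝ → E d → E d × E d} (hZ : ∀ τ ∈ Icc 0 F.T, ∀ q, Z τ q = pt (U τ) q)
    (hR : ∀ τ ∈ Icc 0 F.T, ∀ q, ‖(pt (U τ) q).2‖ ≤ F.G.L + 1)
    (h0 : pos (U 0) = pos (F.init s μ U)) {t : ℝ} (ht : t ∈ Icc 0 F.T) (q : E d) :
    (charOp H Fc g s μ Z t q).2 = (pt (F.psi s μ U t) q).2 := by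
  have hm : (0 : ℝ) ∈ Icc 0 F.T := left_mem_Icc.2 F.T_nonneg
  rw [pt_psi_snd, clampT_of_mem ht, integral_vel_apply_snd, charOp,
    add_comm (∫ τ in (0 : ℝ)..t, (F.vel μ U τ q).2), sub_eq_add_neg,
    ← intervalIntegral.integral_neg]
  have e0 : (fun x => (Z 0 x).1) = pos (F.init s μ U) := by
    rw [← h0]; exact funext fun x => by rw [hZ 0 hm]; rfl
  refine congrArg₂ (· + ·) ?_ (intervalIntegral.integral_congr fun τ hτ => ?_)
  · rw [e0, show (Z 0 q).1 = pos (F.init s μ U) q from congrFun e0 q, SmoothField.nem_apply,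
      hF.initial]
    rfl
  · have hτ' : τ ∈ Icc 0 F.T := uIcc_subset_Icc hm ht hτ
    rw [hF.vel_apply μ (hZ τ hτ') (hR τ hτ')]

lemma Represents.isCharacteristic_flow (hF : F.Represents H Fc g) (hs : s ∈ Icc 0 F.T)
    (μ : PM d) : IsCharacteristic H Fc g F.T s μ (F.flow s μ) := by
  have hR : ∀ τ ∈ Icc 0 F.T, ∀ q, ‖(pt (F.sol s μ τ) q).2‖ ≤ F.G.L + 1 := fun τ _ q => by
    have := F.norm_pt_psi_snd_le s μ (F.sol s μ) τ q
    rwa [F.psi_sol hs] at this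
  have hZ : ∀ τ ∈ Icc 0 F.T, ∀ q, F.flow s μ τ q = pt (F.sol s μ τ) q := fun _ _ _ => rfl
  refine ⟨⟨Continuous.continuousOn ?_, fun t _ x y hxy => ?_, fun t _ x y hxy => ?_⟩,
    fun t ht q => ?_⟩
  · have h1 : Continuous fun w : ℝ × E d => F.sol s μ w.1 w.2 :=
      (continuous_eval (F := Disp d)).comp
        (((F.sol s μ).continuous.comp continuous_fst).prodMk continuous_snd)
    exact (by fun_prop : Continuous fun w : ℝ × E d => ((w.2, 0) : E d × E d)).add h1
  · have h1 := (F.lipTorus_sol hs μ t).eq_of_torusEq hxy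
    change TorusEq (x + (F.sol s μ t x).1) (y + (F.sol s μ t y).1)
    rw [h1, ← torusEq_sub_iff, add_sub_add_right_eq_sub, torusEq_sub_iff]
    exact hxy
  · have h1 := (F.lipTorus_sol hs μ t).eq_of_torusEq hxy
    change 0 + (F.sol s μ t x).2 = 0 + (F.sol s μ t y).2
    rw [h1]
  · have e1 := hF.charOp_fst hs μ hZ hR ht q
    have e2 := hF.charOp_snd (s := s) μ hZ hR (F.pos_sol_zero hs μ) ht q
    rw [F.psi_sol hs μ] at e1 e2
    exact Prod.ext e1 e2

end FlowData

/-! ### Uniqueness of the characteristics -/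

lemma clampT_clampT {T : ℝ} (hT : 0 ≤ T) (t : ℝ) : clampT T (clampT T t) = clampT T t :=
  clampT_of_mem (clampT_mem hT t)

lemma norm_integral_sub_integral_le {Y : Type} [NormedAddCommGroup Y] [NormedSpace ℝ Y]
    {T a t t' c : ℝ} {w : ℝ → Y} (hw : ContinuousOn w (Icc 0 T)) (hc : ∀ τ ∈ Icc 0 T, ‖w τ‖ ≤ c)
    (ha : a ∈ Icc 0 T) (ht : t ∈ Icc 0 T) (ht' : t' ∈ Icc 0 T) :
    ‖(∫ τ in a..t', w τ) - ∫ τ in a..t, w τ‖ ≤ c * |t' - t| := by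
  rw [intervalIntegral.integral_interval_sub_left
    (hw.mono (uIcc_subset_Icc ha ht')).intervalIntegrable
    (hw.mono (uIcc_subset_Icc ha ht)).intervalIntegrable]
  exact intervalIntegral.norm_integral_le_of_norm_le_const fun τ hτ =>
    hc τ (uIcc_subset_Icc ht ht' (uIoc_subset_uIcc hτ))

namespace FlowData

variable {F : FlowData d} {s : ℝ} {H : E d → E d → ℝ} {Fc g : E d → PM d → ℝ}

lemma Represents.norm_velocity_le (hF : F.Represents H Fc g) {z : E d × E d}
    (hz : ‖z.2‖ ≤ F.G.L + 1) (μ : PM d) :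
    ‖gradient (fun p => H z.1 p) z.2‖ ≤ F.K.L ∧
    ‖gradient (fun q => H q z.2) z.1 + gradq Fc z.1 μ‖ ≤ F.K.L := by
  have h := F.K.smooth.bound z μ
  rw [hF.field z μ hz] at h
  refine ⟨?_, ?_⟩
  · have h1 := (norm_fst_le _).trans h
    rwa [hamField, Prod.fst_sub, sub_zero] at h1
  · have h1 := (norm_snd_le _).trans h
    rwa [hamField, Prod.snd_sub, ← neg_add', norm_neg] at h1

lemma Represents.norm_gradq_le (hF : F.Represents H Fc g) (q : E d) (μ : PM d) :
    ‖gradq g q μ‖ ≤ F.G.L := by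
  have h := (norm_snd_le _).trans (F.G.smooth.bound (q, 0) μ)
  rwa [hF.initial] at h

/-- The momentum of a characteristic stays in the region where the velocity of the flow is that of
the characteristic system. -/
lemma Represents.norm_momentum_le (hF : F.Represents H Fc g) {μ : PM d} {Z : ℝ → E d → E d × E d}
    (hZ : IsCharacteristic H Fc g F.T s μ Z) : ∀ t ∈ Icc 0 F.T, ∀ q, ‖(Z t q).2‖ ≤ F.G.L + 1 := by
  have hK := F.KL_nonneg
  have key : ∀ t ∈ Icc 0 F.T, ∀ q, (∀ τ ∈ Ioc 0 t, ‖(Z τ q).2‖ ≤ F.G.L + 1) →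
      ‖(Z t q).2‖ < F.G.L + 1 := fun t ht q h => by
    have h1 : ‖∫ τ in (0 : ℝ)..t, (gradient (fun q' => H q' (Z τ q).2) (Z τ q).1
        + gradq Fc (Z τ q).1 (push (fun x => (Z τ x).1) μ))‖ ≤ F.K.L * |t - 0| :=
      intervalIntegral.norm_integral_le_of_norm_le_const fun τ hτ => by
        rw [uIoc_of_le ht.1] at hτ
        exact (hF.norm_velocity_le (h τ hτ) _).2
    rw [sub_zero, abs_of_nonneg ht.1] at h1
    have h2 := mul_le_mul_of_nonneg_left ht.2 hK
    have h3 := F.KT_le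
    have h4 := hF.norm_gradq_le (Z 0 q).1 (push (fun x => (Z 0 x).1) μ)
    rw [← hZ.2 t ht q]
    refine (norm_sub_le _ _).trans_lt ?_
    linarith
  intro t ht q
  refine forall_le_of_bootstrap (φ := fun t => ‖(Z t q).2‖) ?_
    (fun t ht h => key t ht q fun τ hτ => h τ ⟨hτ.1.le, hτ.2⟩)
    (key 0 (left_mem_Icc.2 F.T_nonneg) q fun τ hτ => absurd hτ.2 hτ.1.not_ge).le t ht
  have h1 : ContinuousOn (fun t => Z t q) (Icc 0 F.T) :=
    hZ.1.cont.comp (f := fun t : ℝ => (t, q)) (by fun_prop) fun t ht => ⟨ht, mem_univ q⟩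
  exact (continuous_snd.comp_continuousOn h1).norm

lemma continuousOn_field (A : SmoothField d) {S : Set ℝ} {z : ℝ → E d × E d} {m : ℝ → PM d}
    {c : ℝ} (hz : ContinuousOn z S) (hm : ∀ τ ∈ S, ∀ τ' ∈ S, wass (m τ) (m τ') ≤ c * |τ' - τ|) :
    ContinuousOn (fun τ => A.f (z τ) (m τ)) S := fun τ hτ => by
  refine tendsto_iff_norm_sub_tendsto_zero.2 ?_
  have h1 : Tendsto (fun τ' => A.L * (‖z τ' - z τ‖ + c * |τ' - τ|)) (𝓝[S] τ) (𝓝 0) := by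
    have h2 := tendsto_iff_norm_sub_tendsto_zero.1 (hz τ hτ)
    have h3 : Tendsto (fun τ' : ℝ => c * |τ' - τ|) (𝓝[S] τ) (𝓝 0) := by
      have : Tendsto (fun τ' : ℝ => c * |τ' - τ|) (𝓝 τ) (𝓝 (c * |τ - τ|)) :=
        (by fun_prop : Continuous fun τ' : ℝ => c * |τ' - τ|).tendsto τ
      rw [sub_self, abs_zero, mul_zero] at this
      exact this.mono_left nhdsWithin_le_nhds
    simpa using (h2.add h3).const_mul A.L
  refine squeeze_zero' (Eventually.of_forall fun _ => norm_nonneg _) ?_ h1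
  filter_upwards [self_mem_nhdsWithin] with τ' hτ'
  exact (A.smooth.lip _ _ _ _).trans (mul_le_mul_of_nonneg_left
    (add_le_add le_rfl (hm τ hτ τ' hτ')) A.L_nonneg)

/-- A characteristic is Lipschitz in time, uniformly in the position, so that it is a continuous
curve in the space of displacements. -/
lemma Represents.time_lipschitz (hF : F.Represents H Fc g) (hH : IsHamiltonian H)
    (hs : s ∈ Icc 0 F.T) {μ : PM d} {Z : ℝ → E d → E d × E d}
    (hZ : IsCharacteristic H Fc g F.T s μ Z) {t t' : ℝ} (ht : t ∈ Icc 0 F.T)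
    (ht' : t' ∈ Icc 0 F.T) (q : E d) : ‖Z t' q - Z t q‖ ≤ F.K.L * |t' - t| := by
  have hR := hF.norm_momentum_le hZ
  have hc : ∀ q, ContinuousOn (fun t => Z t q) (Icc 0 F.T) := fun q =>
    hZ.1.cont.comp (f := fun t : ℝ => (t, q)) (by fun_prop) fun t ht => ⟨ht, mem_univ q⟩
  have hfst : ∀ q, ∀ t ∈ Icc 0 F.T, ∀ t' ∈ Icc 0 F.T,
      ‖(Z t' q).1 - (Z t q).1‖ ≤ F.K.L * |t' - t| := fun q t ht t' ht' => by
    rw [← hZ.2 t ht q, ← hZ.2 t' ht' q, charOp, charOp, add_sub_add_left_eq_sub]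
    exact norm_integral_sub_integral_le
      (w := fun τ => gradient (fun p => H (Z τ q).1 p) (Z τ q).2)
      (continuous_fst.comp_continuousOn (hH.contDiff_hamField.continuous.comp_continuousOn (hc q)))
      (fun τ hτ => (hF.norm_velocity_le (hR τ hτ q) μ).1) hs ht ht'
  have hpos : ∀ t ∈ Icc 0 F.T, Continuous fun x => (Z t x).1 := fun t ht =>
    continuous_fst.comp (hZ.1.cont.comp_continuous (f := fun x : E d => (t, x)) (by fun_prop)
      fun x => ⟨ht, mem_univ x⟩)
  -- the law of the position is Lipschitz in time, so that the force is continuous in time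
  have hlaw : ∀ τ ∈ Icc 0 F.T, ∀ τ' ∈ Icc 0 F.T, wass (push (fun x => (Z τ x).1) μ)
      (push (fun x => (Z τ' x).1) μ) ≤ F.K.L * |τ' - τ| := fun τ hτ τ' hτ' =>
    wass_push_le (hpos τ hτ) (hpos τ' hτ') (mul_nonneg F.KL_nonneg (abs_nonneg _))
      (fun x => hfst x τ hτ τ' hτ') μ
  have hw : ContinuousOn (fun τ => gradient (fun q' => H q' (Z τ q).2) (Z τ q).1
      + gradq Fc (Z τ q).1 (push (fun x => (Z τ x).1) μ)) (Icc 0 F.T) := by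
    refine (continuous_snd.comp_continuousOn (continuousOn_field F.K (hc q) hlaw)).neg.congr
      fun τ hτ => ?_
    simp only [Function.comp_apply, Pi.neg_apply]
    rw [hF.field _ _ (hR τ hτ q), hamField, Prod.snd_sub, ← neg_add', neg_neg]
  refine max_le (hfst q t ht t' ht') ?_
  change ‖(Z t' q).2 - (Z t q).2‖ ≤ _
  rw [← hZ.2 t ht q, ← hZ.2 t' ht' q, charOp, charOp, sub_sub_sub_cancel_left, abs_sub_comm]
  exact norm_integral_sub_integral_le hw (fun τ hτ => (hF.norm_velocity_le (hR τ hτ q) _).2)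
    (left_mem_Icc.2 F.T_nonneg) ht' ht

/-- A characteristic as a curve of displacements. -/
lemma Represents.exists_curve (hF : F.Represents H Fc g) (hH : IsHamiltonian H)
    (hs : s ∈ Icc 0 F.T) {μ : PM d} {Z : ℝ → E d → E d × E d}
    (hZ : IsCharacteristic H Fc g F.T s μ Z) :
    ∃ U : Curve d, ∀ t q, pt (U t) q = Z (clampT F.T t) q := by
  have hR := hF.norm_momentum_le hZ
  have hG := F.GL_nonneg
  have hKT := F.KT_nonneg
  have hb : ∀ t ∈ Icc 0 F.T, ∀ q, ‖Z t q - (q, 0)‖ ≤ F.K.L * F.T + (F.G.L + 1) := fun t ht q => by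
    refine max_le ?_ ?_
    · change ‖(Z t q).1 - q‖ ≤ _
      rw [← hZ.2 t ht q, charOp, add_sub_cancel_left]
      have h1 := norm_integral_le_of_mem_Icc hs ht F.KL_nonneg
        fun τ hτ => (hF.norm_velocity_le (hR τ hτ q) μ).1
      linarith
    · change ‖(Z t q).2 - 0‖ ≤ _
      rw [sub_zero]
      have := hR t ht q
      linarith
  let V : ℝ → Disp d := fun t => BoundedContinuousFunction.ofNormedAddCommGroup
    (fun q => Z (clampT F.T t) q - (q, 0))
    ((hZ.1.cont.comp_continuous (f := fun x : E d => (clampT F.T t, x)) (by fun_prop)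
      fun x => ⟨clampT_mem F.T_nonneg t, mem_univ x⟩).sub (by fun_prop)) _
    (hb _ (clampT_mem F.T_nonneg t))
  have hV : ∀ t t', ‖V t' - V t‖ ≤ F.K.L * ‖t' - t‖ := fun t t' => by
    refine (BoundedContinuousFunction.norm_le (mul_nonneg F.KL_nonneg (norm_nonneg _))).2
      fun q => ?_
    change ‖(Z (clampT F.T t') q - (q, 0)) - (Z (clampT F.T t) q - (q, 0))‖ ≤ _
    rw [sub_sub_sub_cancel_right]
    exact (hF.time_lipschitz hH hs hZ (clampT_mem F.T_nonneg t) (clampT_mem F.T_nonneg t') q).trans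
      (mul_le_mul_of_nonneg_left (abs_clampT_sub_le _ _ _) F.KL_nonneg)
  refine ⟨BoundedContinuousFunction.ofNormedAddCommGroup V
    (continuous_of_norm_sub_le F.KL_nonneg hV) (F.K.L * F.T + (F.G.L + 1))
    (fun t => (BoundedContinuousFunction.norm_le (by positivity)).2
      (hb _ (clampT_mem F.T_nonneg t))), fun t q => ?_⟩
  exact add_sub_cancel ((q, 0) : E d × E d) (Z (clampT F.T t) q)

/-- Every characteristic is a fixed point of `psi`, hence equal to the flow. -/
lemma Represents.eq_flow (hF : F.Represents H Fc g) (hH : IsHamiltonian H)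
    (hs : s ∈ Icc 0 F.T) {μ : PM d} {Z : ℝ → E d → E d × E d}
    (hZ : IsCharacteristic H Fc g F.T s μ Z) {t : ℝ} (ht : t ∈ Icc 0 F.T) (q : E d) :
    Z t q = F.flow s μ t q := by
  obtain ⟨U, hU⟩ := hF.exists_curve hH hs hZ
  have h0 := left_mem_Icc.2 F.T_nonneg
  have hZU : ∀ τ ∈ Icc 0 F.T, ∀ q, Z τ q = pt (U τ) q := fun τ hτ q => by
    rw [hU, clampT_of_mem hτ]
  have hR : ∀ τ ∈ Icc 0 F.T, ∀ q, ‖(pt (U τ) q).2‖ ≤ F.G.L + 1 := fun τ hτ q => by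
    rw [← hZU τ hτ]; exact hF.norm_momentum_le hZ τ hτ q
  have hpos : pos (U 0) = pos (F.init s μ U) := funext fun q => by
    have h1 := hF.charOp_fst hs μ hZU hR h0 q
    rw [hZ.2 0 h0 q, hZU 0 h0 q, pt_psi_fst, clampT_of_mem h0] at h1
    exact h1
  have hfix : ∀ τ ∈ Icc 0 F.T, ∀ q, F.psi s μ U τ q = U τ q := fun τ hτ q => by
    have h1 : charOp H Fc g s μ Z τ q = pt (F.psi s μ U τ) q :=
      Prod.ext (hF.charOp_fst hs μ hZU hR hτ q) (hF.charOp_snd μ hZU hR hpos hτ q)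
    rw [hZ.2 τ hτ q, hZU τ hτ q] at h1
    exact (add_left_cancel h1).symm
  have hpsi : F.psi s μ U = U := by
    ext1 τ
    ext1 q
    have hc := clampT_mem F.T_nonneg τ
    have e1 : F.psi s μ U τ = F.psi s μ U (clampT F.T τ) := by
      rw [psi_apply, psi_apply, clampT_clampT F.T_nonneg]
    have e2 : U τ q = U (clampT F.T τ) q := by
      have h1 : pt (U τ) q = pt (U (clampT F.T τ)) q := by
        rw [hU, hU, clampT_clampT F.T_nonneg]
      exact add_left_cancel h1
    rw [e1, e2]
    exact hfix _ hc q
  rw [hZU t ht, F.eq_sol hs hpsi]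
  rfl

end FlowData

end MFG

end

theorem mainTheorem4 (d : ℕ) (H : E d → E d → ℝ) (F g : E d → PM d → ℝ)
    (hH : IsHamiltonian H) (hF : IsMasterCoupling F) (hg : IsMasterCoupling g) :
    ∃ T₀ > 0, ∀ T : ℝ, 0 < T → T ≤ T₀ →
      ∃ S : ℝ → PM d → ℝ → E d → E d × E d,
        -- `S s μ` is the characteristic map: the unique fixed point in `𝓜`
        (∀ s ∈ Set.Icc 0 T, ∀ μ, IsCharacteristic H F g T s μ (S s μ) ∧
          ∀ Z, IsCharacteristic H F g T s μ Z → ∀ t ∈ Set.Icc 0 T, ∀ q, Z t q = S s μ t q) ∧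
        (∀ s ∈ Set.Icc 0 T, ∀ μ, ∀ t ∈ Set.Icc 0 T, ∀ q,
          DifferentiableWithinAt ℝ (fun τ => S s μ τ q) (Set.Icc 0 T) t ∧
          DifferentiableAt ℝ (S s μ t) q) ∧
        ∃ (D : ℝ → ℝ → E d → E d → PM d → (E d →L[ℝ] E d × E d)) (C : ℝ),
          -- first-order expansion with quadratic remainder
          (∀ s ∈ Set.Icc 0 T, ∀ t ∈ Set.Icc 0 T, ∀ t' ∈ Set.Icc 0 T, ∀ (q q' : E d) (μ ν : PM d)
            (γ : MeasureTheory.Measure (E d × E d)), IsOptPlan γ μ ν →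
            ‖S s ν t' q' - S s μ t q
                - (t' - t) • derivWithin (fun τ => S s μ τ q) (Set.Icc 0 T) t
                - fderiv ℝ (S s μ t) q (q' - q)
                - ∫ z, D t s q z.1 μ (z.2 - z.1) ∂γ‖
              ≤ C * ((t' - t) ^ 2 + ‖q' - q‖ ^ 2 + wass μ ν ^ 2)) ∧
          -- `D` is Lipschitz on `[0,T] × [0,T] × 𝕋^d × 𝕋^d × 𝒫(𝕋^d)`
          (∀ t ∈ Set.Icc 0 T, ∀ t' ∈ Set.Icc 0 T, ∀ s ∈ Set.Icc 0 T, ∀ s' ∈ Set.Icc 0 T,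
            ∀ (q q' x x' : E d) (μ ν : PM d),
            ‖D t' s' q' x' ν - D t s q x μ‖
              ≤ C * (|t' - t| + |s' - s| + torusDist q' q + torusDist x' x + wass μ ν)) := by
  obtain ⟨g', Ng, Lg, hsg, htg⟩ := exists_smoothFn_initial hg
  have hLg : 0 ≤ Lg := hsg.nonneg
  -- momenta stay below `Lg + 1`: the initial ones are at most `Lg`, and they change by less than
  -- one
  obtain ⟨f, f', Nf, Lf, hsf, htf, hf⟩ :=
    exists_smoothFn_field hH hF (R := Lg + 1) (by positivity)
  have hLf : 0 ≤ Lf := hsf.nonneg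
  -- `Lf` and `Lg` only depend on `H`, `F` and `g`
  refine ⟨1 / (100 * (Lf + 1) * (1 + Lg)), by positivity, fun T hT hT₀ => ?_⟩
  have hsmall : Lf * T * (1 + Lg) ≤ 1 / 100 := by
    rw [le_div_iff₀ (by positivity)] at hT₀
    have : 0 ≤ T * (1 + Lg) := by positivity
    linarith
  let Φ : FlowData d := ⟨⟨f, f', Nf, Lf, hsf, htf⟩, ⟨_, g', Ng, Lg, hsg, htg⟩, fun _ _ => rfl, T,
    hT.le, hsmall⟩
  have hΦ : Φ.Represents H F g := ⟨hf, fun _ _ => rfl⟩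
  obtain ⟨C₁, hC₁, h₁⟩ := Φ.exists_norm_flow_sub_le
  obtain ⟨C₂, hC₂, h₂⟩ := Φ.exists_norm_dXF_sub_le
  refine ⟨Φ.flow, fun s hs μ => ⟨hΦ.isCharacteristic_flow hs μ,
    fun Z hZ t ht q => hΦ.eq_flow hH hs hZ ht q⟩, fun s hs μ t ht q =>
    ⟨(Φ.hasDerivWithinAt_flow hs μ ht q).differentiableWithinAt,
      (Φ.hasFDerivAt_flow hs μ t q).differentiableAt⟩,
    fun t s q x μ => Φ.dXF s μ t q x, C₁ + C₂, fun s hs t ht t' ht' q q' μ ν γ hγ => ?_,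
    fun t _ t' _ s hs s' hs' q q' x x' μ ν => ?_⟩
  · have e1 : derivWithin (fun τ => Φ.flow s μ τ q) (Set.Icc 0 T) t
        = Φ.vel μ (Φ.sol s μ) t q :=
      (Φ.hasDerivWithinAt_flow hs μ ht q).derivWithin (uniqueDiffOn_Icc hT t ht)
    rw [e1, (Φ.hasFDerivAt_flow hs μ t q).fderiv]
    exact (h₁ s hs t ht t' ht' q q' μ ν γ hγ).trans
      (mul_le_mul_of_nonneg_right (by linarith) (by positivity))
  · have hW := wass_nonneg μ ν
    have hq := torusDist_nonneg q' q
    have hx := torusDist_nonneg x' x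
    exact (h₂ s hs s' hs' μ ν t t' q q' x x').trans
      (mul_le_mul_of_nonneg_right (by linarith) (by positivity))
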